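/- **Theorem (generalized Weyl formula).** Let $R$ be a reduced irreducible crystallographic root system with Weyl group $W$, positive roots $R_+$, positive root cone $Q_+$, weight lattice $P$, dominant weights $P_+$, coweight lattice $P^\vee$. Roots, weights and $z$ lie in a complex vector space $M$; coroots, coweights and $x$ lie in its dual $N$; $(\cdot,\cdot)$ is the pairing. Let $m=\{m_\alpha\}$, $m_\alpha\in\mathbb Z_{\ge0}$, be $W$-invariant, and let $q\in\mathbb C^\times$ not be a root of unity. Fix $\log q$, put $q^a=e^{a\log q}$ and $[a]=q^a-q^{-a}$. For $W$-invariant $k$ let $\rho_k=\frac12\sum_{\alpha\in R_+}k_\alpha\alpha$, and let $\rho^\vee=\frac12\sum_{\alpha\in R_+}m_\alpha\alpha^\vee$. *Baker–Akhiezer function.* A normalized BA function is a function $\psi(x,z)=q^{2(x,z)}\sum_{\nu}\psi_\nu(x)q^{2(\nu,z)}$, with $\nu\in P^\vee$ running over the polytope $\{\rho^\vee-\sum_{\alpha\in R_+}l_\alpha\alpha^\vee: l_\alpha\in\mathbb R,\ 0\le l_\alpha\le m_\alpha\}$ and all $\psi_\nu$ continuous in $x$, such that $\psi(x,z+\frac12s\alpha)=\psi(x,z-\frac12s\alpha)$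 whenever $\alpha\in R$, $s=1,\dots,m_\alpha$ and $q^{2(\alpha^\vee,z)}=1$, and such that $\psi_{\rho^\vee}(x)=\prod_{\alpha\in R_+}\prod_{j=1}^{m_\alpha}[j-(\alpha,x)]$. Put $\Phi_+(x,z)=\sum_{w\in W}\psi(wx,z)$ and $\Phi_-(x,z)=\sum_{w\in W}(-1)^w\psi(wx,z)$. *Macdonald polynomials.* Write $\mathfrak m_\nu(x)=\sum_{\tau\in W\nu}q^{2(\tau,x)}$, and $\nu\prec\mu$ if $0\neq\mu-\nu\in Q_+$. A coweight $\pi$ is minuscule if $|(\pi,\alpha)|\le1$ for all $\alpha\in R$; it is quasiminuscule if $\pi\in R^\vee$ and $|(\pi,\alpha)|\le 1$ for all $\alpha\in R\setminus\{\pm\pi^\vee\}$. For such $\pi$ the Macdonald operator with $t=q^k$ is $$D^\pi=\sum_{\tau\in W\pi}a_\tau(T^\tau-1)+\sum_{\tau\in W\pi}q^{-2(\rho_k,\tau)},\qquad a_\tau(x)=\prod_{(\alpha,\tau)>0}\frac{[k_\alpha+(\alpha,x)]}{[(\alpha,x)]}\prod_{(\alpha,\tau)=2}\frac{[k_\alpha+1+(\alpha,x)]}{[1+(\alpha,x)]},$$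 where $(T^\tau f)(x)=f(x+\tau)$ and the products are over $\alpha\in R$. For $\mu\in P_+$ a Macdonald polynomial $P_\mu(x;q,q^k)$ is a finite sum $\mathfrak m_\mu+\sum_{\nu\prec\mu,\,\nu\in P_+}a_{\mu\nu}\mathfrak m_\nu$ with $D^\pi P_\mu=c^\pi_\mu P_\mu$ for all (quasi)minuscule $\pi$, where $c^\pi_\mu=\sum_{\tau\in W\pi}q^{2(\tau,\mu+\rho_k)}$. The triple $(\mu,q,k)$ is called nondegenerate if for every $\nu\in P_+$ with $\nu\prec\mu$ there is a (quasi)minuscule $\pi$ with $c^\pi_\nu\ne c^\pi_\mu$. Then: 1. The normalized BA function $\psi$ exists and is unique. 2. Let $\lambda\in\rho_{m+1}+P_+$, $c(\lambda,m)=\prod_{\alpha\in R_+}\prod_{j=1}^{m_\alpha}[j-(\alpha^\vee,\lambda)]$ and $\delta_m(x)=\prod_{\alpha\in R_+}\prod_{j=-m_\alpha}^{m_\alpha}[(\alpha,x)+j]$. Then $c(\lambda,m)\neq0$, and there are Macdonald polynomials $P_{\lambda+\rho_m}(x;q,q^{-m})$ and $P_{\lambda-\rho_{m+1}}(x;q,q^{m+1})$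 such that for all $x$ $$\Phi_+(x,\lambda)=c(\lambda,m)\,P_{\lambda+\rho_m}(x;q,q^{-m}),\qquad \Phi_-(x,\lambda)=c(\lambda,m)\,\delta_m(x)\,P_{\lambda-\rho_{m+1}}(x;q,q^{m+1}).$$ Each of the two polynomials is the only Macdonald polynomial with its parameters whenever these are nondegenerate. 3. (Localization.) There is a bound $B$ such that for every stable $\mu$, i.e. $\mu\in P_+$ with $(\mu,\alpha^\vee)>2m_\alpha$ for all $\alpha\in R_+$, there is a Macdonald polynomial $P_\mu(x;q,q^{-m})$ (the only one, in the nondegenerate case) which has at most $B$ terms $\mathfrak m_\nu$ with nonzero coefficient, all of them with $\nu=\mu-\sum_{\alpha\in R_+}l_\alpha\alpha$, $l_\alpha\in\mathbb R$, $0\le l_\alpha\le m_\alpha$. Here the $l_\alpha$ can be chosen to be integers, except when $R$ has two root lengths and $m$ is zero on the short roots but not on the long ones. 4. If $q$ is real or transcendental over $\mathbb Q$, then $(\mu,q,-m)$ is nondegenerate for all stable $\mu$, and $(\mu,q,m+1)$ is nondegenerate for all $\mu\in P_+$. -/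

import Mathlib

/-!
Conventions.  The Euclidean space of the root system and its dual are kept apart: roots and weights
live in `M`, coroots and coweights live in `N`, and `P.toLinearMap : M → N → ℂ` is the canonical
pairing, written `(·,·)` in the comments.  Both spaces are taken over `ℂ`, so that the variables
`x ∈ N` and `z ∈ M` are complex.  `L` is the chosen value of `log q`.
-/

namespace MacBA

open scoped Classical
noncomputable section

variable {ι M N : Type*} [Fintype ι] [AddCommGroup M] [Module ℂ M] [AddCommGroup N] [Module ℂ N]

/-- `q ^ a := e ^ (a log q)`. -/
def qpow (L a : ℂ) : ℂ := Complex.exp (a * L)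

/-- `[a] = q ^ a - q ^ (-a)`. -/
def brk (L a : ℂ) : ℂ := qpow L a - qpow L (-a)

/-- The Weyl group acting on the coweight space (the space of the variable `x`). -/
def weylN (P : RootPairing ι ℂ M N) : Subgroup (N ≃ₗ[ℂ] N) :=
  Subgroup.closure (Set.range P.coreflection)

/-- The Weyl group acting on the weight space (the space of the variable `z`). -/
def weylM (P : RootPairing ι ℂ M N) : Subgroup (M ≃ₗ[ℂ] M) :=
  Subgroup.closure (Set.range P.reflection)

/-- The positive roots. -/
def posRoots {P : RootPairing ι ℂ M N} (b : P.Base) : Finset ι :=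
  Finset.univ.filter fun i => b.IsPos i

/-- `ρ_k = ½ ∑_{α > 0} k_α α`. -/
def rho {P : RootPairing ι ℂ M N} (b : P.Base) (k : ι → ℂ) : M :=
  (1 / 2 : ℂ) • ∑ i ∈ posRoots b, k i • P.root i

/-- `ρ_k^∨ = ½ ∑_{α > 0} k_α α^∨`. -/
def rhoCo {P : RootPairing ι ℂ M N} (b : P.Base) (k : ι → ℂ) : N :=
  (1 / 2 : ℂ) • ∑ i ∈ posRoots b, k i • P.coroot i

/-- The dominant weights `P_+`. -/
def IsDominant {P : RootPairing ι ℂ M N} (b : P.Base) (μ : M) : Prop :=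
  ∀ i ∈ posRoots b, ∃ n : ℕ, P.coroot' i μ = n

/-- The coweight lattice `P^∨`. -/
def IsCoweight (P : RootPairing ι ℂ M N) (ν : N) : Prop :=
  ∀ i, ∃ n : ℤ, P.root' i ν = n

/-- The positive part `Q_+` of the root lattice; `ν ≼ μ` means `μ - ν ∈ Q_+`. -/
def rootCone {P : RootPairing ι ℂ M N} (b : P.Base) : AddSubmonoid M :=
  AddSubmonoid.closure (P.root '' b.support)

/-- The orbit sum `𝔪_μ(x) = ∑_{τ ∈ W μ} q ^ (2 (τ, x))`. -/
def orbitSum (P : RootPairing ι ℂ M N) (L : ℂ) (μ : M) (x : N) : ℂ :=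
  ∑ᶠ τ ∈ MulAction.orbit (weylM P) μ, qpow L (2 * P.toLinearMap τ x)

/-- The combination `∑_ν a_ν 𝔪_ν(x)` of orbit sums. -/
def orbitPoly (P : RootPairing ι ℂ M N) (L : ℂ) (a : M →₀ ℂ) (x : N) : ℂ :=
  a.sum fun ν c => c * orbitSum P L ν x

/-- Minuscule coweights: `-1 ≤ (π, α) ≤ 1` for all roots `α` (the pairings being integers). -/
def IsMinuscule (P : RootPairing ι ℂ M N) (π : N) : Prop :=
  ∀ i, P.root' i π ∈ ({-1, 0, 1} : Set ℂ)

/-- Quasiminuscule coweights: coroots `π` with `-1 ≤ (π, α) ≤ 1` for all roots `α ≠ ± π^∨`. -/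
def IsQuasiminuscule (P : RootPairing ι ℂ M N) (π : N) : Prop :=
  ∃ j, π = P.coroot j ∧ ∀ i, P.root i ≠ P.root j → P.root i ≠ -P.root j →
    P.root' i π ∈ ({-1, 0, 1} : Set ℂ)

/-- The coefficient `a_τ(x)` of the Macdonald operator with `t_α = q ^ k_α`. -/
def macCoeff (P : RootPairing ι ℂ M N) (L : ℂ) (k : ι → ℂ) (τ x : N) : ℂ :=
  (∏ i : ι with 0 < (P.root' i τ).re,
      brk L (k i + P.root' i x) / brk L (P.root' i x)) *
    ∏ i : ι with P.root' i τ = 2,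
      brk L (k i + 1 + P.root' i x) / brk L (1 + P.root' i x)

/-- The Macdonald operator
`D^π = ∑_{τ ∈ W π} a_τ (T^τ - 1) + ∑_{τ ∈ W π} q ^ (-2 (ρ_k, τ))`, `(T^τ f)(x) = f (x + τ)`. -/
def macOp {P : RootPairing ι ℂ M N} (b : P.Base) (L : ℂ) (k : ι → ℂ) (π : N)
    (f : N → ℂ) (x : N) : ℂ :=
  (∑ᶠ τ ∈ MulAction.orbit (weylN P) π, macCoeff P L k τ x * (f (x + τ) - f x)) +
    (∑ᶠ τ ∈ MulAction.orbit (weylN P) π, qpow L (-2 * P.toLinearMap (rho b k) τ)) * f x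

/-- The diagonal coefficient `c_{μμ} = ∑_{τ ∈ W π} q ^ (2 (τ, μ + ρ_k))` of `D^π`. -/
def macEig {P : RootPairing ι ℂ M N} (b : P.Base) (L : ℂ) (k : ι → ℂ) (π : N) (μ : M) : ℂ :=
  ∑ᶠ τ ∈ MulAction.orbit (weylN P) π, qpow L (2 * P.toLinearMap (μ + rho b k) τ)

/-- The points at which no coefficient of a Macdonald operator has a vanishing denominator. -/
def IsRegularPt (P : RootPairing ι ℂ M N) (L : ℂ) (x : N) : Prop :=
  ∀ i, brk L (P.root' i x) ≠ 0 ∧ brk L (1 + P.root' i x) ≠ 0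

/-- `∑_ν a_ν 𝔪_ν` satisfies the equations that define the Macdonald polynomial `P_μ(x; q, q^k)`:
it is `𝔪_μ` plus a combination of `𝔪_ν`, `ν ≺ μ` dominant, and it is an eigenfunction of `D^π`,
with eigenvalue `c_{μμ}`, for every (quasi)minuscule coweight `π`. -/
structure IsMacdonald {P : RootPairing ι ℂ M N} (b : P.Base) (L : ℂ) (k : ι → ℂ) (μ : M)
    (a : M →₀ ℂ) : Prop where
  lead : a μ = 1
  dominant : ∀ ν ∈ a.support, IsDominant b ν
  lower : ∀ ν ∈ a.support, μ - ν ∈ rootCone b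
  eigen : ∀ π, IsMinuscule P π ∨ IsQuasiminuscule P π → ∀ x, IsRegularPt P L x →
    macOp b L k π (orbitPoly P L a) x = macEig b L k π μ * orbitPoly P L a x

/-- The condition under which `P_μ(x; q, q^k)` is determined by its defining equations: the
diagonal coefficients at `μ` and at any dominant `ν ≺ μ` differ for some `π`. -/
def Nondegenerate {P : RootPairing ι ℂ M N} (b : P.Base) (L : ℂ) (k : ι → ℂ) (μ : M) : Prop :=
  ∀ ν, IsDominant b ν → μ - ν ∈ rootCone b → ν ≠ μ →
    ∃ π, (IsMinuscule P π ∨ IsQuasiminuscule P π) ∧ macEig b L k π ν ≠ macEig b L k π μ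

/-- The polytope `𝒩 = {ρ^∨ - ∑_{α > 0} l_α α^∨ | 0 ≤ l_α ≤ m_α}`, with real `l_α`. -/
def polytopeN {P : RootPairing ι ℂ M N} (b : P.Base) (m : ι → ℕ) : Set N :=
  {ν | ∃ l : ι → ℝ, (∀ i, 0 ≤ l i ∧ l i ≤ m i) ∧
    ν = rhoCo b (fun i => m i) - ∑ i ∈ posRoots b, (l i : ℂ) • P.coroot i}

/-- `ψ` is a Baker–Akhiezer function of `{R, m}` with coefficients `c ν x = ψ_ν(x)`. -/
structure IsBakerAkhiezer {P : RootPairing ι ℂ M N} (b : P.Base) (L : ℂ) (m : ι → ℕ)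
    (c : N →₀ (N → ℂ)) (ψ : N → M → ℂ) : Prop where
  mem : ∀ ν ∈ c.support, IsCoweight P ν ∧ ν ∈ polytopeN b m
  form : ∀ x z, ψ x z = qpow L (2 * P.toLinearMap z x) *
    c.sum fun ν f => f x * qpow L (2 * P.toLinearMap z ν)
  axiality : ∀ i, ∀ s ∈ Finset.Icc 1 (m i), ∀ x z, qpow L (2 * P.coroot' i z) = 1 →
    ψ x (z + ((s : ℂ) / 2) • P.root i) = ψ x (z - ((s : ℂ) / 2) • P.root i)

/-- The normalized Baker–Akhiezer function: its leading coefficient is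
`ψ_{ρ^∨}(x) = ∏_{α > 0} ∏_{j = 1}^{m_α} [j - (α, x)]`.  The coefficients are continuous in `x`: this
fixes `ψ` also at those special `x` where the linear system for the coefficients degenerates. -/
def IsNormalizedBA {N : Type*} [NormedAddCommGroup N] [NormedSpace ℂ N]
    {P : RootPairing ι ℂ M N} (b : P.Base) (L : ℂ) (m : ι → ℕ) (ψ : N → M → ℂ) : Prop :=
  ∃ c : N →₀ (N → ℂ), IsBakerAkhiezer b L m c ψ ∧ (∀ ν, Continuous (c ν)) ∧
    ∀ x, c (rhoCo b fun i => m i) x =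
      ∏ i ∈ posRoots b, ∏ j ∈ Finset.Icc 1 (m i), brk L (j - P.root' i x)

/-- `Φ_+(x, z) = ∑_{w ∈ W} ψ(w x, z)`. -/
def PhiPlus (P : RootPairing ι ℂ M N) (ψ : N → M → ℂ) (x : N) (z : M) : ℂ :=
  ∑ᶠ w : weylN P, ψ ((w : N ≃ₗ[ℂ] N) x) z

/-- `Φ_-(x, z) = ∑_{w ∈ W} (-1)^w ψ(w x, z)`, where `(-1)^w = det w`. -/
def PhiMinus (P : RootPairing ι ℂ M N) (ψ : N → M → ℂ) (x : N) (z : M) : ℂ :=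
  ∑ᶠ w : weylN P, LinearMap.det ((w : N ≃ₗ[ℂ] N) : N →ₗ[ℂ] N) * ψ ((w : N ≃ₗ[ℂ] N) x) z

/-- `δ_m(x) = ∏_{α > 0} ∏_{j = -m_α}^{m_α} [(α, x) + j]`. -/
def deltaFn {P : RootPairing ι ℂ M N} (b : P.Base) (L : ℂ) (m : ι → ℕ) (x : N) : ℂ :=
  ∏ i ∈ posRoots b, ∏ j ∈ Finset.Icc (-(m i : ℤ)) (m i), brk L (P.root' i x + j)

/-- `c(λ, m) = ∏_{α > 0} ∏_{j = 1}^{m_α} [j - (α^∨, λ)]`. -/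
def cFactor {P : RootPairing ι ℂ M N} (b : P.Base) (L : ℂ) (m : ι → ℕ) (lam : M) : ℂ :=
  ∏ i ∈ posRoots b, ∏ j ∈ Finset.Icc 1 (m i), brk L (j - P.coroot' i lam)

/-- Stable weights: `μ` is dominant and `(μ, α^∨) > 2 m_α` for all `α > 0`. -/
def IsStable {P : RootPairing ι ℂ M N} (b : P.Base) (m : ι → ℕ) (μ : M) : Prop :=
  IsDominant b μ ∧ ∀ i ∈ posRoots b, 2 * (m i : ℝ) < (P.coroot' i μ).re

/-- `ν = μ - ∑_{α > 0} l_α α` with real `0 ≤ l_α ≤ m_α`. -/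
def IsLocal {P : RootPairing ι ℂ M N} (b : P.Base) (m : ι → ℕ) (μ ν : M) : Prop :=
  ∃ l : ι → ℝ, (∀ i, 0 ≤ l i ∧ l i ≤ m i) ∧ ν = μ - ∑ i ∈ posRoots b, (l i : ℂ) • P.root i

/-- `ν = μ - ∑_{α > 0} l_α α` with integers `0 ≤ l_α ≤ m_α`. -/
def IsIntLocal {P : RootPairing ι ℂ M N} (b : P.Base) (m : ι → ℕ) (μ ν : M) : Prop :=
  ∃ l : ι → ℕ, (∀ i, l i ≤ m i) ∧ ν = μ - ∑ i ∈ posRoots b, (l i : ℂ) • P.root i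

/-- The Weyl group of a root system is finite, so the sums over it and over its orbits are
finite sums. -/
theorem finite_weylN (P : RootPairing ι ℂ M N) [P.IsRootSystem] : Finite (weylN P) := by
  have key : ∀ w ∈ weylN P, ∀ i, ∃ j, w (P.coroot i) = P.coroot j := by
    intro w hw
    induction hw using Subgroup.closure_induction'' with
    | one => exact fun i => ⟨i, rfl⟩
    | mem w hw =>
      obtain ⟨k, rfl⟩ := hw
      exact fun i => ⟨P.reflectionPerm k i, (P.coroot_reflectionPerm k i).symm⟩
    | inv_mem w hw =>
      obtain ⟨k, rfl⟩ := hw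
      exact fun i => ⟨P.reflectionPerm k i, (P.coroot_reflectionPerm k i).symm⟩
    | mul u v _ _ hu hv =>
      intro i
      obtain ⟨j, hj⟩ := hv i
      obtain ⟨k, hk⟩ := hu j
      exact ⟨k, by rw [LinearEquiv.mul_apply, hj, hk]⟩
  choose f hf using key
  refine Finite.of_injective (fun w : weylN P => f w.1 w.2) fun u v huv => ?_
  refine Subtype.ext (LinearEquiv.toLinearMap_injective ?_)
  refine LinearMap.ext_on_range (v := P.coroot)
    RootPairing.IsRootSystem.span_coroot_eq_top fun i => ?_
  have h1 := hf u.1 u.2 i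
  have h2 := hf v.1 v.2 i
  have h3 : f u.1 u.2 i = f v.1 v.2 i := congrFun huv i
  simp only [LinearEquiv.coe_coe]
  rw [h1, h2, h3]

theorem finite_weylM (P : RootPairing ι ℂ M N) [P.IsRootSystem] : Finite (weylM P) :=
  finite_weylN P.flip

end

end MacBA

open MacBA

open MacBA
namespace MacBA
open scoped Classical
open Filter Topology Finset
open Finsupp (single onFinset mem_support_iff single_apply support_single_subset support_filter
  filter_apply filter_apply_pos finsetSum_apply support_sub mapDomain_apply
  support_smul single_eq_same single_eq_of_ne)
open Complex (exp_ne_zero exp_int_mul exp_sum exp norm_exp ofReal_re ofReal_exp continuous_ofReal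
  add_re ofReal_mul intCast_re ofReal_sum sub_re ofReal_neg neg_re ofReal_zero ofReal_natCast
  re_ofReal_mul re_sum exp_nat_mul natCast_re)
open RootPairing (pairing_same)
open LinearMap (map_add₂ map_sub₂ map_neg₂ map_smul₂ map_zero₂ flip_apply ext_on_range
  toMatrix' det transvection)
open Polynomial (degree_prod degree_X_sub_C eval_prod eval_sub eval_X eval_C aeval)
open Submodule (span span_induction smul_mem subset_span)
open MvPolynomial (monomial eval eval_monomial coe_aeval_eq_eval smul_monomial C_1 X_prime
  algebraMap_eq)
open Function (Injective comp_apply update update_self update_of_ne)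
open Matrix (map_apply mulVec)
open AddSubgroup (zmultiples mem_zmultiples_iff closure_induction)
open Nat (cast_smul_eq_nsmul lt_succ_iff cast_add sub_le)
open Int (cast_smul_eq_zsmul eq_ofNat_of_zero_le cast_natCast cast_neg)
open Set (mem_ofPred_eq)
open Real (exp_le_exp exp_pos)
set_option linter.unusedSectionVars false

variable {ι M N : Type*} [Fintype ι] [AddCommGroup M] [Module ℂ M] [AddCommGroup N] [Module ℂ N]
  {P : RootPairing ι ℂ M N} {L : ℂ} {m : ι → ℕ}

local notation:max "ε" a:max => qpow L (2 * a)
local notation:max "ς" => P.reflectionPerm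
local notation:73 a:74 " ⊙ " i:max => (a / 2) • P.coroot i
local notation:max "m⁺" => fun i => (m i : ℂ) + 1
local notation:max "m⁻" => fun i => -(m i : ℂ)

/-! ### Powers of `q` -/

lemma qpow_zero (L : ℂ) : qpow L 0 = 1 := by simp [qpow]

lemma qpow_add (L a b : ℂ) : qpow L (a + b) = qpow L a * qpow L b := by
  simp [qpow, add_mul, Complex.exp_add]

lemma qpow_ne_zero (L a : ℂ) : qpow L a ≠ 0 := exp_ne_zero _

lemma qpow_neg (L a : ℂ) : qpow L (-a) = (qpow L a)⁻¹ := by simp [qpow, neg_mul, Complex.exp_neg]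

lemma qpow_sub (L a b : ℂ) : qpow L (a - b) = qpow L a / qpow L b := by
  grind [sub_eq_add_neg, qpow_add, qpow_neg]

lemma qpow_int_mul (L : ℂ) (n : ℤ) (a : ℂ) : qpow L (n * a) = qpow L a ^ n := by
  rw [qpow, qpow, ← exp_int_mul, mul_assoc]

lemma qpow_nat_mul (L : ℂ) (n : ℕ) (a : ℂ) : qpow L (n * a) = qpow L a ^ n := by
  exact_mod_cast qpow_int_mul L n a

lemma qpow_two_mul (L a : ℂ) : qpow L (2 * a) = qpow L a ^ 2 := by
  exact_mod_cast qpow_nat_mul L 2 a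

lemma qpow_sum (L : ℂ) {κ : Type*} (s : Finset κ) (f : κ → ℂ) :
    qpow L (∑ i ∈ s, f i) = ∏ i ∈ s, qpow L (f i) := by
  simp [qpow, sum_mul, exp_sum]

/-- `q = e ^ L` is not a root of unity. -/
def NonRoot (L : ℂ) : Prop := ∀ n : ℤ, n ≠ 0 → qpow L n ≠ 1

lemma NonRoot.ne_zero (h : NonRoot L) : L ≠ 0 := by
  rintro rfl
  exact h 1 one_ne_zero (by simp [qpow])

lemma NonRoot.qpow_inj (h : NonRoot L) {m n : ℤ} (e : qpow L m = qpow L n) : m = n := by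
  by_contra hne
  refine h (m - n) (sub_ne_zero.2 hne) ?_
  simp_all [qpow_sub, qpow_ne_zero]

lemma brk_eq (L a : ℂ) : brk L a = qpow L (-a) * (qpow L (2 * a) - 1) := by
  rw [brk, mul_sub, ← qpow_add, mul_one]; ring_nf

lemma brk_eq_zero (L a : ℂ) : brk L a = 0 ↔ qpow L (2 * a) = 1 := by
  simp [brk_eq, qpow_ne_zero, sub_eq_zero]

lemma brk_neg (L a : ℂ) : brk L (-a) = -brk L a := by simp [brk]

lemma NonRoot.brk_int_ne_zero (h : NonRoot L) {n : ℤ} (hn : n ≠ 0) : brk L n ≠ 0 := by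
  rw [Ne, brk_eq_zero]
  have := h (2 * n) (by omega)
  push_cast at this
  exact this

lemma continuous_qpow (L : ℂ) : Continuous (qpow L) := by unfold qpow; fun_prop

lemma continuous_brk (L : ℂ) : Continuous (brk L) := by unfold brk qpow; fun_prop

lemma qpow_pi_div (hL : L ≠ 0) (c : ℂ) :
    qpow L (c * (2 * Real.pi * Complex.I / L)) = exp (c * (2 * Real.pi * Complex.I)) := by
  rw [qpow]; congr 1; field_simp

/-! ### Exponential sums -/

variable (P)

/-- The exponential sum `∑_μ f_μ q ^ (2 (μ, x))`. -/
noncomputable def expSum (L : ℂ) : (M →₀ ℂ) →ₗ[ℂ] (N → ℂ) :=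
  Finsupp.linearCombination ℂ fun μ x => qpow L (2 * P.1 μ x)

lemma expSum_apply (L : ℂ) (f : M →₀ ℂ) (x : N) :
    expSum P L f x = f.sum fun μ c => c * qpow L (2 * P.1 μ x) := by
  simp [expSum, Finsupp.linearCombination_apply, Finsupp.sum, Finset.sum_apply]

lemma expSum_single (L : ℂ) (μ : M) (c : ℂ) (x : N) :
    expSum P L (single μ c) x = c * qpow L (2 * P.1 μ x) := by
  simp [expSum]

lemma expSum_subset (L : ℂ) (f : M →₀ ℂ) (x : N) {S : Finset M}
    (hS : f.support ⊆ S) : expSum P L f x = ∑ μ ∈ S, f μ * qpow L (2 * P.1 μ x) := by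
  rw [expSum_apply, Finsupp.sum_of_support_subset _ hS]
  simp

lemma qpow_pair_add (L : ℂ) (μ : M) (x y : N) : qpow L (2 * P.1 μ (x + y)) = qpow L
    (2 * P.1 μ x) * qpow L (2 * P.1 μ y) := by
  rw [map_add, mul_add, qpow_add]

lemma qpow_add_pair (L : ℂ) (μ ν : M) (x : N) : qpow L (2 * P.1 (μ + ν) x) = qpow L
    (2 * P.1 μ x) * qpow L (2 * P.1 ν x) := by
  rw [map_add₂, mul_add, qpow_add]

/-- Multiplication of the coefficients of `f` by `u`. -/
noncomputable def reweight (u : M → ℂ) (f : M →₀ ℂ) : M →₀ ℂ :=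
  onFinset f.support (fun μ => f μ * u μ) fun μ h => by grind

@[simp] theorem reweight_apply (u : M → ℂ) (f : M →₀ ℂ) (μ : M) :
    reweight u f μ = f μ * u μ := rfl

lemma support_reweight_subset (u : M → ℂ) (f : M →₀ ℂ) :
    (reweight u f).support ⊆ f.support := Finsupp.support_onFinset_subset

lemma support_reweight (u : M → ℂ) (hu : ∀ μ, u μ ≠ 0) (f : M →₀ ℂ) :
    (reweight u f).support = f.support := by
  ext μ; simp [hu]

lemma expSum_reweight (L : ℂ) (f : M →₀ ℂ) (u : M → ℂ) (x : N) : expSum P L (reweight u f) x =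
    ∑ μ ∈ f.support, f μ * u μ * qpow L (2 * P.1 μ x) := by
  rw [expSum_subset P L _ x (support_reweight_subset u f)]
  rfl

lemma expSum_translate (L : ℂ) (f : M →₀ ℂ) (x τ : N) : expSum P L f (x + τ) = expSum P L
    (reweight (fun μ => qpow L (2 * P.1 μ τ)) f) x := by
  rw [expSum_reweight, expSum_subset P L f _ subset_rfl]
  refine sum_congr rfl fun μ _ => ?_
  rw [qpow_pair_add]; ring

lemma class_sum_eq_zero (L : ℂ) (H : AddSubgroup N) (f : M →₀ ℂ) (hf : ∀ h ∈ H,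
    expSum P L f h = 0) (μ : M) : ∑ κ ∈ f.support with
      (∀ h ∈ H, qpow L (2 * P.1 κ h) = qpow L (2 * P.1 μ h)), f κ = 0 := by
  let χ : M → (Multiplicative H →* ℂ) := fun κ =>
    { toFun := fun h => qpow L (2 * P.1 κ (h.toAdd : N))
      map_one' := by simp [qpow_zero]
      map_mul' := fun a b => by simp [← qpow_add, mul_add] }
  have hχ : ∀ κ, (χ κ = χ μ) ↔ (∀ h ∈ H, qpow L (2 * P.1 κ h) = qpow L (2 * P.1 μ h)) := fun κ => by
    constructor
    · exact fun h a ha => DFunLike.congr_fun h (Multiplicative.ofAdd (⟨a, ha⟩ : H))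
    · grind
  have hli := linearIndependent_monoidHom (Multiplicative H) ℂ
  have h0 : Finsupp.linearCombination ℂ
    (fun ψ : Multiplicative H →* ℂ => (ψ : Multiplicative H → ℂ)) (f.mapDomain χ) = 0 := by
    rw [Finsupp.linearCombination_mapDomain]
    funext a
    have := hf _ (Multiplicative.toAdd a).2
    rw [expSum_apply] at this
    simpa [Finsupp.linearCombination_apply, Finsupp.sum, Finset.sum_apply, χ] using! this
  have h1 := linearIndependent_iff.1 hli _ h0
  have h2 := DFunLike.congr_fun h1 (χ μ)
  rw [Finsupp.mapDomain, Finsupp.sum_apply, Finsupp.sum] at h2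
  simp only [single_apply, Finsupp.coe_zero, Pi.zero_apply] at h2
  rw [← h2, sum_filter]
  simp_all

lemma pair_left_injective {μ ν : M} (h : ∀ x, P.1 μ x = P.1 ν x) : μ = ν := P.toPerfPair.injective
    (LinearMap.ext h)

lemma eq_of_forall_qpow (hL : L ≠ 0) {μ ν : M} (h : ∀ x, ε (P.1 μ x) = ε (P.1 ν x)) : μ = ν := by
  refine pair_left_injective P fun x => ?_
  by_contra hne
  have hd : P.1 μ x - P.1 ν x ≠ 0 := sub_ne_zero.2 hne
  have h1 := h ((1 / (2 * (P.1 μ x - P.1 ν x) * L)) • x)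
  rw [← div_eq_one_iff_eq (qpow_ne_zero _ _), ← qpow_sub] at h1
  have : qpow L (2 * P.1 μ ((1 / (2 * (P.1 μ x - P.1 ν x) * L)) • x) -
      2 * P.1 ν ((1 / (2 * (P.1 μ x - P.1 ν x) * L)) • x)) =
      exp 1 := by
    rw [qpow]; congr 1
    simp only [map_smul, smul_eq_mul]
    rw [← mul_sub, ← mul_sub]; field_simp
  rw [this] at h1
  have h2 := congrArg norm h1
  rw [norm_exp] at h2
  simp at h2

lemma expSum_injective (hL : L ≠ 0) : Injective (expSum P L) := by
  rw [injective_iff_map_eq_zero]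
  intro f hf
  ext μ
  by_contra hμ
  have h := class_sum_eq_zero P L ⊤ f (fun h _ => by rw [hf]; rfl) μ
  rw [sum_eq_single_of_mem μ (by simpa using hμ)] at h
  · exact hμ h
  · intro κ hκ hne
    refine absurd (eq_of_forall_qpow P hL fun x => ?_) hne
    simp_all

lemma exists_zsmul_of_forall_qpow (hL : L ≠ 0) (i : ι) {d : M} (h : ∀ x, ε (P.root' i x) = 1 →
    ε (P.1 d x) = 1) : ∃ n : ℤ, d = n • P.root i := by
  have h0 : ∀ x, P.root' i x = 0 → P.1 d x = 0 := fun x hx => by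
    by_contra hne
    have h1 := h ((1 / (2 * P.1 d x * L)) • x) (by simp [hx, qpow_zero])
    have : ε (P.1 d ((1 / (2 * P.1 d x * L)) • x)) = exp 1 := by
      rw [qpow]; congr 1
      simp only [map_smul, smul_eq_mul]
      field_simp
    rw [this] at h1
    have h2 := congrArg norm h1
    rw [norm_exp] at h2
    simp at h2
  have hc : d = (P.coroot' i d / 2) • P.root i := by
    refine pair_left_injective P fun y => ?_
    have h1 := h0 (y - (P.root' i y) ⊙ i) (by simp)
    simp only [map_sub, map_smul, smul_eq_mul, LinearMap.smul_apply] at h1 ⊢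
    simp only [RootPairing.root', RootPairing.coroot', flip_apply] at h1 ⊢
    linear_combination h1
  have h1 := h ((2 * Real.pi * Complex.I / L / 4) • P.coroot i) (by
    have := qpow_pi_div hL 1
    rw [one_mul, one_mul, Complex.exp_two_pi_mul_I] at this
    rw [← this]; congr 1
    simp; ring)
  have h2 : qpow L (P.coroot' i d / 2 * (2 * Real.pi * Complex.I / L)) = 1 := by
    rw [← h1]; congr 1
    simp [RootPairing.coroot']; ring
  rw [qpow_pi_div hL, Complex.exp_eq_one_iff] at h2
  obtain ⟨n, hn⟩ := h2
  have h3 : P.coroot' i d / 2 = n :=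
    mul_right_cancel₀ (by simp [Real.pi_ne_zero] : (2 * Real.pi * Complex.I : ℂ) ≠ 0) hn
  refine ⟨n, ?_⟩
  rw [h3] at hc
  rw [hc, cast_smul_eq_zsmul]

lemma coset_sum_eq_zero (hL : L ≠ 0) (i : ι) (f : M →₀ ℂ) (x₀ : N) (hf : ∀ h,
    ε (P.root' i h) = 1 → expSum P L f (x₀ + h) = 0) (μ : M) : ∑ κ ∈ f.support with (∃ n : ℤ,
    κ = μ + n • P.root i), f κ * ε (P.1 κ x₀) = 0 := by
  let H : AddSubgroup N :=
    { carrier := {h | ε (P.root' i h) = 1}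
      zero_mem' := by simp [qpow_zero]
      add_mem' := fun {a b} ha hb => by
        simp only [mem_ofPred_eq] at ha hb ⊢
        rw [map_add, mul_add, qpow_add, ha, hb, one_mul]
      neg_mem' := fun {a} ha => by
        simp only [mem_ofPred_eq] at ha ⊢
        rw [map_neg, mul_neg, qpow_neg, ha, inv_one] }
  have h := class_sum_eq_zero P L H (reweight (fun μ => ε (P.1 μ x₀)) f) (fun h hh => by
      rw [← expSum_translate, add_comm]; exact hf h hh) μ
  rw [support_reweight _ fun _ => qpow_ne_zero _ _] at h
  rw [← h]
  refine sum_congr (filter_congr fun κ _ => ?_) fun _ _ => rfl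
  constructor
  · rintro ⟨n, rfl⟩ a ha
    have ha' : ε (P.root' i a) = 1 := ha
    rw [qpow_add_pair]
    have : ε (P.1 (n • P.root i) a) = 1 := by
      have : 2 * P.1 (n • P.root i) a = n * (2 * P.root' i a) := by simp; ring
      rw [this, qpow_int_mul, ha', one_zpow]
    rw [this, mul_one]
  · intro hk
    obtain ⟨n, hn⟩ := exists_zsmul_of_forall_qpow P hL i (d := κ - μ) (fun x hx => by
      rw [map_sub₂, mul_sub, qpow_sub, hk x hx, div_self (qpow_ne_zero _ _)])
    grind

/-- The space of exponential sums with exponents in `G`. -/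
noncomputable def expSpace (L : ℂ) (G : Set M) : Submodule ℂ (N → ℂ) :=
  (Finsupp.supported ℂ ℂ G).map (expSum P L)

lemma expSum_mem (L : ℂ) {G : Set M} {f : M →₀ ℂ} (hf : ∀ μ ∈ f.support, μ ∈ G) : expSum P L
    f ∈ expSpace P L G := ⟨f, (Finsupp.mem_supported _ _).2 hf, rfl⟩

lemma mem_expSpace (L : ℂ) {G : Set M} {F : N → ℂ} :
    F ∈ expSpace P L G ↔ ∃ f : M →₀ ℂ, (∀ μ ∈ f.support, μ ∈ G) ∧ expSum P L f = F := by
  simp only [expSpace, Submodule.mem_map, Finsupp.mem_supported]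
  rfl

lemma exp_mem_expSpace (L : ℂ) {G : Set M} {μ : M} (hμ : μ ∈ G) :
    (fun x => qpow L (2 * P.1 μ x)) ∈ expSpace P L G := by
  rw [mem_expSpace]
  refine ⟨single μ 1, fun κ hκ => ?_, ?_⟩
  · grind
  · funext x; rw [expSum_single, one_mul]

lemma expSpace_eq_span (L : ℂ) (G : Set M) :
    expSpace P L G = span ℂ ((fun μ x => qpow L (2 * P.1 μ x)) '' G) := by
  rw [expSpace, expSum, Finsupp.span_image_eq_map_linearCombination]

lemma exp_mul_mem_expSpace (L : ℂ) {G G' : Set M} {κ : M} (hG : ∀ μ ∈ G, κ + μ ∈ G') {F : N → ℂ}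
    (hF : F ∈ expSpace P L G) : (fun x => qpow L (2 * P.1 κ x) * F x) ∈ expSpace P L G' := by
  rw [expSpace_eq_span] at hF
  induction hF using span_induction with
  | mem F h =>
    obtain ⟨μ, hμ, rfl⟩ := h
    simpa only [qpow_add_pair] using exp_mem_expSpace P L (hG μ hμ)
  | zero =>
    have : (fun x => qpow L (2 * P.1 κ x) * (0 : N → ℂ) x) = 0 := by funext x; simp
    rw [this]
    exact zero_mem _
  | add F F' _ _ h h' => simpa only [Pi.add_apply, mul_add] using! add_mem h h'
  | smul c F _ h =>
    simpa only [Pi.smul_apply, smul_eq_mul, mul_left_comm] using! smul_mem _ c h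

lemma translate_mem_expSpace (L : ℂ) {G : Set M} (τ : N) {F : N → ℂ}
    (hF : F ∈ expSpace P L G) : (fun x => F (x + τ)) ∈ expSpace P L G := by
  obtain ⟨f, hf, rfl⟩ := (mem_expSpace P L).1 hF
  have : (fun x => expSum P L f (x + τ)) = expSum P L
    (reweight (fun μ => qpow L (2 * P.1 μ τ)) f) := by
    funext x; rw [expSum_translate]
  rw [this]
  exact expSum_mem P L fun μ hμ => hf μ (support_reweight_subset _ _ hμ)

lemma differentiable_line (L : ℂ) {G : Set M} {F : N → ℂ}
    (hF : F ∈ expSpace P L G) (x v : N) : Differentiable ℂ fun t : ℂ => F (x + t • v) := by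
  obtain ⟨f, hf, rfl⟩ := (mem_expSpace P L).1 hF
  simp only [expSum_subset P L f _ subset_rfl, qpow, map_add, map_smul, smul_eq_mul]
  fun_prop

/-! ### Division -/

lemma exists_exp_mul_pow_sub_one (L : ℂ) (i : ι) (k : ℂ) {G : Set M} {μ : M} (hμ : ∀ n : ℤ,
    μ + n • P.root i ∈ G) (n : ℤ) : ∃ h ∈ expSpace P L G, ∀ x, qpow L (2 * P.1 μ x) *
    (qpow L (2 * (P.root' i x + k)) ^ n - 1) = (qpow L (2 * (P.root' i x + k)) - 1) * h x := by
  have key : ∀ n : ℤ, (fun x => qpow L (2 * P.1 μ x) *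
      qpow L (2 * (P.root' i x + k)) ^ n) ∈ expSpace P L G := fun n => by
    have := smul_mem _ (qpow L (2 * k) ^ n) (exp_mem_expSpace P L (hμ n))
    convert this using 1
    funext x
    rw [Pi.smul_apply, smul_eq_mul, qpow_add_pair, mul_add, qpow_add, mul_zpow,
      ← qpow_int_mul L n (2 * P.root' i x)]
    have : 2 * P.1 (n • P.root i) x = n * (2 * P.root' i x) := by simp; ring
    rw [this]; ring
  induction n using Int.induction_on with
  | zero => exact ⟨0, zero_mem _, fun x => by simp⟩
  | succ n ih =>
    obtain ⟨h, hh, he⟩ := ih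
    refine ⟨h + _, add_mem hh (key n), fun x => ?_⟩
    have := qpow_ne_zero L (2 * (P.root' i x + k))
    rw [zpow_add_one₀ this, Pi.add_apply]
    linear_combination he x
  | pred n ih =>
    obtain ⟨h, hh, he⟩ := ih
    refine ⟨h - _, sub_mem hh (key (-n - 1)), fun x => ?_⟩
    have := qpow_ne_zero L (2 * (P.root' i x + k))
    have h2 := zpow_sub_one₀ this (-n : ℤ)
    rw [Pi.sub_apply]
    grind

lemma exists_eq_mul_of_vanish (hL : L ≠ 0) (i : ι) (k : ℂ) {G : Set M} (hG : ∀ μ ∈ G, ∀ n : ℤ,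
    μ + n • P.root i ∈ G) {F : N → ℂ} (hF : F ∈ expSpace P L G) (h0 : ∀ x, ε (P.root' i x + k) = 1 →
    F x = 0) : ∃ h ∈ expSpace P L G, ∀ x, F x = (ε (P.root' i x + k) - 1) * h x := by
  obtain ⟨f, hf, rfl⟩ := (mem_expSpace P L).1 hF
  let Z := zmultiples (P.root i)
  let r : M → M := fun μ => Quotient.out (QuotientAddGroup.mk μ : M ⧸ Z)
  have hrr : ∀ μ, ∃ n : ℤ, μ = r μ + n • P.root i := fun μ => by
    have h1 : (QuotientAddGroup.mk (r μ) : M ⧸ Z) = QuotientAddGroup.mk μ := Quotient.out_eq _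
    rw [QuotientAddGroup.eq] at h1
    obtain ⟨n, hn⟩ := mem_zmultiples_iff.1 h1
    exact ⟨n, by rw [hn]; abel⟩
  have hrc : ∀ μ (n : ℤ), r (μ + n • P.root i) = r μ := fun μ n => by
    have : (QuotientAddGroup.mk (μ + n • P.root i) : M ⧸ Z) = QuotientAddGroup.mk μ := by
      rw [eq_comm, QuotientAddGroup.eq]
      exact mem_zmultiples_iff.2 ⟨n, by abel⟩
    simp only [r, this]
  have hr_idem : ∀ μ, r (r μ) = r μ := by intro μ; obtain ⟨n, hn⟩ := hrr μ; conv_rhs => rw [hn, hrc]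
  choose n hn using hrr
  have hrG : ∀ μ ∈ G, r μ ∈ G := fun μ hμ => by
    rw [show r μ = μ + (-n μ) • P.root i by
      rw [neg_smul, ← sub_eq_add_neg, eq_sub_iff_add_eq]; exact (hn μ).symm]
    exact hG _ hμ _
  have key : ∀ μ ∈ f.support, ∃ h ∈ expSpace P L G, ∀ x, ε (P.1 μ x) = ε k ^ (-n μ) * ε
    (P.1 (r μ) x) + (ε (P.root' i x + k) - 1) * h x := fun μ hμ => by
    obtain ⟨h, hh, he⟩ := exists_exp_mul_pow_sub_one P L i k (μ := r μ)
      (hG _ (hrG μ (hf μ hμ))) (n μ)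
    refine ⟨(ε k ^ (-n μ)) • h, smul_mem _ _ hh, fun x => ?_⟩
    have h1 : ε (P.1 μ x) = ε (P.1 (r μ) x) * ε (P.root' i x) ^ (n μ) := by
      conv_lhs => rw [hn μ]
      rw [qpow_add_pair, ← qpow_int_mul L (n μ) (2 * P.root' i x)]
      congr 2
      simp; ring
    have h2 := he x
    rw [Pi.smul_apply, smul_eq_mul, mul_left_comm, ← h2, h1, mul_add, qpow_add, mul_zpow]
    have := qpow_ne_zero L (2 * k)
    rw [zpow_neg]
    field_simp
    ring
  choose! h hh he using key
  let g : M →₀ ℂ := ∑ μ ∈ f.support, single (r μ) (f μ * ε k ^ (-n μ))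
  have hg : ∀ x, expSum P L g x = ∑ μ ∈ f.support, f μ * ε k ^ (-n μ) * ε (P.1 (r μ) x) := fun x =>
    by
    simp only [g, map_sum, Finset.sum_apply, expSum_single]
  have hsplit : ∀ x, expSum P L f x = expSum P L g x + (ε (P.root' i x + k) - 1) * ∑ μ ∈ f.support,
    f μ * h μ x := fun x => by
    rw [hg, expSum_subset P L f x subset_rfl, mul_sum, ← sum_add_distrib]
    refine sum_congr rfl fun μ hμ => ?_
    rw [he μ hμ x]; ring
  have hgs : ∀ κ ∈ g.support, r κ = κ := fun κ hκ => by
    have h1 := Finsupp.support_finsetSum hκ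
    simp only [mem_biUnion] at h1
    obtain ⟨μ, _, hμ⟩ := h1
    have h2 := support_single_subset hμ
    rw [mem_singleton] at h2
    rw [h2, hr_idem]
  have hg0 : g = 0 := by
    ext κ
    by_contra hκ
    have hv : ∀ a, ε (P.root' i a) = 1 → expSum P L g ((-(k / 2)) • P.coroot i + a) = 0 := fun a
      ha => by
      have h1 : ε (P.root' i ((-(k / 2)) • P.coroot i + a) + k) = 1 := by rw [← ha]; congr 2; simp
      have h2 := hsplit ((-(k / 2)) • P.coroot i + a)
      rw [h0 _ h1, h1, sub_self, zero_mul, add_zero] at h2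
      exact h2.symm
    have h1 := coset_sum_eq_zero P hL i g _ hv κ
    rw [sum_eq_single_of_mem κ] at h1
    · exact hκ ((mul_eq_zero.1 h1).resolve_right (qpow_ne_zero _ _))
    · grind
    · intro κ' hκ' hne
      obtain ⟨h3, m, h4⟩ := mem_filter.1 hκ'
      refine absurd ?_ hne
      grind
  refine ⟨∑ μ ∈ f.support, f μ • h μ,
    Submodule.sum_mem _ fun μ hμ => smul_mem _ _ (hh μ hμ), fun x => ?_⟩
  rw [hsplit, hg0]
  simp [Finset.sum_apply]

lemma ev_qpow_ne_one (hL : L ≠ 0) (a : ℂ) {s : ℂ} (hs : s ≠ 0) :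
    ∀ᶠ t : ℂ in 𝓝[≠] 0, ε (a + t * s) ≠ 1 := by
  have h : HasDerivAt (fun t : ℂ => ε (a + t * s)) (ε (a + 0 * s) * ((2 * (1 * s)) * L)) 0 := by
    unfold qpow
    exact ((((((hasDerivAt_id (0 : ℂ)).mul_const s).const_add a).const_mul 2).mul_const L)).cexp
  refine h.eventually_ne ?_
  exact mul_ne_zero (qpow_ne_zero _ _) (by simp [hL, hs])

lemma linearIndependent_root_pair [P.IsReduced] {i j : ι}
    (h1 : P.root j ≠ P.root i) (h2 : P.root j ≠ -P.root i) :
    LinearIndependent ℂ ![P.root i, P.root j] :=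
  RootPairing.IsReduced.linearIndependent P (fun h => h1 (by rw [h])) fun h => h2 (by rw [h, neg_neg])

lemma exists_transversal [P.IsReduced] (i : ι) : ∃ v : N, P.root' i v = 0 ∧ ∀ j, P.root j ≠ P.root
    i → P.root j ≠ -P.root i → P.root' j v ≠ 0 := by
  obtain ⟨v, hv, hv'⟩ := Module.Dual.exists_forall_mem_ne_zero_of_forall_exists
    (LinearMap.ker (P.root' i))
    (fun j : {j : ι // P.root j ≠ P.root i ∧ P.root j ≠ -P.root i} => P.root' j.1) (by
      rintro ⟨j, h1, h2⟩
      by_contra! hall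
      have hli := linearIndependent_root_pair P h1 h2
      rw [LinearIndependent.pair_iff] at hli
      have : P.root j = (P.pairing j i / 2) • P.root i := by
        refine pair_left_injective P fun y => ?_
        have h := hall (y - (P.root' i y) ⊙ i) (by simp)
        simp only [map_sub, map_smul, smul_eq_mul, RootPairing.root'_coroot_eq_pairing] at h
        simp only [map_smul, smul_eq_mul, LinearMap.smul_apply]
        simp only [RootPairing.root'] at h
        linear_combination h
      have h3 := hli (P.pairing j i / 2) (-1) (by rw [this]; simp)
      simpa using h3.2)
  exact ⟨v, hv, fun j h1 h2 => hv' ⟨j, h1, h2⟩⟩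

variable {P} in
lemma tendsto_line {G : Set M} {F : N → ℂ} (hF : F ∈ expSpace P L G) (x v : N) :
    Tendsto (fun e : ℂ => F (x + e • v)) (𝓝[≠] 0) (𝓝 (F x)) := by
  have h3 := (differentiable_line P L hF x v).continuous.tendsto 0
  rw [zero_smul, add_zero] at h3
  exact h3.mono_left nhdsWithin_le_nhds

lemma exists_expSpace_eq_of_tendsto [P.IsReduced] (hL : L ≠ 0)
    {κ : Type*} (J : Finset κ) (a : κ → ι) (k : κ → ℂ) {G : Set M}
    (hG : ∀ i, ∀ μ ∈ G, ∀ n : ℤ, μ + n • P.root i ∈ G) {F u : N → ℂ} (hF : F ∈ expSpace P L G)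
    (hu : ∀ x, (∀ j ∈ J, ε (P.root' (a j) x + k j) ≠ 1) →
      F x = u x * ∏ j ∈ J, (ε (P.root' (a j) x + k j) - 1))
    (hlim : ∀ j ∈ J, ∀ x, ε (P.root' (a j) x + k j) = 1 →
      (∀ j' ∈ J, P.root (a j') ≠ P.root (a j) → P.root (a j') ≠ -P.root (a j) →
        ε (P.root' (a j') x + k j') ≠ 1) →
      Tendsto (fun t : ℂ => (ε (P.root' (a j) (x + t • P.coroot (a j)) + k j) - 1) *
        u (x + t • P.coroot (a j))) (𝓝[≠] 0) (𝓝 0)) :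
    ∃ g ∈ expSpace P L G, ∀ x, (∀ j ∈ J, ε (P.root' (a j) x + k j) ≠ 1) →
      g x = u x := by
  have hev : ∀ j (x v : N), (ε (P.root' (a j) x + k j) ≠ 1 ∨ P.root' (a j) v ≠ 0) → ∀ᶠ t : ℂ in 𝓝[≠]
    0, ε (P.root' (a j) (x + t • v) + k j) ≠ 1 := fun j x v h => by
    rcases h with h | h
    · refine Filter.Eventually.filter_mono nhdsWithin_le_nhds ?_
      have hc : Continuous fun t : ℂ => ε (P.root' (a j) (x + t • v) + k j) := by
        simp only [map_add, map_smul, smul_eq_mul, qpow]; fun_prop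
      exact hc.continuousAt.eventually_ne (by simpa using h)
    · filter_upwards [ev_qpow_ne_one hL (P.root' (a j) x + k j) h] with t ht
      convert ht using 3
      simp; ring
  suffices H : ∀ T ⊆ J, ∃ g ∈ expSpace P L G, ∀ x, (∀ j ∈ J, ε (P.root' (a j) x + k j) ≠ 1) → g x =
    u x * ∏ j ∈ J \ T, (ε (P.root' (a j) x + k j) - 1) by
    simpa using H J subset_rfl
  intro T
  induction T using Finset.induction_on with
  | empty => exact fun _ => ⟨F, hF, by simpa using hu⟩
  | insert j T hjT ih =>
    intro hT
    have hj : j ∈ J := hT (mem_insert_self _ _)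
    obtain ⟨g, hg, hgu⟩ := ih fun x hx => hT (mem_insert_of_mem hx)
    have hsplit : J \ T = insert j (J \ insert j T) := by grind
    have hnot : j ∉ J \ insert j T := by simp
    have hgen : ∀ x, ε (P.root' (a j) x + k j) = 1 → (∀ j' ∈ J, P.root (a j') ≠ P.root (a j) →
      P.root (a j') ≠ -P.root (a j) → ε (P.root' (a j') x + k j') ≠ 1) → g x = 0 := fun x hx hx' =>
      by
      have hreg : ∀ᶠ t : ℂ in 𝓝[≠] 0, ∀ j' ∈ J, ε (P.root' (a j') (x + t • P.coroot (a j)) + k j') ≠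
        1 := by
        rw [Filter.eventually_all_finset]
        intro j' hj'
        apply hev
        by_cases h1 : P.root (a j') = P.root (a j)
        · right; simp [RootPairing.root', h1]
        by_cases h2 : P.root (a j') = -P.root (a j)
        · right; simp [RootPairing.root', h2]
        · exact Or.inl (hx' j' hj' h1 h2)
      have hl := hlim j hj x hx hx'
      have hprod : Tendsto (fun t : ℂ => ∏ j' ∈ J \ insert j T,
          (ε (P.root' (a j') (x + t • P.coroot (a j)) + k j') - 1)) (𝓝[≠] 0)
          (𝓝 (∏ j' ∈ J \ insert j T,
          (ε (P.root' (a j') (x + (0 : ℂ) • P.coroot (a j)) + k j') - 1))) := by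
        refine Filter.Tendsto.mono_left (Continuous.tendsto ?_ 0) nhdsWithin_le_nhds
        simp only [map_add, map_smul, smul_eq_mul, qpow]; fun_prop
      have h1 := hl.mul hprod
      rw [zero_mul] at h1
      refine tendsto_nhds_unique (tendsto_line hg x (P.coroot (a j))) (h1.congr' ?_)
      filter_upwards [hreg] with t ht
      rw [hgu _ ht, hsplit, prod_insert hnot]; ring
    have hzero : ∀ x, ε (P.root' (a j) x + k j) = 1 → g x = 0 := fun x hx => by
      obtain ⟨v, hv, hv'⟩ := exists_transversal P (a j)
      have hreg : ∀ᶠ t : ℂ in 𝓝[≠] 0, ∀ j' ∈ J, P.root (a j') ≠ P.root (a j) → P.root (a j') ≠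
        -P.root (a j) → ε (P.root' (a j') (x + t • v) + k j') ≠ 1 := by
        rw [Filter.eventually_all_finset]
        intro j' hj'
        by_cases h1 : P.root (a j') = P.root (a j)
        · simp [h1]
        by_cases h2 : P.root (a j') = -P.root (a j)
        · simp [h2]
        filter_upwards [hev j' x v (Or.inr (hv' _ h1 h2))] with t ht _ _ using ht
      refine tendsto_nhds_unique (tendsto_line hg x v) (tendsto_const_nhds.congr' ?_)
      filter_upwards [hreg] with t ht
      exact (hgen _ (by simpa [hv] using hx) ht).symm
    obtain ⟨h, hh, he⟩ := exists_eq_mul_of_vanish P hL (a j) (k j) (hG (a j)) hg hzero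
    refine ⟨h, hh, fun x hx => ?_⟩
    grind

/-! ### Asymptotics of exponential sums -/

lemma qpow_ray (hL : L ≠ 0) (μ : M) (x y : N) (t : ℝ) : ε (P.1 μ (x + ((t : ℂ) / L) • y)) = ε
    (P.1 μ x) * exp (2 * t * P.1 μ y) := by
  rw [qpow_pair_add]
  congr 1
  rw [qpow]; congr 1
  simp only [map_smul, smul_eq_mul]
  field_simp

lemma re_lt_of_tendsto_ray (hL : L ≠ 0) (y : N) (μ₀ : M)
    (h : M →₀ ℂ) (hr : ∀ μ ∈ h.support, ∃ r : ℝ, P.1 (μ - μ₀) y = r) (d : ℝ)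
    (hlim : ∀ x, Tendsto (fun t : ℝ => exp (-(2 * t * (P.1 μ₀ y + d))) *
      expSum P L h (x + ((t : ℂ) / L) • y)) atTop (𝓝 0)) :
    ∀ μ ∈ h.support, (P.1 (μ - μ₀) y).re < d := by
  by_contra! hcon
  obtain ⟨μ₁, hμ₁, hd₁⟩ := hcon
  obtain ⟨μ₂, hμ₂, hmax⟩ := exists_max_image h.support (fun μ => (P.1 (μ - μ₀) y).re) ⟨μ₁, hμ₁⟩
  set D := (P.1 (μ₂ - μ₀) y).re with hD
  have hdD : d ≤ D := hd₁.trans (hmax μ₁ hμ₁)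
  have hre : ∀ μ ∈ h.support, P.1 μ y = P.1 μ₀ y + ((P.1 (μ - μ₀) y).re : ℂ) := fun μ hμ => by
    obtain ⟨r, h1⟩ := hr μ hμ
    rw [h1, ofReal_re, ← h1]; simp
  let top := h.filter fun μ => (P.1 (μ - μ₀) y).re = D
  have htop : expSum P L top = 0 := by
    funext x
    have h1 : Tendsto (fun t : ℝ => exp (-(2 * t * (P.1 μ₀ y + D))) *
        expSum P L h (x + ((t : ℂ) / L) • y)) atTop (𝓝 (expSum P L top x)) := by
      have h2 : ∀ t : ℝ, exp (-(2 * t * (P.1 μ₀ y + D))) * expSum P L h (x + ((t : ℂ) / L) • y) =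
        ∑ μ ∈ h.support, h μ * ε (P.1 μ x) * (Real.exp (2 * t * ((P.1 (μ - μ₀) y).re - D)) : ℝ) :=
        fun t => by
        rw [expSum_subset P L h _ subset_rfl, mul_sum]
        refine sum_congr rfl fun μ hμ => ?_
        rw [qpow_ray P hL, hre μ hμ, ofReal_exp]
        push_cast
        have : exp (2 * t * (((P.1 (μ - μ₀) y).re : ℂ) - D)) = exp (-(2 * t * (P.1 μ₀ y + D))) * exp
          (2 * t * (P.1 μ₀ y + ((P.1 (μ - μ₀) y).re : ℂ))) := by
          rw [← Complex.exp_add]; congr 1; ring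
        rw [this]; ring
      simp_rw [h2]
      have h3 : expSum P L top x = ∑ μ ∈ h.support, h μ * ε (P.1 μ x) *
        ((if (P.1 (μ - μ₀) y).re = D then 1 else 0 : ℝ) : ℂ) := by
        rw [expSum_subset P L top x (S := h.support)
          (by rw [support_filter]; exact filter_subset _ _)]
        refine sum_congr rfl fun μ _ => ?_
        rw [filter_apply]
        split_ifs <;> simp
      rw [h3]
      refine tendsto_finsetSum _ fun μ hμ => Tendsto.const_mul _ ?_
      refine (continuous_ofReal.tendsto _).comp ?_
      split_ifs with heq
      · rw [heq]; simp
      · have hlt : (P.1 (μ - μ₀) y).re - D < 0 := sub_neg.2 (lt_of_le_of_ne (hmax μ hμ) heq)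
        refine Real.tendsto_exp_atBot.comp ?_
        exact Tendsto.atTop_mul_const_of_neg hlt (tendsto_id.const_mul_atTop two_pos)
    have h4 : Tendsto (fun t : ℝ => exp (-(2 * t * (P.1 μ₀ y + D))) *
        expSum P L h (x + ((t : ℂ) / L) • y)) atTop (𝓝 0) := by
      have h5 := hlim x
      rw [tendsto_zero_iff_norm_tendsto_zero] at h5 ⊢
      refine squeeze_zero' (Eventually.of_forall fun _ => norm_nonneg _) ?_ h5
      filter_upwards [eventually_ge_atTop (0 : ℝ)] with t ht
      rw [norm_mul, norm_mul]
      refine mul_le_mul_of_nonneg_right ?_ (norm_nonneg _)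
      rw [norm_exp, norm_exp, exp_le_exp]
      simp
      nlinarith
    rw [tendsto_nhds_unique h1 h4]; rfl
  have h6 := expSum_injective P hL (htop.trans (map_zero _).symm)
  have h7 := DFunLike.congr_fun h6 μ₂
  have h8 : top μ₂ = h μ₂ := filter_apply_pos (fun μ => (P.1 (μ - μ₀) y).re = D) h hD.symm
  grind

variable {P}

local notation:max "𝓔" => expSum P L

variable (P)

/-- Functions on the roots that are invariant under the Weyl group. -/
abbrev WInv {A : Type*} (k : ι → A) : Prop := ∀ i j, k (ς i j) = k j

/-! ### The Weyl group -/

/-- The Weyl group, acting simultaneously on the weight space, the coweight space and the index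
set of the roots. -/
def Weyl : Subgroup ((M ≃ₗ[ℂ] M) × (N ≃ₗ[ℂ] N) × Equiv.Perm ι) := Subgroup.closure
    (Set.range fun i => (P.reflection i, P.coreflection i, ς i))

/-- The reflection in a root as an element of `Weyl`. -/
def reflTriple (i : ι) : Weyl P :=
  ⟨(P.reflection i, P.coreflection i, ς i), Subgroup.subset_closure ⟨i, rfl⟩⟩

lemma reflTriple_mul_self (i : ι) : reflTriple P i * reflTriple P i = 1 := by
  refine Subtype.ext (Prod.ext ?_ (Prod.ext ?_ ?_))
  · ext x; simp [reflTriple]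
  · ext x; simp [reflTriple]
  · ext x; simp [reflTriple]

lemma reflTriple_inv (i : ι) : (reflTriple P i)⁻¹ = reflTriple P i := inv_eq_of_mul_eq_one_left
    (reflTriple_mul_self P i)

lemma weyl_induction {p : Weyl P → Prop} (one : p 1)
    (mul : ∀ i w, p w → p (reflTriple P i * w)) (w : Weyl P) : p w := by
  obtain ⟨w, hw⟩ := w
  induction hw using Subgroup.closure_induction_left with
  | one => exact one
  | mul_left x hx y hy h =>
    obtain ⟨i, rfl⟩ := hx
    exact mul i ⟨y, hy⟩ h
  | inv_mul_cancel x hx y hy h =>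
    obtain ⟨i, rfl⟩ := hx
    have := mul i ⟨y, hy⟩ h
    rwa [← reflTriple_inv] at this

lemma root_weyl (w : Weyl P) (i : ι) : P.root (w.1.2.2 i) = w.1.1 (P.root i) := by
  induction w using weyl_induction P with
  | one => rfl
  | mul j w ih =>
    change P.root (ς j (w.1.2.2 i)) = P.reflection j (w.1.1 (P.root i))
    rw [P.root_reflectionPerm, ih]

lemma coroot_weyl (w : Weyl P) (i : ι) : P.coroot (w.1.2.2 i) = w.1.2.1 (P.coroot i) := by
  induction w using weyl_induction P with
  | one => rfl
  | mul j w ih =>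
    change P.coroot (ς j (w.1.2.2 i)) = P.coreflection j (w.1.2.1 (P.coroot i))
    rw [P.coroot_reflectionPerm, ih]

lemma pair_weyl (w : Weyl P) (μ : M) (ν : N) : P.1 (w.1.1 μ) (w.1.2.1 ν) = P.1 μ ν := by
  induction w using weyl_induction P with
  | one => rfl
  | mul j w ih =>
    change P.1 (P.reflection j (w.1.1 μ)) (P.coreflection j (w.1.2.1 ν)) = _
    rw [← ih]
    simp only [P.reflection_apply, P.coreflection_apply, map_sub, map_smul, LinearMap.sub_apply,
      LinearMap.smul_apply, smul_eq_mul, RootPairing.root', RootPairing.coroot',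
      flip_apply, P.root_coroot_two]
    ring

lemma pair_weyl_right (w : Weyl P) (μ : M) (ν : N) : P.1 μ (w.1.2.1 ν) = P.1 (w⁻¹.1.1 μ) ν := by
  rw [← pair_weyl P w (w⁻¹.1.1 μ) ν]
  simp

lemma root'_weyl (w : Weyl P) (i : ι) (x : N) :
    P.root' (w.1.2.2 i) (w.1.2.1 x) = P.root' i x := by
  rw [RootPairing.root', root_weyl, pair_weyl]

lemma coroot'_weyl (w : Weyl P) (i : ι) (μ : M) :
    P.coroot' (w.1.2.2 i) (w.1.1 μ) = P.coroot' i μ := by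
  simp [coroot_weyl, pair_weyl]

lemma invariant_weyl {A : Type*} {k : ι → A} (hk : WInv P k) (w : Weyl P) (i : ι) : k
    (w.1.2.2 i) = k i := by
  induction w using weyl_induction P with
  | one => rfl
  | mul j w ih =>
    change k (ς j (w.1.2.2 i)) = k i
    rw [hk, ih]

lemma weyl_ext [P.IsRootSystem] {v w : Weyl P} (h : ∀ i, v.1.2.2 i = w.1.2.2 i) : v = w := by
  refine Subtype.ext (Prod.ext ?_ (Prod.ext ?_ ?_))
  · refine LinearEquiv.toLinearMap_injective (ext_on_range (v := P.root)
      RootPairing.IsRootSystem.span_root_eq_top fun i => ?_)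
    simp only [LinearEquiv.coe_coe]
    rw [← root_weyl, ← root_weyl, h]
  · refine LinearEquiv.toLinearMap_injective (ext_on_range (v := P.coroot)
      RootPairing.IsRootSystem.span_coroot_eq_top fun i => ?_)
    simp only [LinearEquiv.coe_coe]
    rw [← coroot_weyl, ← coroot_weyl, h]
  · exact Equiv.ext h

instance finite_Weyl [P.IsRootSystem] : Finite (Weyl P) :=
  Finite.of_injective (fun w : Weyl P => w.1.2.2) fun v w h =>
    weyl_ext P fun i => DFunLike.congr_fun (h : v.1.2.2 = w.1.2.2) i

noncomputable instance fintype_Weyl [P.IsRootSystem] : Fintype (Weyl P) := Fintype.ofFinite _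

lemma weylN_iff (g : N ≃ₗ[ℂ] N) : g ∈ weylN P ↔ ∃ w : Weyl P, w.1.2.1 = g := by
  constructor
  · intro hg
    induction hg using Subgroup.closure_induction with
    | mem x hx => obtain ⟨i, rfl⟩ := hx; exact ⟨reflTriple P i, rfl⟩
    | one => exact ⟨1, rfl⟩
    | mul x y _ _ hx hy =>
      obtain ⟨v, rfl⟩ := hx; obtain ⟨w, rfl⟩ := hy; exact ⟨v * w, rfl⟩
    | inv x _ hx => obtain ⟨v, rfl⟩ := hx; exact ⟨v⁻¹, rfl⟩
  · rintro ⟨w, rfl⟩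
    induction w using weyl_induction P with
    | one => exact one_mem _
    | mul i w ih => exact mul_mem (Subgroup.subset_closure ⟨i, rfl⟩) ih

lemma mem_orbitN_iff (π τ : N) :
    τ ∈ MulAction.orbit (weylN P) π ↔ ∃ w : Weyl P, τ = w.1.2.1 π := by
  constructor
  · rintro ⟨⟨g, hg⟩, rfl⟩
    obtain ⟨w, rfl⟩ := (weylN_iff P g).1 hg
    exact ⟨w, rfl⟩
  · rintro ⟨w, rfl⟩
    exact ⟨⟨_, (weylN_iff P _).2 ⟨w, rfl⟩⟩, rfl⟩

lemma weyl_eq_of_coweight [P.IsRootSystem] {v w : Weyl P} (h : v.1.2.1 = w.1.2.1) : v = w :=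
    weyl_ext P fun i => P.coroot.injective (by rw [coroot_weyl, coroot_weyl, h])

/-- The triples correspond to the elements of the Weyl group acting on the coweight space. -/
noncomputable def weylNEquiv [P.IsRootSystem] : Weyl P ≃ weylN P := Equiv.ofBijective
    (fun w => ⟨w.1.2.1, (weylN_iff P _).2 ⟨w, rfl⟩⟩) <| by
    constructor
    · exact fun v w h => weyl_eq_of_coweight P (congrArg Subtype.val h)
    · rintro ⟨g, hg⟩
      obtain ⟨w, rfl⟩ := (weylN_iff P g).1 hg
      exact ⟨w, rfl⟩

lemma sum_weylN [P.IsRootSystem] (F : (N ≃ₗ[ℂ] N) → ℂ) :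
    ∑ᶠ w : weylN P, F w = ∑ w : Weyl P, F w.1.2.1 := by
  rw [← finsum_comp_equiv (weylNEquiv P), finsum_eq_sum_of_fintype]
  rfl

lemma reflTriple_reflectionPerm [P.IsRootSystem] (i j : ι) :
    reflTriple P (ς i j) = reflTriple P i * reflTriple P j * reflTriple P i := by
  refine weyl_ext P fun k => P.root.injective ?_
  change P.root (ς _ k) = P.root (ς i (ς j (ς i k)))
  simp only [P.root_reflectionPerm, P.reflection_reflectionPerm]
  rfl

variable {P}

lemma weyl_induction_simple [P.IsRootSystem] [P.IsCrystallographic]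
    [P.IsReduced] (b : P.Base) {p : Weyl P → Prop} (one : p 1)
    (mul : ∀ i ∈ b.support, ∀ w, p w → p (reflTriple P i * w)) (w : Weyl P) : p w := by
  have h : ∀ i, ∀ w, p w → p (reflTriple P i * w) := fun i => by
    refine b.induction_reflect i ?_ mul ?_
    · grind [reflTriple_reflectionPerm, reflTriple_mul_self]
    · intro i j hi hj w hw
      rw [reflTriple_reflectionPerm, mul_assoc, mul_assoc]
      exact mul j hj _ (hi _ (mul j hj w hw))
  exact weyl_induction P one h w

/-! ### Positive roots -/

lemma root_neg (i : ι) : P.root (ς i i) = -P.root i := by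
  simp

lemma coroot_neg (i : ι) : P.coroot (ς i i) = -P.coroot i := by
  simp

section Positive

variable [P.IsRootSystem] [P.IsCrystallographic] [P.IsReduced]
  (b : P.Base)

variable {b} in
lemma mem_posRoots {i : ι} : i ∈ posRoots b ↔ b.IsPos i := by simp [posRoots]

lemma simple_mem {i : ι} (hi : i ∈ b.support) : i ∈ posRoots b :=
  mem_posRoots.2 (b.isPos_of_mem_support hi)

lemma isPos_neg_iff (i : ι) : b.IsPos (ς i i) ↔ ¬ b.IsPos i :=
  RootPairing.Base.IsPos.neg_iff_not b i

lemma isPos_simple_refl {i j : ι} (hj : j ∈ b.support) (hij : i ≠ j)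
    (hij' : i ≠ ς j j) : b.IsPos (ς j i) ↔ b.IsPos i := by
  have key : ∀ i, i ≠ j → b.IsPos i → b.IsPos (ς j i) := fun i hij h =>
    h.reflectionPerm hj hij
  refine ⟨fun h => ?_, key i hij⟩
  have := key (ς j i) (fun h' => hij' ?_) h
  · simp_all
  · have := congrArg (ς j) h'
    rwa [P.reflectionPerm_self] at this

lemma map_posRoots_erase {j : ι} (hj : j ∈ b.support) :
    ((posRoots b).erase j).map (ς j).toEmbedding = (posRoots b).erase j := by
  have key : ∀ i ∈ (posRoots b).erase j, ς j i ∈ (posRoots b).erase j := fun i hi => by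
    rw [mem_erase, mem_posRoots] at hi ⊢
    refine ⟨fun h => ?_, hi.2.reflectionPerm hj hi.1⟩
    have h1 := congrArg (ς j) h
    rw [P.reflectionPerm_self] at h1
    rw [h1, isPos_neg_iff] at hi
    exact hi.2 (b.isPos_of_mem_support hj)
  refine eq_of_subset_of_card_le (fun i hi => ?_) (card_map _).ge
  obtain ⟨k, hk, rfl⟩ := Finset.mem_map.1 hi
  exact key k hk

lemma sum_posRoots_refl {A : Type*} [AddCommMonoid A] {j : ι} (hj : j ∈ b.support) (F : ι → A) :
    ∑ i ∈ (posRoots b).erase j, F (ς j i) = ∑ i ∈ (posRoots b).erase j, F i := by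
  conv_rhs => rw [← map_posRoots_erase b hj, sum_map]
  rfl

lemma prod_posRoots_refl {A : Type*} [CommMonoid A] {j : ι} (hj : j ∈ b.support) (F : ι → A) :
    ∏ i ∈ (posRoots b).erase j, F (ς j i) = ∏ i ∈ (posRoots b).erase j, F i := by
  conv_rhs => rw [← map_posRoots_erase b hj, prod_map]
  rfl

lemma pos_or_neg (i : ι) : b.IsPos i ∨ b.IsPos (ς i i) := by
  rw [isPos_neg_iff]; exact em _

lemma isPos_simple_neg {j : ι} (hj : j ∈ b.support) : ¬ b.IsPos (ς j j) := by
  rw [isPos_neg_iff, not_not]; exact b.isPos_of_mem_support hj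

lemma isPos_flip (i : ι) : b.flip.IsPos i ↔ b.IsPos i := by
  refine b.induction_reflect (p := fun i => b.flip.IsPos i ↔ b.IsPos i) i ?_ ?_ ?_
  · intro i hi
    have h1 := isPos_neg_iff b i
    have h2 : b.flip.IsPos (ς i i) ↔ ¬ b.flip.IsPos i := isPos_neg_iff b.flip i
    grind
  · exact fun j hj => iff_of_true (b.flip.isPos_of_mem_support hj) (b.isPos_of_mem_support hj)
  · intro i j hi hj
    by_cases h1 : i = j
    · subst h1
      exact iff_of_false (isPos_simple_neg b.flip hj) (isPos_simple_neg b hj)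
    by_cases h2 : i = ς j j
    · subst h2
      rw [P.reflectionPerm_self]
      exact iff_of_true (b.flip.isPos_of_mem_support hj) (b.isPos_of_mem_support hj)
    · have h3 : b.flip.IsPos (ς j i) ↔ b.flip.IsPos i := isPos_simple_refl b.flip hj h1 h2
      rw [h3, hi, isPos_simple_refl b hj h1 h2]

lemma posRoots_flip : posRoots b.flip = posRoots b := by
  ext i; rw [mem_posRoots, mem_posRoots, isPos_flip]

lemma rho_flip (k : ι → ℂ) : rho b.flip k = rhoCo b k := by rw [rho, rhoCo, posRoots_flip]; rfl

/-! ### Coordinates -/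

/-- The fundamental coweights. -/
noncomputable def fundCo (j : b.support) : N := P.flip.toPerfPair.symm (b.toWeightBasis.coord j)

lemma pair_fundCo (μ : M) (j : b.support) : P.1 μ (fundCo b j) = b.toWeightBasis.coord j μ := by
  have : P.flip.toPerfPair (fundCo b j) = b.toWeightBasis.coord j := by simp [fundCo]
  rw [← this]; rfl

lemma root'_fundCo (i j : b.support) : P.root' i (fundCo b j) = if i = j then 1 else 0 := by
  simp [pair_fundCo, single_apply]

lemma eq_sum_root (μ : M) : μ = ∑ j : b.support, P.1 μ (fundCo b j) • P.root j := by
  conv_lhs => rw [← b.toWeightBasis.sum_repr μ]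
  simp [pair_fundCo]

lemma pair_eq_sum (μ : M) (y : N) :
    P.1 μ y = ∑ j : b.support, P.1 μ (fundCo b j) * P.root' j y := by
  conv_lhs => rw [eq_sum_root b μ]
  simp

lemma ext_simple {x y : N} (h : ∀ j ∈ b.support, P.root' j x = P.root' j y) : x = y := by
  refine P.flip.toPerfPair.injective (LinearMap.ext fun μ => ?_)
  change P.1 μ x = P.1 μ y
  rw [pair_eq_sum b, pair_eq_sum b]
  grind

variable (P)

/-- The root lattice. -/
def rootLat : AddSubgroup M := AddSubgroup.closure (Set.range P.root)

lemma root_mem_rootLat (i : ι) : P.root i ∈ rootLat P := AddSubgroup.subset_closure ⟨i, rfl⟩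

variable {P}

lemma mem_rootLat {d : M} :
    d ∈ rootLat P ↔ ∀ j : b.support, ∃ n : ℤ, P.1 d (fundCo b j) = n := by
  constructor
  · intro h j
    induction h using closure_induction with
    | mem x hx =>
      obtain ⟨i, rfl⟩ := hx
      obtain ⟨f, _, _, hf⟩ := b.exists_root_eq_sum_int i
      rw [hf]
      simp only [map_sum, LinearMap.sum_apply]
      rw [sum_eq_single_of_mem (j : ι) j.2]
      · have := root'_fundCo b j j
        simp_all
      · intro i hi hne
        have := root'_fundCo b ⟨i, hi⟩ j
        simp_all [Subtype.ext_iff]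
    | zero => exact ⟨0, by simp⟩
    | add x y _ _ hx hy =>
      obtain ⟨a, ha⟩ := hx; obtain ⟨c, hc⟩ := hy
      exact ⟨a + c, by simp [ha, hc]⟩
    | neg x _ hx =>
      obtain ⟨a, ha⟩ := hx
      exact ⟨-a, by simp [ha]⟩
  · intro h
    rw [eq_sum_root b d]
    refine sum_mem fun j _ => ?_
    obtain ⟨n, hn⟩ := h j
    grind [cast_smul_eq_zsmul, zsmul_mem, root_mem_rootLat]

/-- The real cone spanned by the positive roots. -/
def realCone : AddSubmonoid M where
  carrier := {d | ∀ j : b.support, ∃ r : ℝ, 0 ≤ r ∧ P.1 d (fundCo b j) = r}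
  zero_mem' := fun j => ⟨0, le_rfl, by simp⟩
  add_mem' := fun {x y} hx hy j => by
    obtain ⟨r, hr, hr'⟩ := hx j; obtain ⟨s, hs, hs'⟩ := hy j
    exact ⟨r + s, add_nonneg hr hs, by simp [hr', hs']⟩

lemma smul_mem_realCone {d : M} (hd : d ∈ realCone b) {r : ℝ} (hr : 0 ≤ r) :
    (r : ℂ) • d ∈ realCone b := fun j => by
  obtain ⟨s, hs, hs'⟩ := hd j
  exact ⟨r * s, mul_nonneg hr hs, by simp [hs']⟩

lemma simple_mem_rootCone {j : ι} (hj : j ∈ b.support) : P.root j ∈ rootCone b :=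
  AddSubmonoid.subset_closure (Set.mem_image_of_mem _ hj)

lemma root_mem_rootCone {i : ι} (hi : b.IsPos i) : P.root i ∈ rootCone b := by
  obtain ⟨f, -, hf | hf⟩ := b.exists_root_eq_sum_nat_or_neg i
  · grind [sum_mem, nsmul_mem, simple_mem_rootCone]
  · have h : P.root i = ∑ j ∈ b.support, (-(f j : ℤ)) • P.root j := by simp_all
    have h1 := b.height_eq_sum h
    rw [RootPairing.Base.isPos_iff, h1, sum_neg_distrib, Left.neg_pos_iff] at hi
    exact absurd hi (not_lt.2 (sum_nonneg fun j _ => by positivity))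

variable {b} in
lemma mem_rootCone {d : M} : d ∈ rootCone b ↔ d ∈ realCone b ∧ d ∈ rootLat P := by
  constructor
  · intro h
    induction h using AddSubmonoid.closure_induction with
    | mem x hx =>
      obtain ⟨i, hi, rfl⟩ := hx
      refine ⟨fun j => ?_, root_mem_rootLat P i⟩
      have := root'_fundCo b ⟨i, hi⟩ j
      refine ⟨if (⟨i, hi⟩ : b.support) = j then 1 else 0, by split_ifs <;> norm_num, ?_⟩
      rw [this]; split_ifs <;> simp
    | zero => simp
    | add x y _ _ hx hy => exact ⟨add_mem hx.1 hy.1, add_mem hx.2 hy.2⟩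
  · rintro ⟨h1, h2⟩
    rw [mem_rootLat b] at h2
    rw [eq_sum_root b d]
    refine sum_mem fun j _ => ?_
    obtain ⟨n, hn⟩ := h2 j
    obtain ⟨r, hr, hr'⟩ := h1 j
    rw [hn] at hr'
    have h3 : (n : ℝ) = r := by exact_mod_cast hr'
    obtain ⟨k, rfl⟩ := eq_ofNat_of_zero_le (by exact_mod_cast h3 ▸ hr : 0 ≤ n)
    grind [cast_natCast, cast_smul_eq_nsmul, nsmul_mem, simple_mem_rootCone]

end Positive

local notation:max "𝐬" => reflTriple P
variable [P.IsRootSystem] [P.IsCrystallographic] [P.IsReduced] {b : P.Base}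
local notation:max "R₊" => posRoots b

/-! ### Dominance and the Weyl group -/

/-- The Weyl group elements of the dual root system. -/
def flipTriple (w : Weyl P) : Weyl P.flip := ⟨(w.1.2.1, w.1.1, w.1.2.2), by
    induction w using weyl_induction P with
    | one => exact one_mem _
    | mul i w ih => exact mul_mem (reflTriple P.flip i).2 ih⟩

/-- The Weyl group elements of a root system obtained from those of its dual. -/
def unflipTriple (w : Weyl P.flip) : Weyl P := ⟨(w.1.2.1, w.1.1, w.1.2.2), by
    induction w using weyl_induction P.flip with
    | one => exact one_mem _
    | mul i w ih => exact mul_mem (𝐬 i).2 ih⟩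

variable (P)

lemma weyl_inv_apply (w : Weyl P) (i : ι) :
    w.1.2.2 (w⁻¹.1.2.2 i) = i := Equiv.apply_symm_apply w.1.2.2 i

lemma weyl_inv_applyM (w : Weyl P) (μ : M) :
    w.1.1 (w⁻¹.1.1 μ) = μ := LinearEquiv.apply_symm_apply w.1.1 μ

lemma weyl_inv_applyN (w : Weyl P) (ν : N) :
    w.1.2.1 (w⁻¹.1.2.1 ν) = ν := LinearEquiv.apply_symm_apply w.1.2.1 ν

lemma coroot'_weyl_right (w : Weyl P) (i : ι) (μ : M) :
    P.coroot' i (w.1.1 μ) = P.coroot' (w⁻¹.1.2.2 i) μ := by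
  grind [coroot'_weyl, weyl_inv_apply]

lemma root'_weyl_right (w : Weyl P) (i : ι) (ν : N) :
    P.root' i (w.1.2.1 ν) = P.root' (w⁻¹.1.2.2 i) ν := by
  grind [root'_weyl, weyl_inv_apply]

lemma coroot'_neg (i : ι) (μ : M) : P.coroot' (ς i i) μ = -P.coroot' i μ := by
  simp [RootPairing.coroot']

lemma root'_neg (i : ι) (ν : N) : P.root' (ς i i) ν = -P.root' i ν := by
  simp [RootPairing.root']

lemma reflectionPerm_weyl (w : Weyl P) (i : ι) : w.1.2.2 (ς i i) = ς (w.1.2.2 i) (w.1.2.2 i) :=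
    P.root.injective (by grind [root_weyl, root_neg])

section Dominance

variable (b)

variable {P}

lemma root_mem_realCone {i : ι} (hi : b.IsPos i) : P.root i ∈ realCone b :=
  (mem_rootCone.1 (root_mem_rootCone b hi)).1

lemma realCone_salient {d : M} (h : d ∈ realCone b) (h' : -d ∈ realCone b) :
    d = 0 := by
  rw [eq_sum_root b d]
  refine sum_eq_zero fun j _ => ?_
  obtain ⟨r, hr, hr'⟩ := h j
  obtain ⟨s, hs, hs'⟩ := h' j
  rw [map_neg₂, hr'] at hs'
  have : -r = s := by exact_mod_cast hs'
  have h0 : r = 0 := by linarith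
  rw [hr', h0]; simp

/-- Real strictly dominant elements of the coweight space. -/
def RegDom (y : N) : Prop := ∀ j ∈ b.support, ∃ r : ℝ, 0 < r ∧ P.root' j y = r

/-- Real dominant elements of the weight space. -/
def RDom (μ : M) : Prop := ∀ j ∈ b.support, ∃ r : ℝ, 0 ≤ r ∧ P.coroot' j μ = r

lemma pair_nonneg {d : M} (hd : d ∈ realCone b) {y : N} (hy : ∀ j ∈ b.support, ∃ r : ℝ, 0 ≤ r ∧
    P.root' j y = r) : ∃ r : ℝ, 0 ≤ r ∧ P.1 d y = r := by
  choose r hr hr' using hd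
  choose! s hs hs' using hy
  refine ⟨∑ j : b.support, r j * s j, sum_nonneg fun j _ => mul_nonneg (hr j) (hs j j.2), ?_⟩
  rw [pair_eq_sum b]
  push_cast
  grind

lemma pair_pos {d : M} (hd : d ∈ realCone b) (h0 : d ≠ 0) {y : N} (hy : RegDom b y) :
    ∃ r : ℝ, 0 < r ∧ P.1 d y = r := by
  choose r hr hr' using hd
  choose! s hs hs' using hy
  refine ⟨∑ j : b.support, r j * s j, ?_, ?_⟩
  · refine (sum_nonneg fun j _ => mul_nonneg (hr j) (hs j j.2).le).lt_of_ne fun h => h0 ?_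
    rw [eq_comm, sum_eq_zero_iff_of_nonneg fun j _ => mul_nonneg (hr j) (hs j j.2).le] at h
    rw [eq_sum_root b d]
    refine sum_eq_zero fun j hj => ?_
    rw [hr' j, (mul_eq_zero.1 (h j hj)).resolve_right (hs j j.2).ne']
    simp
  · rw [pair_eq_sum b]
    push_cast
    grind

lemma RegDom.root'_pos {y : N} (hy : RegDom b y) {i : ι} (hi : b.IsPos i) : ∃ r : ℝ, 0 < r ∧
    P.root' i y = r := pair_pos b (root_mem_realCone b hi) (P.ne_zero i) hy

lemma RegDom.root'_real {y : N} (hy : RegDom b y) (i : ι) : ∃ r : ℝ, P.root' i y = r := by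
  rcases pos_or_neg b i with h | h
  · obtain ⟨r, -, hr⟩ := hy.root'_pos b h; exact ⟨r, hr⟩
  · obtain ⟨r, -, hr⟩ := hy.root'_pos b h
    rw [root'_neg, neg_eq_iff_eq_neg] at hr
    exact ⟨-r, by rw [hr]; simp⟩

lemma RegDom.rootLat_real {y : N} (hy : RegDom b y) {d : M} (hd : d ∈ rootLat P) :
    ∃ r : ℝ, P.1 d y = r := by
  induction hd using closure_induction with
  | mem x hx => obtain ⟨i, rfl⟩ := hx; exact hy.root'_real b i
  | zero => exact ⟨0, by simp⟩
  | add x y _ _ hx hy =>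
    obtain ⟨r, hr⟩ := hx; obtain ⟨s, hs⟩ := hy; exact ⟨r + s, by simp [hr, hs]⟩
  | neg x _ hx => obtain ⟨r, hr⟩ := hx; exact ⟨-r, by simp [hr]⟩

/-- The sum of the fundamental coweights. -/
noncomputable def sumFundCo : N := ∑ j, fundCo b j

lemma root'_sumFundCo {i : ι} (hi : i ∈ b.support) : P.root' i (sumFundCo b) = 1 := by
  rw [sumFundCo, map_sum]
  have := fun j => root'_fundCo b ⟨i, hi⟩ j
  simp [this]

lemma regDom_smul_add (j : b.support) {t : ℝ} (ht : 0 ≤ t) :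
    RegDom b ((t : ℂ) • fundCo b j + sumFundCo b) := fun i hi => by
  refine ⟨t * (if (⟨i, hi⟩ : b.support) = j then 1 else 0) + 1, by positivity, ?_⟩
  have := root'_fundCo b ⟨i, hi⟩ j
  rw [map_add, map_smul, root'_sumFundCo b hi, this]
  split_ifs <;> simp

lemma regDom_sumFundCo : RegDom b (sumFundCo b) := fun i hi =>
  ⟨1, one_pos, by rw [root'_sumFundCo b hi]; simp⟩

lemma mem_realCone_of_forall_regDom {d : M} (hr : ∀ j : b.support, ∃ r : ℝ,
    P.1 d (fundCo b j) = r) (h : ∀ y, RegDom b y → 0 ≤ (P.1 d y).re) : d ∈ realCone b := fun j => by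
  obtain ⟨r, hr⟩ := hr j
  refine ⟨r, ?_, hr⟩
  by_contra! hneg
  set s := (P.1 d (sumFundCo b)).re
  have h0 : 0 ≤ s := h _ (regDom_sumFundCo b)
  have := h _ (regDom_smul_add b j (t := (s + 1) / (-r)) (by
    apply div_nonneg <;> linarith))
  rw [map_add, map_smul, hr, smul_eq_mul, add_re, ← ofReal_mul, ofReal_re] at this
  have h2 : (s + 1) / (-r) * r = -(s + 1) := by grind
  linarith

lemma mem_rootCone_of_forall_regDom {d : M} (hd : d ∈ rootLat P)
    (h : ∀ y, RegDom b y → 0 ≤ (P.1 d y).re) : d ∈ rootCone b := by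
  rw [mem_rootCone]
  refine ⟨mem_realCone_of_forall_regDom b (fun j => ?_) h, hd⟩
  obtain ⟨n, hn⟩ := (mem_rootLat b).1 hd j
  exact ⟨n, by rw [hn]; simp⟩

lemma coroot_mem_realCone_flip {i : ι} (hi : b.IsPos i) : P.coroot i ∈ realCone b.flip :=
  root_mem_realCone b.flip ((isPos_flip b i).2 hi)

lemma coroot_mem_rootCone_flip {i : ι} (hi : b.IsPos i) : P.coroot i ∈ rootCone b.flip :=
  root_mem_rootCone b.flip ((isPos_flip b i).2 hi)

lemma RDom.coroot'_nonneg {μ : M} (hμ : RDom b μ) {i : ι} (hi : b.IsPos i) : ∃ r : ℝ, 0 ≤ r ∧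
    P.coroot' i μ = r := pair_nonneg b.flip (coroot_mem_realCone_flip b hi) hμ

lemma RDom.coroot'_real {μ : M} (hμ : RDom b μ) (i : ι) : ∃ r : ℝ, P.coroot' i μ = r := by
  rcases pos_or_neg b i with h | h
  · obtain ⟨r, -, hr⟩ := hμ.coroot'_nonneg b h; exact ⟨r, hr⟩
  · obtain ⟨r, -, hr⟩ := hμ.coroot'_nonneg b h
    rw [coroot'_neg, neg_eq_iff_eq_neg] at hr
    exact ⟨-r, by rw [hr]; simp⟩

lemma isDominant_iff {μ : M} : IsDominant b μ ↔ ∀ j ∈ b.support, ∃ n : ℕ, P.coroot' j μ = n := by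
  refine ⟨fun h j hj => h j (simple_mem b hj), fun h i hi => ?_⟩
  have h1 := coroot_mem_rootCone_flip b (mem_posRoots.1 hi)
  change ∃ n : ℕ, P.1 μ (P.coroot i) = n
  generalize P.coroot i = x at h1
  induction h1 using AddSubmonoid.closure_induction with
  | mem x hx => obtain ⟨j, hj, rfl⟩ := hx; exact h j hj
  | zero => exact ⟨0, by simp⟩
  | add x y _ _ hx hy =>
    obtain ⟨r, hr⟩ := hx; obtain ⟨s, hs⟩ := hy; exact ⟨r + s, by simp [hr, hs]⟩

lemma IsDominant.rDom {μ : M} (h : IsDominant b μ) : RDom b μ := fun j hj => by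
  obtain ⟨n, hn⟩ := h j (simple_mem b hj)
  exact ⟨n, n.cast_nonneg, by rw [hn]; simp⟩

variable (P)

/-- The integral weights. -/
def IsWeight (μ : M) : Prop := ∀ i, ∃ n : ℤ, P.coroot' i μ = n

variable {P}

lemma IsDominant.isWeight {μ : M} (h : IsDominant b μ) : IsWeight P μ := fun i => by
  rcases pos_or_neg b i with hi | hi
  · obtain ⟨n, hn⟩ := h i (mem_posRoots.2 hi); exact ⟨n, by rw [hn]; simp⟩
  · obtain ⟨n, hn⟩ := h _ (mem_posRoots.2 hi)
    rw [coroot'_neg, neg_eq_iff_eq_neg] at hn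
    exact ⟨-n, by rw [hn]; simp⟩

lemma isDominant_of_rDom {μ : M} (h : RDom b μ) (h' : IsWeight P μ) : IsDominant b μ := by
  rw [isDominant_iff]
  intro j hj
  obtain ⟨r, hr, hr'⟩ := h j hj
  obtain ⟨n, hn⟩ := h' j
  rw [hn] at hr'
  have h3 : (n : ℝ) = r := by exact_mod_cast hr'
  obtain ⟨k, rfl⟩ := eq_ofNat_of_zero_le (by exact_mod_cast h3 ▸ hr : 0 ≤ n)
  exact ⟨k, by rw [hn]; simp⟩

lemma weyl_sub_mem_rootLat {μ : M} (hμ : IsWeight P μ) (w : Weyl P) :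
    w.1.1 μ - μ ∈ rootLat P := by
  induction w using weyl_induction P with
  | one => simp
  | mul i w ih =>
    change P.reflection i (w.1.1 μ) - μ ∈ _
    obtain ⟨n, hn⟩ := hμ (w⁻¹.1.2.2 i)
    have h1 : P.coroot' i (w.1.1 μ) = n := by rw [← hn, coroot'_weyl_right]
    rw [P.reflection_apply, h1, cast_smul_eq_zsmul, sub_right_comm]
    exact sub_mem ih (zsmul_mem (root_mem_rootLat P i) n)

lemma IsWeight.weyl {μ : M} (hμ : IsWeight P μ) (w : Weyl P) : IsWeight P (w.1.1 μ) := fun i => by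
  obtain ⟨n, hn⟩ := hμ (w⁻¹.1.2.2 i)
  exact ⟨n, by rw [← hn, coroot'_weyl_right]⟩

lemma isWeight_root (i : ι) : IsWeight P (P.root i) := fun j =>
  ⟨P.pairingIn ℤ i j, by rw [RootPairing.root_coroot'_eq_pairing, ← P.algebraMap_pairingIn ℤ]; rfl⟩

lemma weyl_mem_rootLat {d : M} (hd : d ∈ rootLat P) (w : Weyl P) : w.1.1 d ∈ rootLat P := by
  induction hd using closure_induction with
  | mem x hx =>
    obtain ⟨i, rfl⟩ := hx
    rw [← root_weyl]; exact root_mem_rootLat P _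
  | zero => rw [map_zero]; exact zero_mem _
  | add x y _ _ hx hy => rw [map_add]; exact add_mem hx hy
  | neg x _ hx => rw [map_neg]; exact neg_mem hx

lemma exists_weyl_rDom {μ : M} (hμ : ∀ i, ∃ r : ℝ, P.coroot' i μ = r) :
    ∃ w : Weyl P, RDom b (w.1.1 μ) ∧ w.1.1 μ - μ ∈ realCone b := by
  obtain ⟨w, hw, hmax⟩ := exists_max_image (univ.filter fun w : Weyl P => w.1.1 μ - μ ∈ realCone b)
    (fun w => (P.1 (w.1.1 μ) (sumFundCo b)).re) ⟨1, by simp⟩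
  rw [mem_filter] at hw
  refine ⟨w, fun j hj => ?_, hw.2⟩
  obtain ⟨r, hr⟩ := hμ (w⁻¹.1.2.2 j)
  have h1 : P.coroot' j (w.1.1 μ) = r := by rw [← hr, coroot'_weyl_right]
  refine ⟨r, ?_, h1⟩
  by_contra! hneg
  have h2 : (𝐬 j * w).1.1 μ = w.1.1 μ + ((-r : ℝ) : ℂ) • P.root j := by
    change P.reflection j (w.1.1 μ) = _
    rw [P.reflection_apply, h1]; simp [sub_eq_add_neg]
  have h3 := hmax (𝐬 j * w) (by
    rw [mem_filter, h2, add_sub_right_comm]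
    exact ⟨mem_univ _, add_mem hw.2 (smul_mem_realCone b
      (root_mem_realCone b (b.isPos_of_mem_support hj)) (by linarith))⟩)
  rw [h2] at h3
  have h4 := root'_sumFundCo b hj
  simp only [map_add₂, map_smul₂, h4] at h3
  simp at h3
  linarith

lemma exists_simple_le {i : ι} (hi : b.IsPos i) : ∃ j ∈ b.support, (∃ w : Weyl P, w.1.2.2 j = i) ∧
    P.coroot i - P.coroot j ∈ rootCone b.flip := by
  obtain ⟨n, hn⟩ : ∃ n : ℕ, (b.height i).toNat ≤ n := ⟨_, le_rfl⟩
  induction n generalizing i with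
  | zero => rw [RootPairing.Base.isPos_iff] at hi; omega
  | succ n ih =>
    by_cases his : i ∈ b.support
    · exact ⟨i, his, ⟨1, rfl⟩, by rw [sub_self]; exact zero_mem _⟩
    obtain ⟨j, hj, hji⟩ := hi.exists_mem_support_pos_pairingIn
    have hij : i ≠ j := fun h => his (h ▸ hj)
    have hp := hi.reflectionPerm hj hij
    have h1 : P.root (ς j i) = P.root i + (-P.pairingIn ℤ i j) • P.root j := by
      rw [P.root_reflectionPerm, neg_smul, P.reflection_apply_root' ℤ, sub_eq_add_neg]
    have h2 := b.height_add_zsmul h1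
    rw [RootPairing.Base.height_one_of_mem_support hj] at h2
    have hij' : 0 < P.pairingIn ℤ i j := by rwa [P.zero_lt_pairingIn_iff']
    obtain ⟨k, hk, ⟨w, hw⟩, hc⟩ := ih hp (by
      simp at h2; omega)
    refine ⟨k, hk, ⟨𝐬 j * w, ?_⟩, ?_⟩
    · change ς j (w.1.2.2 k) = i
      rw [hw, P.reflectionPerm_self]
    · have h3 : P.coroot i - P.coroot k = (P.coroot (ς j i) - P.coroot k) +
        (P.pairingIn ℤ j i).toNat • P.coroot j := by
        rw [P.coroot_reflectionPerm, P.coreflection_apply]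
        have h5 : P.root' j (P.coroot i) = ((P.pairingIn ℤ j i).toNat : ℂ) := by
          rw [P.root'_coroot_eq_pairing, ← P.algebraMap_pairingIn ℤ]
          have : ((P.pairingIn ℤ j i).toNat : ℤ) = P.pairingIn ℤ j i := Int.toNat_of_nonneg hji.le
          have h6 : (((P.pairingIn ℤ j i).toNat : ℤ) : ℂ) = (P.pairingIn ℤ j i : ℂ) := by rw [this]
          exact h6.symm
        rw [h5, cast_smul_eq_nsmul]; abel
      rw [h3]
      exact add_mem hc (nsmul_mem (simple_mem_rootCone b.flip hj) _)

lemma le_coroot' {k : ι → ℝ} (hk : WInv P k) (hk0 : ∀ i, 0 ≤ k i)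
    {μ : M} (hμ : ∀ j ∈ b.support, ∃ r : ℝ, k j ≤ r ∧ P.coroot' j μ = r) {i : ι}
    (hi : b.IsPos i) : ∃ r : ℝ, k i ≤ r ∧ P.coroot' i μ = r := by
  obtain ⟨j, hj, ⟨w, hw⟩, hc⟩ := exists_simple_le b hi
  obtain ⟨r, hr, hr'⟩ := hμ j hj
  obtain ⟨s, hs, hs'⟩ := pair_nonneg b.flip (mem_rootCone.1 hc).1 (y := μ)
    fun j hj => by obtain ⟨r, hr, hr'⟩ := hμ j hj; exact ⟨r, (hk0 j).trans hr, hr'⟩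
  have h1 : P.coroot' i μ - P.coroot' j μ = s := by simp_all
  refine ⟨s + r, ?_, ?_⟩
  · rw [← hw, invariant_weyl P hk]; linarith
  · rw [← sub_add_cancel (P.coroot' i μ) (P.coroot' j μ), h1, hr']; simp

lemma coroot'_rho {k : ι → ℂ} (hk : WInv P k) {j : ι}
    (hj : j ∈ b.support) : P.coroot' j (rho b k) = k j := by
  rw [rho, map_smul, map_sum, ← add_sum_erase _ _ (simple_mem b hj)]
  have h := sum_posRoots_refl b hj fun i => P.coroot' j (k i • P.root i)
  have h1 : ∀ i, P.coroot' j (k (ς j i) • P.root (ς j i)) = -P.coroot' j (k i • P.root i) :=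
    fun i => by
    rw [hk, P.root_reflectionPerm, P.reflection_apply]
    simp [RootPairing.coroot']
    ring
  simp only [h1, sum_neg_distrib] at h
  have h2 : ∑ i ∈ (R₊).erase j, P.coroot' j (k i • P.root i) = 0 := by grind
  rw [h2]
  simp [RootPairing.coroot']
  ring

/-! ### Words in the simple reflections -/

/-- `w` is a product of `n` simple reflections. -/
def IsWord : ℕ → Weyl P → Prop
  | 0, w => w = 1
  | n + 1, w => ∃ j ∈ b.support, ∃ w', IsWord n w' ∧ w = 𝐬 j * w'

lemma exists_isWord (w : Weyl P) : ∃ n, IsWord b n w := by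
  induction w using weyl_induction_simple b with
  | one => exact ⟨0, rfl⟩
  | mul i hi w ih => obtain ⟨n, hn⟩ := ih; exact ⟨n + 1, i, hi, w, hn, rfl⟩

/-- The exchange property. -/
lemma exists_shorter {n : ℕ} {w : Weyl P} (hw : IsWord b n w) {i : ι} (hi : b.IsPos i)
    (h : ¬ b.IsPos (w⁻¹.1.2.2 i)) : ∃ n', n = n' + 1 ∧ IsWord b n' (𝐬 i * w) := by
  induction n generalizing w i with
  | zero =>
    obtain rfl : w = 1 := hw
    simp_all
  | succ n ih =>
    obtain ⟨j, hj, w', hw', rfl⟩ := hw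
    by_cases hij : i = j
    · grind [reflTriple_mul_self]
    · obtain ⟨n', rfl, hn'⟩ := ih hw' (hi.reflectionPerm hj hij) (by
        convert h using 2
        rw [mul_inv_rev, reflTriple_inv]; rfl)
      refine ⟨n' + 1, rfl, j, hj, _, hn', ?_⟩
      grind [reflTriple_reflectionPerm, reflTriple_mul_self]

lemma eq_of_rDom_aux {n : ℕ} {w : Weyl P} (hw : IsWord b n w) {μ ν : M} (hμ : RDom b μ)
    (hν : RDom b ν) (h : w.1.1 ν = μ) : μ = ν ∧ ((∀ j ∈ b.support, P.coroot' j μ ≠ 0) → w = 1) := by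
  induction n using Nat.strong_induction_on generalizing w with
  | _ n ih =>
    rcases n with _ | n
    · obtain rfl : w = 1 := hw
      exact ⟨h.symm, fun _ => rfl⟩
    obtain ⟨j, hj, w', hw', rfl⟩ := hw
    have hjp := b.isPos_of_mem_support hj
    by_cases hneg : b.IsPos (w'⁻¹.1.2.2 j)
    · obtain ⟨r, hr, hr'⟩ := hμ j hj
      obtain ⟨s, hs, hs'⟩ := hν.coroot'_nonneg b hneg
      have h1 : w'.1.1 ν = P.reflection j μ := by rw [← h]; exact (P.reflection_same j _).symm
      have h2 : P.coroot' j (w'.1.1 ν) = s := by rw [← hs', coroot'_weyl_right]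
      have h3 : P.coroot' j (P.reflection j μ) = -P.coroot' j μ := by
        rw [P.reflection_apply]; simp [RootPairing.coroot']; ring
      rw [h1, h3, hr'] at h2
      have h4 : -r = s := by exact_mod_cast h2
      have h5 : P.coroot' j μ = 0 := by rw [hr', show r = 0 by linarith]; simp
      have h6 : P.reflection j μ = μ := by rw [P.reflection_apply, h5]; simp
      rw [h6] at h1
      grind
    · obtain ⟨n', rfl, hn'⟩ := exists_shorter b hw' hjp hneg
      exact ih n' (by omega) hn' h

lemma eq_of_rDom {w : Weyl P} {μ ν : M} (hμ : RDom b μ) (hν : RDom b ν)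
    (h : w.1.1 ν = μ) : μ = ν := by
  obtain ⟨n, hn⟩ := exists_isWord b w
  exact (eq_of_rDom_aux b hn hμ hν h).1

lemma eq_one_of_rDom {w : Weyl P} {μ : M} (hμ : RDom b μ)
    (hreg : ∀ j ∈ b.support, P.coroot' j μ ≠ 0) (h : w.1.1 μ = μ) : w = 1 := by
  obtain ⟨n, hn⟩ := exists_isWord b w
  exact (eq_of_rDom_aux b hn hμ hμ h).2 hreg

lemma RDom.sub_weyl_mem {μ : M} (hμ : RDom b μ) (w : Weyl P) : μ - w.1.1 μ ∈ realCone b := by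
  obtain ⟨v, hv, hv'⟩ := exists_weyl_rDom b (μ := w.1.1 μ) fun i => by
    obtain ⟨r, hr⟩ := hμ.coroot'_real b (w⁻¹.1.2.2 i)
    exact ⟨r, by rw [← hr, coroot'_weyl_right]⟩
  rwa [show v.1.1 (w.1.1 μ) = μ from eq_of_rDom b (w := v * w) hv hμ rfl] at hv'

lemma IsDominant.sub_weyl_mem {μ : M} (hμ : IsDominant b μ) (w : Weyl P) :
    μ - w.1.1 μ ∈ rootCone b := by
  rw [mem_rootCone]
  refine ⟨hμ.rDom.sub_weyl_mem b w, ?_⟩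
  rw [← neg_sub]
  exact neg_mem (weyl_sub_mem_rootLat hμ.isWeight w)

/-- The longest element of the Weyl group. -/
lemma exists_longest : ∃ w : Weyl P, ∀ i, b.IsPos (w.1.2.2 i) ↔ ¬ b.IsPos i := by
  obtain ⟨w, hw, -⟩ := exists_weyl_rDom b.flip (μ := -sumFundCo b) fun i => by
    obtain ⟨r, hr⟩ := (regDom_sumFundCo b).root'_real b i
    refine ⟨-r, ?_⟩
    simp_all
  have key : ∀ i, b.IsPos i → ¬ b.IsPos ((unflipTriple w).1.2.2 i) := fun i hi hwi => by
    obtain ⟨r, hr, hr'⟩ := hw.coroot'_nonneg b.flip ((isPos_flip b _).2 hwi)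
    obtain ⟨s, hs, hs'⟩ := (regDom_sumFundCo b).root'_pos b hi
    have h1 : P.root' ((unflipTriple w).1.2.2 i) ((unflipTriple w).1.2.1 (-sumFundCo b)) = r := hr'
    rw [root'_weyl, map_neg, hs'] at h1
    have : -s = r := by exact_mod_cast h1
    linarith
  refine ⟨unflipTriple w, fun i => ⟨fun h h' => key i h' h, fun h => ?_⟩⟩
  have h1 := key _ ((isPos_neg_iff b i).2 h)
  simp_all [reflectionPerm_weyl, isPos_neg_iff]

end Dominance

variable {P}

/-! ### Width of sets with long strings -/

lemma exists_sum_le_of_ordered {κ : Type*} (I : Finset κ) (hI : I.Nonempty) (t a c : κ → ℝ)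
    (ht : ∀ i ∈ I, ∀ j ∈ I, t i = t j → i = j) (hac : ∀ i ∈ I, ∀ j ∈ I, t i < t j →
    a j ≤ c i) : ∃ i ∈ I, ∃ j ∈ I, ∑ k ∈ I, (a k - c k) ≤ a i - c j := by
  induction I using strongInduction with
  | _ I ih =>
    obtain ⟨n, hn, hmax⟩ := exists_max_image I t hI
    rcases (I.erase n).eq_empty_or_nonempty with he | hne
    · refine ⟨n, hn, n, hn, ?_⟩
      rw [← add_sum_erase _ _ hn, he]; simp
    grind [add_sum_erase]

/-- A finite set all of whose strings in certain directions are long is at least as wide as the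
zonotope generated by these directions. -/
lemma exists_width {V : Type*} [AddCommGroup V] [Module ℝ V] (S : Finset V) (hS : S.Nonempty)
    {κ : Type*} (I : Finset κ) (v : κ → V) (η : Module.Dual ℝ V) (hη : ∀ i ∈ I, η (v i) ≠ 0)
    (hpar : ∀ i ∈ I, ∀ j ∈ I, i ≠ j → ∀ r : ℝ, v j ≠ r • v i) (m : κ → ℝ) (hstr : ∀ i ∈ I, ∀ ν ∈ S,
    ∃ p ∈ S, ∃ p' ∈ S, ∃ K r : ℝ, m i ≤ K ∧ p - p' = K • v i ∧ p = ν + r • v i) : ∃ p ∈ S, ∃ p' ∈ S,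
    ∑ i ∈ I, m i * |η (v i)| ≤ η p - η p' := by
  rcases I.eq_empty_or_nonempty with rfl | hI
  · grind
  have : Finite {p : κ × κ // p.1 ∈ I ∧ p.2 ∈ I ∧ p.1 ≠ p.2} :=
    Set.Finite.to_subtype ((I ×ˢ I).finite_toSet.subset fun p hp => by simpa using ⟨hp.1, hp.2.1⟩)
  obtain ⟨ξ, hξ⟩ := Module.exists_dual_forall_apply_ne_zero (K := ℝ)
    (fun p : {p : κ × κ // p.1 ∈ I ∧ p.2 ∈ I ∧ p.1 ≠ p.2} =>
      v p.1.2 - (η (v p.1.2) / η (v p.1.1)) • v p.1.1) (by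
      grind)
  have hs : ∀ i ∈ I, ∃ p ∈ S, ∃ p' ∈ S, m i * |η (v i)| ≤ η p - η p' ∧ (∀ x ∈ S,
    ξ x - ξ (v i) / η (v i) * η x ≤ ξ p - ξ (v i) / η (v i) * η p) ∧ (∀ x ∈ S,
    ξ x - ξ (v i) / η (v i) * η x ≤ ξ p' - ξ (v i) / η (v i) * η p') := fun i hi => by
    obtain ⟨ν, hν, hmax⟩ := exists_max_image S (fun x => ξ x - ξ (v i) / η (v i) * η x) hS
    obtain ⟨p, hp, p', hp', K, r, hK, h1, h2⟩ := hstr i hi ν hν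
    have h3 : p' = ν + (r - K) • v i := by rw [sub_smul, ← h1, h2]; abel
    have h4 : ∀ r : ℝ, ξ (ν + r • v i) - ξ (v i) / η (v i) * η (ν + r • v i) = ξ ν - ξ (v i) / η
      (v i) * η ν := fun r => by
      grind [map_smul, smul_eq_mul]
    have h5 : η p - η p' = K * η (v i) := by rw [← map_sub, h1, map_smul, smul_eq_mul]
    have h6 : ∀ x ∈ S, ξ x - ξ (v i) / η (v i) * η x ≤ ξ p - ξ (v i) / η (v i) * η p := by grind
    have h7 : ∀ x ∈ S, ξ x - ξ (v i) / η (v i) * η x ≤ ξ p' - ξ (v i) / η (v i) * η p' := by grind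
    rcases le_or_gt 0 (η (v i)) with hpos | hneg
    · grind [abs_of_nonneg, mul_le_mul_of_nonneg_right]
    · refine ⟨p', hp', p, hp, ?_, h7, h6⟩
      rw [abs_of_neg hneg]
      nlinarith
  choose! p hp p' hp' h1 h2 h3 using hs
  obtain ⟨i, hi, j, hj, hij⟩ := exists_sum_le_of_ordered I hI (fun i => ξ (v i) / η (v i))
    (fun i => η (p i)) (fun i => η (p' i)) (fun i hi j hj h => by
      by_contra hne
      refine hξ ⟨(i, j), hi, hj, hne⟩ ?_
      grind [map_smul, smul_eq_mul]) (fun i hi j hj hlt => by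
      have h4 := h3 i hi _ (hp j hj)
      have h5 := h2 j hj _ (hp' i hi)
      nlinarith)
  exact ⟨p i, hp i hi, p' j, hp' j hj, (sum_le_sum h1).trans hij⟩

/-! ### Strings -/

lemma sum_mul_eval_eq_zero {F J : Type*} [Field F] (T : Finset J) (c A B : J → F) (t : F)
    (hAB : ∀ j ∈ T, A j * B j = t) (m : ℕ)
    (h : ∀ s ∈ Icc 1 m, ∑ j ∈ T, c j * (A j ^ s - B j ^ s) = 0) (p : Polynomial F)
    (hp : p.degree < m) : ∑ j ∈ T, c j * (A j - B j) * p.eval (A j + B j) = 0 := by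
  have key : ∀ n, n < m → ∑ j ∈ T, c j * (A j - B j) * (A j + B j) ^ n = 0 := by
    have h2 : ∀ n k, n + k < m → ∑ j ∈ T, c j * (A j + B j) ^ n * (A j ^ (k + 1) - B j ^ (k + 1)) = 0 := by
      intro n
      induction n with
      | zero =>
        simp_all
      | succ n ih =>
        intro k hk
        have e : ∀ j ∈ T, c j * (A j + B j) ^ (n + 1) * (A j ^ (k + 1) - B j ^ (k + 1)) = c j *
          (A j + B j) ^ n * (A j ^ (k + 2) - B j ^ (k + 2)) + t *
          (c j * (A j + B j) ^ n * (A j ^ k - B j ^ k)) := by grind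
        rw [sum_congr rfl e, sum_add_distrib, ← mul_sum, ih (k + 1) (by omega), zero_add]
        rcases k with _ | k
        · simp
        · rw [ih k (by omega), mul_zero]
    intro n hn
    rw [← h2 n 0 (by simpa using hn)]
    exact sum_congr rfl fun j _ => by ring
  rcases eq_or_ne p 0 with rfl | h0
  · simp
  have e : ∀ j, p.eval (A j + B j) = ∑ n ∈ range m, p.coeff n * (A j + B j) ^ n := fun j =>
    Polynomial.eval_eq_sum_range' ((Polynomial.natDegree_lt_iff_degree_lt h0).2 hp) _
  simp_rw [e, mul_sum]
  rw [sum_comm]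
  refine sum_eq_zero fun n hn => ?_
  have := key n (mem_range.1 hn)
  have e2 : ∀ j ∈ T, c j * (A j - B j) * (p.coeff n * (A j + B j) ^ n) = p.coeff n *
    (c j * (A j - B j) * (A j + B j) ^ n) := fun j _ => by ring
  rw [sum_congr rfl e2, ← mul_sum, this, mul_zero]

lemma lt_card_of_power_sums {F J : Type*} [Field F] (T : Finset J) (c θ : J → F) (t : F) (m : ℕ)
    (hθ : ∀ j ∈ T, θ j ≠ 0) (hinj : ∀ i ∈ T, ∀ j ∈ T, θ i = θ j → i = j) (hres : ∀ i ∈ T, ∀ j ∈ T,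
    t * θ i * θ j ≠ 1) (hc : ∀ j ∈ T, c j ≠ 0) (hne : T.Nonempty) (h : ∀ s ∈ Icc 1 m, ∑ j ∈ T,
    c j * ((t * θ j) ^ s - (θ j)⁻¹ ^ s) = 0) : m < T.card := by
  by_contra! hcon
  obtain ⟨j, hj⟩ := hne
  have h1 := sum_mul_eval_eq_zero T c (fun j => t * θ j) (fun j => (θ j)⁻¹) t
    (fun j hj => by grind) m h
    (∏ i ∈ T.erase j, (Polynomial.X - Polynomial.C (t * θ i + (θ i)⁻¹))) (by
      rw [degree_prod, sum_congr rfl fun _ _ => degree_X_sub_C _]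
      simp only [sum_const, card_erase_of_mem hj, nsmul_eq_mul, mul_one]
      have : 0 < T.card := card_pos.2 ⟨j, hj⟩
      exact_mod_cast (by omega : T.card - 1 < m))
  rw [sum_eq_single_of_mem j hj] at h1
  · simp only [eval_prod, eval_sub, eval_X, eval_C,
      mul_eq_zero, prod_eq_zero_iff, hc j hj, false_or] at h1
    grind
  · intro i hi hij
    rw [eval_prod, prod_eq_zero (mem_erase.2 ⟨hij, hi⟩) (by simp), mul_zero]

lemma exists_sub_ge_of_card {T : Finset ℤ} {m : ℕ} (h : m < T.card) :
    ∃ a ∈ T, ∃ c ∈ T, (m : ℤ) ≤ a - c := by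
  have hne : T.Nonempty := card_pos.1 (by omega)
  refine ⟨T.max' hne, T.max'_mem _, T.min' hne, T.min'_mem _, ?_⟩
  have h1 : T ⊆ Icc (T.min' hne) (T.max' hne) := fun x hx =>
    mem_Icc.2 ⟨T.min'_le x hx, T.le_max' x hx⟩
  have h2 := card_le_card h1
  rw [Int.card_Icc] at h2
  omega

/-! ### Axial coefficient systems -/

variable (P)

/-- The value of an integral weight on a coroot, as an integer. -/
noncomputable def zp (i : ι) (μ : M) : ℤ := ⌊(P.coroot' i μ).re⌋

variable {P}

lemma zp_of_eq {i : ι} {μ : M} {n : ℤ} (h : P.coroot' i μ = n) : zp P i μ = n := by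
  rw [zp, h, intCast_re, Int.floor_intCast]

lemma cast_zp {μ : M} (h : IsWeight P μ) (i : ι) : (zp P i μ : ℂ) = P.coroot' i μ := by
  obtain ⟨n, hn⟩ := h i
  rw [zp_of_eq hn, hn]

lemma zp_add_zsmul {μ : M} (h : IsWeight P μ) (i : ι) (n : ℤ) :
    zp P i (μ + n • P.root i) = zp P i μ + 2 * n := by
  refine zp_of_eq ?_
  rw [map_add, map_zsmul, ← cast_zp h]
  simp [RootPairing.coroot']
  ring

lemma IsWeight.add {μ ν : M} (h : IsWeight P μ) (h' : IsWeight P ν) :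
    IsWeight P (μ + ν) := fun i => by
  obtain ⟨a, ha⟩ := h i; obtain ⟨c, hc⟩ := h' i
  exact ⟨a + c, by grind⟩

lemma IsWeight.neg {μ : M} (h : IsWeight P μ) : IsWeight P (-μ) := fun i => by
  obtain ⟨a, ha⟩ := h i
  exact ⟨-a, by grind⟩

lemma IsWeight.sub {μ ν : M} (h : IsWeight P μ) (h' : IsWeight P ν) : IsWeight P (μ - ν) := by
  rw [sub_eq_add_neg]; exact h.add h'.neg

/-- The coefficients `v μ` define a function `q ^ (2 (x, ·)) ∑ v μ q ^ (2 (μ, ·))` satisfying the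
axiality conditions, where `t i` stands for `q ^ (2 (α_i, x))`. -/
def CoefAxial {P : RootPairing ι ℂ M N} (b : P.Base) (L : ℂ) {R : Type*} [CommRing R] [Algebra ℂ R]
    (t : ι → R) (m : ι → ℕ) (S : Finset M) (v : M → R) : Prop := ∀ i ∈ posRoots b, ∀ μ ∈ S,
    ∀ s ∈ Icc 1 (m i), ∑ κ ∈ S with (∃ n : ℤ, κ = μ + n • P.root i), v κ *
    ((t i * algebraMap ℂ R (qpow L (zp P i κ))) ^ s - algebraMap ℂ R (qpow L (-zp P i κ)) ^ s) = 0

/-- The values of `t` at which strings of coefficients degenerate. -/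
def NonRes (L : ℂ) {R : Type*} [CommRing R] [Algebra ℂ R] (t : R) : Prop :=
  ∀ n : ℤ, t ≠ algebraMap ℂ R (qpow L (2 * n))

section Axial

variable (b)

variable {b} in
lemma CoefAxial.exists_string (hL : NonRoot L) {F : Type*} [Field F] [Algebra ℂ F] {t : ι → F}
    {S : Finset M} {v : M → F} (h : CoefAxial b L t m S v) (hS : ∀ μ ∈ S, IsWeight P μ) {i : ι}
    (hi : i ∈ R₊) (hres : NonRes L (t i)) {μ : M} (hμ : μ ∈ S) (hv : v μ ≠ 0) : ∃ p ∈ S, v p ≠ 0 ∧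
    ∃ p' ∈ S, v p' ≠ 0 ∧ ∃ K r : ℤ, (m i : ℤ) ≤ K ∧ p - p' = K • P.root i ∧ p = μ + r • P.root i :=
    by
  let T := S.filter fun κ => (∃ n : ℤ, κ = μ + n • P.root i) ∧ v κ ≠ 0
  have hT : ∀ κ ∈ T, κ ∈ S ∧ (∃ n : ℤ, κ = μ + n • P.root i) ∧ v κ ≠ 0 := fun κ hκ => by
    simpa [T] using hκ
  have hinj : ∀ κ ∈ T, ∀ κ' ∈ T, zp P i κ = zp P i κ' → κ = κ' := fun κ hκ κ' hκ' he => by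
    obtain ⟨-, ⟨n, rfl⟩, -⟩ := hT κ hκ
    obtain ⟨-, ⟨n', rfl⟩, -⟩ := hT κ' hκ'
    simp_all [zp_add_zsmul]
  have hcard : m i < T.card := by
    refine lt_card_of_power_sums T v (fun κ => algebraMap ℂ F (qpow L (zp P i κ))) (t i) (m i)
      (fun κ _ => ?_) (fun κ hκ κ' hκ' he => ?_) (fun κ hκ κ' hκ' he => ?_)
      (fun κ hκ => (hT κ hκ).2.2) ⟨μ, ?_⟩ fun s hs => ?_
    · rw [Ne, map_eq_zero]; exact qpow_ne_zero _ _
    · exact hinj κ hκ κ' hκ' (hL.qpow_inj ((algebraMap ℂ F).injective he))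
    · obtain ⟨-, ⟨n, hn⟩, -⟩ := hT κ hκ
      obtain ⟨-, ⟨n', hn'⟩, -⟩ := hT κ' hκ'
      refine hres (-(zp P i μ + n + n')) ?_
      rw [mul_assoc, ← map_mul, ← qpow_add] at he
      have h1 : (zp P i κ : ℂ) + zp P i κ' = -(2 * ((-(zp P i μ + n + n') : ℤ) : ℂ)) := by
        rw [hn, hn', zp_add_zsmul (hS μ hμ), zp_add_zsmul (hS μ hμ)]
        push_cast; ring
      rw [h1, qpow_neg, map_inv₀] at he
      grind
    · simp only [T, mem_filter]
      exact ⟨hμ, ⟨0, by simp⟩, hv⟩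
    · have h1 := h i hi μ hμ s hs
      rw [← sum_filter_ne_zero] at h1
      rw [← h1, filter_filter]
      refine (sum_subset_zero_on_sdiff (fun κ hκ => ?_) (fun κ hκ => ?_) fun κ hκ => ?_).symm
      · grind
      · grind [map_inv₀, qpow_neg]
      · rw [← map_inv₀, ← qpow_neg]
  have hex : ∃ p ∈ T, ∃ p' ∈ T, (2 * m i : ℤ) ≤ zp P i p - zp P i p' := by
    have h2 : m i < (T.image fun κ => (zp P i κ - zp P i μ) / 2).card := by
      rwa [card_image_of_injOn fun κ hκ κ' hκ' he => hinj κ hκ κ' hκ' ?_]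
      obtain ⟨-, ⟨n, rfl⟩, -⟩ := hT κ hκ
      obtain ⟨-, ⟨n', rfl⟩, -⟩ := hT κ' hκ'
      simp only [zp_add_zsmul (hS μ hμ)] at he ⊢
      omega
    obtain ⟨a, ha, c, hc, hac⟩ := exists_sub_ge_of_card h2
    obtain ⟨p, hp, rfl⟩ := mem_image.1 ha
    obtain ⟨p', hp', rfl⟩ := mem_image.1 hc
    refine ⟨p, hp, p', hp', ?_⟩
    obtain ⟨-, ⟨n', rfl⟩, -⟩ := hT p' hp'
    simp only [zp_add_zsmul (hS μ hμ)] at hac ⊢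
    omega
  obtain ⟨p, hp, p', hp', hpp⟩ := hex
  obtain ⟨h1, ⟨n, rfl⟩, h2⟩ := hT p hp
  obtain ⟨h3, ⟨n', rfl⟩, h4⟩ := hT p' hp'
  simp only [zp_add_zsmul (hS μ hμ)] at hpp
  exact ⟨_, h1, h2, _, h3, h4, n - n', n, by omega, by rw [sub_smul]; abel, rfl⟩

variable (P)

/-- The real functional `μ ↦ Re (μ, y)`. -/
noncomputable def rePair (y : N) : Module.Dual ℝ M :=
  Complex.reLm ∘ₗ ((P.1.flip y).restrictScalars ℝ)

lemma rePair_apply (y : N) (μ : M) : rePair P y μ = (P.1 μ y).re := rfl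

variable {P}

lemma posRoots_not_parallel {i j : ι} (hi : b.IsPos i) (hj : b.IsPos j) (hij : i ≠ j) (c : ℂ) :
    P.root j ≠ c • P.root i := fun h => by
  have h1 := linearIndependent_root_pair P (i := i) (j := j) (fun h => hij (P.root.injective h).symm)
    (fun h => by rw [← root_neg] at h; grind [isPos_neg_iff])
  rw [LinearIndependent.pair_iff] at h1
  simpa using (h1 c (-1) (by rw [h]; simp)).2

variable {b} in
lemma CoefAxial.exists_width (hL : NonRoot L) {F : Type*} [Field F] [Algebra ℂ F] {t : ι → F}
    {S : Finset M} {v : M → F} (h : CoefAxial b L t m S v) (hS : ∀ μ ∈ S, IsWeight P μ)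
    {I : Finset ι} (hI : I ⊆ R₊) (hres : ∀ i ∈ I, NonRes L (t i)) (y : N) (hy : ∀ i ∈ I,
    (P.root' i y).re ≠ 0) (hne : ∃ μ ∈ S, v μ ≠ 0) : ∃ p ∈ S, v p ≠ 0 ∧ ∃ p' ∈ S, v p' ≠ 0 ∧
    ∑ i ∈ I, m i * |(P.root' i y).re| ≤ (P.1 p y).re - (P.1 p' y).re := by
  obtain ⟨p, hp, p', hp', hpp⟩ := MacBA.exists_width (S.filter fun μ => v μ ≠ 0)
    (by obtain ⟨μ, h1, h2⟩ := hne; exact ⟨μ, mem_filter.2 ⟨h1, h2⟩⟩) I P.root (rePair P y)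
    hy (fun i hi j hj hij r => by
      rw [← Complex.coe_smul]
      exact posRoots_not_parallel b (mem_posRoots.1 (hI hi)) (mem_posRoots.1 (hI hj)) hij _)
    (fun i => m i) (fun i hi μ hμ => by
      rw [mem_filter] at hμ
      obtain ⟨p, h1, h2, p', h3, h4, K, r, h5, h6, h7⟩ :=
        h.exists_string hL hS (hI hi) (hres i hi) hμ.1 hμ.2
      refine ⟨p, mem_filter.2 ⟨h1, h2⟩, p', mem_filter.2 ⟨h3, h4⟩, K, r,
        by exact_mod_cast h5, ?_, ?_⟩
      · rw [h6, cast_smul_eq_zsmul]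
      · rw [h7, cast_smul_eq_zsmul])
  rw [mem_filter] at hp hp'
  exact ⟨p, hp.1, hp.2, p', hp'.1, hp'.2, hpp⟩

/-! ### The hull of a Weyl group orbit -/

/-- The weights all of whose conjugates are below `κ`. -/
def hull (κ : M) : Set M := {μ | ∀ w : Weyl P, κ - w.1.1 μ ∈ rootCone b}

lemma weyl_mem_hull {κ μ : M} (h : μ ∈ hull b κ) (w : Weyl P) : w.1.1 μ ∈ hull b κ :=
  fun v => h (v * w)

lemma sub_mem_hull {κ μ : M} (h : μ ∈ hull b κ) : κ - μ ∈ rootCone b := h 1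

lemma longest_mem_rootCone {w : Weyl P} (hw : ∀ i, b.IsPos (w.1.2.2 i) ↔ ¬ b.IsPos i)
    {d : M} (hd : d ∈ rootCone b) : -w.1.1 d ∈ rootCone b := by
  induction hd using AddSubmonoid.closure_induction with
  | mem x hx =>
    obtain ⟨i, hi, rfl⟩ := hx
    rw [← root_weyl, ← root_neg]
    refine root_mem_rootCone b ?_
    rw [isPos_neg_iff, hw, not_not]
    exact b.isPos_of_mem_support hi
  | zero => simp
  | add x y _ _ hx hy => rw [map_add, neg_add]; exact add_mem hx hy

lemma hull_finite (κ : M) : (hull b κ).Finite := by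
  obtain ⟨w, hw⟩ := exists_longest b
  have hc : ∀ d ∈ rootCone b, ∀ j : b.support, ∃ n : ℕ, P.1 d (fundCo b j) = n := fun d hd j => by
    rw [mem_rootCone] at hd
    obtain ⟨n, hn⟩ := (mem_rootLat b).1 hd.2 j
    obtain ⟨r, hr, hr'⟩ := hd.1 j
    rw [hn] at hr'
    have h3 : (n : ℝ) = r := by exact_mod_cast hr'
    obtain ⟨k, rfl⟩ := eq_ofNat_of_zero_le (by exact_mod_cast h3 ▸ hr : 0 ≤ n)
    exact ⟨k, by rw [hn]; simp⟩
  have key : ∀ μ ∈ hull b κ, ∀ j : b.support, ∃ n ∈ range (⌈‖P.1 (κ - w.1.1 κ) (fundCo b j)‖⌉₊ + 1),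
    P.1 (κ - μ) (fundCo b j) = n := fun μ hμ j => by
    obtain ⟨n, hn⟩ := hc _ (sub_mem_hull b hμ) j
    have h2 := longest_mem_rootCone b hw (hμ w⁻¹)
    rw [map_sub, weyl_inv_applyM] at h2
    obtain ⟨k, hk⟩ := hc _ h2 j
    refine ⟨n, ?_, hn⟩
    have h3 : κ - w.1.1 κ = (κ - μ) + -(w.1.1 κ - μ) := by abel
    rw [h3, map_add₂, hn, hk, mem_range, lt_succ_iff]
    rw [← cast_add, Complex.norm_natCast, Nat.ceil_natCast]
    omega
  refine Set.Finite.of_surjOn (s := Set.range fun f : (j : b.support) →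
    range (⌈‖P.1 (κ - w.1.1 κ) (fundCo b j)‖⌉₊ + 1) => κ - ∑ j, ((f j : ℕ) : ℂ) • P.root j) id
    (fun μ hμ => ?_) (Set.finite_range _)
  choose n hn hn' using key μ hμ
  refine ⟨μ, ⟨fun j => ⟨n j, hn j⟩, ?_⟩, rfl⟩
  have h1 := eq_sum_root b (κ - μ)
  grind

/-- The hull as a finset. -/
noncomputable def hullF (κ : M) : Finset M := (hull_finite b κ).toFinset

variable {b} in
lemma mem_hullF {κ μ : M} : μ ∈ hullF b κ ↔ μ ∈ hull b κ := by simp [hullF]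

lemma isWeight_rootLat {d : M} (hd : d ∈ rootLat P) : IsWeight P d := by
  induction hd using closure_induction with
  | mem x hx => obtain ⟨i, rfl⟩ := hx; exact isWeight_root i
  | zero => exact fun i => ⟨0, by simp⟩
  | add x y _ _ hx hy => exact hx.add hy
  | neg x _ hx => exact hx.neg

lemma isWeight_of_mem_hull {κ μ : M} (hκ : IsWeight P κ) (h : μ ∈ hull b κ) : IsWeight P μ := by
  have := hκ.sub (isWeight_rootLat (mem_rootCone.1 (sub_mem_hull b h)).2)
  rwa [sub_sub_cancel] at this

lemma IsDominant.mem_hull {κ : M} (hκ : IsDominant b κ) : κ ∈ hull b κ := hκ.sub_weyl_mem b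

/-- `ρ_m` for integers `m`. -/
noncomputable abbrev rhoN (m : ι → ℕ) : M := rho b fun i => (m i : ℂ)

lemma coroot'_rhoN (hm : WInv P m) {j : ι} (hj : j ∈ b.support) : P.coroot' j (rhoN b m) = m j :=
    coroot'_rho b (fun i j => by rw [hm]) hj

lemma isDominant_rhoN (hm : WInv P m) : IsDominant b (rhoN b m) := by
  rw [isDominant_iff]
  exact fun j hj => ⟨m j, coroot'_rhoN b hm hj⟩

lemma longest_rho {w : Weyl P} (hw : ∀ i, b.IsPos (w.1.2.2 i) ↔ ¬ b.IsPos i) {k : ι → ℂ}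
    (hk : WInv P k) : w.1.1 (rho b k) = -rho b k := by
  rw [rho, map_smul, map_sum, ← smul_neg, ← sum_neg_distrib]
  congr 1
  have key : ∀ i, b.IsPos i → b.IsPos (ς (w.1.2.2 i) (w.1.2.2 i)) := fun i hi => by
    rwa [isPos_neg_iff, hw, not_not]
  have hinv : ∀ i j, ς i i = ς j j → i = j := fun i j h =>
    P.root.injective (by rw [← neg_inj, ← root_neg, ← root_neg, h])
  refine sum_bij (fun i _ => ς (w.1.2.2 i) (w.1.2.2 i))
    (fun i hi => mem_posRoots.2 (key i (mem_posRoots.1 hi)))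
    (fun i _ j _ h => w.1.2.2.injective (hinv _ _ h)) (fun i hi => ?_) (fun i _ => ?_)
  · refine ⟨ς (w⁻¹.1.2.2 i) (w⁻¹.1.2.2 i), mem_posRoots.2 ?_, ?_⟩
    · grind [isPos_neg_iff, weyl_inv_apply, mem_posRoots]
    · refine P.root.injective ?_
      grind [root_neg, reflectionPerm_weyl, weyl_inv_apply]
  · rw [hk, invariant_weyl P hk, root_neg, map_smul, root_weyl]
    simp

@[to_additive]
lemma prod_eq_prod_posRoots {A : Type*} [CommMonoid A] (f : ι → A) :
    ∏ i, f i = ∏ i ∈ R₊, f i * f (ς i i) := by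
  rw [← prod_filter_mul_prod_filter_not univ (fun i => b.IsPos i), prod_mul_distrib]
  have hinv : ∀ i, ς (ς i i) (ς i i) = i := fun i =>
    P.root.injective (by rw [root_neg, root_neg, neg_neg])
  refine congrArg₂ _ rfl (prod_bij' (fun i _ => ς i i)
    (fun i _ => ς i i) (fun i hi => ?_) (fun i hi => ?_) (fun i _ => hinv i)
    (fun i _ => hinv i) fun i _ => by rw [hinv])
  · grind [mem_posRoots, isPos_neg_iff]
  simp_all [isPos_neg_iff, mem_posRoots]

lemma sum_posRoots_even {A : Type*} [AddCommGroup A] [Module ℝ A] (f : ι → A) (hf : ∀ i,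
    f (ς i i) = f i) : ∑ i, f i = (2 : ℝ) • ∑ i ∈ R₊, f i := by
  grind [sum_eq_sum_posRoots, smul_sum, two_smul]

lemma sum_posRoots_weyl {A : Type*} [AddCommGroup A] [Module ℝ A] (f : ι → A) (hf : ∀ i,
    f (ς i i) = f i) (w : Weyl P) : ∑ i ∈ R₊, f (w.1.2.2 i) = ∑ i ∈ R₊, f i := by
  have h1 := sum_posRoots_even b f hf
  have h2 := sum_posRoots_even b (fun i => f (w.1.2.2 i)) fun i => by rw [reflectionPerm_weyl, hf]
  rw [Equiv.sum_comp w.1.2.2 f, h1] at h2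
  simp_all

lemma pair_rho (k : ι → ℂ) (y : N) : P.1 (rho b k) y = (1 / 2) * ∑ i ∈ R₊, k i * P.root' i y := by
  simp [rho, RootPairing.root']

lemma add_rho_mem (hm : WInv P m) {μ : M}
    (h : μ ∈ hull b (rhoN b m)) : μ + rhoN b m ∈ rootCone b := by
  obtain ⟨w, hw⟩ := exists_longest b
  have h2 := longest_mem_rootCone b hw (h w⁻¹)
  grind [weyl_inv_applyM, longest_rho, neg_sub, sub_neg_eq_add]

lemma isWeight_hull_rho (hm : WInv P m) : ∀ μ ∈ hullF b (rhoN b m), IsWeight P μ := fun _ h =>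
  isWeight_of_mem_hull b (isDominant_rhoN b hm).isWeight (mem_hullF.1 h)

variable {b} in
lemma CoefAxial.eq_zero (hL : NonRoot L) {F : Type*} [Field F] [Algebra ℂ F] {t : ι → F}
    (hm : WInv P m) {v : M → F} (h : CoefAxial b L t m (hullF b (rhoN b m)) v) (hres : ∀ i ∈ R₊,
    NonRes L (t i)) (h0 : v (rhoN b m) = 0) : ∀ μ ∈ hullF b (rhoN b m), v μ = 0 := by
  by_contra! hne
  have hy := regDom_sumFundCo b
  obtain ⟨p, hp, hvp, p', hp', -, hpp⟩ := h.exists_width hL (isWeight_hull_rho b hm)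
    subset_rfl hres (sumFundCo b) (fun i hi => by
      obtain ⟨r, hr, hr'⟩ := hy.root'_pos b (mem_posRoots.1 hi)
      rw [hr']; exact hr.ne') hne
  have h1 : ∑ i ∈ R₊, m i * |(P.root' i (sumFundCo b)).re| = 2 *
    (P.1 (rhoN b m) (sumFundCo b)).re := by
    rw [pair_rho]
    have : ∀ i ∈ R₊, (m i : ℂ) * P.root' i (sumFundCo b) =
      ((m i * |(P.root' i (sumFundCo b)).re| : ℝ) : ℂ) := fun i hi => by
      obtain ⟨r, hr, hr'⟩ := hy.root'_pos b (mem_posRoots.1 hi)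
      rw [hr', ofReal_re, abs_of_pos hr]; simp
    rw [sum_congr rfl this, ← ofReal_sum]
    have : (1 / 2 : ℂ) = ((1 / 2 : ℝ) : ℂ) := by norm_num
    rw [this, ← ofReal_mul, ofReal_re]; ring
  rw [mem_hullF] at hp hp'
  have h2 := add_rho_mem b hm hp'
  obtain ⟨r, hr, hr'⟩ := pair_nonneg b (mem_rootCone.1 h2).1 (y := sumFundCo b)
    fun j hj => by obtain ⟨r, hr, hr'⟩ := hy j hj; exact ⟨r, hr.le, hr'⟩
  have h3 := congrArg Complex.re hr'
  rw [map_add₂, add_re, ofReal_re] at h3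
  have h4 : rhoN b m - p ≠ 0 := fun h => hvp (by rw [← sub_eq_zero.1 h, h0])
  obtain ⟨s, hs, hs'⟩ := pair_pos b (mem_rootCone.1 (sub_mem_hull b hp)).1 h4 hy
  grind [map_sub₂, sub_re, ofReal_re]

end Axial

local notation:max "ϱ" => rhoN b m
local notation:max "𝓗" => hullF b (rhoN b m)

/-! ### Axial functions -/

variable (P)

/-- The axiality conditions. -/
def FunAxial (L : ℂ) (m : ι → ℕ) (F : N → ℂ) : Prop := ∀ i, ∀ s ∈ Icc 1 (m i), ∀ x, qpow L
    (2 * P.root' i x) = 1 → F (x + (s : ℂ) ⊙ i) = F (x - (s : ℂ) ⊙ i)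

lemma expSum_sub_eq (L : ℂ) (f : M →₀ ℂ) (i : ι) (s : ℂ) (x : N) :
    expSum P L f (x + s ⊙ i) - expSum P L f (x - s ⊙ i) =
      expSum P L (reweight (fun κ => qpow L (s * P.coroot' i κ) - qpow L (-(s * P.coroot' i κ))) f)
        x := by
  rw [expSum_reweight, expSum_subset P L f _ subset_rfl,
    expSum_subset P L f _ subset_rfl, ← sum_sub_distrib]
  refine sum_congr rfl fun κ _ => ?_
  rw [sub_eq_add_neg x, ← neg_smul, qpow_pair_add, qpow_pair_add]
  have h1 : 2 * P.1 κ (s ⊙ i) = s * P.coroot' i κ := by simp [RootPairing.coroot']; ring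
  have h2 : 2 * P.1 κ ((-(s / 2)) • P.coroot i) = -(s * P.coroot' i κ) := by simp_all
  rw [h1, h2]; ring

lemma expSum_eq_zero_of_coset (L : ℂ) (i : ι) (f : M →₀ ℂ) (S : Finset M) (hS : f.support ⊆ S)
    (h : ∀ μ ∈ S, ∑ κ ∈ S with (∃ n : ℤ, κ = μ + n • P.root i), f κ = 0) {x : N}
    (hx : qpow L (2 * P.root' i x) = 1) : expSum P L f x = 0 := by
  rw [expSum_subset P L f x hS]
  let φ : M → M ⧸ zmultiples (P.root i) := fun μ => QuotientAddGroup.mk μ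
  rw [← sum_fiberwise_of_maps_to (s := S) (t := S.image φ) (g := φ)
    fun μ hμ => mem_image_of_mem _ hμ]
  refine sum_eq_zero fun c hc => ?_
  obtain ⟨μ, hμ, rfl⟩ := mem_image.1 hc
  have hφ : ∀ κ, φ κ = φ μ ↔ ∃ n : ℤ, κ = μ + n • P.root i := fun κ => by
    rw [eq_comm, QuotientAddGroup.eq, mem_zmultiples_iff]
    constructor
    · grind
    · grind
  have e : ∀ κ ∈ S.filter (fun κ => φ κ = φ μ), f κ * qpow L (2 * P.1 κ x) = f κ * qpow L
    (2 * P.1 μ x) := fun κ hκ => by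
    obtain ⟨n, rfl⟩ := (hφ κ).1 (mem_filter.1 hκ).2
    rw [qpow_add_pair]
    have : 2 * P.1 (n • P.root i) x = n * (2 * P.root' i x) := by simp [RootPairing.root']; ring
    rw [this, qpow_int_mul, hx, one_zpow, mul_one]
  rw [sum_congr rfl e, ← sum_mul]
  simp only [hφ]
  rw [h μ hμ, zero_mul]

/-- The finitely supported function with values `v μ` at the points `ξ + μ`, `μ ∈ S`. -/
noncomputable def shiftF (ξ : M) (S : Finset M) (v : M → ℂ) : M →₀ ℂ :=
  ∑ μ ∈ S, single (ξ + μ) (v μ)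

lemma expSum_shiftF (L : ℂ) (ξ : M) (S : Finset M) (v : M → ℂ) (x : N) : expSum P L (shiftF ξ S v)
    x = qpow L (2 * P.1 ξ x) * ∑ μ ∈ S, v μ * qpow L (2 * P.1 μ x) := by
  rw [shiftF, map_sum, Finset.sum_apply, mul_sum]
  grind [expSum_single, qpow_add_pair]

lemma shiftF_apply (ξ : M) (S : Finset M) (v : M → ℂ) {μ : M} (hμ : μ ∈ S) :
    shiftF ξ S v (ξ + μ) = v μ := by
  rw [shiftF, finsetSum_apply, sum_eq_single_of_mem μ hμ]
  · simp
  grind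

lemma support_shiftF (ξ : M) (S : Finset M) (v : M → ℂ) :
    (shiftF ξ S v).support ⊆ S.image (ξ + ·) := by
  refine Finsupp.support_finsetSum.trans fun κ hκ => ?_
  grind

lemma shiftF_of_support (ξ : M) (S : Finset M) (f : M →₀ ℂ) (h : f.support ⊆ S.image (ξ + ·)) :
    shiftF ξ S (fun μ => f (ξ + μ)) = f := by
  ext κ
  by_cases hκ : κ ∈ S.image (ξ + ·)
  · grind [shiftF_apply]
  grind [support_shiftF]

section Axial

variable (b)

variable {P}

lemma funAxial_of_pos (hm : WInv P m) {F : N → ℂ} (h : ∀ i ∈ R₊, ∀ s ∈ Icc 1 (m i), ∀ x,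
    ε (P.root' i x) = 1 → F (x + (s : ℂ) ⊙ i) = F (x - (s : ℂ) ⊙ i)) : FunAxial P L m F := fun i s
    hs x hx => by
  rcases pos_or_neg b i with hi | hi
  · exact h i (mem_posRoots.2 hi) s hs x hx
  · have := h _ (mem_posRoots.2 hi) s (by rwa [hm]) x (by
      rw [root'_neg, mul_neg, qpow_neg, hx, inv_one])
    simp_all [sub_eq_add_neg]

variable (P)

lemma axial_term (L : ℂ) {κ : M} (hκ : IsWeight P κ) (i : ι) (ξ : M)
    (s : ℕ) :
    qpow L (s * P.coroot' i (ξ + κ)) - qpow L (-(s * P.coroot' i (ξ + κ))) =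
      qpow L (-(s * P.coroot' i ξ)) *
        ((qpow L (2 * P.coroot' i ξ) * algebraMap ℂ ℂ (qpow L (zp P i κ))) ^ s -
          algebraMap ℂ ℂ (qpow L (-zp P i κ)) ^ s) := by
  rw [Algebra.algebraMap_self, RingHom.id_apply, RingHom.id_apply, ← qpow_add, ← qpow_nat_mul,
    ← qpow_nat_mul, mul_sub, ← qpow_add, ← qpow_add, map_add, cast_zp hκ]
  congr 2 <;> ring

variable {P}

lemma funAxial_shiftF_iff (hL : L ≠ 0) (hm : WInv P m) (ξ : M) {S : Finset M} (hS : ∀ μ ∈ S,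
    IsWeight P μ) (v : M → ℂ) : FunAxial P L m (𝓔 (shiftF ξ S v)) ↔ CoefAxial b L
    (fun i => ε (P.coroot' i ξ)) m S v := by
  have hcos : ∀ (i : ι) (μ κ : M), (∃ n : ℤ, ξ + κ = ξ + μ + n • P.root i) ↔ ∃ n : ℤ, κ = μ + n •
    P.root i := fun i μ κ => by
    grind
  have key : ∀ (i : ι) (s : ℕ) (μ : M),
      ∑ κ ∈ S.image (ξ + ·) with (∃ n : ℤ, κ = ξ + μ + n • P.root i),
        reweight (fun κ => qpow L (s * P.coroot' i κ) - qpow L (-(s * P.coroot' i κ)))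
          (shiftF ξ S v) κ = qpow L (-(s * P.coroot' i ξ)) *
        ∑ κ ∈ S with (∃ n : ℤ, κ = μ + n • P.root i),
          v κ * ((ε (P.coroot' i ξ) * algebraMap ℂ ℂ (qpow L (zp P i κ))) ^ s -
            algebraMap ℂ ℂ (qpow L (-zp P i κ)) ^ s) := fun i s μ => by
    rw [filter_image, sum_image fun _ _ _ _ h => add_left_cancel h, mul_sum]
    simp only [hcos]
    refine sum_congr rfl fun κ hκ => ?_
    have hκS := (mem_filter.1 hκ).1
    rw [reweight_apply, shiftF_apply ξ S v hκS, axial_term P L (hS κ hκS)]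
    ring
  have hsub : ∀ u : M → ℂ, (reweight u (shiftF ξ S v)).support ⊆ S.image (ξ + ·) := fun u =>
    (support_reweight_subset _ _).trans (support_shiftF _ _ _)
  constructor
  · intro h i _ μ hμ s hs
    have h1 := coset_sum_eq_zero P hL i
      (reweight (fun κ => qpow L (s * P.coroot' i κ) - qpow L (-(s * P.coroot' i κ)))
          (shiftF ξ S v)) 0 (fun a ha => by
        rw [zero_add, ← expSum_sub_eq, sub_eq_zero]
        exact h i s hs a ha) (ξ + μ)
    simp only [map_zero, mul_zero, qpow_zero, mul_one] at h1
    rw [Finset.sum_subset (filter_subset_filter _ (hsub _)), key] at h1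
    · grind [qpow_ne_zero]
    grind
  · intro h
    refine funAxial_of_pos b hm fun i hi s hs x hx => ?_
    rw [← sub_eq_zero, expSum_sub_eq]
    refine expSum_eq_zero_of_coset P L i _ (S.image (ξ + ·)) (hsub _) (fun μ' hμ' => ?_) hx
    obtain ⟨μ, hμ, rfl⟩ := mem_image.1 hμ'
    rw [key, h i hi μ hμ s hs, mul_zero]

variable {b} in
lemma CoefAxial.exists_edge (hL : NonRoot L) {F : Type*} [Field F] [Algebra ℂ F] {t : ι → F}
    (hm : WInv P m) {v : M → F} (h : CoefAxial b L t m 𝓗 v) (w : Weyl P) {j : ι}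
    (hj : j ∈ b.support) (hres : ∀ i ∈ R₊, i ≠ w.1.2.2 j → i ≠ w.1.2.2 (ς j j) → NonRes L (t i))
    (hne : ∃ μ ∈ 𝓗, v μ ≠ 0) : ∃ n : ℕ, n ≤ m j ∧ v (w.1.1 (ϱ - n • P.root j)) ≠ 0 := by
  set y : N := sumFundCo b - fundCo b ⟨j, hj⟩
  have hys : ∀ k ∈ b.support, P.root' k y = if k = j then 0 else 1 := fun k hk => by
    have := root'_fundCo b ⟨k, hk⟩ ⟨j, hj⟩
    grind [root'_sumFundCo]
  have hynn : ∀ k ∈ b.support, ∃ r : ℝ, 0 ≤ r ∧ P.root' k y = r := fun k hk => by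
    rw [hys k hk]
    split_ifs
    · exact ⟨0, le_rfl, by simp⟩
    · exact ⟨1, zero_le_one, by simp⟩
  have hzero : ∀ d ∈ realCone b, P.1 d y = 0 → ∃ r : ℝ, 0 ≤ r ∧ d = (r : ℂ) • P.root j := fun d hd
    h0 => by
    choose r hr hr' using hd
    refine ⟨r ⟨j, hj⟩, hr _, ?_⟩
    rw [pair_eq_sum b] at h0
    have h1 : ∑ k : b.support, r k * (if (k : ι) = j then 0 else 1) = 0 := by
      have : ((∑ k : b.support, r k * (if (k : ι) = j then 0 else 1) : ℝ) : ℂ) = 0 := by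
        rw [← h0]; push_cast
        refine sum_congr rfl fun k _ => ?_
        rw [hr', hys k k.2]
        split_ifs <;> simp
      exact_mod_cast this
    rw [sum_eq_zero_iff_of_nonneg fun k _ => mul_nonneg (hr k) (by split_ifs <;> simp)] at h1
    rw [eq_sum_root b d, sum_eq_single_of_mem ⟨j, hj⟩ (mem_univ _), hr']
    intro k _ hk
    have h2 := h1 k (mem_univ _)
    rw [if_neg fun h => hk (Subtype.ext h), mul_one] at h2
    rw [hr', h2]; simp
  have hroot : ∀ k, k ≠ j → k ≠ ς j j → P.root' k y ≠ 0 := by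
    have hpos : ∀ k, b.IsPos k → k ≠ j → P.root' k y ≠ 0 := fun k hk hkj h0 => by
      obtain ⟨r, -, hr⟩ := hzero _ (root_mem_realCone b hk) h0
      exact posRoots_not_parallel b (b.isPos_of_mem_support hj) hk (Ne.symm hkj) _ hr
    intro k hk hk'
    rcases pos_or_neg b k with h1 | h1
    · exact hpos k h1 hk
    · grind [root_neg, neg_neg, root'_neg]
  have hreal : ∀ k, ∃ r : ℝ, P.root' k y = r := fun k => by
    rcases pos_or_neg b k with h1 | h1
    · obtain ⟨r, -, hr⟩ := pair_nonneg b (root_mem_realCone b h1) hynn; exact ⟨r, hr⟩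
    · obtain ⟨r, -, hr⟩ := pair_nonneg b (root_mem_realCone b h1) hynn
      refine ⟨-r, ?_⟩
      rw [ofReal_neg, ← hr]
      simp
  set I := (R₊).filter fun i => i ≠ w.1.2.2 j ∧ i ≠ w.1.2.2 (ς j j) with hI
  have hIr : ∀ i ∈ I, P.root' i (w.1.2.1 y) ≠ 0 := fun i hi => by
    rw [hI, mem_filter] at hi
    rw [root'_weyl_right]
    grind [weyl_inv_apply]
  obtain ⟨p, hp, hvp, p', hp', -, hpp⟩ := h.exists_width hL (isWeight_hull_rho b hm)
    (I := I) (filter_subset _ _) (fun i hi => by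
      grind) (w.1.2.1 y) (fun i hi => by
      have h1 := hIr i hi
      rw [root'_weyl_right] at h1 ⊢
      obtain ⟨r, hr⟩ := hreal (w⁻¹.1.2.2 i)
      rw [hr] at h1 ⊢
      exact_mod_cast h1) hne
  have hsum : ∑ i ∈ I, m i * |(P.root' i (w.1.2.1 y)).re| = 2 * (P.1 ϱ y).re := by
    have h1 : ∑ i ∈ I, m i * |(P.root' i (w.1.2.1 y)).re| = ∑ i ∈ R₊, m i *
      |(P.root' i (w.1.2.1 y)).re| := by
      refine Finset.sum_subset (filter_subset _ _) fun i hi hi' => ?_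
      rw [hI, mem_filter, not_and, not_and_or, not_not, not_not] at hi'
      have h0 : P.root' j y = 0 := by rw [hys j hj, if_pos rfl]
      rcases hi' hi with rfl | rfl
      · rw [root'_weyl, h0]; simp
      · rw [root'_weyl, root'_neg, h0]; simp
    have h2 := sum_posRoots_weyl b (fun i => m i * |(P.root' i (w.1.2.1 y)).re|) (fun i => by
      rw [hm, root'_neg, neg_re, abs_neg]) w
    rw [h1, ← h2, pair_rho]
    have : ∀ i ∈ R₊, (m i : ℂ) * P.root' i y =
      ((m (w.1.2.2 i) * |(P.root' (w.1.2.2 i) (w.1.2.1 y)).re| : ℝ) : ℂ) := fun i hi => by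
      obtain ⟨r, hr, hr'⟩ := pair_nonneg b (root_mem_realCone b (mem_posRoots.1 hi)) hynn
      rw [invariant_weyl P hm, root'_weyl, hr', ofReal_re, abs_of_nonneg hr]; simp
    rw [sum_congr rfl this, ← ofReal_sum]
    have : (1 / 2 : ℂ) = ((1 / 2 : ℝ) : ℂ) := by norm_num
    rw [this, ← ofReal_mul, ofReal_re]; ring
  rw [hsum, pair_weyl_right, pair_weyl_right] at hpp
  rw [mem_hullF] at hp hp'
  replace hp := weyl_mem_hull b hp w⁻¹
  replace hp' := weyl_mem_hull b hp' w⁻¹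
  obtain ⟨r, hr, hr'⟩ := pair_nonneg b (mem_rootCone.1 (add_rho_mem b hm hp')).1 hynn
  obtain ⟨s, hs, hs'⟩ := pair_nonneg b (mem_rootCone.1 (sub_mem_hull b hp)).1 hynn
  have h3 := congrArg Complex.re hr'
  have h4 : (P.1 ϱ y).re - (P.1 (w⁻¹.1.1 p) y).re = s := by
    rw [← sub_re, ← LinearMap.sub_apply, ← map_sub, hs', ofReal_re]
  rw [map_add₂, add_re, ofReal_re] at h3
  have hs0 : s = 0 := by linarith
  rw [hs0, ofReal_zero] at hs'
  obtain ⟨c, hc, hc'⟩ := hzero _ (mem_rootCone.1 (sub_mem_hull b hp)).1 hs'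
  have hjj : P.1 (P.root j) (fundCo b ⟨j, hj⟩) = 1 := by
    have := root'_fundCo b ⟨j, hj⟩ ⟨j, hj⟩
    simpa using this
  obtain ⟨n, hn⟩ := (mem_rootLat b).1 (mem_rootCone.1 (sub_mem_hull b hp)).2 ⟨j, hj⟩
  rw [hc', map_smul₂, hjj, smul_eq_mul, mul_one] at hn
  have hcn : c = n := by exact_mod_cast hn
  obtain ⟨k, rfl⟩ := eq_ofNat_of_zero_le (by exact_mod_cast hcn ▸ hc : 0 ≤ n)
  have hk : w⁻¹.1.1 p = ϱ - k • P.root j := by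
    have h5 : (c : ℂ) • P.root j = k • P.root j := by rw [hcn]; push_cast; rw [cast_smul_eq_nsmul]
    rw [← h5, ← hc']; abel
  refine ⟨k, ?_, ?_⟩
  · have h6 := sub_mem_hull b (weyl_mem_hull b hp (𝐬 j))
    obtain ⟨e, he, he'⟩ := (mem_rootCone.1 h6).1 ⟨j, hj⟩
    have h7 : ϱ - (𝐬 j).1.1 (w⁻¹.1.1 p) = ((m j - k : ℝ) : ℂ) • P.root j := by
      change _ - P.reflection j _ = _
      rw [hk, map_sub, map_nsmul, P.reflection_apply_self, P.reflection_apply, coroot'_rhoN b hm hj]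
      module
    rw [h7, map_smul₂, hjj, smul_eq_mul, mul_one] at he'
    have : (m j - k : ℝ) = e := by exact_mod_cast he'
    have : (k : ℝ) ≤ m j := by linarith
    exact_mod_cast this
  · rwa [← hk, weyl_inv_applyM]

variable {b} in
lemma CoefAxial.exists_string_of_antisymm (hL : NonRoot L) {F : Type*} [Field F] [CharZero F]
    [Algebra ℂ F] {t : ι → F} {S : Finset M} {v : M → F} (h : CoefAxial b L t m S v) (hS : ∀ μ ∈ S,
    IsWeight P μ) {i : ι} (hi : i ∈ R₊) (c : ℤ) (ht : t i = algebraMap ℂ F (ε c)) (hrS : ∀ κ ∈ S,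
    κ - (zp P i κ + c) • P.root i ∈ S) (hrv : ∀ κ ∈ S, v (κ - (zp P i κ + c) • P.root i) = -v κ)
    {μ : M} (hμ : μ ∈ S) (hv : v μ ≠ 0) : ∃ p ∈ S, v p ≠ 0 ∧ ∃ p' ∈ S, v p' ≠ 0 ∧ ∃ K r : ℤ,
    (2 * m i + 1 : ℤ) ≤ K ∧ p - p' = K • P.root i ∧ p = μ + r • P.root i := by
  set σ : M → M := fun κ => κ - (zp P i κ + c) • P.root i with hσ
  have hzσ : ∀ κ ∈ S, zp P i (σ κ) + c = -(zp P i κ + c) := fun κ hκ => by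
    rw [hσ]
    simp only
    rw [sub_eq_add_neg, ← neg_smul, zp_add_zsmul (hS κ hκ)]; ring
  have hσσ : ∀ κ ∈ S, σ (σ κ) = κ := fun κ hκ => by
    change σ κ - (zp P i (σ κ) + c) • P.root i = κ
    rw [hzσ κ hκ, neg_smul, sub_neg_eq_add]
    exact sub_add_cancel _ _
  set A := S.filter fun κ => ∃ n : ℤ, κ = μ + n • P.root i with hA
  have hAσ : ∀ κ ∈ A, σ κ ∈ A := fun κ hκ => by
    rw [hA, mem_filter] at hκ ⊢
    obtain ⟨h1, n, hn⟩ := hκ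
    refine ⟨hrS κ h1, n - (zp P i κ + c), ?_⟩
    rw [sub_smul, ← add_sub_assoc, ← hn]
  let T := A.filter fun κ => 0 < zp P i κ + c ∧ v κ ≠ 0
  have hT : ∀ κ ∈ T, κ ∈ S ∧ (∃ n : ℤ, κ = μ + n • P.root i) ∧ 0 < zp P i κ + c ∧ v κ ≠ 0 :=
    fun κ hκ => by grind
  have hinj : ∀ κ ∈ T, ∀ κ' ∈ T, zp P i κ = zp P i κ' → κ = κ' := fun κ hκ κ' hκ' he => by
    grind [zp_add_zsmul]
  have hfix : ∀ κ ∈ S, zp P i κ + c = 0 → v κ = 0 := fun κ hκ h0 => by grind [zero_smul, sub_zero]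
  have hTne : T.Nonempty := by grind
  let q : M → F := fun κ => algebraMap ℂ F (qpow L (zp P i κ + c))
  have hcard : m i < T.card := by
    refine lt_card_of_power_sums T v q 1 (m i) (fun κ _ => ?_) (fun κ hκ κ' hκ' he => ?_)
      (fun κ hκ κ' hκ' he => ?_) (fun κ hκ => (hT κ hκ).2.2.2) hTne fun s hs => ?_
    · rw [Ne, map_eq_zero]; exact qpow_ne_zero _ _
    · have h1 : zp P i κ + c = zp P i κ' + c := hL.qpow_inj (by
        have := (algebraMap ℂ F).injective he
        exact_mod_cast this)
      grind
    · rw [one_mul, ← map_mul, ← qpow_add, ← map_one (algebraMap ℂ F)] at he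
      refine hL (zp P i κ + c + (zp P i κ' + c)) ?_ (by
        have := (algebraMap ℂ F).injective he
        exact_mod_cast this)
      grind
    · set g : M → F := fun κ => v κ * ((1 * q κ) ^ s - (q κ)⁻¹ ^ s) with hg
      have hgσ : ∀ κ ∈ S, g (σ κ) = g κ := fun κ hκ => by
        have h1 : ((zp P i (σ κ) : ℂ) + c) = -(zp P i κ + c) := by exact_mod_cast hzσ κ hκ
        grind [qpow_neg, map_inv₀]
      have h1 : ∑ κ ∈ A, g κ = 0 := by
        have h2 := h i hi μ hμ s hs
        rw [← mul_zero ((algebraMap ℂ F (qpow L (-c))) ^ s), ← h2, mul_sum]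
        refine sum_congr rfl fun κ _ => ?_
        simp only [hg]
        have e1 : q κ = algebraMap ℂ F (qpow L (-c)) *
          (algebraMap ℂ F (ε c) * algebraMap ℂ F (qpow L (zp P i κ))) := by
          simp only [q, ← map_mul, ← qpow_add]; ring_nf
        have e2 : (q κ)⁻¹ = algebraMap ℂ F (qpow L (-c)) * algebraMap ℂ F (qpow L (-zp P i κ)) := by
          simp only [q, ← map_mul, ← map_inv₀, ← qpow_neg, ← qpow_add]; ring_nf
        rw [ht, one_mul, e2, e1]
        ring
      have h2 : ∑ κ ∈ A, g κ = ∑ κ ∈ A with 0 < zp P i κ + c, g κ + ∑ κ ∈ A with zp P i κ + c < 0, g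
        κ := by
        rw [← sum_filter_add_sum_filter_not A (fun κ => 0 < zp P i κ + c)]
        congr 1
        refine (Finset.sum_subset (fun κ hκ => ?_) fun κ hκ hκ' => ?_).symm
        · grind
        · grind
      have hAS : ∀ κ ∈ A, κ ∈ S := fun κ hκ => (mem_filter.1 hκ).1
      have h3 : ∑ κ ∈ A with zp P i κ + c < 0, g κ = ∑ κ ∈ A with 0 < zp P i κ + c, g κ := by
        refine sum_bij' (fun κ _ => σ κ) (fun κ _ => σ κ) (fun κ hκ => ?_) (fun κ hκ => ?_)
          (fun κ hκ => ?_) (fun κ hκ => ?_) (fun κ hκ => ?_)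
        all_goals rw [mem_filter] at hκ
        · grind
        · grind
        · exact hσσ κ (hAS κ hκ.1)
        · exact hσσ κ (hAS κ hκ.1)
        · grind
      rw [h2, h3, ← two_mul] at h1
      have h4 := (mul_eq_zero.1 h1).resolve_left two_ne_zero
      rw [← h4]
      refine Finset.sum_subset (fun κ hκ => ?_) fun κ hκ hκ' => ?_
      · grind
      grind
  have h2 : m i < (T.image fun κ => (zp P i κ + c - 1) / 2).card := by
    rwa [card_image_of_injOn fun κ hκ κ' hκ' he => hinj κ hκ κ' hκ' ?_]
    obtain ⟨-, ⟨n, rfl⟩, -⟩ := hT κ hκ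
    obtain ⟨-, ⟨n', rfl⟩, -⟩ := hT κ' hκ'
    simp only [zp_add_zsmul (hS μ hμ)] at he ⊢
    omega
  obtain ⟨a, ha, a', ha', haa⟩ := exists_sub_ge_of_card h2
  obtain ⟨p, hp, rfl⟩ := mem_image.1 ha
  obtain ⟨p', hp', rfl⟩ := mem_image.1 ha'
  obtain ⟨h3, ⟨n, hn⟩, h4, h5⟩ := hT p hp
  have h6 := (hT p' hp').2.2.1
  exact ⟨p, h3, h5, σ p, hrS p h3, by grind,
    zp P i p + c, n, by omega, by grind, hn⟩

end Axial

variable {P}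

/-! ### The coefficients of the Macdonald operators -/

/-- The factor of `a_τ(x)` belonging to a root `α` with `(α, τ) = n` and `(α, x) = a`. -/
noncomputable def hfac (L k n a : ℂ) : ℂ := (if 0 < n.re then brk L (k + a) / brk L a else 1) *
    (if n = 2 then brk L (k + 1 + a) / brk L (1 + a) else 1)

variable (P)

lemma macCoeff_eq_prod (L : ℂ) (k : ι → ℂ) (τ x : N) :
    macCoeff P L k τ x = ∏ i, hfac L (k i) (P.root' i τ) (P.root' i x) := by
  simp only [macCoeff, hfac, prod_mul_distrib, prod_filter]

lemma macCoeff_weyl (L : ℂ) {k : ι → ℂ} (hk : WInv P k) (w : Weyl P) (τ x : N) : macCoeff P L k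
    (w.1.2.1 τ) (w.1.2.1 x) = macCoeff P L k τ x := by
  rw [macCoeff_eq_prod, macCoeff_eq_prod, ← Equiv.prod_comp w.1.2.2]
  refine prod_congr rfl fun i _ => ?_
  rw [root'_weyl, root'_weyl, invariant_weyl P hk]

lemma brk_add_period {L p : ℂ} (hp : qpow L (2 * p) = 1) (a : ℂ) :
    brk L (a + p) = qpow L p * brk L a := by
  have h : qpow L (-p) = qpow L p := by
    rw [qpow_neg, eq_comm, ← mul_eq_one_iff_eq_inv₀ (qpow_ne_zero _ _), ← sq, ← qpow_two_mul, hp]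
  rw [brk, brk, neg_add, qpow_add, qpow_add, h]; ring

lemma hfac_add_period {L p : ℂ} (hp : qpow L (2 * p) = 1) (k n a : ℂ) :
    hfac L k n (a + p) = hfac L k n a := by
  simp only [hfac, ← add_assoc, brk_add_period hp, mul_div_mul_left _ _ (qpow_ne_zero L p)]

/-- The factor of `a_τ(x)` belonging to a pair `±α` of opposite roots. -/
noncomputable def pfac (L k n a : ℂ) : ℂ := hfac L k n a * hfac L k (-n) (-a)

lemma pfac_neg (L k n a : ℂ) : pfac L k (-n) (-a) = pfac L k n a := by
  rw [pfac, pfac, neg_neg, neg_neg, mul_comm]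

lemma pfac_add_period {L p : ℂ} (hp : qpow L (2 * p) = 1) (k n a : ℂ) :
    pfac L k n (a + p) = pfac L k n a := by
  have hp' : qpow L (2 * -p) = 1 := by rw [mul_neg, qpow_neg, hp, inv_one]
  rw [pfac, pfac, neg_add, hfac_add_period hp, hfac_add_period hp']

/-- The factor of `a_τ(x)` belonging to the roots other than `±α_i`. -/
noncomputable def restCoeff (L : ℂ) (k : ι → ℂ) (i : ι) (τ x : N) : ℂ := ∏ j ∈ univ.filter
    (fun j => P.root j ≠ P.root i ∧ P.root j ≠ -P.root i), hfac L (k j) (P.root' j τ) (P.root' j x)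

lemma macCoeff_eq_mul (L : ℂ) {k : ι → ℂ} (hk : WInv P k) (i : ι) (τ x : N) : macCoeff P L k τ x =
    pfac L (k i) (P.root' i τ) (P.root' i x) * restCoeff P L k i τ x := by
  rw [macCoeff_eq_prod, restCoeff, ← prod_filter_mul_prod_filter_not univ
    (fun j => P.root j ≠ P.root i ∧ P.root j ≠ -P.root i), mul_comm]
  have hne : i ≠ ς i i := fun h => by
    have h1 := root_neg (P := P) i
    rw [← h] at h1
    have h2 : (2 : ℂ) • P.root i = 0 := by rw [two_smul]; nth_rewrite 1 [h1]; simp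
    exact P.ne_zero i ((smul_eq_zero.1 h2).resolve_left two_ne_zero)
  have : univ.filter (fun j => ¬(P.root j ≠ P.root i ∧ P.root j ≠ -P.root i)) = {i,
    ς i i} := by
    ext j
    simp only [mem_filter, mem_univ, true_and, not_and_or, not_not,
      mem_insert, mem_singleton, ← root_neg, P.root.injective.eq_iff]
  rw [this, prod_pair hne, root'_neg, root'_neg, hk, pfac]

lemma continuousAt_hfac {L k n a : ℂ} (h1 : brk L a ≠ 0) (h2 : brk L (1 + a) ≠ 0) :
    ContinuousAt (hfac L k n) a := by
  have c := continuous_brk L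
  refine ContinuousAt.mul ?_ ?_
  · split_ifs
    · exact ContinuousAt.div (by fun_prop) c.continuousAt h1
    · exact continuousAt_const
  · split_ifs
    · exact ContinuousAt.div (by fun_prop) (by fun_prop) h2
    · exact continuousAt_const

lemma tendsto_restCoeff (L : ℂ) (k : ι → ℂ) (i : ι) (τ x v : N) (hx : ∀ j, P.root j ≠ P.root i →
    P.root j ≠ -P.root i → brk L (P.root' j x) ≠ 0 ∧ brk L (1 + P.root' j x) ≠ 0) : Tendsto
    (fun t : ℂ => restCoeff P L k i τ (x + t • v)) (𝓝[≠] 0) (𝓝 (restCoeff P L k i τ x)) := by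
  refine Filter.Tendsto.mono_left ?_ nhdsWithin_le_nhds
  refine tendsto_finsetProd _ fun j hj => ?_
  rw [mem_filter] at hj
  obtain ⟨h1, h2⟩ := hx j hj.2.1 hj.2.2
  have h3 : Continuous fun t : ℂ => P.root' j (x + t • v) := by
    simp only [map_add, map_smul, smul_eq_mul]; fun_prop
  have h4 := h3.tendsto 0
  rw [zero_smul, add_zero] at h4
  exact (continuousAt_hfac h1 h2).tendsto.comp h4

section Pole

lemma brk_zero (L : ℂ) : brk L 0 = 0 := by simp [brk]

lemma NonRoot.brk_ne (hL : NonRoot L) (n : ℤ) {a : ℂ} (ha : a = n) (hn : n ≠ 0) :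
    brk L a ≠ 0 := ha ▸ hL.brk_int_ne_zero hn

lemma eventually_brk_ne (hL : L ≠ 0) (a : ℂ) : ∀ᶠ e : ℂ in 𝓝[≠] 0, brk L (a + e) ≠ 0 := by
  filter_upwards [ev_qpow_ne_one hL a one_ne_zero] with e he
  rw [Ne, brk_eq_zero]
  simpa using he

/-- The possible pairings of roots with (quasi)minuscule coweights. -/
def IsSmall (n : ℤ) : Prop := n = -2 ∨ n = -1 ∨ n = 0 ∨ n = 1 ∨ n = 2

lemma IsSmall.neg {n : ℤ} (h : IsSmall n) : IsSmall (-n) := by unfold IsSmall at *; omega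

lemma hfac_of_nonpos (L k a : ℂ) {n : ℤ} (hn : n ≤ 0) : hfac L k n a = 1 := by
  have h1 : ¬ (0 : ℝ) < ((n : ℂ)).re := by simpa using hn
  have h2 : (n : ℂ) ≠ 2 := fun h => by
    have : n = 2 := by exact_mod_cast h
    omega
  rw [hfac, if_neg h1, if_neg h2, one_mul]

lemma hfac_one (L k a : ℂ) : hfac L k (1 : ℤ) a = brk L (k + a) / brk L a := by
  rw [hfac, if_pos (by simp), if_neg (by norm_num), mul_one]

lemma hfac_two (L k a : ℂ) : hfac L k (2 : ℤ) a =
    brk L (k + a) / brk L a * (brk L (k + 1 + a) / brk L (1 + a)) := by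
  rw [hfac, if_pos (by simp), if_pos (by norm_num)]

lemma pfac_of_nonneg (L k a : ℂ) {n : ℤ} (hn : 0 ≤ n) : pfac L k n a = hfac L k n a := by
  rw [pfac, ← cast_neg, hfac_of_nonpos L k _ (by omega : -n ≤ 0), mul_one]

lemma pfac_k_zero (L : ℂ) {n : ℤ} (hn : IsSmall n) {a : ℂ} (h0 : brk L a ≠ 0)
    (h1 : brk L (1 + a) ≠ 0) (h2 : brk L (1 - a) ≠ 0) : pfac L 0 n a = 1 := by
  have h3 : brk L (-a) ≠ 0 := by rw [brk_neg]; exact neg_ne_zero.2 h0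
  have key : ∀ n : ℤ, 0 ≤ n → IsSmall n → ∀ a, brk L a ≠ 0 → brk L (1 + a) ≠ 0 → pfac L 0 n a = 1 :=
    fun n hn hs a h0 h1 => by
    rw [pfac_of_nonneg L 0 a hn]
    rcases hs with rfl | rfl | rfl | rfl | rfl
    · omega
    · omega
    · exact hfac_of_nonpos L 0 a le_rfl
    · rw [hfac_one, zero_add, div_self h0]
    · rw [hfac_two, zero_add, div_self h0, zero_add, div_self h1, one_mul]
  rcases le_total 0 n with h | h
  · exact key n h hn a h0 h1
  · rw [← pfac_neg, ← cast_neg]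
    exact key (-n) (by omega) hn.neg _ h3 (by rwa [← sub_eq_add_neg])

lemma tendsto_qpow_sub_one_mul {f : ℂ → ℂ} {c : ℂ} (hf : Tendsto f (𝓝[≠] 0) (𝓝 c)) :
    Tendsto (fun e => (ε e - 1) * f e) (𝓝[≠] 0) (𝓝 0) := by
  have h : Tendsto (fun e => ε e - 1) (𝓝[≠] 0) (𝓝 0) := by
    have h1 : Continuous fun e => ε e - 1 := by unfold qpow; fun_prop
    have h2 := h1.tendsto 0
    simp only [mul_zero, qpow_zero, sub_self] at h2
    exact h2.mono_left nhdsWithin_le_nhds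
  simpa using h.mul hf

lemma tendsto_brk_add (L c : ℂ) : Tendsto (fun e => brk L (c + e)) (𝓝[≠] 0) (𝓝 (brk L c)) := by
  have h1 : Continuous fun e => brk L (c + e) := (continuous_brk L).comp (by fun_prop)
  have h2 := h1.tendsto 0
  rw [add_zero] at h2
  exact h2.mono_left nhdsWithin_le_nhds

lemma qpow_sub_one_eq (L a : ℂ) : qpow L (2 * a) - 1 = qpow L a * brk L a := by
  rw [brk_eq, ← mul_assoc, ← qpow_add, add_neg_cancel, qpow_zero, one_mul]

lemma tendsto_qpow (L : ℂ) : Tendsto (fun e => qpow L e) (𝓝[≠] 0) (𝓝 1) := by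
  have h2 := (continuous_qpow L).tendsto 0
  rw [qpow_zero] at h2
  exact h2.mono_left nhdsWithin_le_nhds

lemma exists_tendsto_pfac_zero (hL : NonRoot L) (m : ℕ) {n : ℤ} (hn : 0 ≤ n)
    (hs : IsSmall n) : ∃ r, Tendsto (fun e => (ε e - 1) * pfac L (-m) n e) (𝓝[≠] 0) (𝓝 r) ∧
    ((m : ℤ) < n → r = 0) := by
  have hev : ∀ᶠ e : ℂ in 𝓝[≠] 0, brk L e ≠ 0 := by simpa using eventually_brk_ne hL.ne_zero 0
  have h1 : brk L 1 ≠ 0 := hL.brk_ne 1 (by simp) one_ne_zero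
  simp only [pfac_of_nonneg L _ _ hn]
  rcases hs with rfl | rfl | rfl | rfl | rfl
  · omega
  · omega
  · refine ⟨0, ?_, fun _ => rfl⟩
    simp only [hfac_of_nonpos L _ _ le_rfl]
    exact tendsto_qpow_sub_one_mul tendsto_const_nhds
  · refine ⟨1 * brk L (-m), ?_, fun h => ?_⟩
    · refine ((tendsto_qpow L).mul (tendsto_brk_add L (-m))).congr' ?_
      filter_upwards [hev] with e he
      rw [hfac_one, qpow_sub_one_eq]; field_simp
    · have : m = 0 := by omega
      simp [this, brk_zero]
  · refine ⟨1 * brk L (-m) * (brk L (-m + 1) / brk L 1), ?_, fun h => ?_⟩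
    · refine (((tendsto_qpow L).mul (tendsto_brk_add L (-m))).mul
        ((tendsto_brk_add L (-m + 1)).div (tendsto_brk_add L 1) h1)).congr' ?_
      filter_upwards [hev] with e he
      rw [hfac_two, qpow_sub_one_eq, Pi.div_apply]; field_simp
    · have : m = 0 ∨ m = 1 := by omega
      rcases this with rfl | rfl <;> simp [brk_zero]

lemma tendsto_pfac_pos (hL : NonRoot L) (m : ℕ) {n : ℤ} (hn : 0 ≤ n) (hs : IsSmall n) {s : ℤ}
    (hs0 : s ≠ 0) (hs1 : n = 2 → s ≠ -1) : Tendsto (fun e => pfac L (-m) n (s + e)) (𝓝[≠] 0)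
    (𝓝 (pfac L (-m) n s)) ∧ (s ≤ m → (m : ℤ) < s + n → pfac L (-m) n s = 0) := by
  simp only [pfac_of_nonneg L _ _ hn]
  have h0 : brk L s ≠ 0 := hL.brk_int_ne_zero hs0
  rcases hs with rfl | rfl | rfl | rfl | rfl
  · omega
  · omega
  · simp only [hfac_of_nonpos L _ _ le_rfl]
    simp
  · simp only [hfac_one, ← add_assoc]
    refine ⟨(tendsto_brk_add L _).div (tendsto_brk_add L _) h0, fun h h' => ?_⟩
    have : s = m := by omega
    simp [this, brk_zero]
  · have h1 : brk L (1 + s) ≠ 0 := hL.brk_ne (1 + s) (by push_cast; rfl) (by have := hs1 rfl; omega)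
    simp only [hfac_two, ← add_assoc]
    refine ⟨((tendsto_brk_add L _).div (tendsto_brk_add L _) h0).mul
      ((tendsto_brk_add L _).div (tendsto_brk_add L _) h1), fun h h' => ?_⟩
    have : s = m ∨ s = m - 1 := by omega
    rcases this with rfl | rfl <;> simp [brk_zero]

lemma exists_tendsto_pfac_two (hL : NonRoot L) (m : ℕ) : ∃ r, Tendsto
    (fun e => (ε e - 1) * pfac L (-m) (2 : ℤ) ((-1 : ℤ) + e)) (𝓝[≠] 0) (𝓝 r) := by
  have hev : ∀ᶠ e : ℂ in 𝓝[≠] 0, brk L e ≠ 0 := by simpa using eventually_brk_ne hL.ne_zero 0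
  have h1 : brk L (-1) ≠ 0 := hL.brk_ne (-1) (by simp) (by norm_num)
  simp only [pfac_of_nonneg L _ _ (by norm_num : (0 : ℤ) ≤ 2)]
  refine ⟨_, (((tendsto_qpow L).mul (tendsto_brk_add L (-m + 1 + -1))).mul
    ((tendsto_brk_add L (-m + -1)).div (tendsto_brk_add L (-1)) h1)).congr' ?_⟩
  filter_upwards [hev] with e he
  rw [hfac_two, qpow_sub_one_eq]
  push_cast
  have e1 : 1 + (-1 + e) = e := by ring
  rw [e1, ← add_assoc, ← add_assoc, Pi.div_apply]; field_simp

end Pole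

variable {P}

lemma tendsto_neg_zero : Tendsto (fun e : ℂ => -e) (𝓝[≠] 0) (𝓝[≠] 0) := by
  refine tendsto_nhdsWithin_iff.2 ⟨?_, ?_⟩
  · have := (continuous_neg (G := ℂ)).tendsto 0
    rw [neg_zero] at this
    exact this.mono_left nhdsWithin_le_nhds
  · filter_upwards [self_mem_nhdsWithin] with e he
    simpa using he

lemma tendsto_mul_punctured {c : ℂ} (hc : c ≠ 0) :
    Tendsto (fun e : ℂ => c * e) (𝓝[≠] 0) (𝓝[≠] 0) := by
  refine tendsto_nhdsWithin_iff.2 ⟨?_, ?_⟩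
  · have := (continuous_const_mul c).tendsto 0
    rw [mul_zero] at this
    exact this.mono_left nhdsWithin_le_nhds
  · filter_upwards [self_mem_nhdsWithin] with e he
    simpa [hc] using he

lemma qpow_sub_one_neg (L e : ℂ) :
    qpow L (2 * e) - 1 = -qpow L (2 * e) * (qpow L (2 * -e) - 1) := by
  rw [mul_sub, neg_mul, ← qpow_add]
  ring_nf
  rw [qpow_zero]; ring

lemma tendsto_neg_qpow_two (L : ℂ) : Tendsto (fun e => -qpow L (2 * e)) (𝓝[≠] 0) (𝓝 (-1)) := by
  have h1 : Continuous fun e => -qpow L (2 * e) := by unfold qpow; fun_prop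
  have h2 := h1.tendsto 0
  rw [mul_zero, qpow_zero] at h2
  exact h2.mono_left nhdsWithin_le_nhds

section Pole

lemma exists_tendsto_pfac_zero' (hL : NonRoot L) (m : ℕ) {n : ℤ} (hs : IsSmall n) : ∃ r, Tendsto
    (fun e => (ε e - 1) * pfac L (-m) n e) (𝓝[≠] 0) (𝓝 r) ∧ ((m : ℤ) < |n| → r = 0) := by
  rcases le_total 0 n with hn | hn
  · obtain ⟨r, h1, h2⟩ := exists_tendsto_pfac_zero hL m hn hs
    grind
  · obtain ⟨r, h1, h2⟩ := exists_tendsto_pfac_zero hL m (by omega : 0 ≤ -n) hs.neg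
    refine ⟨-1 * r, ?_, fun h => by grind⟩
    refine ((tendsto_neg_qpow_two L).mul (h1.comp tendsto_neg_zero)).congr fun e => ?_
    rw [qpow_sub_one_neg L e, ← pfac_neg L _ n e, comp_apply, cast_neg]; ring

lemma tendsto_pfac (hL : NonRoot L) (m : ℕ) {n : ℤ} (hs : IsSmall n) {s : ℤ} (hs0 : s ≠ 0)
    (hs1 : n = 2 → s ≠ -1) (hs2 : n = -2 → s ≠ 1) : Tendsto (fun e => pfac L (-m) n (s + e))
    (𝓝[≠] 0) (𝓝 (pfac L (-m) n s)) ∧ (|s| ≤ m → (m : ℤ) < |s + n| → pfac L (-m) n s = 0) := by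
  rcases le_total 0 n with hn | hn
  · obtain ⟨h1, h2⟩ := tendsto_pfac_pos hL m hn hs hs0 hs1
    grind
  · obtain ⟨h1, h2⟩ := tendsto_pfac_pos hL m (by omega : 0 ≤ -n) hs.neg (neg_ne_zero.2 hs0)
      (fun h => by have := hs2 (by omega); omega)
    push_cast at h1 h2
    rw [pfac_neg] at h1 h2
    refine ⟨(h1.comp tendsto_neg_zero).congr fun e => ?_, fun h h' => h2 ?_ ?_⟩
    · rw [comp_apply, ← neg_add, pfac_neg]
    · rw [abs_le] at h; omega
    grind

end Pole

/-! ### The Macdonald operators -/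

variable (P)

/-- The operator `∑_τ a_τ (T^τ - 1) + C`. -/
noncomputable def opD (L : ℂ) (k : ι → ℂ) (O : Finset N) (C : ℂ) (F : N → ℂ) (x : N) : ℂ := ∑ τ ∈ O,
    macCoeff P L k τ x * (F (x + τ) - F x) + C * F x

/-- `O` is a union of orbits of (quasi)minuscule coweights. -/
structure SmallSet (O : Finset N) : Prop where
  weyl : ∀ w : Weyl P, ∀ τ ∈ O, w.1.2.1 τ ∈ O
  small : ∀ τ ∈ O, ∀ i, ∃ n : ℤ, IsSmall n ∧ P.root' i τ = n ∧ (n = 2 → τ = P.coroot i)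

variable {P}

lemma SmallSet.eq_neg_coroot {O : Finset N} (hO : SmallSet P O) {τ : N}
    (hτ : τ ∈ O) {i : ι} {n : ℤ} (h : P.root' i τ = n) (hn : n = -2) : τ = -P.coroot i := by
  obtain ⟨n', -, h1, h2⟩ := hO.small τ hτ (ς i i)
  rw [root'_neg, h] at h1
  have h3 : -n = n' := by exact_mod_cast h1
  rw [h2 (by omega), coroot_neg]

lemma SmallSet.eq_coroot {O : Finset N} (hO : SmallSet P O) {τ : N}
    (hτ : τ ∈ O) {i : ι} {n : ℤ} (h : P.root' i τ = n) (hn : n = 2) : τ = P.coroot i := by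
  obtain ⟨n', -, h1, h2⟩ := hO.small τ hτ i
  rw [h] at h1
  exact h2 (by rw [← hn]; exact_mod_cast h1.symm)

lemma FunAxial.int {F : N → ℂ} (h : FunAxial P L m F) {i : ι} {x : N} (hx : ε (P.root' i x) = 1)
    {u : ℤ} (hu : |u| ≤ m i) : F (x + (u : ℂ) ⊙ i) = F (x - (u : ℂ) ⊙ i) := by
  rcases lt_trichotomy u 0 with h0 | rfl | h0
  · have := h i u.natAbs (by grind) x hx
    have e : ((u.natAbs : ℕ) : ℂ) = -u := by
      have h1 : ((u.natAbs : ℕ) : ℤ) = -u := by omega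
      have h2 : (((u.natAbs : ℕ) : ℤ) : ℂ) = -u := by rw [h1]; push_cast; rfl
      rw [← h2, cast_natCast]
    simp_all [neg_div, sub_eq_add_neg]
  · simp
  · have := h i u.natAbs (by grind) x hx
    grind [cast_natCast]

section Operator

variable {O : Finset N}

variable (P)

lemma root'_line (i : ι) (x : N) (e : ℂ) : P.root' i (x + e ⊙ i) = P.root' i x + e := by
  simp

variable {P}

lemma macCoeff_line {k : ι → ℂ} (hk : WInv P k) {i : ι} {s : ℤ} {x : N}
    (hx : ε (P.root' i x) = ε s) (τ : N) (e : ℂ) : macCoeff P L k τ (x + e ⊙ i) = pfac L (k i)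
    (P.root' i τ) (s + e) * restCoeff P L k i τ (x + e • ((1 / 2 : ℂ) • P.coroot i)) := by
  rw [macCoeff_eq_mul P L hk i, root'_line]
  have hp : ε (P.root' i x - s) = 1 := by rw [mul_sub, qpow_sub, hx, div_self (qpow_ne_zero _ _)]
  have e1 : P.root' i x + e = s + e + (P.root' i x - s) := by ring
  grind [pfac_add_period, smul_smul]

lemma macCoeff_symm {k : ι → ℂ} (hk : WInv P k) {i : ι} {x : N} (hx : ε (P.root' i x) = 1) (τ : N)
    (u : ℂ) : macCoeff P L k (P.coreflection i τ) (x - u ⊙ i) = macCoeff P L k τ (x + u ⊙ i) := by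
  rw [← macCoeff_weyl P L hk (𝐬 i) τ]
  change _ = macCoeff P L k (P.coreflection i τ) (P.coreflection i _)
  have e : P.coreflection i (x + u ⊙ i) = x - u ⊙ i + (-P.root' i x) • P.coroot i := by
    rw [P.coreflection_apply, root'_line]; module
  rw [e, macCoeff_eq_prod, macCoeff_eq_prod]
  refine prod_congr rfl fun j _ => ?_
  rw [map_add, map_smul, P.root'_coroot_eq_pairing, ← P.algebraMap_pairingIn ℤ, smul_eq_mul,
    hfac_add_period]
  have e2 : 2 * (-P.root' i x * algebraMap ℤ ℂ (P.pairingIn ℤ j i)) =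
    ((-P.pairingIn ℤ j i : ℤ) : ℂ) * (2 * P.root' i x) := by
    rw [algebraMap_int_eq, eq_intCast]; push_cast; ring
  rw [e2, qpow_int_mul, hx, one_zpow]

lemma FunAxial.shift {F : N → ℂ} (h : FunAxial P L m F) {i : ι} {x : N} (hx : ε (P.root' i x) = 1)
    {τ : N} {n s : ℤ} (hn : P.root' i τ = n) (hs : |s + n| ≤ m i) : F (x + (s : ℂ) ⊙ i + τ) = F
    (x - (s : ℂ) ⊙ i + P.coreflection i τ) := by
  have h1 := h.int (x := x + τ - (n : ℂ) ⊙ i) (i := i) (u := s + n) (by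
    rw [← hx]; simp [hn]) hs
  convert h1 using 2
  · module
  · rw [P.coreflection_apply, hn]; module

lemma tendsto_line_half {G : Set M} {F : N → ℂ} (hF : F ∈ expSpace P L G) (x v : N) :
    Tendsto (fun e : ℂ => F (x + (e / 2) • v)) (𝓝[≠] 0) (𝓝 (F x)) := by
  refine (tendsto_line hF x ((1 / 2 : ℂ) • v)).congr fun e => ?_
  rw [smul_smul, mul_one_div]

lemma tendsto_line_half_add {G : Set M} {F : N → ℂ} (hF : F ∈ expSpace P L G) (x v τ : N) :
    Tendsto (fun e : ℂ => F (x + (e / 2) • v + τ)) (𝓝[≠] 0) (𝓝 (F (x + τ))) := by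
  refine (tendsto_line_half hF (x + τ) v).congr fun e => ?_
  rw [add_right_comm]

variable (hL : NonRoot L) (hm : WInv P m)
  (hO : SmallSet P O)

include hL hm hO

variable (P)

/-- The points at which only the denominators belonging to `±α_i` may vanish. -/
def GenAt (L : ℂ) (i : ι) (x : N) : Prop := ∀ j, P.root j ≠ P.root i → P.root j ≠ -P.root i → brk L
    (P.root' j x) ≠ 0 ∧ brk L (1 + P.root' j x) ≠ 0

variable {P}

lemma tendsto_macCoeff {i : ι} {s : ℤ} {x : N} (hx : ε (P.root' i x) = ε s) (hg : GenAt P L i x)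
    {τ : N} {n : ℤ} (hn : P.root' i τ = n) (hsm : IsSmall n) (hs0 : s ≠ 0) (hs1 : n = 2 → s ≠ -1)
    (hs2 : n = -2 → s ≠ 1) : ∃ A, Tendsto (fun e : ℂ => macCoeff P L m⁻ τ (x + e ⊙ i)) (𝓝[≠] 0)
    (𝓝 A) ∧ (|s| ≤ m i → (m i : ℤ) < |s + n| → A = 0) := by
  obtain ⟨h1, h2⟩ := tendsto_pfac hL (m i) hsm hs0 hs1 hs2
  refine ⟨_, (h1.mul (tendsto_restCoeff P L m⁻ i τ x
    ((1 / 2 : ℂ) • P.coroot i) hg)).congr fun e => ?_, fun h h' => by rw [h2 h h', zero_mul]⟩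
  rw [macCoeff_line (fun i j => by rw [hm]) hx, hn]

lemma tendsto_opD_pole_zero {G : Set M} {F : N → ℂ} (hF : F ∈ expSpace P L G)
    (hax : FunAxial P L m F) (C : ℂ) {i : ι} {x : N} (hx : ε (P.root' i x) = 1)
    (hg : GenAt P L i x) : Tendsto (fun e : ℂ => (ε e - 1) * opD P L m⁻ O C F (x + e ⊙ i)) (𝓝[≠] 0)
    (𝓝 0) := by
  set k : ι → ℂ := fun i => -(m i : ℂ) with hkdef
  have hk : WInv P k := fun i j => by simp only [hkdef, hm]
  have hx' : ε (P.root' i x) = ε (0 : ℤ) := by rw [hx]; simp [qpow_zero]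
  have hR : ∀ τ ∈ O, ∃ R, Tendsto (fun e : ℂ => (ε e - 1) * macCoeff P L k τ (x + e ⊙ i)) (𝓝[≠] 0)
    (𝓝 R) ∧ ∀ n : ℤ, P.root' i τ = n → (m i : ℤ) < |n| → R = 0 := fun τ hτ => by
    obtain ⟨n, hsm, hn, -⟩ := hO.small τ hτ i
    obtain ⟨r, h1, h2⟩ := exists_tendsto_pfac_zero' hL (m i) hsm
    refine ⟨_, (h1.mul (tendsto_restCoeff P L k i τ x ((1 / 2 : ℂ) • P.coroot i) hg)).congr
      fun e => ?_, fun n' hn' h => ?_⟩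
    · rw [macCoeff_line hk hx', hn, Int.cast_zero, zero_add, mul_assoc]
    · simp_all
  choose! R hR hR0 using hR
  have hrefl : ∀ τ ∈ O, P.coreflection i τ ∈ O := fun τ hτ => hO.weyl (𝐬 i) τ hτ
  have hRσ : ∀ τ ∈ O, R (P.coreflection i τ) = -R τ := fun τ hτ => by
    have h1 := (tendsto_neg_qpow_two L).mul ((hR τ hτ).comp tendsto_neg_zero)
    rw [neg_one_mul] at h1
    refine tendsto_nhds_unique (hR _ (hrefl τ hτ)) (h1.congr fun e => ?_)
    have h2 := macCoeff_symm hk hx τ (-e)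
    rw [neg_div, neg_smul, sub_neg_eq_add] at h2
    rw [comp_apply, ← mul_assoc, ← qpow_sub_one_neg, neg_div, neg_smul, h2]
  have hFs : ∀ τ ∈ O, R τ * F (x + P.coreflection i τ) = R τ * F (x + τ) := fun τ hτ => by
    obtain ⟨n, hsm, hn, -⟩ := hO.small τ hτ i
    rcases le_or_gt |n| (m i : ℤ) with h | h
    · have := hax.shift hx (s := 0) hn (by simpa using h)
      simp_all
    · rw [hR0 τ hτ n hn h]; simp
  have hsum : ∑ τ ∈ O, R τ * (F (x + τ) - F x) = 0 := by
    have h1 : ∑ τ ∈ O, R τ * (F (x + τ) - F x) = -∑ τ ∈ O, R τ * (F (x + τ) - F x) := by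
      rw [← sum_neg_distrib]
      refine sum_bij' (fun τ _ => P.coreflection i τ) (fun τ _ => P.coreflection i τ) hrefl hrefl
        (fun τ _ => P.coreflection_same i τ) (fun τ _ => P.coreflection_same i τ) fun τ hτ => ?_
      rw [hRσ τ hτ, mul_sub, mul_sub, neg_mul, hFs τ hτ]; ring
    exact self_eq_neg.1 h1
  have hlim : Tendsto (fun e : ℂ => ∑ τ ∈ O, (ε e - 1) *
      macCoeff P L k τ (x + e ⊙ i) *
        (F (x + e ⊙ i + τ) - F (x + e ⊙ i)) +
        (ε e - 1) * (C * F (x + e ⊙ i))) (𝓝[≠] 0)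
      (𝓝 (∑ τ ∈ O, R τ * (F (x + τ) - F x) + 0)) := by
    refine (tendsto_finsetSum _ fun τ hτ => (hR τ hτ).mul (Tendsto.sub ?_ ?_)).add
      (tendsto_qpow_sub_one_mul (Tendsto.const_mul C ?_) (c := C * F x))
    · exact tendsto_line_half_add hF _ _ _
    · exact tendsto_line_half hF _ _
    · exact tendsto_line_half hF _ _
  rw [hsum, add_zero] at hlim
  refine hlim.congr fun e => ?_
  rw [opD, mul_add, mul_sum]
  simp only [mul_assoc]

lemma tendsto_opD_pole_one {G : Set M} {F : N → ℂ} (hF : F ∈ expSpace P L G)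
    (hax : FunAxial P L m F) (C : ℂ) {i : ι} {x : N} (hx : ε (P.root' i x + 1) = 1)
    (hg : GenAt P L i x) : Tendsto (fun e : ℂ => (ε e - 1) * opD P L m⁻ O C F (x + e ⊙ i)) (𝓝[≠] 0)
    (𝓝 0) := by
  set k : ι → ℂ := fun i => -(m i : ℂ) with hkdef
  have hk : WInv P k := fun i j => by simp only [hkdef, hm]
  have hx' : ε (P.root' i x) = ε (-1 : ℤ) := by
    have e : 2 * P.root' i x = 2 * (P.root' i x + 1) + 2 * ((-1 : ℤ) : ℂ) := by ring
    rw [e, qpow_add, hx, one_mul]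
  have hterm : ∀ τ ∈ O, Tendsto
    (fun e : ℂ => (ε e - 1) * (macCoeff P L k τ (x + e ⊙ i) * (F (x + e ⊙ i + τ) - F (x + e ⊙ i))))
    (𝓝[≠] 0) (𝓝 0) := fun τ hτ => by
    obtain ⟨n, hsm, hn, -⟩ := hO.small τ hτ i
    have hF1 : Tendsto (fun e : ℂ => F (x + e ⊙ i + τ) - F (x + e ⊙ i)) (𝓝[≠] 0)
      (𝓝 (F (x + τ) - F x)) := by
      refine Tendsto.sub ?_ ?_
      · exact tendsto_line_half_add hF _ _ _
      · exact tendsto_line_half hF _ _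
    by_cases h2 : n = 2
    · subst h2
      by_cases hmi : m i = 0
      · refine tendsto_qpow_sub_one_mul (Tendsto.mul ?_ hF1)
          (c := restCoeff P L k i τ x * (F (x + τ) - F x))
        refine (tendsto_restCoeff P L k i τ x ((1 / 2 : ℂ) • P.coroot i) hg).congr' ?_
        filter_upwards [eventually_brk_ne hL.ne_zero (-1), eventually_brk_ne hL.ne_zero 0,
          tendsto_neg_zero.eventually (eventually_brk_ne hL.ne_zero 2)] with e h1 h2 h3
        rw [macCoeff_line hk hx', hn]
        have h0 : k i = 0 := by simp [hkdef, hmi]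
        rw [h0, pfac_k_zero L (Or.inr (Or.inr (Or.inr (Or.inr rfl)))) (by simpa using h1)
          (by simpa using h2) (by
            grind), one_mul]
      · obtain ⟨r, hr⟩ := exists_tendsto_pfac_two hL (m i)
        have h0 : F (x + τ) - F x = 0 := by
          have hτ' := hO.eq_coroot hτ hn rfl
          have := hax i 1 (by rw [mem_Icc]; omega) (x + (1 / 2 : ℂ) • P.coroot i) (by
            convert hx using 3; simp)
          rw [sub_eq_zero, hτ']
          convert this using 2
          · module
          · module
        rw [h0] at hF1
        have h3 := (hr.mul (tendsto_restCoeff P L k i τ x ((1 / 2 : ℂ) • P.coroot i) hg)).mul hF1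
        rw [mul_zero] at h3
        refine h3.congr fun e => ?_
        rw [macCoeff_line hk hx', hn]
        ring
    · obtain ⟨A, hA, -⟩ := tendsto_macCoeff hL hm hO hx' hg hn hsm (by norm_num)
        (fun h => absurd h h2) (fun _ => by norm_num)
      exact tendsto_qpow_sub_one_mul (hA.mul hF1)
  have hC : Tendsto (fun e : ℂ => (ε e - 1) * (C * F (x + e ⊙ i))) (𝓝[≠] 0) (𝓝 0) := by
    refine tendsto_qpow_sub_one_mul (Tendsto.const_mul C ?_) (c := C * F x)
    exact tendsto_line_half hF _ _
  have hlim := (tendsto_finsetSum O hterm).add hC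
  simp only [sum_const_zero, add_zero] at hlim
  refine hlim.congr fun e => ?_
  rw [opD, mul_add, mul_sum]

lemma tendsto_opD_sub {G : Set M} {F : N → ℂ} (hF : F ∈ expSpace P L G) (hax : FunAxial P L m F)
    (C : ℂ) {i : ι} {x : N} (hx : ε (P.root' i x) = 1) {s : ℕ} (hs : s ∈ Icc 1 (m i))
    (hg : GenAt P L i (x + (s : ℂ) ⊙ i)) : Tendsto
    (fun e : ℂ => opD P L m⁻ O C F (x + (s + e) ⊙ i) - opD P L m⁻ O C F (x - (s + e) ⊙ i)) (𝓝[≠] 0)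
    (𝓝 0) := by
  set k : ι → ℂ := fun i => -(m i : ℂ) with hkdef
  have hk : WInv P k := fun i j => by simp only [hkdef, hm]
  rw [mem_Icc] at hs
  have hx' : ε (P.root' i (x + (s : ℂ) ⊙ i)) = ε (s : ℤ) := by
    rw [root'_line, mul_add, qpow_add, hx, one_mul]; rfl
  have hrefl : ∀ τ ∈ O, P.coreflection i τ ∈ O := fun τ hτ => hO.weyl (𝐬 i) τ hτ
  set B : N → ℂ → ℂ := fun τ e => F (x + (s + e) ⊙ i + τ) - F
    (x + (s + e) ⊙ i) - (F (x - (s + e) ⊙ i + P.coreflection i τ) - F (x - (s + e) ⊙ i)) with hB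
  have hD : ∀ e : ℂ, opD P L k O C F (x + (s + e) ⊙ i) - opD P L k O C F (x - (s + e) ⊙ i) =
    ∑ τ ∈ O, macCoeff P L k τ (x + (s + e) ⊙ i) * B τ e + C *
    (F (x + (s + e) ⊙ i) - F (x - (s + e) ⊙ i)) := fun e => by
    have h1 : ∑ τ ∈ O, macCoeff P L k τ (x - (s + e) ⊙ i) *
      (F (x - (s + e) ⊙ i + τ) - F (x - (s + e) ⊙ i)) = ∑ τ ∈ O, macCoeff P L k τ
      (x + (s + e) ⊙ i) * (F (x - (s + e) ⊙ i + P.coreflection i τ) - F (x - (s + e) ⊙ i)) := by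
      refine sum_bij' (fun τ _ => P.coreflection i τ) (fun τ _ => P.coreflection i τ) hrefl hrefl
        (fun τ _ => P.coreflection_same i τ) (fun τ _ => P.coreflection_same i τ) fun τ hτ => ?_
      rw [← macCoeff_symm hk hx (P.coreflection i τ), P.coreflection_same]
    rw [opD, opD, h1]
    simp only [hB, mul_sub, sum_sub_distrib]
    ring
  have hF0 : F (x + (s : ℂ) ⊙ i) = F (x - (s : ℂ) ⊙ i) := hax i s (mem_Icc.2 hs) x hx
  have hlimp : ∀ τ, Tendsto (fun e : ℂ => F (x + (s + e) ⊙ i + τ)) (𝓝[≠] 0)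
    (𝓝 (F (x + (s : ℂ) ⊙ i + τ))) := fun τ => by
    convert tendsto_line hF (x + (s : ℂ) ⊙ i + τ) ((1 / 2 : ℂ) • P.coroot i) using 3; module
  have hlimm : ∀ τ, Tendsto (fun e : ℂ => F (x - (s + e) ⊙ i + τ)) (𝓝[≠] 0)
    (𝓝 (F (x - (s : ℂ) ⊙ i + τ))) := fun τ => by
    convert tendsto_line hF (x - (s : ℂ) ⊙ i + τ) ((-1 / 2 : ℂ) • P.coroot i) using 3; module
  have hlimp0 := hlimp 0
  have hlimm0 := hlimm 0
  simp only [add_zero] at hlimp0 hlimm0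
  have hBlim : ∀ τ, Tendsto (B τ) (𝓝[≠] 0)
    (𝓝 (F (x + (s : ℂ) ⊙ i + τ) - F (x - (s : ℂ) ⊙ i + P.coreflection i τ))) := fun τ => by
    have := ((hlimp τ).sub hlimp0).sub ((hlimm (P.coreflection i τ)).sub hlimm0)
    rw [hF0] at this
    convert this using 2
    ring
  have hpt : ∀ e : ℂ, x + (s + e) ⊙ i = x + (s : ℂ) ⊙ i + e ⊙ i := fun e => by module
  have hterm : ∀ τ ∈ O, Tendsto (fun e : ℂ => macCoeff P L k τ (x + (s + e) ⊙ i) * B τ e) (𝓝[≠] 0)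
    (𝓝 0) := fun τ hτ => by
    obtain ⟨n, hsm, hn, -⟩ := hO.small τ hτ i
    by_cases h2 : n = -2 ∧ s = 1
    · obtain ⟨rfl, rfl⟩ := h2
      have hτ' := hO.eq_neg_coroot hτ hn rfl
      obtain ⟨r, hr⟩ := exists_tendsto_pfac_two hL (m i)
      set H : ℂ → ℂ := fun e => F (x + (-1 + e) ⊙ i) - F (x + (1 - e) ⊙ i) with hH
      have hBH : ∀ e, B τ e = H e + H (-e) := fun e => by
        have e1 : x + ((1 : ℕ) + e) ⊙ i + τ = x + (-1 + e) ⊙ i := by rw [hτ']; module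
        have e2 : x - ((1 : ℕ) + e) ⊙ i + P.coreflection i τ = x + (1 - e) ⊙ i := by
          rw [hτ', map_neg, P.coreflection_apply_self]; module
        have e3 : x - ((1 : ℕ) + e) ⊙ i = x + (-1 + -e) ⊙ i := by module
        grind
      have hHd : Differentiable ℂ H := by
        have h1 := differentiable_line P L hF x (P.coroot i)
        exact (h1.comp (by fun_prop : Differentiable ℂ fun e : ℂ => (-1 + e) / 2)).sub
          (h1.comp (by fun_prop : Differentiable ℂ fun e : ℂ => (1 - e) / 2))
      have hB0 : B τ 0 = 0 := by
        have := hF0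
        rw [hBH, hH]
        simp only [neg_zero, add_zero, sub_zero]
        rw [Nat.cast_one, sub_eq_add_neg, ← neg_smul, ← neg_div] at this
        rw [this]; ring
      have hderiv : HasDerivAt (B τ) 0 0 := by
        have h1 : HasDerivAt (fun e => H e + H (-e)) (deriv H 0 + deriv H (-0) * (-1)) 0 :=
          (hHd 0).hasDerivAt.add ((hHd (-0)).hasDerivAt.comp 0 (hasDerivAt_neg 0))
        rw [show B τ = fun e => H e + H (-e) from funext hBH]
        convert h1 using 1
        ring
      have hq : HasDerivAt (fun e : ℂ => qpow L (2 * -e) - 1) (-2 * L) 0 := by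
        unfold qpow
        have := ((((hasDerivAt_neg (0 : ℂ)).const_mul 2).mul_const L).cexp).sub_const 1
        simpa using this
      have hdiv : Tendsto (fun e => B τ e / (qpow L (2 * -e) - 1)) (𝓝[≠] 0) (𝓝 (0 / (-2 * L))) := by
        have h1 := hasDerivAt_iff_tendsto_slope_zero.1 hderiv
        have h2 := hasDerivAt_iff_tendsto_slope_zero.1 hq
        have h3 := h1.div h2 (by simp [hL.ne_zero])
        refine h3.congr' ?_
        filter_upwards [self_mem_nhdsWithin] with e he
        simp only [zero_add, Pi.div_apply, hB0, sub_zero, neg_zero, mul_zero, qpow_zero, sub_self,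
          smul_eq_mul]
        rw [mul_div_mul_left _ _ (inv_ne_zero he)]
      have h4 := ((hr.comp tendsto_neg_zero).mul (tendsto_restCoeff P L k i τ
        (x + ((1 : ℕ) : ℂ) ⊙ i) ((1 / 2 : ℂ) • P.coroot i) hg)).mul hdiv
      rw [zero_div, mul_zero] at h4
      refine h4.congr' ?_
      filter_upwards [tendsto_neg_zero.eventually (ev_qpow_ne_one hL.ne_zero 0
        one_ne_zero)] with e he
      rw [hpt, macCoeff_line hk hx', hn, comp_apply]
      have e5 : pfac L (k i) ((-2 : ℤ) : ℂ) (((1 : ℕ) : ℤ) + e) = pfac L (-(m i)) (2 : ℤ)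
        ((-1 : ℤ) + -e) := by
        rw [← pfac_neg]; congr 1
        · ring
        · ring
      grind
    · obtain ⟨A, hA, hA0⟩ := tendsto_macCoeff hL hm hO hx' hg hn hsm (by omega)
        (fun _ => by omega) (fun h h' => h2 ⟨h, by omega⟩)
      have h3 := hA.mul (hBlim τ)
      have h4 : A * (F (x + (s : ℂ) ⊙ i + τ) - F (x - (s : ℂ) ⊙ i + P.coreflection i τ)) = 0 := by
        rcases le_or_gt |(s : ℤ) + n| (m i : ℤ) with h | h
        · have := hax.shift hx (s := s) hn h
          grind [cast_natCast]
        · grind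
      grind
  have hC := (hlimp0.sub hlimm0).const_mul C
  have := (tendsto_finsetSum O hterm).add hC
  grind [sum_const_zero]

end Operator

/-! ### Invariance of spaces of axial functions -/

variable (P)

/-- Multiplication by `φ` preserves the exponential sums with exponents in `G`. -/
def MulPres (L : ℂ) (G : Set M) (φ : N → ℂ) : Prop :=
  ∀ F ∈ expSpace P L G, (fun x => φ x * F x) ∈ expSpace P L G

variable {P}

lemma MulPres.mul {G : Set M} {φ χ : N → ℂ}
    (hφ : MulPres P L G φ) (hχ : MulPres P L G χ) : MulPres P L G fun x => φ x * χ x :=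
  fun F hF => by simpa only [mul_assoc] using hφ _ (hχ F hF)

lemma MulPres.prod {G : Set M} {κ : Type*} (J : Finset κ) {φ : κ → N → ℂ} (hφ : ∀ j ∈ J,
    MulPres P L G (φ j)) : MulPres P L G fun x => ∏ j ∈ J, φ j x := by
  induction J using Finset.induction_on with
  | empty => intro F hF; simpa using hF
  | insert j J hj ih =>
    simp_all [mul]

variable (P)

lemma mulPres_affine (L : ℂ) {G : Set M}
    (hG : ∀ i, ∀ μ ∈ G, ∀ n : ℤ, μ + n • P.root i ∈ G) (i : ι) (c k d : ℂ) :
    MulPres P L G fun x => c * qpow L (2 * (P.root' i x + k)) + d := fun F hF => by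
  have h1 := exp_mul_mem_expSpace P L (κ := P.root i) (G' := G) (fun μ hμ => by
    have := hG i μ hμ 1
    rwa [one_smul, add_comm] at this) hF
  convert add_mem (smul_mem _ (c * qpow L (2 * k)) h1) (smul_mem _ d hF) using 1
  grind [Pi.add_apply, Pi.smul_apply, smul_eq_mul, mul_add, qpow_add]

lemma exists_mulPres_hfac (L : ℂ) {G : Set M} (hG : ∀ i, ∀ μ ∈ G, ∀ n : ℤ, μ + n • P.root i ∈ G)
    (i : ι) (k n : ℂ) : ∃ φ, MulPres P L G φ ∧ ∀ x, brk L (P.root' i x) ≠ 0 → brk L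
    (1 + P.root' i x) ≠ 0 → φ x = hfac L k n (P.root' i x) *
    ((qpow L (2 * (P.root' i x + 0)) - 1) * (qpow L (2 * (P.root' i x + 1)) - 1)) := by
  have key : ∀ (c : Prop) [Decidable c] (e : ℂ), ∃ φ, MulPres P L G φ ∧ ∀ x, brk L
    (e + P.root' i x) ≠ 0 → φ x =
    (if c then brk L (k + e + P.root' i x) / brk L (e + P.root' i x) else 1) *
        (qpow L (2 * (P.root' i x + e)) - 1) := fun c _ e => by
    by_cases hc : c
    · refine ⟨_, mulPres_affine P L hG i (qpow L k) e (-qpow L (-k)), fun x hx => ?_⟩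
      rw [if_pos hc, add_comm (P.root' i x) e, qpow_sub_one_eq, brk]
      field_simp
      rw [sub_mul, ← qpow_add, ← qpow_add, ← qpow_add]
      ring_nf
    · refine ⟨_, mulPres_affine P L hG i 1 e (-1), fun x hx => ?_⟩
      rw [if_neg hc]; ring
  obtain ⟨φ, h1, h2⟩ := key (0 < n.re) 0
  obtain ⟨χ, h3, h4⟩ := key (n = 2) 1
  refine ⟨_, h1.mul h3, fun x hx hx' => ?_⟩
  rw [h2 x (by rwa [zero_add]), h4 x hx', hfac]
  grind

section Operator

variable {O : Finset N}

variable {P}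

lemma exists_numerator {G : Set M} (hG : ∀ i, ∀ μ ∈ G, ∀ n : ℤ, μ + n • P.root i ∈ G) (k : ι → ℂ)
    (C : ℂ) {F : N → ℂ} (hF : F ∈ expSpace P L G) : ∃ F' ∈ expSpace P L G, ∀ x, IsRegularPt P L x →
    F' x = opD P L k O C F x * ∏ j : ι, ((ε (P.root' j x + 0) - 1) * (ε (P.root' j x + 1) - 1)) :=
    by
  choose φ h1 h2 using fun (τ : N) (i : ι) => exists_mulPres_hfac P L hG i (k i) (P.root' i τ)
  have hE : MulPres P L G fun x => ∏ j : ι,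
    ((ε (P.root' j x + 0) - 1) * (ε (P.root' j x + 1) - 1)) := by
    refine MulPres.prod _ fun j _ => MulPres.mul ?_ ?_
    · simpa [sub_eq_add_neg] using mulPres_affine P L hG j 1 0 (-1)
    · simpa [sub_eq_add_neg] using mulPres_affine P L hG j 1 1 (-1)
  refine ⟨∑ τ ∈ O, (fun x => (∏ i, φ τ i x) * (F (x + τ) - F x)) +
    C • fun x => (∏ j : ι, ((ε (P.root' j x + 0) - 1) *
        (ε (P.root' j x + 1) - 1))) * F x, ?_, fun x hx => ?_⟩
  · refine add_mem (sum_mem fun τ _ => ?_) (smul_mem _ _ (hE F hF))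
    exact MulPres.prod univ (fun i _ => h1 τ i) _ (sub_mem (translate_mem_expSpace P L τ hF) hF)
  · rw [opD, add_mul, sum_mul]
    simp only [Pi.add_apply, Finset.sum_apply, Pi.smul_apply, smul_eq_mul]
    congr 1
    · refine sum_congr rfl fun τ _ => ?_
      rw [macCoeff_eq_prod, mul_right_comm, ← prod_mul_distrib]
      congr 1
      exact prod_congr rfl fun i _ => h2 τ i x (hx i).1 (hx i).2
    · ring

lemma eventually_regular (hL : NonRoot L) {i : ι} {x : N} (hg : GenAt P L i x) :
    ∀ᶠ e : ℂ in 𝓝[≠] 0, IsRegularPt P L (x + e ⊙ i) := by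
  have hev : ∀ c : ℂ, ∀ᶠ e : ℂ in 𝓝[≠] 0, brk L (c + e) ≠ 0 ∧ brk L (c + -e) ≠ 0 := fun c =>
    (eventually_brk_ne hL.ne_zero c).and
      (tendsto_neg_zero.eventually (eventually_brk_ne hL.ne_zero c))
  unfold IsRegularPt
  rw [eventually_all]
  intro j
  by_cases h1 : P.root j = P.root i
  · filter_upwards [hev (P.root' i x), hev (1 + P.root' i x)] with e h2 h3
    grind [root'_line]
  by_cases h2 : P.root j = -P.root i
  · rw [← root_neg] at h2
    filter_upwards [hev (-P.root' i x), hev (1 + -P.root' i x)] with e h2 h3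
    grind [root'_neg, root'_line]
  · obtain ⟨h3, h4⟩ := hg j h1 h2
    have c1 : Continuous fun e : ℂ => brk L (P.root' j (x + e ⊙ i)) := by
      simp only [map_add, map_smul, smul_eq_mul, brk, qpow]; fun_prop
    have c2 : Continuous fun e : ℂ => brk L (1 + P.root' j (x + e ⊙ i)) := by
      simp only [map_add, map_smul, smul_eq_mul, brk, qpow]; fun_prop
    refine Filter.Eventually.filter_mono nhdsWithin_le_nhds ?_
    exact (c1.continuousAt.eventually_ne (by simpa using h3)).and
      (c2.continuousAt.eventually_ne (by simpa using h4))

lemma eventually_genAt (hL : NonRoot L) {i : ι} {v : N}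
    (hv : ∀ j, P.root j ≠ P.root i → P.root j ≠ -P.root i → P.root' j v ≠ 0) (x : N) :
    ∀ᶠ t : ℂ in 𝓝[≠] 0, GenAt P L i (x + t • v) := by
  unfold GenAt
  rw [eventually_all]
  intro j
  by_cases h1 : P.root j = P.root i
  · simp [h1]
  by_cases h2 : P.root j = -P.root i
  · simp [h2]
  filter_upwards [ev_qpow_ne_one hL.ne_zero (P.root' j x) (hv j h1 h2),
    ev_qpow_ne_one hL.ne_zero (1 + P.root' j x) (hv j h1 h2)] with t h3 h4 _ _
  rw [Ne, brk_eq_zero, Ne, brk_eq_zero, map_add, map_smul, smul_eq_mul]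
  grind

lemma exists_opD (hL : NonRoot L) (hm : WInv P m) (hO : SmallSet P O) {G : Set M} (hG : ∀ i,
    ∀ μ ∈ G, ∀ n : ℤ, μ + n • P.root i ∈ G) (C : ℂ) {F : N → ℂ} (hF : F ∈ expSpace P L G)
    (hax : FunAxial P L m F) : ∃ g ∈ expSpace P L G, (∀ x, IsRegularPt P L x →
    g x = opD P L m⁻ O C F x) ∧ FunAxial P L m g := by
  set k : ι → ℂ := fun i => -(m i : ℂ)
  let kk : ι × Bool → ℂ := fun j => if j.2 then 1 else 0
  have hreg : ∀ x, (∀ j ∈ (univ : Finset (ι × Bool)), ε (P.root' j.1 x + kk j) ≠ 1) ↔ IsRegularPt P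
    L x := fun x => by
    constructor
    · intro h i
      rw [Ne, brk_eq_zero, Ne, brk_eq_zero, add_comm 1]
      exact ⟨by simpa [kk] using h (i, false) (mem_univ _),
        by simpa [kk] using h (i, true) (mem_univ _)⟩
    · rintro h ⟨i, c⟩ -
      obtain ⟨h1, h2⟩ := h i
      rw [Ne, brk_eq_zero] at h1 h2
      grind
  have hprod : ∀ x, ∏ j : ι × Bool, (ε (P.root' j.1 x + kk j) - 1) = ∏ j : ι,
    ((ε (P.root' j x + 0) - 1) * (ε (P.root' j x + 1) - 1)) := fun x => by
    rw [Fintype.prod_prod_type]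
    refine prod_congr rfl fun i _ => ?_
    rw [Fintype.prod_bool, mul_comm]; simp [kk]
  obtain ⟨F', hF', hF'e⟩ := exists_numerator (O := O) hG k C hF
  obtain ⟨g, hg, hge⟩ := exists_expSpace_eq_of_tendsto P hL.ne_zero
    (univ : Finset (ι × Bool)) Prod.fst kk hG hF' (u := opD P L k O C F)
    (fun x hx => by rw [hprod]; exact hF'e x ((hreg x).1 hx))
    (fun j _ x hx hx' => by
      have hgen : GenAt P L j.1 x := fun j' h1 h2 => by
        rw [Ne, brk_eq_zero, Ne, brk_eq_zero, add_comm 1]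
        exact ⟨by simpa [kk] using hx' (j', false) (mem_univ _) h1 h2,
          by simpa [kk] using hx' (j', true) (mem_univ _) h1 h2⟩
      have h3 : Tendsto (fun e : ℂ => (ε e - 1) * opD P L k O C F (x + e ⊙ j.1)) (𝓝[≠] 0) (𝓝 0) :=
        by
        obtain ⟨j, c⟩ := j
        cases c
        · exact tendsto_opD_pole_zero hL hm hO hF hax C (by simpa [kk] using hx) hgen
        · exact tendsto_opD_pole_one hL hm hO hF hax C (by simpa [kk] using hx) hgen
      refine (h3.comp (tendsto_mul_punctured two_ne_zero)).congr fun t => ?_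
      have e1 : 2 * t / 2 = t := by ring
      rw [comp_apply, e1]
      congr 2
      rw [map_add, map_smul, P.root'_coroot_eq_pairing, P.pairing_same, smul_eq_mul,
        show 2 * (P.root' j.1 x + t * 2 + kk j) = 2 * (P.root' j.1 x + kk j) + 2 * (2 * t) by ring,
        qpow_add, hx, one_mul])
  have hge' : ∀ x, IsRegularPt P L x → g x = opD P L k O C F x := fun x hx => hge x ((hreg x).2 hx)
  refine ⟨g, hg, hge', fun i s hs x hx => ?_⟩
  have hgen : ∀ x, ε (P.root' i x) = 1 → GenAt P L i (x + (s : ℂ) ⊙ i) → GenAt P L i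
    (x - (s : ℂ) ⊙ i) → g (x + (s : ℂ) ⊙ i) = g (x - (s : ℂ) ⊙ i) := fun x hx h1 h2 => by
    rw [← sub_eq_zero]
    have l1 := tendsto_opD_sub hL hm hO hF hax C hx hs h1
    have l2 := (tendsto_line_half hg (x + (s : ℂ) ⊙ i) (P.coroot i)).sub
      ((tendsto_line_half hg (x - (s : ℂ) ⊙ i) (P.coroot i)).comp tendsto_neg_zero)
    refine tendsto_nhds_unique l2 (l1.congr' ?_)
    filter_upwards [eventually_regular hL h1,
      tendsto_neg_zero.eventually (eventually_regular hL h2)] with e h3 h4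
    rw [comp_apply, hge' _ h3, hge' _ h4]
    congr 2
    · module
    · module
  obtain ⟨v, hv, hv'⟩ := exists_transversal P i
  refine tendsto_nhds_unique (tendsto_line hg (x + (s : ℂ) ⊙ i) v)
    ((tendsto_line hg (x - (s : ℂ) ⊙ i) v).congr' ?_)
  filter_upwards [eventually_genAt hL hv' (x + (s : ℂ) ⊙ i),
    eventually_genAt hL hv' (x - (s : ℂ) ⊙ i)] with t h1 h2
  have := hgen (x + t • v) (by simpa [hv] using hx) (by rwa [add_right_comm])
    (by rwa [add_sub_right_comm])
  rw [add_right_comm, add_sub_right_comm] at this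
  exact this.symm

/-! ### Leading coefficients -/

lemma tendsto_brk_ratio (hL : L ≠ 0) (k a : ℂ) {r : ℝ} (hr : r ≠ 0) : Tendsto
    (fun t : ℝ => brk L (k + (a + (t : ℂ) / L * r)) / brk L (a + (t : ℂ) / L * r)) atTop
    (𝓝 (qpow L (if 0 < r then k else -k))) ∧
      ∀ᶠ t : ℝ in atTop, brk L (a + (t : ℂ) / L * r) ≠ 0 := by
  have hq : ∀ (c : ℂ) (t : ℝ), qpow L (c + (t : ℂ) / L * r) = qpow L c * (Real.exp (t * r) : ℝ) := by
    intro c t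
    rw [qpow_add]; congr 1
    rw [qpow, ofReal_exp]; congr 1
    push_cast; field_simp
  have hqn : ∀ (c : ℂ) (t : ℝ), qpow L (-(c + (t : ℂ) / L * r)) = qpow L (-c) *
    (Real.exp (-(t * r)) : ℝ) := fun c t => by
    rw [qpow_neg, hq, mul_inv, qpow_neg, Real.exp_neg, Complex.ofReal_inv]
  have key : ∀ (s : ℝ), 0 < s → ∀ c : ℂ, Tendsto (fun t : ℝ => qpow L c -
      qpow L (-c) * ((Real.exp (-(2 * t * s)) : ℝ) : ℂ)) atTop (𝓝 (qpow L c)) := fun s hs c => by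
    have h1 : Tendsto (fun t : ℝ => Real.exp (-(2 * t * s))) atTop (𝓝 0) := by
      refine Real.tendsto_exp_atBot.comp (tendsto_neg_atTop_atBot.comp ?_)
      exact (tendsto_id.const_mul_atTop two_pos).atTop_mul_const hs
    have h2 := ((continuous_ofReal.tendsto 0).comp h1).const_mul (qpow L (-c))
    have h3 := h2.const_sub (qpow L c)
    simpa using h3
  have hb : ∀ c : ℂ, ∀ t : ℝ, 0 < r → brk L (c + (t : ℂ) / L * r) = (Real.exp (t * r) : ℝ) *
    (qpow L c - qpow L (-c) * ((Real.exp (-(2 * t * r)) : ℝ) : ℂ)) := fun c t _ => by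
    rw [brk, hq, hqn, mul_sub]
    have : (Real.exp (-(t * r)) : ℝ) = Real.exp (t * r) * Real.exp (-(2 * t * r)) := by
      rw [← Real.exp_add]; ring_nf
    rw [this]; push_cast; ring
  have hb' : ∀ c : ℂ, ∀ t : ℝ, r < 0 → brk L (c + (t : ℂ) / L * r) = -(Real.exp (-(t * r)) : ℝ) *
    (qpow L (-c) - qpow L (- -c) * ((Real.exp (-(2 * t * (-r))) : ℝ) : ℂ)) := fun c t _ => by
    rw [brk, hq, hqn, mul_sub]
    have : (Real.exp (t * r) : ℝ) = Real.exp (-(t * r)) * Real.exp (-(2 * t * (-r))) := by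
      rw [← Real.exp_add]; ring_nf
    rw [this, neg_neg]; push_cast; ring
  have hne : ∀ x : ℝ, ((Real.exp x : ℝ) : ℂ) ≠ 0 := fun x => by exact_mod_cast (exp_pos x).ne'
  rcases lt_or_gt_of_ne hr with h | h
  · rw [if_neg (not_lt.2 h.le)]
    refine ⟨?_, ?_⟩
    · have h1 := (key (-r) (neg_pos.2 h) (-(k + a))).div (key (-r) (neg_pos.2 h) (-a))
        (qpow_ne_zero _ _)
      rw [← qpow_sub, show -(k + a) - -a = -k by ring] at h1
      refine h1.congr fun t => ?_
      rw [← add_assoc, hb' _ t h, hb' _ t h, mul_div_mul_left _ _ (neg_ne_zero.2 (hne _))]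
      rfl
    · filter_upwards [(key (-r) (neg_pos.2 h) (-a)).eventually_ne (qpow_ne_zero _ _)] with t ht
      grind
  · rw [if_pos h]
    refine ⟨?_, ?_⟩
    · have h1 := (key r h (k + a)).div (key r h a) (qpow_ne_zero _ _)
      rw [← qpow_sub, show (k + a) - a = k by ring] at h1
      refine h1.congr fun t => ?_
      rw [← add_assoc, hb _ t h, hb _ t h, mul_div_mul_left _ _ (hne _)]
      rfl
    · filter_upwards [(key r h a).eventually_ne (qpow_ne_zero _ _)] with t ht
      grind

lemma tendsto_macCoeff_ray (b : P.Base) (hL : L ≠ 0) {k : ι → ℂ} (hk : WInv P k)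
    (hO : SmallSet P O) {τ : N} (hτ : τ ∈ O) {y : N} (hy : RegDom b y) (x : N) : Tendsto
    (fun t : ℝ => macCoeff P L k τ (x + ((t : ℂ) / L) • y)) atTop (𝓝 (ε (P.1 (rho b k) τ))) := by
  choose r hr using hy.root'_real b
  have hrpos : ∀ i, b.IsPos i ↔ 0 < r i := by
    have h1 : ∀ i, b.IsPos i → 0 < r i := fun i hi => by
      obtain ⟨s, hs, hs'⟩ := hy.root'_pos b hi
      rw [hr] at hs'
      have : r i = s := by exact_mod_cast hs'
      rwa [this]
    intro i
    refine ⟨h1 i, fun h => ?_⟩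
    by_contra hn
    have h2 := h1 _ ((isPos_neg_iff b i).2 hn)
    have h3 := hr (ς i i)
    rw [root'_neg, hr] at h3
    have : -r i = r (ς i i) := by exact_mod_cast h3
    linarith
  have hr0 : ∀ i, r i ≠ 0 := fun i h => by
    rcases pos_or_neg b i with hi | hi
    · grind
    · have h2 := (hrpos _).1 hi
      have h3 := hr (ς i i)
      rw [root'_neg, hr, h] at h3
      have : -(0 : ℝ) = r (ς i i) := by exact_mod_cast h3
      linarith
  choose n hnS hn hn2 using hO.small τ hτ
  have hfac_lim : ∀ i, Tendsto
    (fun t : ℝ => hfac L (k i) (P.root' i τ) (P.root' i (x + ((t : ℂ) / L) • y))) atTop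
    (𝓝 (qpow L (if b.IsPos i then max (n i) 0 * k i else max (n i) 0 * -k i))) := fun i => by
    have hl : ∀ t : ℝ, P.root' i (x + ((t : ℂ) / L) • y) = P.root' i x + (t : ℂ) / L * r i := by simp_all
    simp only [hl, hn]
    have hneg : n i ≤ 0 → Tendsto (fun t : ℝ => hfac L (k i) (n i) (P.root' i x + (t : ℂ) / L * r i))
        atTop (𝓝 (qpow L (if b.IsPos i then max (n i) 0 * k i else max (n i) 0 * -k i))) := by
      intro h
      simp only [hfac_of_nonpos L _ _ h, max_eq_right h, Int.cast_zero, zero_mul, ite_self, qpow_zero]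
      exact tendsto_const_nhds
    have h1 := (tendsto_brk_ratio hL (k i) (P.root' i x) (hr0 i)).1
    have h2 := (tendsto_brk_ratio hL (k i) (1 + P.root' i x) (hr0 i)).1
    rcases hnS i with h | h | h | h | h
    · exact hneg (by omega)
    · exact hneg (by omega)
    · exact hneg (by omega)
    · simp only [h, hfac_one]
      simp_all
    · simp only [h, hfac_two]
      have h3 := h1.mul h2
      rw [← qpow_add] at h3
      have e1 : (if b.IsPos i then ((max 2 0 : ℤ) : ℂ) * k i else ((max 2 0 : ℤ) : ℂ) * -k i) =
          (if 0 < r i then k i else -k i) + if 0 < r i then k i else -k i := by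
        simp only [hrpos]
        split_ifs <;> norm_num <;> ring
      grind
  simp only [macCoeff_eq_prod]
  have hl := tendsto_finsetProd univ fun i _ => hfac_lim i
  rw [← qpow_sum] at hl
  have hsum : ∑ i, (if b.IsPos i then (max (n i) 0 : ℤ) * k i else (max (n i) 0 : ℤ) * -k i) =
      2 * P.1 (rho b k) τ := by
    rw [pair_rho, ← mul_assoc, mul_one_div_cancel two_ne_zero, one_mul, sum_eq_sum_posRoots b]
    refine sum_congr rfl fun i hi => ?_
    have hi' := mem_posRoots.1 hi
    have h2 := hn (ς i i)
    rw [root'_neg, hn] at h2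
    have h3 : -n i = n (ς i i) := by exact_mod_cast h2
    rw [if_pos hi', if_neg ((isPos_neg_iff b i).not.2 (not_not.2 hi')), hk, ← h3, hn]
    have : (n i : ℂ) = ((max (n i) 0 - max (-n i) 0 : ℤ) : ℂ) := by simp
    rw [this]; push_cast; ring
  rwa [hsum] at hl

lemma eventually_regular_ray (b : P.Base) (hL : L ≠ 0) {y : N} (hy : RegDom b y) (x : N) : ∀ᶠ
    t : ℝ in atTop, IsRegularPt P L (x + ((t : ℂ) / L) • y) := by
  unfold IsRegularPt
  rw [eventually_all]
  intro i
  obtain ⟨r, hr⟩ := hy.root'_real b i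
  have hr0 : r ≠ 0 := by
    rintro rfl
    rcases pos_or_neg b i with hi | hi
    · obtain ⟨s, hs, hs'⟩ := hy.root'_pos b hi
      simp_all
    · obtain ⟨s, hs, hs'⟩ := hy.root'_pos b hi
      rw [root'_neg, hr] at hs'
      have : -(0 : ℝ) = s := by exact_mod_cast hs'
      linarith
  filter_upwards [(tendsto_brk_ratio hL 0 (P.root' i x) hr0).2,
    (tendsto_brk_ratio hL 0 (1 + P.root' i x) hr0).2] with t h1 h2
  rw [map_add, map_smul, hr, smul_eq_mul, ← add_assoc]
  exact ⟨h1, h2⟩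

variable (P)

lemma tendsto_expSum_ray (hL : L ≠ 0) {y : N} {μ₀ : M} {f : M →₀ ℂ} (hf : ∀ μ ∈ f.support,
    ∃ r : ℝ, P.1 (μ - μ₀) y = r) {d : ℝ} (hd : ∀ μ ∈ f.support, (P.1 (μ - μ₀) y).re ≤ d)
    (x : N) : Tendsto (fun t : ℝ => exp (-(2 * t * (P.1 μ₀ y + d))) * 𝓔 f (x + ((t : ℂ) / L) • y))
    atTop (𝓝 (𝓔 (f.filter fun μ => (P.1 (μ - μ₀) y).re = d) x)) := by
  set top : M →₀ ℂ := f.filter fun μ => (P.1 (μ - μ₀) y).re = d with htop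
  have hre : ∀ μ ∈ f.support, P.1 μ y = P.1 μ₀ y + ((P.1 (μ - μ₀) y).re : ℂ) := fun μ hμ => by
    obtain ⟨r, h1⟩ := hf μ hμ
    rw [h1, ofReal_re, ← h1]; simp
  have h2 : ∀ t : ℝ, exp (-(2 * t * (P.1 μ₀ y + d))) * 𝓔 f (x + ((t : ℂ) / L) • y) =
    ∑ μ ∈ f.support, f μ * ε (P.1 μ x) * (Real.exp (2 * t * ((P.1 (μ - μ₀) y).re - d)) : ℝ) :=
    fun t => by
    rw [expSum_subset P L f _ subset_rfl, mul_sum]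
    refine sum_congr rfl fun μ hμ => ?_
    rw [qpow_ray P hL, hre μ hμ, ofReal_exp]
    push_cast
    have : exp (2 * t * (((P.1 (μ - μ₀) y).re : ℂ) - d)) = exp (-(2 * t * (P.1 μ₀ y + d))) * exp
      (2 * t * (P.1 μ₀ y + ((P.1 (μ - μ₀) y).re : ℂ))) := by
      rw [← Complex.exp_add]; congr 1; ring
    rw [this]; ring
  simp_rw [h2]
  have h3 : 𝓔 top x = ∑ μ ∈ f.support, f μ * ε (P.1 μ x) *
    ((if (P.1 (μ - μ₀) y).re = d then 1 else 0 : ℝ) : ℂ) := by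
    rw [expSum_subset P L top x (S := f.support)
      (by rw [htop, support_filter]; exact filter_subset _ _)]
    refine sum_congr rfl fun μ _ => ?_
    rw [htop, filter_apply]
    split_ifs <;> simp
  rw [h3]
  refine tendsto_finsetSum _ fun μ hμ => Tendsto.const_mul _ ?_
  refine (continuous_ofReal.tendsto _).comp ?_
  split_ifs with heq
  · rw [heq]; simp
  · have hlt : (P.1 (μ - μ₀) y).re - d < 0 := sub_neg.2 (lt_of_le_of_ne (hd μ hμ) heq)
    refine Real.tendsto_exp_atBot.comp ?_
    exact Tendsto.atTop_mul_const_of_neg hlt (tendsto_id.const_mul_atTop two_pos)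

variable {P}

lemma opD_leading (b : P.Base) (hL : L ≠ 0) {k : ι → ℂ} (hk : WInv P k) (hO : SmallSet P O)
    (C : ℂ) {y : N} (hy : RegDom b y) {μ₀ : M} {f h : M →₀ ℂ} (hf : ∀ μ ∈ f.support, ∃ r : ℝ,
    P.1 (μ - μ₀) y = r) (hh : ∀ μ ∈ h.support, ∃ r : ℝ, P.1 (μ - μ₀) y = r) (hfh : ∀ x,
    IsRegularPt P L x → 𝓔 h x = opD P L k O C (𝓔 f) x) {d : ℝ} (hd : ∀ μ ∈ f.support,
    (P.1 (μ - μ₀) y).re ≤ d) {μ : M} (hμ : d ≤ (P.1 (μ - μ₀) y).re) : h μ = f μ * (∑ τ ∈ O,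
    ε (P.1 (μ + rho b k) τ) - ∑ τ ∈ O, ε (P.1 (rho b k) τ) + C) := by
  set top : M →₀ ℂ := f.filter fun μ => (P.1 (μ - μ₀) y).re = d with htop
  have hF := tendsto_expSum_ray P hL hf hd
  set E : M → ℂ := fun μ => ∑ τ ∈ O, ε (P.1 (μ + rho b k) τ) - ∑ τ ∈ O, ε (P.1 (rho b k) τ) + C with
    hE
  have htopE : ∀ x, 𝓔 (reweight E top) x = ∑ τ ∈ O, ε (P.1 (rho b k) τ) *
    (𝓔 top (x + τ) - 𝓔 top x) + C * 𝓔 top x := fun x => by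
    rw [expSum_reweight, expSum_subset P L top x subset_rfl]
    simp only [expSum_subset P L top _ subset_rfl, mul_sum, ← sum_sub_distrib]
    rw [sum_comm, ← sum_add_distrib]
    refine sum_congr rfl fun μ _ => ?_
    have e1 : ∀ τ ∈ O, ε (P.1 (rho b k) τ) * (top μ * ε (P.1 μ (x + τ)) - top μ * ε (P.1 μ x)) =
      (top μ * ε (P.1 μ x)) * (ε (P.1 (μ + rho b k) τ) - ε (P.1 (rho b k) τ)) := fun τ _ => by
      rw [qpow_pair_add, qpow_add_pair]; ring
    rw [sum_congr rfl e1, ← mul_sum, sum_sub_distrib, hE]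
    ring
  have hlim : ∀ x, Tendsto (fun t : ℝ => exp (-(2 * t * (P.1 μ₀ y + d))) *
      𝓔 (h - reweight E top) (x + ((t : ℂ) / L) • y)) atTop (𝓝 0) := fun x => by
    have h1 : Tendsto
      (fun t : ℝ => exp (-(2 * t * (P.1 μ₀ y + d))) * opD P L k O C (𝓔 f) (x + ((t : ℂ) / L) • y))
      atTop (𝓝 (𝓔 (reweight E top) x)) := by
      rw [htopE]
      have h2 := (tendsto_finsetSum O fun τ hτ => (tendsto_macCoeff_ray b hL hk hO hτ hy x).mul
        ((hF (x + τ)).sub (hF x))).add ((hF x).const_mul C)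
      refine h2.congr fun t => ?_
      rw [opD, mul_add (exp _) (∑ τ ∈ O, _) _, mul_sum]
      congr 1
      · grind
      · ring
    have h3 : Tendsto
      (fun t : ℝ => exp (-(2 * t * (P.1 μ₀ y + d))) * 𝓔 (reweight E top) (x + ((t : ℂ) / L) • y))
      atTop (𝓝 (𝓔 (reweight E top) x)) := by
      have h2 : ∀ t : ℝ, exp (-(2 * t * (P.1 μ₀ y + d))) * 𝓔 (reweight E top)
        (x + ((t : ℂ) / L) • y) = 𝓔 (reweight E top) x := fun t => by
        rw [expSum_reweight, expSum_reweight, mul_sum]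
        refine sum_congr rfl fun μ hμ => ?_
        rw [htop, support_filter, mem_filter] at hμ
        obtain ⟨r, hr⟩ := hf μ hμ.1
        have hd' := hμ.2
        rw [hr, ofReal_re] at hd'
        rw [map_sub₂, sub_eq_iff_eq_add', hd'] at hr
        rw [qpow_ray P hL, hr]
        have := exp_ne_zero (2 * t * (P.1 μ₀ y + d))
        rw [Complex.exp_neg]
        field_simp
      exact tendsto_const_nhds.congr fun t => (h2 t).symm
    have h4 := h1.sub h3
    rw [sub_self] at h4
    refine h4.congr' ?_
    filter_upwards [eventually_regular_ray b hL hy x] with t ht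
    rw [map_sub, Pi.sub_apply, hfh _ ht]; ring
  have hlow := re_lt_of_tendsto_ray P hL y μ₀ (h - reweight E top) (fun κ hκ => by
    rcases mem_union.1 (support_sub hκ) with h1 | h1
    · exact hh κ h1
    · refine hf κ ?_
      have := support_reweight_subset _ _ h1
      rw [htop, support_filter] at this
      exact (mem_filter.1 this).1) d hlim
  have h0 : (h - reweight E top) μ = 0 := by grind
  rw [Finsupp.sub_apply, reweight_apply, sub_eq_zero] at h0
  rw [h0, htop, filter_apply]
  grind

end Operator

variable {P}

/-! ### Orbits of (quasi)minuscule coweights -/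

section Orbit

variable (P)

noncomputable instance : Fintype (Weyl P) := Fintype.ofFinite _

/-- The Weyl orbit of a coweight. -/
noncomputable def orbitF (π : N) : Finset N := univ.image fun w : Weyl P => w.1.2.1 π

variable {P}

lemma mem_orbitF {π τ : N} : τ ∈ orbitF P π ↔ ∃ w : Weyl P, w.1.2.1 π = τ := by simp [orbitF]

lemma coe_orbitF (π : N) : (orbitF P π : Set N) = MulAction.orbit (weylN P) π := by
  ext τ
  simp [mem_orbitF, mem_orbitN_iff, eq_comm]

lemma finsum_orbit {A : Type*} [AddCommMonoid A] (π : N) (F : N → A) :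
    ∑ᶠ τ ∈ MulAction.orbit (weylN P) π, F τ = ∑ τ ∈ orbitF P π, F τ := by
  rw [← coe_orbitF, finsum_mem_coe_finset]

lemma weyl_mem_orbitF {π τ : N} (h : τ ∈ orbitF P π) (w : Weyl P) : w.1.2.1 τ ∈ orbitF P π := by
  obtain ⟨v, rfl⟩ := mem_orbitF.1 h
  exact mem_orbitF.2 ⟨w * v, rfl⟩

lemma self_mem_orbitF (π : N) : π ∈ orbitF P π := mem_orbitF.2 ⟨1, rfl⟩

lemma sum_weyl_invariant {O : Finset N} (hO : ∀ w : Weyl P, ∀ τ ∈ O, w.1.2.1 τ ∈ O) {A : Type*}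
    [AddCommMonoid A] (w : Weyl P) (F : N → A) : ∑ τ ∈ O, F (w.1.2.1 τ) = ∑ τ ∈ O, F τ := by
  refine sum_bij' (fun τ _ => w.1.2.1 τ) (fun τ _ => w⁻¹.1.2.1 τ) (fun τ h => hO w τ h)
    (fun τ h => hO w⁻¹ τ h) (fun τ _ => ?_) (fun τ _ => weyl_inv_applyN P w τ) fun _ _ => rfl
  simp

lemma smallSet_orbitF {π : N} (h : IsMinuscule P π ∨ IsQuasiminuscule P π) :
    SmallSet P (orbitF P π) where
  weyl w _ hτ := weyl_mem_orbitF hτ w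
  small := by
    have key : ∀ i, ∃ n : ℤ, IsSmall n ∧ P.root' i π = n ∧ (n = 2 → π = P.coroot i) := by
      have h3 : ∀ c : ℂ, c ∈ ({-1, 0, 1} : Set ℂ) → ∃ n : ℤ, IsSmall n ∧ c = n ∧ n ≠ 2 := by
        rintro c (rfl | rfl | rfl)
        · exact ⟨-1, by unfold IsSmall; omega, by simp, by norm_num⟩
        · exact ⟨0, by unfold IsSmall; omega, by simp, by norm_num⟩
        · exact ⟨1, by unfold IsSmall; omega, by simp, by norm_num⟩
      intro i
      rcases h with h | ⟨j, rfl, h⟩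
      · obtain ⟨n, h1, h2, h4⟩ := h3 _ (h i)
        grind
      · by_cases h1 : P.root i = P.root j
        · rw [P.root.injective h1]
          exact ⟨2, by unfold IsSmall; omega, by simp, fun _ => rfl⟩
        by_cases h2 : P.root i = -P.root j
        · rw [← root_neg] at h2
          rw [P.root.injective h2, root'_neg]
          exact ⟨-2, by unfold IsSmall; omega, by simp, by norm_num⟩
        grind
    intro τ hτ i
    obtain ⟨w, rfl⟩ := mem_orbitF.1 hτ
    obtain ⟨n, h1, h2, h4⟩ := key (w⁻¹.1.2.2 i)
    grind [root'_weyl_right, coroot_weyl, weyl_inv_apply]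

variable (P)

lemma exists_isQuasiminuscule [Nonempty ι] : ∃ j, IsQuasiminuscule P (P.coroot j) := by
  obtain ⟨j, hj⟩ := Finite.exists_max (P.posRootForm ℤ).rootLength
  refine ⟨j, j, rfl, fun i h1 h2 => ?_⟩
  by_contra h
  refine absurd ((P.posRootForm ℤ).rootLength_lt_of_pairingIn_notMem h1 h2 fun h3 => h ?_)
    (not_lt.2 (hj i))
  have h4 : P.root' i (P.coroot j) = ((P.pairingIn ℤ i j : ℤ) : ℂ) :=
    (P.algebraMap_pairingIn ℤ i j).symm
  simp_all

variable {P}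

lemma eq_zero_of_orbitF [P.IsIrreducible] {π : N} (hπ : π ≠ 0) {d : M}
    (h : ∀ τ ∈ orbitF P π, P.1 d τ = 0) : d = 0 := by
  have h1 : span ℂ (orbitF P π : Set N) = ⊤ := by
    refine RootPairing.IsIrreducible.eq_top_of_invtSubmodule_coreflection (P := P) _ (fun i => ?_)
      fun h0 => hπ ?_
    · rw [Module.End.mem_invtSubmodule, Submodule.span_le]
      exact fun τ hτ => subset_span (weyl_mem_orbitF hτ (reflTriple P i))
    · simp_all [self_mem_orbitF]
  refine pair_left_injective P (fun x => ?_)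
  have hx : x ∈ span ℂ (orbitF P π : Set N) := h1 ▸ Submodule.mem_top
  rw [map_zero₂]
  induction hx using span_induction with
  | mem τ hτ => exact h τ hτ
  | zero => simp
  | add x y _ _ hx hy => rw [map_add, hx, hy, add_zero]
  | smul c x _ hx => rw [map_smul, hx, smul_zero]

end Orbit

/-! ### Equivariance of the operators -/

section Operator

variable {O : Finset N}

variable (P)

lemma expSum_weyl (L : ℂ) (w : Weyl P) (f : M →₀ ℂ) (x : N) :
    expSum P L (f.mapDomain w.1.1) (w.1.2.1 x) = expSum P L f x := by
  rw [expSum_apply, Finsupp.sum_mapDomain_index_inj w.1.1.injective, expSum_apply]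
  simp only [pair_weyl]

variable {P}

lemma isRegularPt_weyl (w : Weyl P) {x : N} (h : IsRegularPt P L x) :
    IsRegularPt P L (w.1.2.1 x) := fun i => by
  rw [root'_weyl_right]; exact h _

lemma opD_weyl {k : ι → ℂ} (hk : WInv P k) (hO : SmallSet P O) (C : ℂ) (F : N → ℂ) (w : Weyl P)
    (x : N) : opD P L k O C (fun y => F (w.1.2.1 y)) x = opD P L k O C F (w.1.2.1 x) := by
  rw [opD, opD, ← sum_weyl_invariant hO.weyl w fun τ => macCoeff P L k τ (w.1.2.1 x) *
    (F (w.1.2.1 x + τ) - F (w.1.2.1 x))]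
  simp only [macCoeff_weyl P L hk, map_add]

lemma opD_leading_weyl (b : P.Base) (hL : L ≠ 0) {k : ι → ℂ} (hk : WInv P k) (hO : SmallSet P O)
    (C : ℂ) {y : N} (hy : RegDom b y) (w : Weyl P) {μ₀ : M} {f h : M →₀ ℂ} (hf : ∀ μ ∈ f.support,
    μ - μ₀ ∈ rootLat P) (hh : ∀ μ ∈ h.support, μ - μ₀ ∈ rootLat P) (hfh : ∀ x, IsRegularPt P L x →
    𝓔 h x = opD P L k O C (𝓔 f) x) {d : ℝ} (hd : ∀ μ ∈ f.support, (P.1 (w.1.1 (μ - μ₀)) y).re ≤ d)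
    {μ : M} (hμ : d ≤ (P.1 (w.1.1 (μ - μ₀)) y).re) : h μ = f μ * (∑ τ ∈ O,
    ε (P.1 (w.1.1 μ + rho b k) τ) - ∑ τ ∈ O, ε (P.1 (rho b k) τ) + C) := by
  have hs : ∀ g : M →₀ ℂ, (∀ μ ∈ g.support, μ - μ₀ ∈ rootLat P) → ∀ μ ∈ (g.mapDomain w.1.1).support,
    ∃ r : ℝ, P.1 (μ - w.1.1 μ₀) y = r := fun g hg μ hμ => by
    rw [Finsupp.mapDomain_support_of_injective w.1.1.injective, mem_image] at hμ
    obtain ⟨κ, hκ, rfl⟩ := hμ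
    rw [← map_sub]
    exact hy.rootLat_real b (weyl_mem_rootLat (hg κ hκ) w)
  have key := opD_leading b hL hk hO C hy (hs f hf) (hs h hh) (fun x hx => ?_) (d := d)
    (fun μ hμ => ?_) (μ := w.1.1 μ) (by rwa [← map_sub])
  · rwa [mapDomain_apply w.1.1.injective, mapDomain_apply w.1.1.injective] at key
  · have h1 := hfh _ (isRegularPt_weyl w⁻¹ hx)
    have h2 : ∀ (g : M →₀ ℂ) x, 𝓔 (g.mapDomain w.1.1) x = 𝓔 g (w⁻¹.1.2.1 x) := fun g x => by
      have := expSum_weyl P L w g (w⁻¹.1.2.1 x)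
      rwa [weyl_inv_applyN] at this
    rw [h2, h1, ← opD_weyl hk hO]
    congr 1
    funext x
    rw [h2]
  · rw [Finsupp.mapDomain_support_of_injective w.1.1.injective, mem_image] at hμ
    grind

lemma root'_sumFundCo_ne_zero (b : P.Base) (i : ι) : P.root' i (sumFundCo b) ≠ 0 := by
  have h1 : ∀ i, b.IsPos i → P.root' i (sumFundCo b) ≠ 0 := fun i hi => by
    obtain ⟨r, hr, h2⟩ := (regDom_sumFundCo b).root'_pos b hi
    rw [h2]
    exact_mod_cast hr.ne'
  grind [pos_or_neg, root'_neg]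

lemma deltaFn_ne_zero_iff (b : P.Base) (m : ι → ℕ) (x : N) : deltaFn b L m x ≠ 0 ↔ ∀ i ∈ posRoots
    b, ∀ j ∈ Icc (-(m i : ℤ)) (m i), ε (P.root' i x + j) ≠ 1 := by
  simp only [deltaFn, prod_ne_zero_iff, Ne, brk_eq_zero]

lemma eq_zero_of_regular (b : P.Base)
    (hL : L ≠ 0) (m : ι → ℕ) {G : Set M} {F : N → ℂ} (hF : F ∈ expSpace P L G)
    (h : ∀ x, IsRegularPt P L x → deltaFn b L m x ≠ 0 → F x = 0) : F = 0 := by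
  funext x
  have h0 : ∀ c i, ∀ᶠ t : ℂ in 𝓝[≠] 0, ε (P.root' i (x + t • sumFundCo b) + c) ≠ 1 :=
    fun c i => by
    simp_all [ev_qpow_ne_one, root'_sumFundCo_ne_zero, add_right_comm]
  have h1 : ∀ᶠ t : ℂ in 𝓝[≠] 0, F (x + t • sumFundCo b) = 0 := by
    have h2 : ∀ᶠ t : ℂ in 𝓝[≠] 0, IsRegularPt P L (x + t • sumFundCo b) := by
      unfold IsRegularPt
      rw [eventually_all]
      intro i
      filter_upwards [h0 0 i, h0 1 i] with t h1 h2
      rw [Ne, Ne, brk_eq_zero, brk_eq_zero, add_comm 1]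
      exact ⟨by rwa [add_zero] at h1, h2⟩
    have h3 : ∀ᶠ t : ℂ in 𝓝[≠] 0, deltaFn b L m (x + t • sumFundCo b) ≠ 0 := by
      simp only [deltaFn_ne_zero_iff, Finset.eventually_all]
      exact fun i _ j _ => h0 j i
    filter_upwards [h2, h3] with t using h _
  have h2 := tendsto_line (L := L) hF x (sumFundCo b)
  exact tendsto_nhds_unique h2 (tendsto_const_nhds.congr' (h1.mono fun t ht => ht.symm))

end Operator

/-! ### Axial eigenfunctions -/

section Eigen

variable (b) {O : Finset N}

lemma opD_add (k : ι → ℂ) (C : ℂ) (F G : N → ℂ) (x : N) :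
    opD P L k O C (F + G) x = opD P L k O C F x + opD P L k O C G x := by
  simp only [opD, Pi.add_apply]
  rw [add_add_add_comm, ← sum_add_distrib]
  grind

lemma opD_smul (k : ι → ℂ) (C c : ℂ) (F : N → ℂ) (x : N) :
    opD P L k O C (c • F) x = c * opD P L k O C F x := by
  simp only [opD, Pi.smul_apply, smul_eq_mul]
  rw [mul_add, mul_sum]
  grind

variable (P)

/-- The axial exponential sums with exponents in `G`. -/
noncomputable def axialSpace (L : ℂ) (m : ι → ℕ) (G : Set M) : Submodule ℂ (N → ℂ) where
  carrier := {F | F ∈ expSpace P L G ∧ FunAxial P L m F}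
  zero_mem' := ⟨zero_mem _, fun _ _ _ _ _ => rfl⟩
  add_mem' := fun hF hG => ⟨add_mem hF.1 hG.1, fun i s hs x hx => by
    rw [Pi.add_apply, Pi.add_apply, hF.2 i s hs x hx, hG.2 i s hs x hx]⟩
  smul_mem' := fun c F hF => ⟨smul_mem _ c hF.1, fun i s hs x hx => by
    rw [Pi.smul_apply, Pi.smul_apply, hF.2 i s hs x hx]⟩

variable {P}

lemma exists_opD_hull (hL : NonRoot L) (hm : WInv P m) (hO : SmallSet P O) (C : ℂ) {ξ κ₀ : M}
    (hκ : IsWeight P κ₀) {F : N → ℂ}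
    (hF : F ∈ axialSpace P L m {μ | μ - ξ ∈ hull b κ₀}) : ∃ g ∈ axialSpace P L m
    {μ | μ - ξ ∈ hull b κ₀}, ∀ x, IsRegularPt P L x → g x = opD P L m⁻ O C F x := by
  have hlat : ∀ μ, μ - ξ ∈ hull b κ₀ → μ - (ξ + κ₀) ∈ rootLat P := fun μ hμ => by
    have h1 := neg_mem (mem_rootCone.1 (sub_mem_hull b hμ)).2
    rwa [neg_sub, sub_sub] at h1
  obtain ⟨f, hf, rfl⟩ := (mem_expSpace P L).1 hF.1
  obtain ⟨g, hg, hgD, hga⟩ := exists_opD (G := {μ | μ - (ξ + κ₀) ∈ rootLat P}) hL hm hO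
    (fun i μ hμ n => by
      have : μ + n • P.root i - (ξ + κ₀) = (μ - (ξ + κ₀)) + n • P.root i := by abel
      grind [add_mem, zsmul_mem, root_mem_rootLat]) C
    (expSum_mem P L fun μ hμ => hlat μ (hf μ hμ)) hF.2
  obtain ⟨h, hh, rfl⟩ := (mem_expSpace P L).1 hg
  refine ⟨_, ⟨expSum_mem P L fun μ hμ w => ?_, hga⟩, hgD⟩
  have hw : κ₀ - w.1.1 (μ - ξ) = -w.1.1 (μ - (ξ + κ₀)) - (w.1.1 κ₀ - κ₀) := by grind
  refine mem_rootCone_of_forall_regDom b (hw ▸ sub_mem (neg_mem (weyl_mem_rootLat (hh μ hμ) w))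
    (weyl_sub_mem_rootLat hκ w)) fun y hy => ?_
  rw [map_sub₂, sub_re, sub_nonneg]
  by_contra hlt
  have hfd : ∀ κ ∈ f.support, (P.1 (w.1.1 (κ - ξ)) y).re ≤ (P.1 κ₀ y).re := fun κ hκ => by
    obtain ⟨r, hr, h1⟩ := pair_nonneg b (mem_rootCone.1 (hf κ hκ w)).1
      (fun j hj => by obtain ⟨r, hr, h⟩ := hy j hj; exact ⟨r, hr.le, h⟩)
    rw [map_sub₂] at h1
    have := congrArg Complex.re h1
    rw [sub_re, ofReal_re] at this
    linarith
  have hsub : ∀ κ, (P.1 (w.1.1 (κ - (ξ + κ₀))) y).re =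
    (P.1 (w.1.1 (κ - ξ)) y).re - (P.1 (w.1.1 κ₀) y).re := fun κ => by
    simp [sub_sub]
  have key := opD_leading_weyl b hL.ne_zero (fun i j => by simp only [hm]) hO C hy w
    (fun κ hκ => hlat _ (hf κ hκ)) hh hgD
    (d := (P.1 κ₀ y).re - (P.1 (w.1.1 κ₀) y).re)
    (fun κ hκ => by grind) (μ := μ) (by rw [hsub]; linarith)
  grind

lemma exists_eigenvector (hL : NonRoot L) (hm : WInv P m) (hO : SmallSet P O) (C : ℂ) {ξ κ₀ : M}
    (hκ : κ₀ ∈ rootLat P) {F : N → ℂ} (hF : F ∈ axialSpace P L m {μ | μ - ξ ∈ hull b κ₀})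
    (hF0 : F ≠ 0) : ∃ (e : ℂ) (f : M →₀ ℂ), f ≠ 0 ∧ (∀ μ ∈ f.support, μ - ξ ∈ hull b κ₀) ∧ FunAxial
    P L m (𝓔 f) ∧ ∀ x, IsRegularPt P L x → opD P L m⁻ O C (𝓔 f) x = e * 𝓔 f x := by
  set V := axialSpace P L m {μ | μ - ξ ∈ hull b κ₀}
  have hfin : FiniteDimensional ℂ V := by
    have h1 : V ≤ expSpace P L {μ | μ - ξ ∈ hull b κ₀} := fun F hF => hF.1
    have : FiniteDimensional ℂ (expSpace P L {μ | μ - ξ ∈ hull b κ₀}) := by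
      rw [expSpace_eq_span]
      refine FiniteDimensional.span_of_finite ℂ (Set.Finite.image _ ?_)
      exact (hull_finite b κ₀).preimage (sub_left_injective.injOn)
    exact Submodule.finiteDimensional_of_le h1
  have : Nontrivial V := ⟨⟨⟨F, hF⟩, 0, fun h => hF0 (congrArg Subtype.val h)⟩⟩
  choose T hTV hT using fun F : V => exists_opD_hull b hL hm hO C (isWeight_rootLat hκ) F.2
  have huniq : ∀ F G : V, (∀ x, IsRegularPt P L x → F.1 x = G.1 x) → F = G := fun F G h => by
    refine Subtype.ext (sub_eq_zero.1 (eq_zero_of_regular b hL.ne_zero m (sub_mem F.2.1 G.2.1)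
      fun x hx _ => ?_))
    simp_all
  let D : Module.End ℂ V :=
    { toFun := fun F => ⟨T F, hTV F⟩
      map_add' := fun F G => huniq _ _ fun x hx => by
        change T (F + G) x = T F x + T G x
        grind [Submodule.coe_add, opD_add]
      map_smul' := fun c F => huniq _ _ fun x hx => by
        change T (c • F) x = c * T F x
        grind [Submodule.coe_smul, opD_smul] }
  obtain ⟨e, he⟩ := Module.End.exists_eigenvalue D
  obtain ⟨v, hv⟩ := he.exists_hasEigenvector
  obtain ⟨f, hf, hfv⟩ := (mem_expSpace P L).1 v.2.1
  refine ⟨e, f, fun h0 => hv.2 (Subtype.ext ?_), hf, hfv ▸ v.2.2, fun x hx => ?_⟩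
  · rw [← hfv, h0, map_zero]; rfl
  · have h1 : (D v).1 x = (e • v).1 x := by rw [hv.apply_eq_smul]
    rwa [hfv, ← hT v x hx]

lemma exists_coefAxial_of_generic (hL : NonRoot L) (hm : WInv P m) (hO : SmallSet P O) {ξ κ₀ : M}
    (hκ : κ₀ ∈ rootLat P) {F : N → ℂ} (hF : F ∈ axialSpace P L m {μ | μ - ξ ∈ hull b κ₀})
    (hF0 : F ≠ 0) (hgen : ∀ κ ∈ hull b κ₀, ∀ κ' ∈ hull b κ₀, ∀ w w' : Weyl P, ∑ τ ∈ O,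
    ε (P.1 (ξ + (κ - w.1.1 ϱ)) τ) = ∑ τ ∈ O, ε (P.1 (ξ + (κ' - w'.1.1 ϱ)) τ) →
    κ - w.1.1 ϱ = κ' - w'.1.1 ϱ) : ∃ κ ∈ hull b κ₀, ∃ v : M → ℂ, (∃ μ ∈ 𝓗, v μ ≠ 0) ∧ CoefAxial b L
    (fun i => ε (P.coroot' i (ξ + (κ - ϱ)))) m 𝓗 v := by
  obtain ⟨e, f, hf0, hf, hfa, hfe⟩ := exists_eigenvector b hL hm hO
    (∑ τ ∈ O, ε (P.1 (rho b fun i => -(m i : ℂ)) τ)) hκ hF hF0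
  have hlat : ∀ μ ∈ hull b κ₀, μ ∈ rootLat P := fun μ hμ => by
    have h1 := sub_mem hκ (mem_rootCone.1 (sub_mem_hull b hμ)).2
    rwa [sub_sub_cancel] at h1
  have hneg : rho b m⁻ = -ϱ := by simp only [rhoN, rho, neg_smul, sum_neg_distrib, smul_neg]
  have hne : f.support.Nonempty := Finsupp.support_nonempty_iff.2 hf0
  have htop : ∀ (w : Weyl P) (y : N), RegDom b y → ∃ μ ∈ f.support, (∀ μ' ∈ f.support,
    (P.1 (w.1.1 (μ' - ξ)) y).re ≤ (P.1 (w.1.1 (μ - ξ)) y).re) ∧ ∑ τ ∈ O, ε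
    (P.1 (ξ + ((μ - ξ) - w⁻¹.1.1 ϱ)) τ) = e := fun w y hy => by
    obtain ⟨μ, hμ, hmax⟩ := f.support.exists_max_image (fun μ => (P.1 (w.1.1 (μ - ξ)) y).re) hne
    refine ⟨μ, hμ, hmax, ?_⟩
    have hsup : (e • f).support ⊆ f.support := support_smul
    have h1 := opD_leading_weyl b hL.ne_zero (k := fun i => -(m i : ℂ))
      (fun i j => by simp only [hm]) hO _ hy w (h := e • f)
      (fun κ hκ => hlat _ (hf κ hκ)) (fun κ hκ => hlat _ (hf κ (hsup hκ)))
      (fun x hx => by rw [hfe x hx, map_smul]; rfl) hmax le_rfl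
    rw [Finsupp.smul_apply, smul_eq_mul, mul_comm, sub_add_cancel] at h1
    rw [mul_left_cancel₀ (mem_support_iff.1 hμ) h1, ← sum_weyl_invariant hO.weyl w
      fun τ => ε (P.1 (w.1.1 μ + rho b fun i => -(m i : ℂ)) τ)]
    refine sum_congr rfl fun τ _ => ?_
    have h2 : ξ + (μ - ξ - w⁻¹.1.1 ϱ) = μ - w⁻¹.1.1 ϱ := by abel
    rw [h2, hneg, ← sub_eq_add_neg, ← pair_weyl P w (μ - _), map_sub w.1.1, weyl_inv_applyM]
  obtain ⟨μ₀, hμ₀, -, h0⟩ := htop 1 _ (regDom_sumFundCo b)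
  have hone : (1 : Weyl P)⁻¹.1.1 ϱ = ϱ := rfl
  set c := (μ₀ - ξ) - ϱ with hc
  have hle : ∀ μ ∈ f.support, ∀ (w : Weyl P) y, RegDom b y → (P.1 (w.1.1 (μ - ξ)) y).re ≤
    (P.1 (w.1.1 c + ϱ) y).re := fun μ hμ w y hy => by
    obtain ⟨μ₁, hμ₁, hmax, h1⟩ := htop w y hy
    have h2 := hgen _ (hf _ hμ₁) _ (hf _ hμ₀) w⁻¹ 1 (h1.trans h0.symm)
    have h3 : w.1.1 c + ϱ = w.1.1 (μ₁ - ξ) := by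
      change _ = c at h2
      rw [← h2, map_sub, weyl_inv_applyM, sub_add_cancel]
    rw [h3]
    exact hmax μ hμ
  have hρ := (isDominant_rhoN b hm).isWeight
  have hsupp : ∀ μ ∈ f.support, μ - (ξ + c) ∈ hull b ϱ := fun μ hμ w => by
    have h1 : ϱ - w.1.1 (μ - (ξ + c)) = (w.1.1 c + ϱ) - w.1.1 (μ - ξ) := by
      simp only [map_sub, map_add]; abel
    have h2 : ϱ - w.1.1 (μ - (ξ + c)) = w.1.1 ((μ₀ - ξ) - (μ - ξ)) - (w.1.1 ϱ - ϱ) := by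
      rw [hc]; simp only [map_sub, map_add]; abel
    refine mem_rootCone_of_forall_regDom b ?_ fun y hy => ?_
    · rw [h2]
      exact sub_mem (weyl_mem_rootLat (sub_mem (hlat _ (hf _ hμ₀)) (hlat _ (hf _ hμ))) w)
        (weyl_sub_mem_rootLat hρ w)
    · rw [h1, map_sub₂, sub_re, sub_nonneg]
      exact hle μ hμ w y hy
  have hsh := shiftF_of_support (ξ + c) 𝓗 f fun μ hμ =>
    mem_image.2 ⟨_, mem_hullF.2 (hsupp μ hμ), by abel⟩
  refine ⟨μ₀ - ξ, hf _ hμ₀, fun μ => f (ξ + c + μ), ?_, ?_⟩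
  · refine ⟨μ₀ - (ξ + c), mem_hullF.2 (hsupp _ hμ₀), ?_⟩
    simp only [add_sub_cancel]
    exact mem_support_iff.1 hμ₀
  · rw [← hsh] at hfa
    exact (funAxial_shiftF_iff b hL.ne_zero hm (ξ + c) (isWeight_hull_rho b hm) _).1 hfa

/-! ### An axial exponential sum at every spectral parameter -/

variable (P)

/-- The exponential polynomial `∏_α ∏_{j ≤ m_α} (q ^ (2 (α, x) + 2 j) - 1)`. -/
noncomputable def seedFn (L : ℂ) (m : ι → ℕ) (x : N) : ℂ :=
  ∏ i : ι, ∏ j ∈ Icc 1 (m i), (qpow L (2 * (P.root' i x + j)) - 1)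

variable {P}

lemma seedFn_eq_zero {i : ι} {s : ℕ} (hs : s ∈ Icc 1 (m i)) {x : N}
    (hx : ε (P.root' i x + s) = 1) : seedFn P L m x = 0 :=
  prod_eq_zero (mem_univ i) (prod_eq_zero hs (by rw [hx, sub_self]))

lemma seedFn_line_eq_zero (hm : WInv P m) {i : ι} {s : ℕ} (hs : s ∈ Icc 1 (m i)) {x : N}
    (hx : ε (P.root' i x) = 1) : seedFn P L m (x + (s : ℂ) ⊙ i) = 0 ∧ seedFn P L m
    (x - (s : ℂ) ⊙ i) = 0 := by
  constructor
  · refine seedFn_eq_zero (i := ς i i) (by rwa [hm]) ?_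
    simp_all [root'_neg, qpow_neg]
  · refine seedFn_eq_zero (i := i) hs ?_
    simp_all

lemma exists_mem_hull_of_finite (S : Finset M) (hS : ∀ μ ∈ S, μ ∈ rootLat P) :
    ∃ κ ∈ rootLat P, ∀ μ ∈ S, μ ∈ hull b κ := by
  have h1 : ∀ T : Finset M, (∀ μ ∈ T, μ ∈ rootLat P) → ∃ κ ∈ rootLat P, ∀ μ ∈ T, κ - μ ∈ rootCone
    b := fun T => by
    induction T using Finset.induction_on with
    | empty => exact fun _ => ⟨0, zero_mem _, by simp⟩
    | insert μ T _ ih =>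
      intro hT
      obtain ⟨κ, hκ, h⟩ := ih fun ν hν => hT ν (mem_insert_of_mem hν)
      have hpos : ∀ d ∈ rootLat P, ∃ p ∈ rootCone b, p + d ∈ rootCone b := fun d hd => by
        induction hd using closure_induction with
        | mem x hx =>
          obtain ⟨i, rfl⟩ := hx
          rcases pos_or_neg b i with hi | hi
          · exact ⟨0, zero_mem _, by rw [zero_add]; exact root_mem_rootCone b hi⟩
          · exact ⟨_, root_mem_rootCone b hi, by simp⟩
        | zero => exact ⟨0, zero_mem _, by rw [zero_add]; exact zero_mem _⟩
        | add x y _ _ hx hy =>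
          obtain ⟨p, hp, hp'⟩ := hx
          obtain ⟨r, hr, hr'⟩ := hy
          exact ⟨p + r, add_mem hp hr, by rw [add_add_add_comm]; exact add_mem hp' hr'⟩
        | neg x _ hx =>
          grind [add_neg_cancel_right]
      obtain ⟨p, hp, hp'⟩ := hpos (κ - μ) (sub_mem hκ (hT μ (mem_insert_self _ _)))
      refine ⟨κ + p, add_mem hκ (mem_rootCone.1 hp).2, fun ν hν => ?_⟩
      grind [add_sub_right_comm, add_mem]
  obtain ⟨κ, hκ, h⟩ := h1 (S.biUnion fun μ => univ.image fun w : Weyl P => w.1.1 μ) (fun ν hν => by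
      obtain ⟨μ, hμ, hν⟩ := mem_biUnion.1 hν
      obtain ⟨w, -, rfl⟩ := mem_image.1 hν
      exact weyl_mem_rootLat (hS μ hμ) w)
  exact ⟨κ, hκ, fun μ hμ w => h _ (mem_biUnion.2 ⟨μ, hμ, mem_image.2 ⟨w, mem_univ _, rfl⟩⟩)⟩

lemma exists_hull_axialSpace (hL : L ≠ 0) (hm : WInv P m) :
    ∃ κ₀ ∈ rootLat P, ∀ ξ : M, ∃ F ∈ axialSpace P L m {μ | μ - ξ ∈ hull b κ₀}, F ≠ 0 := by
  have hmem : seedFn P L m ∈ expSpace P L (rootLat P : Set M) := by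
    have h1 : MulPres P L (rootLat P : Set M) (seedFn P L m) := by
      refine MulPres.prod _ fun i _ => MulPres.prod _ fun j _ => ?_
      have := mulPres_affine P L (G := (rootLat P : Set M)) (fun i μ hμ n =>
        add_mem hμ (zsmul_mem (root_mem_rootLat P i) n)) i 1 j (-1)
      simpa only [one_mul, ← sub_eq_add_neg] using this
    have h2 := h1 _ (exp_mem_expSpace P L (μ := 0) (zero_mem (rootLat P)))
    simpa [qpow_zero] using h2
  obtain ⟨f, hf, hfs⟩ := (mem_expSpace P L).1 hmem
  obtain ⟨κ₀, hκ, h⟩ := exists_mem_hull_of_finite b f.support hf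
  refine ⟨κ₀, hκ, fun ξ => ⟨fun x => ε (P.1 ξ x) * seedFn P L m x, ⟨?_, ?_⟩, ?_⟩⟩
  · rw [← hfs]
    exact exp_mul_mem_expSpace P L (G := hull b κ₀) (fun μ hμ => by simp_all) (expSum_mem P L h)
  · intro i s hs x hx
    grind [seedFn_line_eq_zero]
  · have hne : ∀ᶠ t : ℂ in 𝓝[≠] 0, seedFn P L m ((0 : N) + t • sumFundCo b) ≠ 0 := by
      simp only [seedFn, prod_ne_zero_iff]
      rw [eventually_all]
      intro i
      rw [eventually_imp_distrib_left]
      intro _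
      rw [Finset.eventually_all]
      intro j _
      filter_upwards [ev_qpow_ne_one hL (j : ℂ) (root'_sumFundCo_ne_zero b i)] with t ht
      rwa [sub_ne_zero, map_add, map_zero, zero_add, map_smul, smul_eq_mul, add_comm]
    obtain ⟨t, ht⟩ := hne.exists
    exact fun h0 => mul_ne_zero (qpow_ne_zero _ _) ht (congrFun h0 _)

end Eigen

/-! ### Functions that are entire on lines -/

/-- `F` is entire on every complex line. -/
def LineDiff (F : M → ℂ) : Prop := ∀ x v, Differentiable ℂ fun t : ℂ => F (x + t • v)

lemma LineDiff.eventually_ne {F : M → ℂ} (hF : LineDiff F) (x v : M) {t₀ : ℂ}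
    (h : F (x + t₀ • v) ≠ 0) : ∀ᶠ t : ℂ in 𝓝[≠] 0, F (x + t • v) ≠ 0 := by
  have han : AnalyticOnNhd ℂ (fun t : ℂ => F (x + t • v)) Set.univ :=
    (hF x v).differentiableOn.analyticOnNhd isOpen_univ
  rcases (han 0 (Set.mem_univ _)).eventually_eq_zero_or_eventually_ne_zero with h0 | h0
  · exact absurd (han.eqOn_zero_of_preconnected_of_eventuallyEq_zero isPreconnected_univ
      (Set.mem_univ 0) h0 (Set.mem_univ t₀)) h
  · exact h0

lemma exists_common_ne {κ : Type*} (J : Finset κ) (F : κ → M → ℂ) (hF : ∀ j ∈ J, LineDiff (F j))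
    (h : ∀ j ∈ J, ∃ x, F j x ≠ 0) : ∃ x, ∀ j ∈ J, F j x ≠ 0 := by
  induction J using Finset.induction_on with
  | empty => exact ⟨0, by simp⟩
  | insert j J _ ih =>
    obtain ⟨x, hx⟩ := ih (fun i hi => hF i (mem_insert_of_mem hi))
      fun i hi => h i (mem_insert_of_mem hi)
    obtain ⟨y, hy⟩ := h j (mem_insert_self _ _)
    have h1 := (hF j (mem_insert_self _ _)).eventually_ne x (y - x) (t₀ := 1)
      (by rwa [one_smul, add_sub_cancel])
    have h2 : ∀ᶠ t : ℂ in 𝓝[≠] 0, ∀ i ∈ J, F i (x + t • (y - x)) ≠ 0 := by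
      rw [Finset.eventually_all]
      exact fun i hi => (hF i (mem_insert_of_mem hi)).eventually_ne x (y - x) (t₀ := 0)
        (by simp_all)
    obtain ⟨t, h3, h4⟩ := (h1.and h2).exists
    refine ⟨x + t • (y - x), fun i hi => ?_⟩
    grind

lemma LineDiff.comp_add {F : M → ℂ} (hF : LineDiff F) (c : M) : LineDiff fun x => F (x + c) :=
  fun x v => by simpa only [add_right_comm] using hF (x + c) v

lemma lineDiff_qpow (L : ℂ) (φ : Module.Dual ℂ M) (c : ℂ) : LineDiff fun x => qpow L (φ x + c) :=
  fun x v => by simp only [map_add, map_smul, smul_eq_mul, qpow]; fun_prop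

lemma lineDiff_expSum (P : RootPairing ι ℂ N M) (L : ℂ) (f : N →₀ ℂ) :
    LineDiff (expSum P L f) := fun x v =>
  differentiable_line P L (expSum_mem P L (G := Set.univ) fun _ _ => Set.mem_univ _) x v

/-! ### Kernels of matrices over a domain -/

lemma exists_mulVec_eq_zero_of_specializations {R E C k : Type*} [CommRing R] [IsDomain R]
    [Field k] [Fintype E] [Fintype C] [DecidableEq E] [DecidableEq C] (A : Matrix E C R)
    (h : ∀ d : R, d ≠ 0 → ∃ φ : R →+* k, φ d ≠ 0 ∧ ∃ v : C → k, v ≠ 0 ∧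
    (A.map φ).mulVec v = 0) : ∃ v : C → R, v ≠ 0 ∧ A.mulVec v = 0 := by
  set K := FractionRing R
  have hker : ∃ v : C → K, v ≠ 0 ∧ (A.map (algebraMap R K)).mulVec v = 0 := by
    by_contra hno
    push Not at hno
    have hinj : LinearMap.ker (Matrix.toLin' (A.map (algebraMap R K))) = ⊥ := by
      rw [LinearMap.ker_eq_bot']
      intro v hv
      by_contra hv0
      exact hno v hv0 (by rwa [Matrix.toLin'_apply] at hv)
    obtain ⟨g, hg⟩ := LinearMap.exists_leftInverse_of_injective _ hinj
    set B : Matrix C E K := toMatrix' g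
    have hBA : B * A.map (algebraMap R K) = 1 := by
      have h1 := congrArg toMatrix' hg
      rwa [LinearMap.toMatrix'_comp, LinearMap.toMatrix'_toLin', LinearMap.toMatrix'_id] at h1
    obtain ⟨⟨d, hd⟩, hdB⟩ := IsLocalization.exist_integer_multiples (nonZeroDivisors R)
      (univ : Finset (C × E)) fun x => B x.1 x.2
    choose B' hB' using fun x : C × E => hdB x (mem_univ _)
    have hBA' : (Matrix.of fun c e => B' (c, e)) * A = d • (1 : Matrix C C R) := by
      have hK : Injective (algebraMap R K) := IsFractionRing.injective R K
      ext c c'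
      apply hK
      have h1 := congrFun (congrFun hBA c) c'
      rw [Matrix.mul_apply] at h1
      rw [Matrix.mul_apply, map_sum, Matrix.smul_apply, smul_eq_mul, map_mul]
      have h2 : algebraMap R K ((1 : Matrix C C R) c c') = (1 : Matrix C C K) c c' := by
        rw [Matrix.one_apply, Matrix.one_apply]; split_ifs <;> simp
      rw [h2, ← h1, mul_sum]
      refine sum_congr rfl fun e _ => ?_
      have h3 := hB' (c, e)
      rw [Matrix.of_apply, map_mul, h3, Algebra.smul_def, map_apply, mul_assoc]
    obtain ⟨φ, hφ, v, hv, hAv⟩ := h d (nonZeroDivisors.ne_zero hd)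
    refine hv (funext fun c => ?_)
    have h1 : ((Matrix.of fun c e => B' (c, e)).map φ * A.map φ).mulVec v = φ d • v := by
      rw [← Matrix.map_mul, hBA']
      ext c
      simp [mulVec, dotProduct, Matrix.one_apply, Matrix.smul_apply, apply_ite φ]
    rw [← Matrix.mulVec_mulVec, hAv, Matrix.mulVec_zero] at h1
    have h2 := congrFun h1 c
    rw [Pi.zero_apply, Pi.smul_apply, smul_eq_mul] at h2
    exact (mul_eq_zero.1 h2.symm).resolve_left hφ
  obtain ⟨v, hv, hAv⟩ := hker
  obtain ⟨⟨d, hd⟩, hdv⟩ := IsLocalization.exist_integer_multiples (nonZeroDivisors R)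
    (univ : Finset C) v
  choose v' hv' using fun c : C => hdv c (mem_univ _)
  have hK : Injective (algebraMap R K) := IsFractionRing.injective R K
  refine ⟨v', fun h0 => hv (funext fun c => ?_), funext fun e => hK ?_⟩
  · have h1 := hv' c
    rw [h0, Pi.zero_apply, map_zero, Algebra.smul_def] at h1
    refine (mul_eq_zero.1 h1.symm).resolve_left fun h2 => nonZeroDivisors.ne_zero hd (hK ?_)
    rwa [map_zero]
  · have h1 := congrFun hAv e
    rw [mulVec, dotProduct, Pi.zero_apply] at h1
    rw [mulVec, dotProduct, map_sum, Pi.zero_apply, map_zero,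
      ← mul_zero (algebraMap R K d), ← h1, mul_sum]
    refine sum_congr rfl fun c _ => ?_
    rw [map_mul, hv', Algebra.smul_def, map_apply, mul_left_comm]

/-! ### The coordinate ring of the spectral torus -/

section Torus

variable (b) (L : ℂ)

/-- The coordinates `q ^ (2 (α_j^∨, ξ))` of a spectral parameter. -/
noncomputable def torusPt (ξ : M) : b.support → ℂ := fun j => qpow L (2 * P.coroot' j ξ)

/-- The coefficients of a positive coroot in terms of the simple ones. -/
noncomputable def corootExp (i : ι) : b.support →₀ ℕ :=
  Finsupp.equivFunOnFinite.symm fun j => ⌊(P.flip.toLinearMap (P.coroot i) (fundCo b.flip j)).re⌋₊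

lemma cast_corootExp {i : ι} (hi : b.IsPos i) (j : b.support) :
    ((corootExp b i j : ℕ) : ℂ) = P.flip.toLinearMap (P.coroot i) (fundCo b.flip j) := by
  have h1 := mem_rootCone.1 (coroot_mem_rootCone_flip b hi)
  obtain ⟨n, hn⟩ := (mem_rootLat b.flip).1 h1.2 j
  obtain ⟨r, hr, hr'⟩ := h1.1 j
  rw [hn] at hr'
  have h3 : (n : ℝ) = r := by exact_mod_cast hr'
  obtain ⟨k, rfl⟩ := eq_ofNat_of_zero_le (by exact_mod_cast h3 ▸ hr : 0 ≤ n)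
  have h4 : corootExp b i j = ⌊(P.flip.toLinearMap (P.coroot i) (fundCo b.flip j)).re⌋₊ := rfl
  rw [h4, hn]
  simp

lemma coroot'_eq_sum {i : ι} (hi : b.IsPos i) (ξ : M) :
    P.coroot' i ξ = ∑ j : b.support, (corootExp b i j : ℂ) * P.coroot' j ξ := by
  have h1 := pair_eq_sum b.flip (P.coroot i) ξ
  change P.coroot' i ξ = _ at h1
  exact h1.trans (sum_congr rfl fun (j : b.support) _ => by rw [cast_corootExp b hi j]; rfl)

lemma coroot'_fundCo_flip (i j : b.support) :
    P.coroot' i (fundCo b.flip j) = if i = j then 1 else 0 := by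
  refine (root'_fundCo b.flip i j).trans ?_
  grind

/-- The monomial that represents `q ^ (2 (α^∨, ξ))` for a positive root `α`. -/
noncomputable def torusMon (i : ι) : MvPolynomial b.support ℂ := monomial (corootExp b i) 1

lemma eval_torusMon {i : ι} (hi : b.IsPos i) (ξ : M) :
    eval (torusPt b L ξ) (torusMon b i) = qpow L (2 * P.coroot' i ξ) := by
  rw [torusMon, eval_monomial, one_mul, Finsupp.prod_fintype _ _ (by simp),
    coroot'_eq_sum b hi, mul_sum, qpow_sum]
  refine prod_congr rfl fun j _ => ?_
  rw [mul_left_comm, qpow_nat_mul]; rfl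

lemma exists_torusPt_eq (hL : L ≠ 0) (a : b.support → ℂ) (ha : ∀ j, a j ≠ 0) :
    ∃ ξ : M, torusPt b L ξ = a := by
  refine ⟨∑ j : b.support, (Complex.log (a j) / (2 * L)) • fundCo b.flip j, funext fun i => ?_⟩
  have h1 : P.coroot' i (∑ j : b.support, (Complex.log (a j) / (2 * L)) • fundCo b.flip j) =
    Complex.log (a i) / (2 * L) := by
    rw [map_sum, sum_eq_single_of_mem i (mem_univ _)]
    · rw [map_smul, smul_eq_mul, coroot'_fundCo_flip, if_pos rfl, mul_one]
    · intro j _ hj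
      rw [map_smul, smul_eq_mul, coroot'_fundCo_flip, if_neg (Ne.symm hj), mul_zero]
  rw [torusPt, h1, qpow]
  rw [show 2 * (Complex.log (a i) / (2 * L)) * L = Complex.log (a i) by field_simp,
    Complex.exp_log (ha i)]

lemma exists_eval_torusPt_ne_zero (hL : L ≠ 0) {p : MvPolynomial b.support ℂ} (hp : p ≠ 0) :
    ∃ ξ : M, eval (torusPt b L ξ) p ≠ 0 := by
  by_contra hno
  push Not at hno
  refine hp (MvPolynomial.funext_set (fun _ => {0}ᶜ) (fun _ => ?_) fun a ha => ?_)
  · exact (Set.finite_singleton (0 : ℂ)).infinite_compl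
  · obtain ⟨ξ, rfl⟩ := exists_torusPt_eq b L hL a fun j => ha j (Set.mem_univ _)
    rw [hno, map_zero]

lemma lineDiff_eval (p : MvPolynomial b.support ℂ) :
    LineDiff fun ξ => eval (torusPt b L ξ) p := fun x v => by
  induction p using MvPolynomial.induction_on with
  | C a => simp
  | add p r hp hr => simp_all
  | mul_X p j hp =>
    simp only [map_mul, MvPolynomial.eval_X]
    refine hp.mul ?_
    simp only [torusPt, map_add, map_smul, smul_eq_mul, qpow]
    fun_prop

end Torus

/-! ### Change of rings for axial systems -/

section Coef

variable {R R' : Type*} [CommRing R] [Algebra ℂ R]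
  [CommRing R'] [Algebra ℂ R'] {t : ι → R} {S : Finset M} {v : M → R}

lemma CoefAxial.map (h : CoefAxial b L t m S v) (φ : R →ₐ[ℂ] R') :
    CoefAxial b L (fun i => φ (t i)) m S fun μ => φ (v μ) := fun i hi μ hμ s hs => by
  have h1 := congrArg φ (h i hi μ hμ s hs)
  simp_all

lemma CoefAxial.congr (h : CoefAxial b L t m S v) {t' : ι → R} {v' : M → R} (ht : ∀ i ∈ R₊,
    t' i = t i) (hv : ∀ μ ∈ S, v' μ = v μ) : CoefAxial b L t' m S v' := fun i hi μ hμ s hs => by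
  rw [← h i hi μ hμ s hs]
  exact sum_congr rfl fun κ hκ => by grind

lemma CoefAxial.mul (h : CoefAxial b L t m S v) (c : R) :
    CoefAxial b L t m S fun μ => c * v μ := fun i hi μ hμ s hs => by
  rw [← mul_zero c, ← h i hi μ hμ s hs, mul_sum]
  grind

lemma CoefAxial.of_mul [IsDomain R] {c : R} (hc : c ≠ 0)
    (h : CoefAxial b L t m S fun μ => c * v μ) : CoefAxial b L t m S v := fun i hi μ hμ s hs => by
  refine (mul_eq_zero.1 ?_).resolve_left hc
  rw [← h i hi μ hμ s hs, mul_sum]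
  grind

/-- The matrix of the system of equations `CoefAxial`. -/
noncomputable def axialMatrix (b : P.Base) (L : ℂ) (t : ι → R) (m : ι → ℕ) (S : Finset M) :
    Matrix ((i : posRoots b) × S × Icc 1 (m i)) S R := fun e κ =>
  if ∃ n : ℤ, (κ : M) = (e.2.1 : M) + n • P.root e.1 then
    (t e.1 * algebraMap ℂ R (qpow L (zp P e.1 κ))) ^ (e.2.2 : ℕ) -
      algebraMap ℂ R (qpow L (-zp P e.1 κ)) ^ (e.2.2 : ℕ) else 0

lemma axialMatrix_mulVec (v : M → R) (e) :
    (axialMatrix b L t m S).mulVec (fun κ => v κ) e =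
      ∑ κ ∈ S with (∃ n : ℤ, κ = (e.2.1 : M) + n • P.root e.1),
        v κ * ((t e.1 * algebraMap ℂ R (qpow L (zp P e.1 κ))) ^ (e.2.2 : ℕ) -
          algebraMap ℂ R (qpow L (-zp P e.1 κ)) ^ (e.2.2 : ℕ)) := by
  rw [sum_filter, ← sum_coe_sort S, mulVec, dotProduct]
  refine sum_congr rfl fun κ _ => ?_
  rw [axialMatrix]
  split_ifs
  · exact mul_comm _ _
  · exact zero_mul _

lemma coefAxial_iff_mulVec :
    CoefAxial b L t m S v ↔ (axialMatrix b L t m S).mulVec (fun κ => v κ) = 0 := by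
  constructor
  · intro h
    funext e
    rw [axialMatrix_mulVec]
    exact h e.1 e.1.2 e.2.1 e.2.1.2 e.2.2 e.2.2.2
  · intro h i hi μ hμ s hs
    have := congrFun h ⟨⟨i, hi⟩, ⟨μ, hμ⟩, ⟨s, hs⟩⟩
    rwa [axialMatrix_mulVec] at this

lemma axialMatrix_map (φ : R →ₐ[ℂ] R') :
    (axialMatrix b L t m S).map φ = axialMatrix b L (fun i => φ (t i)) m S := by
  ext e κ
  rw [map_apply, axialMatrix, axialMatrix]
  split_ifs
  · simp
  · exact map_zero φ

end Coef

section Generic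

variable (b)

lemma exists_coefAxial_of_ne_zero [P.IsIrreducible] (hL : NonRoot L) (hm : WInv P m)
    {d : MvPolynomial b.support ℂ} (hd : d ≠ 0) : ∃ ξ : M, eval (torusPt b L ξ) d ≠ 0 ∧ ∃ v : M → ℂ,
    (∃ μ ∈ 𝓗, v μ ≠ 0) ∧ CoefAxial b L (fun i => ε (P.coroot' i ξ)) m 𝓗 v := by
  have hne : Nonempty ι := by
    by_contra h
    rw [not_nonempty_iff] at h
    have := RootPairing.IsIrreducible.nontrivial P
    have h1 := RootPairing.IsRootSystem.span_root_eq_top (P := P)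
    rw [Set.range_eq_empty, Submodule.span_empty] at h1
    exact bot_ne_top h1
  obtain ⟨i₀, hq⟩ := exists_isQuasiminuscule P
  set O := orbitF P (P.coroot i₀)
  have hO : SmallSet P O := smallSet_orbitF (Or.inr hq)
  obtain ⟨κ₀, hκ₀, hseed⟩ := exists_hull_axialSpace b (L := L) hL.ne_zero hm
  have hlat : ∀ μ ∈ hull b κ₀, μ ∈ rootLat P := fun μ hμ => by
    have h1 := sub_mem hκ₀ (mem_rootCone.1 (sub_mem_hull b hμ)).2
    rwa [sub_sub_cancel] at h1
  set A : Finset M := (hullF b κ₀ ×ˢ (univ : Finset (Weyl P))).image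
    fun x => x.1 - x.2.1.1 ϱ
  have hAw : ∀ a ∈ A, IsWeight P a := fun a ha => by
    obtain ⟨x, hx, rfl⟩ := mem_image.1 ha
    exact (isWeight_rootLat (hlat _ (mem_hullF.1 (mem_product.1 hx).1))).sub
      ((isDominant_rhoN b hm).isWeight.weyl _)
  have hAm : ∀ κ ∈ hull b κ₀, ∀ w : Weyl P, κ - w.1.1 ϱ ∈ A := fun κ hκ w =>
    mem_image.2 ⟨(κ, w), mem_product.2 ⟨mem_hullF.2 hκ, mem_univ _⟩, rfl⟩
  set f : M → N →₀ ℂ := fun a => ∑ τ ∈ O, single τ (ε (P.1 a τ)) with hf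
  have hfs : ∀ a ξ, expSum P.flip L (f a) ξ = ∑ τ ∈ O, ε (P.1 (ξ + a) τ) := fun a ξ => by
    rw [hf, map_sum, Finset.sum_apply]
    refine sum_congr rfl fun τ _ => ?_
    rw [expSum_single, qpow_add_pair, mul_comm]; rfl
  have hfτ : ∀ a, ∀ τ ∈ O, f a τ = ε (P.1 a τ) := fun a τ hτ => by
    rw [hf, finsetSum_apply, sum_eq_single_of_mem τ hτ]
    · rw [single_eq_same]
    · grind
  have h1 := exists_common_ne (M := M) (univ : Finset (A ⊕ {x : A × A // x.1 ≠ x.2}))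
    (fun j ξ => Sum.elim (fun a : A => eval (torusPt b L (ξ + a)) d)
      (fun x : {x : A × A // x.1 ≠ x.2} => expSum P.flip L (f x.1.1 - f x.1.2) ξ) j) (fun j _ => by
      rcases j with a | x
      · exact (lineDiff_eval b L d).comp_add a
      · exact lineDiff_expSum P.flip L _) (fun j _ => by
      rcases j with a | x
      · obtain ⟨ξ, hξ⟩ := exists_eval_torusPt_ne_zero b L hL.ne_zero hd
        refine ⟨ξ - a, ?_⟩
        simpa only [Sum.elim_inl, sub_add_cancel] using hξ
      · by_contra hno
        push Not at hno
        refine x.2 (Subtype.ext (sub_eq_zero.1 (eq_zero_of_orbitF (P := P) (π := P.coroot i₀)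
          (P.ne_zero' i₀) fun τ hτ => ?_)))
        have h0 : f x.1.1 - f x.1.2 = 0 := expSum_injective P.flip hL.ne_zero (by
          rw [map_zero]; exact funext hno)
        have h2 := DFunLike.congr_fun h0 τ
        rw [Finsupp.sub_apply, hfτ _ τ hτ, hfτ _ τ hτ, Finsupp.zero_apply, sub_eq_zero] at h2
        obtain ⟨w, rfl⟩ := mem_orbitF.1 hτ
        rw [← coroot_weyl] at h2 ⊢
        obtain ⟨n, hn⟩ := hAw _ x.1.1.2 (w.1.2.2 i₀)
        obtain ⟨k, hk⟩ := hAw _ x.1.2.2 (w.1.2.2 i₀)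
        have hn' : P.1 x.1.1.1 (P.coroot (w.1.2.2 i₀)) = n := hn
        have hk' : P.1 x.1.2.1 (P.coroot (w.1.2.2 i₀)) = k := hk
        rw [hn', hk'] at h2
        have h3 := hL.qpow_inj (m := 2 * n) (n := 2 * k) (by push_cast; exact h2)
        have h4 : n = k := by omega
        rw [map_sub₂, hn', hk', h4, sub_self])
  obtain ⟨ξ, hξ⟩ := h1
  obtain ⟨F, hF, hF0⟩ := hseed ξ
  obtain ⟨κ, hκ, v, hv, hax⟩ := exists_coefAxial_of_generic b hL hm hO hκ₀ hF hF0
    fun κ hκ κ' hκ' w w' heq => by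
      by_contra hne'
      refine hξ (Sum.inr ⟨(⟨_, hAm κ hκ w⟩, ⟨_, hAm κ' hκ' w'⟩), fun h => hne'
        (congrArg Subtype.val h)⟩) (mem_univ _) ?_
      simp only [Sum.elim_inr]
      rw [map_sub, Pi.sub_apply, hfs, hfs, heq, sub_self]
  exact ⟨ξ + (κ - ϱ), hξ (Sum.inl ⟨_, hAm κ hκ 1⟩) (mem_univ _), v, hv, hax⟩

lemma exists_coefAxial_torus [P.IsIrreducible] (hL : NonRoot L) (hm : WInv P m) : ∃ v : M →
    MvPolynomial b.support ℂ, (∃ μ ∈ 𝓗, v μ ≠ 0) ∧ CoefAxial b L (torusMon b) m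
    𝓗 v := by
  have hae : ∀ ξ p, MvPolynomial.aeval (torusPt b L ξ) p = eval (torusPt b L ξ) p :=
    fun ξ p => by rw [← coe_aeval_eq_eval]; rfl
  obtain ⟨v, hv, hAv⟩ := exists_mulVec_eq_zero_of_specializations (k := ℂ)
    (axialMatrix b L (torusMon b) m 𝓗) fun d hd => by
      obtain ⟨ξ, hξ, v, ⟨μ, hμ, hμv⟩, hv⟩ := exists_coefAxial_of_ne_zero b hL hm hd
      refine ⟨(MvPolynomial.aeval (torusPt b L ξ)).toRingHom, ?_, fun κ => v κ, fun h0 => hμv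
        (congrFun h0 ⟨μ, hμ⟩), ?_⟩
      · simp_all
      · have h1 := axialMatrix_map (b := b) (L := L) (t := torusMon b) (m := m)
          (S := 𝓗) (MvPolynomial.aeval (torusPt b L ξ))
        change ((axialMatrix b L (torusMon b) m 𝓗).map
          (MvPolynomial.aeval (torusPt b L ξ))).mulVec _ = 0
        rw [h1, ← coefAxial_iff_mulVec (v := v)]
        refine hv.congr (fun i hi => ?_) fun _ _ => rfl
        rw [hae, eval_torusMon b L (mem_posRoots.1 hi)]
  set v' : M → MvPolynomial b.support ℂ := fun μ =>
    if h : μ ∈ 𝓗 then v ⟨μ, h⟩ else 0 with hv'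
  have h1 : (fun κ : 𝓗 => v' κ) = v := by simp_all
  refine ⟨v', ?_, coefAxial_iff_mulVec.2 (by rw [h1]; exact hAv)⟩
  by_contra hno
  push Not at hno
  exact hv (h1 ▸ funext fun κ => hno κ κ.2)

end Generic

/-! ### Edges of the hull of `ρ_m` -/

/-- The factor `t - q ^ (2 k)`. -/
noncomputable def efac (L : ℂ) {R : Type*} [CommRing R] [Algebra ℂ R] (t : R) (k : ℤ) : R :=
  t - algebraMap ℂ R (qpow L (2 * k))

lemma efac_ne_zero {R : Type*} [CommRing R] [Algebra ℂ R] {t : R} (h : NonRes L t)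
    (k : ℤ) : efac L t k ≠ 0 := sub_ne_zero.2 (h k)

lemma map_efac {R R' : Type*} [CommRing R] [Algebra ℂ R] [CommRing R'] [Algebra ℂ R']
    (φ : R →ₐ[ℂ] R') (t : R) (k : ℤ) : φ (efac L t k) = efac L (φ t) k := by
  rw [efac, efac, map_sub, AlgHom.commutes]

section Edge

variable (b)

lemma refl_rhoN (hm : WInv P m) {j : ι} (hj : j ∈ b.support) :
    (𝐬 j).1.1 ϱ = ϱ - m j • P.root j := by
  change P.reflection j _ = _
  rw [P.reflection_apply, coroot'_rhoN b hm hj, cast_smul_eq_nsmul]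

lemma sub_nsmul_mem_hull {κ x : M} (hx : x ∈ hull b κ) {i : ι} {c n : ℕ}
    (hc : P.coroot' i x = c) (hn : n ≤ c) : x - n • P.root i ∈ hull b κ := by
  rcases Nat.eq_zero_or_pos c with h0 | h0
  · simp_all
  intro w
  have h1 := mem_rootCone.1 (hx w)
  rw [mem_rootCone]
  constructor
  · have hc0 : (c : ℂ) ≠ 0 := by exact_mod_cast h0.ne'
    have key : κ - w.1.1 (x - n • P.root i) = ((1 - n / c : ℝ) : ℂ) • (κ - w.1.1 x) +
      ((n / c : ℝ) : ℂ) • (κ - w.1.1 (P.reflection i x)) := by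
      have h2 : (n : ℂ) • w.1.1 (P.root i) = ((n : ℂ) / c) • (c : ℂ) • w.1.1 (P.root i) := by
        rw [smul_smul, div_mul_cancel₀ _ hc0]
      rw [P.reflection_apply, hc, map_sub, map_sub, map_nsmul, ← cast_smul_eq_nsmul ℂ n, h2,
        map_smul]
      module
    rw [key]
    refine add_mem (smul_mem_realCone b h1.1 ?_) (smul_mem_realCone b
      (mem_rootCone.1 (hx (w * 𝐬 i))).1 (by positivity))
    simp_all [div_le_one_of_le₀]
  · rw [map_sub, map_nsmul, ← root_weyl, ← sub_add]
    exact add_mem h1.2 (nsmul_mem (root_mem_rootLat P _) n)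

lemma exists_nat_of_mem_hull (hm : WInv P m) {j : ι} (hj : j ∈ b.support) {k : ℤ}
    (h : ϱ + k • P.root j ∈ hull b ϱ) : ∃ n ≤ m j, k = -(n : ℤ) := by
  have hjj : P.1 (P.root j) (fundCo b ⟨j, hj⟩) = 1 := by
    have := root'_fundCo b ⟨j, hj⟩ ⟨j, hj⟩
    simpa using this
  have h1 : ∀ r : ℤ, r • P.root j ∈ rootCone b → 0 ≤ r := fun r hr => by
    obtain ⟨e, he, he'⟩ := (mem_rootCone.1 hr).1 ⟨j, hj⟩
    rw [← cast_smul_eq_zsmul ℂ, map_smul₂, hjj, smul_eq_mul, mul_one] at he'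
    have : (r : ℝ) = e := by exact_mod_cast he'
    exact_mod_cast this ▸ he
  have h2 := h1 (-k) (by
    have := sub_mem_hull b h
    simp_all)
  have h3 := h1 (m j + k) (by
    have h4 := h (𝐬 j)
    rw [map_add, refl_rhoN b hm hj, map_zsmul] at h4
    change ϱ - (_ + k • P.reflection j _) ∈ _ at h4
    rw [P.reflection_apply_self] at h4
    convert h4 using 1
    module)
  exact ⟨(-k).toNat, by omega, by omega⟩

lemma exists_simple_weyl {i : ι} (hi : b.IsPos i) :
    ∃ j ∈ b.support, ∃ w : Weyl P, w.1.2.2 j = i := by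
  obtain ⟨j, hj, h, -⟩ := exists_simple_le b hi
  exact ⟨j, hj, h⟩

variable {b} in
lemma CoefAxial.edge_sum {F : Type*} [Field F]
    [Algebra ℂ F] {t : ι → F} (hm : WInv P m) {v : M → F}
    (h : CoefAxial b L t m 𝓗 v) (w : Weyl P) {j : ι} (hj : j ∈ b.support)
    (hw : b.IsPos (w.1.2.2 j)) {s : ℕ} (hs : s ∈ Icc 1 (m j)) :
    ∑ a ∈ range (m j + 1), v (w.1.1 (ϱ - a • P.root j)) *
      ((t (w.1.2.2 j) * algebraMap ℂ F (qpow L (m j - 2 * a))) ^ s -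
        algebraMap ℂ F (qpow L (2 * a - m j)) ^ s) = 0 := by
  have hdom := isDominant_rhoN b hm
  have h1 := h (w.1.2.2 j) (mem_posRoots.2 hw) (w.1.1 ϱ)
    (mem_hullF.2 (weyl_mem_hull b (hdom.mem_hull b) w)) s (by rwa [invariant_weyl P hm])
  rw [← h1]
  have hinj : ∀ a a' : ℕ, w.1.1 (ϱ - a • P.root j) = w.1.1 (ϱ - a' • P.root j) → a = a' := fun a a'
    h2 => by
    have h3 := sub_right_injective (w.1.1.injective h2)
    rw [← cast_smul_eq_nsmul ℂ, ← cast_smul_eq_nsmul ℂ] at h3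
    exact_mod_cast smul_left_injective ℂ (P.ne_zero j) h3
  refine sum_bij (fun a _ => w.1.1 (ϱ - a • P.root j)) (fun a ha => ?_)
    (fun a _ a' _ h2 => hinj a a' h2) (fun κ hκ => ?_) fun a ha => ?_
  · rw [mem_filter, mem_hullF]
    refine ⟨weyl_mem_hull b (sub_nsmul_mem_hull b ((isDominant_rhoN b hm).mem_hull b)
      (coroot'_rhoN b hm hj) (lt_succ_iff.1 (mem_range.1 ha))) w, -(a : ℤ), ?_⟩
    simp [root_weyl, sub_eq_add_neg]
  · rw [mem_filter, mem_hullF] at hκ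
    obtain ⟨hκ, k, rfl⟩ := hκ
    have h2 : w.1.1 ϱ + k • P.root (w.1.2.2 j) = w.1.1 (ϱ + k • P.root j) := by
      rw [map_add, map_zsmul, root_weyl]
    have h3 := weyl_mem_hull b hκ w⁻¹
    rw [h2] at h3 ⊢
    have h4 : w⁻¹.1.1 (w.1.1 (ϱ + k • P.root j)) = ϱ + k • P.root j := by
      have := weyl_inv_applyM P w⁻¹ (ϱ + k • P.root j)
      rwa [inv_inv] at this
    rw [h4] at h3
    obtain ⟨n, hn, rfl⟩ := exists_nat_of_mem_hull b hm hj h3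
    refine ⟨n, mem_range.2 (lt_succ_iff.2 hn), ?_⟩
    rw [neg_smul, natCast_zsmul, sub_eq_add_neg]
  · have hz : zp P (w.1.2.2 j) (w.1.1 (ϱ - a • P.root j)) = m j - 2 * a := by
      refine zp_of_eq ?_
      rw [coroot'_weyl, map_sub, map_nsmul, coroot'_rhoN b hm hj]
      simp [mul_comm]
    rw [hz]
    push_cast
    rw [neg_sub]

lemma exists_edge_relation (hL : NonRoot L) {F : Type*} [Field F] [Algebra ℂ F]
    (hm : WInv P m) {j : ι} (hj : j ∈ b.support) {n : ℕ} (hn : n ≤ m j) : ∃ u : ℂ, u ≠ 0 ∧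
    ∀ {t : ι → F} {v : M → F}, CoefAxial b L t m 𝓗 v → ∀ w : Weyl P, b.IsPos (w.1.2.2 j) →
    NonRes L (t (w.1.2.2 j)) →
    v (w.1.1 (ϱ - n • P.root j)) * ∏ k ∈ Icc 1 n, efac L (t (w.1.2.2 j)) k =
      algebraMap ℂ F u * (v (w.1.1 ϱ) * ∏ k ∈ range n, efac L (t (w.1.2.2 j)) ((k : ℤ) - m j)) := by
  rcases Nat.eq_zero_or_pos n with rfl | hn0
  · exact ⟨1, one_ne_zero, by simp⟩
  set T := range (m j + 1) with hT
  set J := (T.erase 0).erase n with hJ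
  have hnT : n ∈ T.erase 0 := mem_erase.2 ⟨hn0.ne', mem_range.2 (lt_succ_iff.2 hn)⟩
  have h0T : 0 ∈ T := mem_range.2 (Nat.succ_pos _)
  set U : ℕ → ℂ := fun x => qpow L (m j - 2 * x) *
    ∏ a ∈ J, (qpow L (m j - 2 * x) - qpow L (m j - 2 * a)) with hU
  have hU0 : ∀ x ∉ J, U x ≠ 0 := fun x hx => mul_ne_zero (qpow_ne_zero _ _) <|
    prod_ne_zero_iff.2 fun a ha => sub_ne_zero.2 fun h1 => by
      have := hL.qpow_inj (m := m j - 2 * x) (n := m j - 2 * a) (by push_cast; exact h1)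
      exact hx ((by omega : x = a) ▸ ha)
  have hUn := hU0 n (by simp [J])
  refine ⟨-U 0 / U n, div_ne_zero (neg_ne_zero.2 (hU0 0 (by simp [J]))) hUn,
    fun {t v} h w hw hres => ?_⟩
  set τ := t (w.1.2.2 j)
  set z : ℂ → F := fun a => algebraMap ℂ F (qpow L a) with hz
  have hzadd : ∀ a c, z (a + c) = z a * z c := fun a c => by simp only [hz, qpow_add, map_mul]
  set A : ℕ → F := fun a => τ * z (m j - 2 * a) with hA
  set B : ℕ → F := fun a => z (2 * a - m j) with hB
  set c : ℕ → F := fun a => v (w.1.1 (ϱ - a • P.root j)) with hc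
  set e : ℕ → F := fun k => efac L τ ((k : ℤ) - m j) with he
  have he' : ∀ k : ℕ, e k = τ - z (2 * (k - m j)) := fun k => by simp [he, hz, efac]
  have hzz : ∀ x a : ℕ, z (2 * x - m j) = z (m j - 2 * a) * z (2 * ((x + a : ℕ) - m j)) :=
    fun x a => by rw [← hzadd]; push_cast; ring
  have hAB : ∀ a, A a * B a = τ := fun a => by
    rw [hA, hB, mul_assoc, ← hzadd]
    simp [hz, qpow_zero]
  have hsub : ∀ x a, A x + B x - (A a + B a) = (z (m j - 2 * x) - z (m j - 2 * a)) * e (x + a) :=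
    fun x a => by simp only [hA, hB, he']; rw [hzz x a, hzz a x, add_comm a x]; ring
  have hsub' : ∀ x, A x - B x = z (m j - 2 * x) * e (x + x) := fun x => by
    simp only [hA, hB, he']; rw [hzz x x]; ring
  set p : Polynomial F := ∏ a ∈ J, (Polynomial.X - Polynomial.C (A a + B a)) with hp
  have hdeg : p.degree < (m j : ℕ) := by
    rw [hp, degree_prod]
    simp only [degree_X_sub_C, sum_const, nsmul_eq_mul, mul_one]
    rw [hJ, card_erase_of_mem hnT, card_erase_of_mem h0T, hT, card_range]
    exact_mod_cast (by omega : m j + 1 - 1 - 1 < m j)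
  have hpe : ∀ x, p.eval (A x + B x) =
      ∏ a ∈ J, ((z (m j - 2 * x) - z (m j - 2 * a)) * e (x + a)) := fun x => by
    rw [hp, eval_prod]
    exact prod_congr rfl fun a _ => by rw [eval_sub, eval_X, eval_C, hsub]
  have key := sum_mul_eval_eq_zero T c A B τ (fun a _ => hAB a) (m j)
    (fun s hs => h.edge_sum hm w hj hw hs) p hdeg
  rw [← add_sum_erase _ _ h0T, ← add_sum_erase _ _ hnT, sum_eq_zero, add_zero, hpe, hpe, hsub',
    hsub', prod_mul_distrib, prod_mul_distrib] at key
  swap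
  · intro a ha
    rw [hp, eval_prod, prod_eq_zero ha (by simp), mul_zero]
  have hk : ∀ x : ℕ, algebraMap ℂ F (U x) = z (m j - 2 * x) *
      ∏ a ∈ J, (z (m j - 2 * x) - z (m j - 2 * a)) := fun x => by
    simp only [hU, map_mul, map_prod, map_sub, hz]
  have hE0 : e 0 * ∏ a ∈ J, e a = (∏ a ∈ range n, e a) * ∏ a ∈ Ioc n (m j), e a := by
    rw [← prod_insert (by simp [J]), ← prod_union (disjoint_left.2 fun a => by
      rw [mem_range, mem_Ioc]; omega)]
    congr 1; ext a
    simp only [J, T, mem_union, mem_range, mem_Ioc, mem_insert, mem_erase]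
    omega
  have hE1 : e (n + n) * ∏ a ∈ J, e (n + a) =
      (∏ a ∈ Ioc n (m j), e a) * ∏ k ∈ Icc 1 n, efac L τ k := by
    have h2 : (T.erase 0).image (n + ·) = Ioc n (m j) ∪ (Icc 1 n).image (m j + ·) := by
      ext a
      simp only [T, mem_union, mem_image, mem_Ioc, mem_erase, mem_range, mem_Icc]
      refine ⟨fun h => ?_, ?_⟩
      · by_cases h1 : a ≤ m j
        · omega
        · exact .inr ⟨a - m j, by omega, by omega⟩
      · rintro (h | ⟨c, h, rfl⟩)
        · exact ⟨a - n, by omega, by omega⟩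
        · exact ⟨m j + c - n, by omega, by omega⟩
    rw [mul_prod_erase (T.erase 0) (fun a => e (n + a)) hnT,
      ← prod_image (g := (n + ·)) (f := e) (fun a _ a' _ h => by simpa using h), h2, prod_union,
      prod_image fun a _ a' _ h => by simpa using h]
    · simp [he]
    · simp only [disjoint_left, mem_Ioc, mem_image, mem_Icc]; omega
  have key2 : c n * ∏ k ∈ Icc 1 n, efac L τ k =
      algebraMap ℂ F (-U 0 / U n) * (c 0 * ∏ a ∈ range n, e a) := by
    rw [map_div₀, map_neg, div_mul_eq_mul_div, eq_div_iff ((map_ne_zero _).2 hUn)]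
    refine mul_right_cancel₀ (prod_ne_zero_iff.2 fun a (_ : a ∈ Ioc n (m j)) =>
      efac_ne_zero hres ((a : ℤ) - m j)) ?_
    simp only [hk]
    simp only [zero_add] at key
    linear_combination key - (c 0 * (z (m j - 2 * (0 : ℕ)) *
      ∏ a ∈ J, (z (m j - 2 * (0 : ℕ)) - z (m j - 2 * a)))) * hE0 -
      (c n * (z (m j - 2 * n) * ∏ a ∈ J, (z (m j - 2 * n) - z (m j - 2 * a)))) * hE1
  simpa [hc] using key2

end Edge

/-! ### Coefficients at the vertices of the hull of `ρ_m` -/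

section Vertex

/-- `∏_{k ≤ m_α} (t_α - q ^ (± 2 k))`, with sign `+` if and only if `w⁻¹ α` is positive. -/
noncomputable def signFac (b : P.Base) (L : ℂ) {R : Type*} [CommRing R] [Algebra ℂ R] (t : ι → R)
    (m : ι → ℕ) (w : Weyl P) (i : ι) : R :=
  if b.IsPos (w⁻¹.1.2.2 i) then ∏ k ∈ Icc 1 (m i), efac L (t i) k
  else ∏ k ∈ Icc 1 (m i), efac L (t i) (-(k : ℤ))

lemma map_signFac {R R' : Type*} [CommRing R] [Algebra ℂ R] [CommRing R'] [Algebra ℂ R']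
    (φ : R →ₐ[ℂ] R') (t : ι → R) (w : Weyl P) (i : ι) :
    φ (signFac b L t m w i) = signFac b L (fun i => φ (t i)) m w i := by
  rw [signFac, signFac]
  grind [map_prod, map_efac]

lemma signFac_ne_zero {F : Type*} [Field F] [Algebra ℂ F] {t : ι → F} {i : ι}
    (h : NonRes L (t i)) (w : Weyl P) : signFac b L t m w i ≠ 0 := by
  rw [signFac]
  grind [prod_ne_zero_iff, efac_ne_zero]

lemma mul_refl_inv_apply (w : Weyl P) (j i : ι) : (w * 𝐬 j)⁻¹.1.2.2 i = ς j (w⁻¹.1.2.2 i) := by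
  rw [mul_inv_rev, reflTriple_inv]; rfl

lemma refl_vertex (hm : WInv P m) (w : Weyl P) {j : ι} (hj : j ∈ b.support) : (w * 𝐬 j).1.1 ϱ =
    w.1.1 (ϱ - m j • P.root j) := by
  rw [← refl_rhoN b hm hj]; rfl

lemma CoefAxial.vertex_step_pos (hL : NonRoot L) {F : Type*} [Field F] [Algebra ℂ F] {t : ι → F}
    (hm : WInv P m) {v : M → F} (h : CoefAxial b L t m 𝓗 v) (w : Weyl P) {j : ι}
    (hj : j ∈ b.support) (hw : b.IsPos (w.1.2.2 j)) (hres : NonRes L (t (w.1.2.2 j))) : ∃ u : ℂ, u ≠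
    0 ∧ v ((w * 𝐬 j).1.1 ϱ) * signFac b L t m w (w.1.2.2 j) = algebraMap ℂ F u *
    (v (w.1.1 ϱ) * signFac b L t m (w * 𝐬 j) (w.1.2.2 j)) := by
  obtain ⟨u, hu, key⟩ := exists_edge_relation b hL (F := F) hm hj le_rfl
  replace key := key h w hw hres
  refine ⟨u, hu, ?_⟩
  have h1 : w⁻¹.1.2.2 (w.1.2.2 j) = j := by simp
  rw [refl_vertex hm w hj, signFac, signFac, mul_refl_inv_apply, h1,
    if_pos (b.isPos_of_mem_support hj), if_neg (isPos_simple_neg b hj), invariant_weyl P hm, key]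
  congr 2
  refine prod_bij' (fun k _ => m j - k) (fun k _ => m j - k) (fun k hk => ?_) (fun k hk => ?_)
    (fun k hk => ?_) (fun k hk => ?_) fun k hk => ?_
  · grind
  · grind
  · rw [mem_range] at hk; omega
  · rw [mem_Icc] at hk; omega
  grind

lemma CoefAxial.vertex_step (hL : NonRoot L) {F : Type*} [Field F] [Algebra ℂ F] {t : ι → F}
    (hm : WInv P m) {v : M → F} (h : CoefAxial b L t m 𝓗 v) (hres : ∀ i ∈ R₊, NonRes L (t i))
    (w : Weyl P) {j : ι} (hj : j ∈ b.support) : ∃ i ∈ R₊, (∀ i' ∈ R₊, i' ≠ i →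
    (b.IsPos (w⁻¹.1.2.2 i') ↔ b.IsPos ((w * 𝐬 j)⁻¹.1.2.2 i'))) ∧ ∃ u : ℂ, u ≠ 0 ∧ v
    ((w * 𝐬 j).1.1 ϱ) * signFac b L t m w i = algebraMap ℂ F u *
    (v (w.1.1 ϱ) * signFac b L t m (w * 𝐬 j) i) := by
  have hiff : ∀ i ∈ R₊, ∀ i' ∈ R₊, i' ≠ i → (i = w.1.2.2 j ∨ i = ς (w.1.2.2 j) (w.1.2.2 j)) →
    (b.IsPos (w⁻¹.1.2.2 i') ↔ b.IsPos ((w * 𝐬 j)⁻¹.1.2.2 i')) := fun i hi i' hi' hne hij => by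
    have hpos : b.IsPos i := mem_posRoots.1 hi
    have hpos' : b.IsPos i' := mem_posRoots.1 hi'
    have hA : i' ≠ w.1.2.2 j := by
      rintro rfl
      rcases hij with h1 | h1
      · exact hne h1.symm
      · exact (isPos_neg_iff b _).1 (h1 ▸ hpos) hpos'
    have hB : i' ≠ ς (w.1.2.2 j) (w.1.2.2 j) := by
      rintro rfl
      rcases hij with h1 | h1
      · exact (isPos_neg_iff b _).1 hpos' (h1 ▸ hpos)
      · exact hne h1.symm
    rw [mul_refl_inv_apply]
    refine (isPos_simple_refl b hj (fun h1 => hA ?_) fun h1 => hB ?_).symm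
    · rw [← h1, weyl_inv_apply]
    · rw [← reflectionPerm_weyl, ← h1, weyl_inv_apply]
  rcases pos_or_neg b (w.1.2.2 j) with hw | hw
  · exact ⟨_, mem_posRoots.2 hw, fun i' hi' hne => hiff _ (mem_posRoots.2 hw) i' hi' hne
      (Or.inl rfl), h.vertex_step_pos hL hm w hj hw (hres _ (mem_posRoots.2 hw))⟩
  · have h1 : (w * 𝐬 j).1.2.2 j = ς (w.1.2.2 j) (w.1.2.2 j) := by rw [← reflectionPerm_weyl]; rfl
    have h2 : w * 𝐬 j * 𝐬 j = w := by rw [mul_assoc, reflTriple_mul_self, mul_one]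
    have hmem := mem_posRoots.2 hw
    obtain ⟨u, hu, key⟩ := h.vertex_step_pos hL hm (w * 𝐬 j) hj (by rwa [h1])
      (by rw [h1]; exact hres _ hmem)
    rw [h1, h2] at key
    refine ⟨_, hmem, fun i' hi' hne => hiff _ hmem i' hi' hne (Or.inr rfl), u⁻¹, inv_ne_zero hu, ?_⟩
    rw [key, ← mul_assoc, ← map_mul, inv_mul_cancel₀ hu, map_one, one_mul]

lemma CoefAxial.vertex_relation (hL : NonRoot L) {F : Type*} [Field F] [Algebra ℂ F] {t : ι → F}
    (hm : WInv P m) {v : M → F} (h : CoefAxial b L t m 𝓗 v) (hres : ∀ i ∈ R₊, NonRes L (t i))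
    (w : Weyl P) : ∃ u : ℂ, u ≠ 0 ∧ v (w.1.1 ϱ) * ∏ i ∈ R₊, signFac b L t m 1 i = algebraMap ℂ F u *
    (v ϱ * ∏ i ∈ R₊, signFac b L t m w i) := by
  suffices h1 : ∀ w : Weyl P, ∃ u : ℂ, u ≠ 0 ∧ v (w⁻¹.1.1 ϱ) * ∏ i ∈ R₊, signFac b
    L t m 1 i = algebraMap ℂ F u * (v ϱ * ∏ i ∈ R₊, signFac b L t m w⁻¹ i) by
    simpa only [inv_inv] using h1 w⁻¹
  intro w
  induction w using weyl_induction_simple b with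
  | one => exact ⟨1, one_ne_zero, by simp⟩
  | mul j hj w ih =>
    obtain ⟨u, hu, hu'⟩ := ih
    rw [mul_inv_rev, reflTriple_inv]
    obtain ⟨i, hi, hiff, u', hu0, key⟩ := h.vertex_step hL hm hres w⁻¹ hj
    have hprod : ∏ i' ∈ (R₊).erase i, signFac b L t m (w⁻¹ * 𝐬 j) i' = ∏
      i' ∈ (R₊).erase i, signFac b L t m w⁻¹ i' := by
      refine prod_congr rfl fun i' hi' => ?_
      rw [mem_erase] at hi'
      rw [signFac, signFac]
      simp only [hiff i' hi'.2 hi'.1]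
    refine ⟨u' * u, mul_ne_zero hu0 hu, ?_⟩
    grind [signFac_ne_zero, mul_prod_erase]

end Vertex

/-! ### Factorization in the coordinate ring -/

section Factor

lemma dvd_of_forall_prime {R : Type*} [CommRing R] [IsDomain R] [UniqueFactorizationMonoid R]
    {a c : R} (ha : a ≠ 0) (h : ∀ p, Prime p → p ∣ a → p ∣ c ∧ ¬ p ^ 2 ∣ a) : a ∣ c := by
  induction a using UniqueFactorizationMonoid.induction_on_prime with
  | h₁ => exact absurd rfl ha
  | h₂ x hx => exact hx.dvd
  | h₃ a p ha' hp ih =>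
    have h1 := h p hp (dvd_mul_right p a)
    have hpa : ¬ p ∣ a := fun ⟨r, hr⟩ => h1.2 ⟨r, by rw [hr]; ring⟩
    obtain ⟨r, rfl⟩ := ih ha' fun p' hp' hd => by
      obtain ⟨h2, h3⟩ := h p' hp' (hd.mul_left p)
      exact ⟨h2, fun h4 => h3 (h4.mul_left p)⟩
    obtain ⟨s, rfl⟩ := (hp.dvd_or_dvd h1.1).resolve_left hpa
    exact ⟨s, by ring⟩

lemma not_sq_dvd_prod {R κ : Type*} [CommRing R] [IsDomain R] {p : R} (hp : Prime p)
    (J : Finset κ) (f : κ → R) (h1 : ∀ j ∈ J, ¬ p ^ 2 ∣ f j)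
    (h2 : ∀ j ∈ J, ∀ k ∈ J, p ∣ f j → p ∣ f k → j = k) : ¬ p ^ 2 ∣ ∏ j ∈ J, f j := fun h => by
  obtain ⟨j, hj, hpj⟩ := hp.exists_mem_finset_dvd (dvd_trans (dvd_pow_self p two_ne_zero) h)
  rw [← mul_prod_erase _ _ hj] at h
  refine h1 j hj (hp.pow_dvd_of_dvd_mul_right 2 (fun h3 => ?_) h)
  obtain ⟨k, hk, hpk⟩ := hp.exists_mem_finset_dvd h3
  grind

variable (b)

/-- The invariant derivation of the coordinate ring in the direction `ξ`. -/
noncomputable def torusDer (ξ : M) :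
    Derivation ℂ (MvPolynomial b.support ℂ) (MvPolynomial b.support ℂ) :=
  MvPolynomial.mkDerivation ℂ fun j => P.coroot' j ξ • MvPolynomial.X j

lemma torusDer_torusMon {i : ι} (hi : b.IsPos i) (ξ : M) :
    torusDer b ξ (torusMon b i) = P.coroot' i ξ • torusMon b i := by
  rw [torusDer, torusMon, MvPolynomial.mkDerivation_monomial, one_smul, coroot'_eq_sum b hi,
    sum_smul, Finsupp.sum_fintype _ _ (by simp)]
  refine sum_congr rfl fun j _ => ?_
  rcases Nat.eq_zero_or_pos (corootExp b i j) with h | h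
  · rw [h]; simp
  · rw [smul_eq_mul, mul_smul_comm, MvPolynomial.X, MvPolynomial.monomial_mul, mul_one,
      tsub_add_cancel_of_le (Finsupp.single_le_iff.2 h), smul_monomial,
      smul_monomial, smul_eq_mul, smul_eq_mul, mul_one, mul_comm]

lemma torusDer_efac {i : ι} (hi : b.IsPos i) (ξ : M) (n : ℤ) :
    torusDer b ξ (efac L (torusMon b i) n) = P.coroot' i ξ • torusMon b i := by
  rw [efac, map_sub, torusDer_torusMon b hi, Derivation.map_algebraMap, sub_zero]

lemma not_dvd_algebraMap {p : MvPolynomial b.support ℂ} (hp : Prime p) {c : ℂ} (hc : c ≠ 0) :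
    ¬ p ∣ algebraMap ℂ _ c := fun h =>
  hp.not_isUnit (isUnit_of_dvd_unit h ((isUnit_iff_ne_zero.2 hc).map _))

lemma exists_corootExp_ne_zero {i : ι} (hi : b.IsPos i) : ∃ j, corootExp b i j ≠ 0 := by
  by_contra hno
  have h1 := coroot'_eq_sum b hi (P.root i)
  simp_all

lemma not_dvd_torusMon {p : MvPolynomial b.support ℂ} (hp : Prime p) {i : ι} (hi : b.IsPos i)
    {n : ℤ} (h : p ∣ efac L (torusMon b i) n) (k : ι) : ¬ p ∣ torusMon b k := fun hk => by
  rw [torusMon, MvPolynomial.monomial_eq, C_1, one_mul, Finsupp.prod] at hk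
  obtain ⟨j, -, hj⟩ := hp.exists_mem_finset_dvd hk
  have h1 : MvPolynomial.X j ∣ efac L (torusMon b i) n :=
    (hp.associated_of_dvd (X_prime (i := j)) (hp.dvd_of_dvd_pow hj)).dvd_iff_dvd_left.1 h
  obtain ⟨r, hr⟩ := h1
  have h2 := congrArg (eval (0 : b.support → ℂ)) hr
  obtain ⟨l, hl⟩ := exists_corootExp_ne_zero b hi
  rw [map_mul, MvPolynomial.eval_X, Pi.zero_apply, zero_mul, efac, map_sub, torusMon,
    eval_monomial, Finsupp.prod_fintype _ _ (by simp),
    prod_eq_zero (mem_univ l) (by rw [Pi.zero_apply, zero_pow hl]), mul_zero,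
    algebraMap_eq, MvPolynomial.eval_C, zero_sub, neg_eq_zero] at h2
  exact qpow_ne_zero _ _ h2

lemma not_sq_dvd_efac {p : MvPolynomial b.support ℂ} (hp : Prime p) {i : ι} (hi : b.IsPos i)
    (n : ℤ) : ¬ p ^ 2 ∣ efac L (torusMon b i) n := fun h => by
  refine not_dvd_torusMon b hp hi (dvd_trans (dvd_pow_self p two_ne_zero) h) i ?_
  have h1 := torusDer_efac b (L := L) hi ((1 / 2 : ℂ) • P.root i) n
  have h2 : P.coroot' i ((1 / 2 : ℂ) • P.root i) = 1 := by simp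
  obtain ⟨r, hr⟩ := h
  rw [hr, h2, one_smul, Derivation.leibniz, Derivation.leibniz_pow] at h1
  rw [← h1, smul_eq_mul, smul_eq_mul, nsmul_eq_mul]
  refine dvd_add (Dvd.dvd.mul_right (dvd_pow_self p two_ne_zero) _) (Dvd.dvd.mul_left ?_ _)
  refine Dvd.dvd.mul_left ?_ _
  simp

lemma eq_of_dvd_efac {p : MvPolynomial b.support ℂ} (hp : Prime p) {i k : ι} (hi : b.IsPos i)
    (hk : b.IsPos k) {n n' : ℤ} (h : p ∣ efac L (torusMon b i) n)
    (h' : p ∣ efac L (torusMon b k) n') : i = k := by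
  by_contra hik
  have h1 : P.flip.root k ≠ P.flip.root i := fun h => hik (P.coroot.injective h).symm
  have h2 : P.flip.root k ≠ -P.flip.root i := fun h => by simp_all [isPos_neg_iff]
  obtain ⟨ξ, hξ, hξ'⟩ := exists_transversal P.flip i
  have hξi : P.coroot' i ξ = 0 := hξ
  have hξk : P.coroot' k ξ ≠ 0 := hξ' k h1 h2
  have h4 : p ∣ torusDer b ξ p := by
    have h5 := torusDer_efac b (L := L) hi ξ n
    obtain ⟨r, hr⟩ := h
    rw [hr, hξi, zero_smul, Derivation.leibniz, smul_eq_mul, smul_eq_mul] at h5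
    have h6 : p ∣ r * torusDer b ξ p := (dvd_add_right (dvd_mul_right p _)).1 (h5 ▸ dvd_zero p)
    refine (hp.dvd_or_dvd h6).resolve_left fun ⟨s, hs⟩ => not_sq_dvd_efac b (L := L) hp hi n ?_
    exact ⟨s, by rw [hr, hs]; ring⟩
  have h5 := torusDer_efac b (L := L) hk ξ n'
  have h7 := not_dvd_torusMon b hp hi h k
  obtain ⟨r, hr⟩ := h'
  rw [hr, Derivation.leibniz, smul_eq_mul, smul_eq_mul] at h5
  have h6 : p ∣ P.coroot' k ξ • torusMon b k := by
    rw [← h5]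
    exact dvd_add (dvd_mul_right p _) (h4.mul_left _)
  simp_all [Algebra.smul_def]

lemma eq_of_dvd_efac' (hL : NonRoot L) {p : MvPolynomial b.support ℂ} (hp : Prime p) {i : ι}
    {n n' : ℤ} (h : p ∣ efac L (torusMon b i) n) (h' : p ∣ efac L (torusMon b i) n') : n = n' := by
  by_contra hne
  have h1 := dvd_sub h h'
  rw [efac, efac, sub_sub_sub_cancel_left, ← map_sub] at h1
  refine not_dvd_algebraMap b hp (sub_ne_zero.2 fun h2 => hne ?_) h1
  have := hL.qpow_inj (m := 2 * n') (n := 2 * n) (by push_cast; exact h2)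
  omega

lemma efac_torusMon_ne_zero {i : ι} (hi : b.IsPos i) (n : ℤ) :
    efac L (torusMon b i) n ≠ 0 := fun h => by
  have h1 := torusDer_efac b (L := L) hi (P.root i) n
  rw [h, map_zero] at h1
  have h2 : P.coroot' i (P.root i) = 2 := by simp
  rw [h2] at h1
  exact (smul_ne_zero two_ne_zero (by rw [torusMon]; simp)) h1.symm

lemma exists_normalized_torus [P.IsIrreducible] (hL : NonRoot L) (hm : WInv P m) : ∃ v : M →
    MvPolynomial b.support ℂ, CoefAxial b L (torusMon b) m 𝓗 v ∧ v ϱ = ∏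
    i ∈ R₊, ∏ k ∈ Icc 1 (m i), efac L (torusMon b i) k := by
  set R := MvPolynomial b.support ℂ
  let sf := signFac b L (torusMon b) m
  set S := 𝓗
  have hρS : ϱ ∈ S := mem_hullF.2 ((isDominant_rhoN b hm).mem_hull b)
  set K := FractionRing R
  set φK : R →ₐ[ℂ] K := IsScalarTower.toAlgHom ℂ R K
  have hφK : Injective φK := IsFractionRing.injective R K
  have hresK : ∀ i ∈ R₊, NonRes L (φK (torusMon b i)) := fun i hi n h => by
    refine efac_torusMon_ne_zero b (L := L) (mem_posRoots.1 hi) n (hφK ?_)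
    rw [map_efac, efac, h, sub_self, map_zero]
  have hlead : ∀ v : M → R, CoefAxial b L (torusMon b) m S v → (∃ μ ∈ S, v μ ≠ 0) → v ϱ ≠
    0 := by
    rintro v hv ⟨μ, hμ, hne⟩ h0
    refine hne (hφK ?_)
    rw [map_zero]
    exact (hv.map φK).eq_zero hL hm hresK (by rw [h0, map_zero]) μ hμ
  set Z : Set R := {a | ∃ v : M → R, CoefAxial b L (torusMon b) m S v ∧ (∃ μ ∈ S, v μ ≠ 0) ∧
    v ϱ = a}
  obtain ⟨v₀, hv₀, hv₀'⟩ := exists_coefAxial_torus b hL hm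
  obtain ⟨a, ⟨v, hv, hne, rfl⟩, hmin⟩ := (wellFounded_dvdNotUnit (α := R)).has_min Z
    ⟨_, v₀, hv₀', hv₀, rfl⟩
  have hprim : ∀ p, Prime p → ∃ μ ∈ S, ¬ p ∣ v μ := fun p hp => by
    by_contra hno
    push Not at hno
    choose! v' hv' using fun μ (hμ : μ ∈ S) => (hno μ hμ)
    have hax : CoefAxial b L (torusMon b) m S v' :=
      (hv.congr (fun _ _ => rfl) (fun μ hμ => (hv' μ hμ).symm)).of_mul hp.ne_zero
    have hne' : ∃ μ ∈ S, v' μ ≠ 0 := by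
      obtain ⟨μ, hμ, h1⟩ := hne
      exact ⟨μ, hμ, fun h => h1 (by rw [hv' μ hμ, h, mul_zero])⟩
    refine hmin _ ⟨v', hax, hne', rfl⟩ ⟨hlead v' hax hne', p, hp.not_isUnit, ?_⟩
    rw [hv' _ hρS, mul_comm]
  have hdvd : v ϱ ∣ ∏ i ∈ R₊, ∏ k ∈ Icc 1 (m i), efac L (torusMon b i) k := by
    refine dvd_of_forall_prime (hlead v hv hne) fun p hp hpv => ?_
    set I : Ideal R := Ideal.span {p}
    have hI : I.IsPrime := (Ideal.span_singleton_prime hp.ne_zero).2 hp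
    set Kp := FractionRing (R ⧸ I)
    set φ : R →ₐ[ℂ] Kp := (IsScalarTower.toAlgHom ℂ (R ⧸ I) Kp).comp (Ideal.Quotient.mkₐ ℂ I)
    have hφ : ∀ r, φ r = 0 ↔ p ∣ r := fun r => by
      have h1 : φ r = algebraMap (R ⧸ I) Kp (Ideal.Quotient.mk I r) := rfl
      rw [h1, map_eq_zero_iff _ (IsFractionRing.injective (R ⧸ I) Kp),
        Ideal.Quotient.eq_zero_iff_mem, Ideal.mem_span_singleton]
    have haxp := hv.map φ
    obtain ⟨μ, hμ, hpμ⟩ := hprim p hp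
    have hnep : ∃ μ ∈ S, φ (v μ) ≠ 0 := ⟨μ, hμ, fun h => hpμ ((hφ _).1 h)⟩
    have hex : ∃ i ∈ R₊, ∃ n : ℤ, p ∣ efac L (torusMon b i) n := by
      by_contra hno
      push Not at hno
      refine hpμ ((hφ _).1 (haxp.eq_zero hL hm (fun i hi n h => hno i hi n ?_) ((hφ _).2 hpv) μ hμ))
      rw [← hφ, map_efac, efac, h, sub_self]
    obtain ⟨i, hi, n₀, hin⟩ := hex
    have hipos := mem_posRoots.1 hi
    have huniq : ∀ k ∈ R₊, ∀ n : ℤ, p ∣ efac L (torusMon b k) n → k = i :=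
      fun k hk n h => (eq_of_dvd_efac b hp hipos (mem_posRoots.1 hk) hin h).symm
    obtain ⟨j, hj, w, hwj⟩ := exists_simple_weyl b hipos
    obtain ⟨n, hn, hvn⟩ := haxp.exists_edge hL hm w hj (fun k hk hk1 _ n h => by
      refine hk1 ((huniq k hk n ?_).trans hwj.symm)
      rw [← hφ, map_efac, efac, h, sub_self]) hnep
    have hpn : ¬ p ∣ v (w.1.1 (ϱ - n • P.root j)) := fun h => hvn ((hφ _).2 h)
    obtain ⟨u, hu, hedge⟩ := exists_edge_relation b hL (F := FractionRing R) hm hj hn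
    replace hedge := hedge (hv.map φK) w (by rwa [hwj]) (by rw [hwj]; exact hresK i hi)
    have hedgeR : v (w.1.1 (ϱ - n • P.root j)) * ∏ k ∈ Icc 1 n, efac L (torusMon b i) k = algebraMap
      ℂ R u * (v (w.1.1 ϱ) * ∏ k ∈ range n, efac L (torusMon b i) ((k : ℤ) - m j)) := by
      apply hφK
      simp only [map_mul, map_prod, map_efac, AlgHom.commutes]
      rwa [← hwj]
    obtain ⟨u', hu', hvert⟩ := (hv.map φK).vertex_relation hL hm hresK w
    have hvertR : v (w.1.1 ϱ) * ∏ i ∈ R₊, sf 1 i =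
      algebraMap ℂ R u' * (v ϱ * ∏ i ∈ R₊, sf w i) := by
      apply hφK
      simp only [sf, map_mul, map_prod, map_signFac, AlgHom.commutes]
      exact hvert
    have hsw : sf w i = sf 1 i := by
      simp only [sf, signFac]
      have h1 : w⁻¹.1.2.2 i = j := by have := weyl_inv_apply P w⁻¹ j; rwa [inv_inv, hwj] at this
      have h2 : (1 : Weyl P)⁻¹.1.2.2 i = i := rfl
      rw [h1, h2, if_pos (b.isPos_of_mem_support hj), if_pos hipos]
    have hsnz : sf 1 i ≠ 0 := fun h => by
      refine signFac_ne_zero (b := b) (m := m) (t := fun i => φK (torusMon b i)) (hresK i hi) 1 ?_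
      have := congrArg φK h
      rwa [show sf = _ from rfl, map_signFac, map_zero] at this
    rw [← mul_prod_erase _ (fun i => sf 1 i) hi,
      ← mul_prod_erase _ (fun i => sf w i) hi, hsw] at hvertR
    have hvert2 : v (w.1.1 ϱ) * ∏ k ∈ (R₊).erase i, sf 1 k = v ϱ *
      (algebraMap ℂ R u' * ∏ k ∈ (R₊).erase i, sf w k) := by
      refine mul_left_cancel₀ hsnz ?_
      linear_combination hvertR
    have hpe : ¬ p ∣ ∏ k ∈ (R₊).erase i, sf 1 k := fun h => by
      obtain ⟨k, hk, h1⟩ := hp.exists_mem_finset_dvd h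
      rw [mem_erase] at hk
      simp only [sf, signFac] at h1
      split_ifs at h1 <;>
      · obtain ⟨l, -, h2⟩ := hp.exists_mem_finset_dvd h1
        exact hk.1 (huniq k hk.2 _ h2)
    have hlift : ∀ e : ℕ, p ^ e ∣ v ϱ → p ^ e ∣ ∏ k ∈ Icc 1 n, efac L (torusMon b i) k :=
      fun e he => by
      have h1 : p ^ e ∣ v (w.1.1 ϱ) := hp.pow_dvd_of_dvd_mul_right e hpe (hvert2 ▸ he.mul_right _)
      exact hp.pow_dvd_of_dvd_mul_left e hpn (hedgeR ▸ (h1.mul_right _).mul_left _)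
    refine ⟨?_, fun h => not_sq_dvd_prod hp _ _ (fun k _ => not_sq_dvd_efac b hp hipos _)
      (fun k _ k' _ h1 h2 => by exact_mod_cast eq_of_dvd_efac' b hL hp h1 h2) (hlift 2 h)⟩
    have h1 := hlift 1 (by rwa [pow_one])
    rw [pow_one] at h1
    obtain ⟨k, hk, hpk⟩ := hp.exists_mem_finset_dvd h1
    have hmi : m i = m j := by rw [← hwj, invariant_weyl P hm]
    refine dvd_trans hpk (dvd_trans ?_ (dvd_prod_of_mem _ hi))
    refine dvd_prod_of_mem (fun k : ℕ => efac L (torusMon b i) k) ?_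
    rw [mem_Icc] at hk ⊢
    omega
  obtain ⟨g, hg⟩ := hdvd
  exact ⟨fun μ => g * v μ, hv.mul g, by rw [hg, mul_comm]⟩

end Factor

/-! ### The Baker–Akhiezer function -/

section BA

/-- The normalized coefficients `ψ_κ(ξ)` of the Baker–Akhiezer function in the variable `x`. -/
structure IsBACoef (b : P.Base) (L : ℂ) (m : ι → ℕ) (ψ : M → M → ℂ) : Prop where
  axial : ∀ ξ, CoefAxial b L (fun i => qpow L (2 * P.coroot' i ξ)) m (hullF b (rhoN b m))
    fun κ => ψ κ ξ
  lead : ∀ ξ, ψ (rhoN b m) ξ = ∏ i ∈ posRoots b, ∏ j ∈ Icc 1 (m i), brk L (j - P.coroot' i ξ)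
  mem : ∀ κ, ψ κ ∈ expSpace P.flip L {ν | ν + rhoN b.flip m ∈ rootCone b.flip}
  zero : ∀ κ ∉ hullF b (rhoN b m), ψ κ = 0

lemma eval_mem_expSpace (b : P.Base) (L : ℂ)
    (p : MvPolynomial b.support ℂ) : (fun ξ => eval (torusPt b L ξ) p) ∈ expSpace P.flip L
    (rootCone b.flip : Set N) := by
  induction p using MvPolynomial.induction_on with
  | C a =>
    convert smul_mem _ a (exp_mem_expSpace P.flip L (zero_mem (rootCone b.flip))) using 1
    funext ξ
    simp [qpow_zero]
  | add p r hp hr => simp only [map_add]; exact add_mem hp hr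
  | mul_X p j hp =>
    convert exp_mul_mem_expSpace P.flip L (κ := P.coroot j) (fun μ hμ =>
      add_mem (simple_mem_rootCone b.flip j.2) hμ) hp using 1
    funext ξ
    rw [map_mul, MvPolynomial.eval_X, mul_comm]; rfl

lemma exists_isBACoef [P.IsIrreducible] (b : P.Base) (hL : NonRoot L)
    (hm : WInv P m) : ∃ ψ, IsBACoef b L m ψ := by
  obtain ⟨v, hv, hlead⟩ := exists_normalized_torus b hL hm
  set c : ℂ := ∏ i ∈ posRoots b, ∏ j ∈ Icc 1 (m i), -qpow L (-j) with hc
  have hae : ∀ ξ p, MvPolynomial.aeval (torusPt b L ξ) p = eval (torusPt b L ξ) p :=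
    fun ξ p => by rfl
  have hfac : ∀ ξ, ε (P.flip.toLinearMap (-rhoN b.flip m) ξ) = ∏ i ∈ posRoots b, ∏ j ∈ Icc 1 (m i),
    qpow L (-P.coroot' i ξ) := fun ξ => by
    rw [map_neg₂, pair_rho, posRoots_flip, mul_neg, ← mul_assoc,
      mul_one_div_cancel two_ne_zero, one_mul, ← sum_neg_distrib, qpow_sum]
    refine prod_congr rfl fun i _ => ?_
    rw [prod_const, Nat.card_Icc, Nat.add_sub_cancel, ← qpow_nat_mul, mul_neg]; rfl
  refine ⟨fun κ ξ => if κ ∈ hullF b (rhoN b m) then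
    c * (ε (P.flip.toLinearMap (-rhoN b.flip m) ξ) * eval (torusPt b L ξ) (v κ)) else 0, fun ξ =>
      ?_, fun ξ => ?_, fun κ => ?_, fun κ hκ => ?_⟩
  · refine ((hv.map (MvPolynomial.aeval (torusPt b L ξ))).mul
      (c * ε (P.flip.toLinearMap (-rhoN b.flip m) ξ))).congr (fun i hi => ?_) fun κ hκ => ?_
    · grind [eval_torusMon, mem_posRoots]
    grind
  · rw [if_pos (mem_hullF.2 ((isDominant_rhoN b hm).mem_hull b)), hlead, hfac, hc, map_prod,
      ← prod_mul_distrib, ← prod_mul_distrib]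
    refine prod_congr rfl fun i hi => ?_
    rw [map_prod, ← prod_mul_distrib, ← prod_mul_distrib]
    refine prod_congr rfl fun j _ => ?_
    rw [efac, map_sub, eval_torusMon b L (mem_posRoots.1 hi), algebraMap_eq,
      MvPolynomial.eval_C, brk]
    have e1 : qpow L (j - P.coroot' i ξ) = qpow L (-j) * qpow L (-P.coroot' i ξ) * ε j := by
      rw [← qpow_add, ← qpow_add]; ring
    have e2 : qpow L (-(j - P.coroot' i ξ)) = qpow L (-j) * qpow L (-P.coroot' i ξ) * ε
      (P.coroot' i ξ) := by rw [← qpow_add, ← qpow_add]; ring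
    rw [e1, e2]
    push_cast
    ring
  · by_cases hκ : κ ∈ hullF b (rhoN b m)
    · simp only [if_pos hκ]
      exact smul_mem _ c (exp_mul_mem_expSpace P.flip L (fun μ hμ => by
        rw [mem_ofPred_eq, neg_add_cancel_comm]; exact hμ) (eval_mem_expSpace b L (v κ)))
    · simp only [if_neg hκ]
      exact zero_mem _
  · simp only [if_neg hκ]
    rfl

/-- Spectral parameters off all resonances. -/
def IsNonRes (b : P.Base) (L : ℂ) (ξ : M) : Prop :=
  ∀ i ∈ posRoots b, NonRes L (qpow L (2 * P.coroot' i ξ))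

lemma countable_resonances (hL : L ≠ 0) (a : ℂ) {r : ℂ} (hr : r ≠ 0) :
    {t : ℂ | ¬ NonRes L (ε (a + t * r))}.Countable := by
  refine (Set.countable_range fun x : ℤ × ℤ =>
    ((2 * x.1 * L + x.2 * (2 * Real.pi * Complex.I)) / (2 * L) - a) / r).mono fun t ht => ?_
  simp only [NonRes, not_forall, not_not, mem_ofPred_eq] at ht
  obtain ⟨n, hn⟩ := ht
  obtain ⟨k, hk⟩ := Complex.exp_eq_exp_iff_exists_int.1 hn
  refine ⟨(n, k), ?_⟩
  grind

lemma dense_nonRes (hL : L ≠ 0) (I : Finset ι) (ξ v : M) (hv : ∀ i ∈ I, P.coroot' i v ≠ 0) :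
    Dense {t : ℂ | ∀ i ∈ I, NonRes L (ε (P.coroot' i (ξ + t • v)))} := by
  have h1 : (⋃ i ∈ I, {t : ℂ | ¬ NonRes L (ε (P.coroot' i ξ + t * P.coroot' i v))}).Countable :=
    I.countable_toSet.biUnion fun i hi => countable_resonances hL _ (hv i hi)
  convert h1.dense_compl ℂ using 1
  ext t
  simp

lemma eq_of_isNonRes (b : P.Base) (hL : L ≠ 0) {F G : M → ℂ} (hF : ∀ x v,
    Continuous fun t : ℂ => F (x + t • v)) (hG : ∀ x v, Continuous fun t : ℂ => G (x + t • v))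
    (h : ∀ ξ, IsNonRes b L ξ → F ξ = G ξ) : F = G := by
  funext ξ
  have hd := dense_nonRes hL (posRoots b) ξ (sumFundCo b.flip) fun i _ => root'_sumFundCo_ne_zero b.flip i
  have := congrFun ((hF ξ _).ext_on hd (hG ξ (sumFundCo b.flip)) fun t ht => h _ ht) 0
  simpa using this

lemma IsBACoef.lead_ne_zero {ψ : M → M → ℂ} (h : IsBACoef b L m ψ) {ξ : M} (hξ : ∀ i ∈ R₊,
    ∀ k ∈ Icc 1 (m i), ε (P.coroot' i ξ) ≠ ε (k : ℤ)) : ψ ϱ ξ ≠ 0 := by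
  rw [h.lead]
  refine prod_ne_zero_iff.2 fun i hi => prod_ne_zero_iff.2 fun j hj => ?_
  rw [Ne, brk_eq_zero]
  intro h1
  refine hξ i hi j hj ?_
  simp_all [mul_sub, qpow_sub, div_eq_one_iff_eq, qpow_ne_zero]

/-- The Baker–Akhiezer function with coefficients `ψ`. -/
noncomputable def baFn (b : P.Base) (L : ℂ) (m : ι → ℕ) (ψ : M → M → ℂ) (ξ : M) (x : N) : ℂ :=
  expSum P L (shiftF ξ (hullF b (rhoN b m)) fun κ => ψ κ ξ) x

lemma baFn_eq (ψ : M → M → ℂ) (ξ : M) (x : N) : baFn b L m ψ ξ x = ε (P.1 ξ x) * ∑ κ ∈ 𝓗, ψ κ ξ *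
    ε (P.1 κ x) := expSum_shiftF P L ξ _ _ x

lemma IsBACoef.funAxial {ψ : M → M → ℂ} (h : IsBACoef b L m ψ) (hL : NonRoot L) (hm : WInv P m)
    (ξ : M) : FunAxial P L m (baFn b L m ψ ξ) :=
    (funAxial_shiftF_iff b hL.ne_zero hm ξ (isWeight_hull_rho b hm) _).2 (h.axial ξ)

lemma IsBACoef.unique {ψ : M → M → ℂ} (h : IsBACoef b L m ψ) (hL : NonRoot L) (hm : WInv P m)
    {ξ : M} (hξ : IsNonRes b L ξ) {v : M → ℂ} (hv : FunAxial P L m (𝓔 (shiftF ξ 𝓗 v))) : ∀ κ ∈ 𝓗, v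
    κ * ψ ϱ ξ = v ϱ * ψ κ ξ := by
  have h1 := (funAxial_shiftF_iff b hL.ne_zero hm ξ (isWeight_hull_rho b hm) v).1 hv
  have h2 : CoefAxial b L (fun i => ε (P.coroot' i ξ)) m 𝓗 fun κ => ψ ϱ ξ * v κ - v ϱ * ψ κ ξ :=
    fun i hi μ hμ s hs => by
    have e1 := h1.mul (ψ ϱ ξ) i hi μ hμ s hs
    have e2 := (h.axial ξ).mul (v ϱ) i hi μ hμ s hs
    rw [← sub_self (0 : ℂ)]
    nth_rw 1 [← e1]
    rw [← e2, ← sum_sub_distrib]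
    exact sum_congr rfl fun κ _ => by ring
  intro κ hκ
  have := h2.eq_zero hL hm hξ (by rw [mul_comm, sub_self]) κ hκ
  grind

lemma lineDiff_of_mem_expSpace {G : Set N} {F : M → ℂ} (hF : F ∈ expSpace P.flip L G) :
    LineDiff F := fun x v => differentiable_line P.flip L hF x v

end BA

/-! ### Equivariance and duality of the Baker–Akhiezer function -/

section Equivariance

lemma FunAxial.comp_weyl {F : N → ℂ} (hF : FunAxial P L m F) (hm : WInv P m)
    (w : Weyl P) : FunAxial P L m fun x => F (w.1.2.1 x) := fun i s hs x hx => by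
  have := hF (w.1.2.2 i) s (by rwa [invariant_weyl P hm]) (w.1.2.1 x) (by rwa [root'_weyl])
  grind [map_smul, coroot_weyl]

lemma FunAxial.exp_mul {F : N → ℂ} (hF : FunAxial P L m F) {κ : M} (hκ : ∀ i,
    ε (P.coroot' i κ) = 1) : FunAxial P L m fun x => ε (P.1 κ x) * F x := fun i s hs x hx => by
  have e : x + (s : ℂ) ⊙ i = x - (s : ℂ) ⊙ i + s • P.coroot i := by module
  have e' : 2 * P.1 κ (s • P.coroot i) = s * (2 * P.coroot' i κ) := by
    rw [map_nsmul, nsmul_eq_mul, mul_left_comm]; rfl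
  simp only
  rw [hF i s hs x hx, e, qpow_pair_add, e', qpow_nat_mul, hκ, one_pow, mul_one]

lemma CoefAxial.eq_zero_of_antisymm (hL : NonRoot L) {t : ι → ℂ} {S : Finset M} {v : M → ℂ}
    (h : CoefAxial b L t m S v) (hS : ∀ μ ∈ S, IsWeight P μ) {i : ι} (hi : i ∈ R₊) {s : ℕ}
    (hs : s ≤ m i) (ht : t i = ε s) (hres : ∀ k ∈ R₊, k ≠ i → NonRes L (t k)) (hrS : ∀ κ ∈ S,
    κ - (zp P i κ + s) • P.root i ∈ S) (hrv : ∀ κ ∈ S, v (κ - (zp P i κ + s) • P.root i) = -v κ)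
    {y : N} (hy : RegDom b y) (hw : ∀ p ∈ S, ∀ p' ∈ S,
    (P.1 p y).re - (P.1 p' y).re ≤ 2 * (P.1 ϱ y).re + s * (P.root' i y).re) : ∀ κ ∈ S, v κ = 0 := by
  by_contra! hne
  have hpos : ∀ k ∈ R₊, 0 < (P.root' k y).re := fun k hk => by
    obtain ⟨r, hr, hr'⟩ := hy.root'_pos b (mem_posRoots.1 hk)
    rwa [hr']
  set c : ι → ℝ := fun k => m k + if k = i then (m i + 1 : ℝ) else 0 with hc
  obtain ⟨p, hp, p', hp', hpp⟩ := MacBA.exists_width (S.filter fun μ => v μ ≠ 0)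
    (by obtain ⟨μ, h1, h2⟩ := hne; exact ⟨μ, mem_filter.2 ⟨h1, h2⟩⟩) R₊ P.root
    (rePair P y) (fun k hk => (hpos k hk).ne') (fun k hk j hj hij r => by
      rw [← Complex.coe_smul]
      exact posRoots_not_parallel b (mem_posRoots.1 hk) (mem_posRoots.1 hj) hij _)
    c (fun k hk μ hμ => by
      rw [mem_filter] at hμ
      by_cases hki : k = i
      · subst hki
        obtain ⟨p, h1, h2, p', h3, h4, K, r, h5, h6, h7⟩ :=
          h.exists_string_of_antisymm hL hS hk s ht hrS hrv hμ.1 hμ.2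
        have h5' : (2 * m k + 1 : ℝ) ≤ K := by exact_mod_cast h5
        exact ⟨p, mem_filter.2 ⟨h1, h2⟩, p', mem_filter.2 ⟨h3, h4⟩, K, r,
          by grind, by rw [h6, cast_smul_eq_zsmul],
          by rw [h7, cast_smul_eq_zsmul]⟩
      · obtain ⟨p, h1, h2, p', h3, h4, K, r, h5, h6, h7⟩ :=
          h.exists_string hL hS hk (hres k hk hki) hμ.1 hμ.2
        exact ⟨p, mem_filter.2 ⟨h1, h2⟩, p', mem_filter.2 ⟨h3, h4⟩, K, r,
          by simp only [hc, if_neg hki, add_zero]; exact_mod_cast h5,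
          by rw [h6, cast_smul_eq_zsmul], by rw [h7, cast_smul_eq_zsmul]⟩)
  have h1 := hw p (mem_filter.1 hp).1 p' (mem_filter.1 hp').1
  have h2 : ∑ k ∈ R₊, c k * |rePair P y (P.root k)| = 2 * (P.1 ϱ y).re + (m i + 1) *
    (P.root' i y).re := by
    have e : ∀ k ∈ R₊, c k * |rePair P y (P.root k)| = ((m k : ℂ) * P.root' k y).re + if k = i then
      (m i + 1) * (P.root' i y).re else 0 := fun k hk => by
      have e1 : rePair P y (P.root k) = (P.root' k y).re := rfl
      rw [e1, abs_of_pos (hpos k hk), hc, ← ofReal_natCast, re_ofReal_mul]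
      simp only
      split_ifs with hki
      · rw [hki]; ring
      · ring
    rw [sum_congr rfl e, sum_add_distrib, sum_ite_eq' R₊, if_pos hi, rhoN, pair_rho, ← re_sum]
    rw [← Complex.ofReal_ofNat, ← Complex.ofReal_one, ← Complex.ofReal_div, re_ofReal_mul]
    ring
  rw [h2, rePair_apply, rePair_apply] at hpp
  have := hpos i hi
  have : (s : ℝ) ≤ m i := by exact_mod_cast hs
  nlinarith

lemma re_pair_le_of_mem_hull (hm : WInv P m) {y : N}
    (hy : RegDom b y) {μ : M} (h : μ ∈ hull b ϱ) :
    |(P.1 μ y).re| ≤ (P.1 ϱ y).re := by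
  have key : ∀ d ∈ rootCone b, 0 ≤ (P.1 d y).re := fun d hd => by
    obtain ⟨r, hr, hr'⟩ := pair_nonneg b (mem_rootCone.1 hd).1 (y := y) fun j hj => by
      obtain ⟨r, hr, hr'⟩ := hy.root'_pos b (b.isPos_of_mem_support hj)
      exact ⟨r, hr.le, hr'⟩
    rwa [hr']
  have h1 := key _ (sub_mem_hull b h)
  have h2 := key _ (add_rho_mem b hm h)
  grind [map_sub₂, sub_re, map_add₂, add_re]

variable {ψ : M → M → ℂ}

lemma IsBACoef.sum_subset (h : IsBACoef b L m ψ) {S : Finset M} (hS : 𝓗 ⊆ S) (ξ : M) (F : M →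
    ℂ) : ∑ κ ∈ S, ψ κ ξ * F κ = ∑ κ ∈ 𝓗, ψ κ ξ * F κ :=
    (Finset.sum_subset hS fun κ _ hκ => by rw [h.zero κ hκ]; simp).symm

lemma IsBACoef.eq_reflect (h : IsBACoef b L m ψ) (hL : NonRoot L) (hm : WInv P m) {ξ : M} {i : ι}
    (hi : i ∈ R₊) {s : ℕ} (hs : s ≤ m i) (hξ : ε (P.coroot' i ξ) = ε s) (hres : ∀ k ∈ R₊, k ≠ i →
    NonRes L (ε (P.coroot' k ξ))) (κ : M) : ψ κ ξ = ψ (P.reflection i κ - s • P.root i) ξ := by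
  set r : M → M := fun κ => P.reflection i κ - s • P.root i with hr
  have hrr : ∀ κ, r (r κ) = κ := fun κ => by simp_all
  set H := 𝓗
  set S := H ∪ H.image r
  have hHS : H ⊆ S := subset_union_left
  have hrS : ∀ κ ∈ S, r κ ∈ S := fun κ hκ => by grind
  have hwt := isWeight_hull_rho b hm
  have hW : ∀ κ ∈ S, IsWeight P κ := fun κ hκ => by
    rcases mem_union.1 hκ with hκ | hκ
    · exact hwt κ hκ
    · obtain ⟨κ', h1, rfl⟩ := mem_image.1 hκ
      exact ((hwt κ' h1).weyl (𝐬 i)).sub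
        (isWeight_rootLat (nsmul_mem (root_mem_rootLat P i) s))
  have hrz : ∀ κ ∈ S, κ - (zp P i κ + (s : ℤ)) • P.root i = r κ := fun κ hκ => by
    rw [hr]
    simp only
    rw [P.reflection_apply, ← cast_zp (hW κ hκ), ← cast_smul_eq_zsmul ℂ, ← cast_smul_eq_nsmul ℂ]
    module
  set v : M → ℂ := fun κ => ψ κ ξ - ψ (r κ) ξ with hv
  set c := P.coroot' i ξ - s with hc
  have hc1 : ε c = 1 := by rw [hc, mul_sub, qpow_sub, hξ, div_self (qpow_ne_zero _ _)]
  have hG : FunAxial P L m fun x => ε (P.1 (c • P.root i) x) * baFn b L m ψ ξ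
    ((𝐬 i).1.2.1 x) := by
    refine ((h.funAxial hL hm ξ).comp_weyl hm (𝐬 i)).exp_mul fun k => ?_
    obtain ⟨n, hn⟩ := isWeight_root (P := P) i k
    have e : 2 * P.coroot' k (c • P.root i) = n * (2 * c) := by rw [map_smul, smul_eq_mul, hn]; ring
    rw [e, qpow_int_mul, hc1, one_zpow]
  have hax : CoefAxial b L (fun i => ε (P.coroot' i ξ)) m S v := by
    rw [← funAxial_shiftF_iff b hL.ne_zero hm ξ hW]
    have e : ∀ x, 𝓔 (shiftF ξ S v) x = baFn b L m ψ ξ x - ε (P.1 (c • P.root i) x) * baFn b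
      L m ψ ξ ((𝐬 i).1.2.1 x) := fun x => by
      have e1 : ∑ κ ∈ S, ψ (r κ) ξ * ε (P.1 κ x) = ∑ κ ∈ S, ψ κ ξ * ε (P.1 (r κ) x) := sum_nbij' r r
        hrS hrS (fun κ _ => hrr κ) (fun κ _ => hrr κ) fun κ _ => by rw [hrr]
      rw [expSum_shiftF, baFn_eq, baFn_eq]
      simp only [hv, sub_mul]
      rw [sum_sub_distrib, e1, h.sum_subset hHS, h.sum_subset hHS, mul_sub]
      congr 1
      rw [← mul_assoc, mul_sum, mul_sum]
      refine sum_congr rfl fun κ _ => ?_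
      rw [mul_left_comm, mul_left_comm _ (ψ κ ξ), ← qpow_add_pair, mul_assoc, ← qpow_add_pair,
        pair_weyl_right, reflTriple_inv, ← qpow_add_pair]
      refine congrArg (fun μ => ψ κ ξ * ε (P.1 μ x)) ?_
      change _ = _ + P.reflection i (ξ + κ)
      rw [map_add, hr, P.reflection_apply i ξ, hc, ← cast_smul_eq_nsmul ℂ]
      module
    intro k s' hs' x hx
    rw [e, e, (h.funAxial hL hm ξ) k s' hs' x hx]
    exact congrArg _ (hG k s' hs' x hx)
  have hy := regDom_sumFundCo b
  obtain ⟨ri, hri, hri'⟩ := hy.root'_pos b (mem_posRoots.1 hi)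
  have hb : ∀ p ∈ S, (P.1 p (sumFundCo b)).re ≤ (P.1 ϱ (sumFundCo b)).re ∧
    -(P.1 ϱ (sumFundCo b)).re - s * (P.root' i (sumFundCo b)).re ≤ (P.1 p (sumFundCo b)).re := by
    have h0 : 0 ≤ (s : ℝ) * (P.root' i (sumFundCo b)).re := by rw [hri']; exact by positivity
    intro p hp
    rcases mem_union.1 hp with hp | hp
    · have := abs_le.1 (re_pair_le_of_mem_hull hm hy (mem_hullF.1 hp))
      grind
    · obtain ⟨κ', h1, rfl⟩ := mem_image.1 hp
      have := abs_le.1 (re_pair_le_of_mem_hull hm hy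
        (weyl_mem_hull b (mem_hullF.1 h1) (𝐬 i)))
      have e : (P.1 (r κ') (sumFundCo b)).re =
        (P.1 ((𝐬 i).1.1 κ') (sumFundCo b)).re - s * (P.root' i (sumFundCo b)).re := by
        rw [hr]
        rw [map_sub, map_nsmul, LinearMap.sub_apply, sub_re, LinearMap.smul_apply,
          nsmul_eq_mul, ← ofReal_natCast, re_ofReal_mul]
        rfl
      grind
  have key := hax.eq_zero_of_antisymm hL hW hi hs hξ hres (fun κ hκ => by
    grind) (fun κ hκ => by
    grind) hy fun p hp p' hp' => by
    grind
  by_cases hκ : κ ∈ S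
  · grind
  · rw [h.zero κ fun h' => hκ (hHS h'), h.zero (r κ) fun h' => hκ (by
      rw [← hrr κ]; exact hrS _ (hHS h'))]

end Equivariance

section Equivariance

variable {ψ : M → M → ℂ}

lemma LineDiff.comp_linear {F : M → ℂ} (hF : LineDiff F) (w : M →ₗ[ℂ] M) :
    LineDiff fun ξ => F (w ξ) := fun x v => by simpa using hF (w x) (w v)

lemma LineDiff.continuous {F : M → ℂ} (hF : LineDiff F) (x v : M) :
    Continuous fun t : ℂ => F (x + t • v) := (hF x v).continuous

lemma LineDiff.mul {F G : M → ℂ} (hF : LineDiff F) (hG : LineDiff G) :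
    LineDiff fun ξ => F ξ * G ξ := fun x v => (hF x v).mul (hG x v)

lemma LineDiff.sum {κ : Type*} (S : Finset κ) {F : κ → M → ℂ} (hF : ∀ k ∈ S, LineDiff (F k)) :
    LineDiff fun ξ => ∑ k ∈ S, F k ξ := fun x v => Differentiable.fun_sum fun k hk => hF k hk x v

lemma IsBACoef.lineDiff (h : IsBACoef b L m ψ) (κ : M) : LineDiff (ψ κ) :=
  lineDiff_of_mem_expSpace (h.mem κ)

lemma prod_brk_reflect (L a : ℂ) (n : ℕ) : (∏ k ∈ Icc 1 n, brk L (k - a)) * (∏ k ∈ range n,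
    efac L (qpow L (2 * a)) ((k : ℤ) - n)) * ∏ k ∈ Icc 1 n, -qpow L (2 * k) = (∏ k ∈ Icc 1 n,
    brk L (k + a)) * ∏ k ∈ Icc 1 n, efac L (qpow L (2 * a)) (k : ℕ) := by
  have h1 : ∏ k ∈ range n, efac L (qpow L (2 * a)) ((k : ℤ) - n) = ∏ k ∈ Icc 1 n, efac L
    (qpow L (2 * a)) (-(k : ℤ)) := by
    refine prod_nbij' (fun k => n - k) (fun k => n - k) ?_ ?_ ?_ ?_ fun k hk => ?_
    any_goals intro k hk; simp only [mem_range, mem_Icc] at hk ⊢; omega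
    rw [mem_range] at hk
    push_cast [hk.le]
    ring
  rw [h1, ← prod_mul_distrib, ← prod_mul_distrib, ← prod_mul_distrib]
  refine prod_congr rfl fun k _ => ?_
  have hk := qpow_ne_zero L k
  simp only [efac, brk, Algebra.algebraMap_self, RingHom.id_apply, cast_neg, cast_natCast,
    mul_neg, neg_add, sub_eq_add_neg, qpow_add, qpow_neg, qpow_two_mul, neg_neg]
  field_simp
  ring

lemma exists_wall_point (hL : NonRoot L) (i : ι) : ∃ ξ : M, P.coroot' i ξ = 0 ∧ ∀ k ∈ (R₊).filter
    fun k => k ≠ i ∧ k ≠ ς i i, NonRes L (ε (P.coroot' k ξ)) := by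
  obtain ⟨v, hv, hv'⟩ := exists_transversal P.flip i
  obtain ⟨t, ht⟩ := (dense_nonRes (P := P) hL.ne_zero
    ((R₊).filter fun k => k ≠ i ∧ k ≠ ς i i) 0 v fun k hk => by
      rw [mem_filter] at hk
      refine hv' k (fun h => hk.2.1 (P.coroot.injective h)) fun h => hk.2.2 (P.coroot.injective ?_)
      rw [coroot_neg]; exact h).nonempty
  refine ⟨0 + t • v, ?_, ht⟩
  rw [zero_add, map_smul, show P.coroot' i v = 0 from hv, smul_zero]

lemma coroot'_refl_self (i : ι) (ξ : M) : P.coroot' i (P.reflection i ξ) = -P.coroot' i ξ := by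
  rw [P.reflection_apply, map_sub, map_smul, P.root_coroot'_eq_pairing, P.pairing_same, smul_eq_mul]
  ring

lemma lead_refl_eq (h : IsBACoef b L m ψ) (hm : WInv P m) {j : ι} (hj : j ∈ b.support) (ξ : M) : ψ
    ϱ ξ * (∏ k ∈ range (m j), efac L (ε (P.coroot' j ξ)) ((k : ℤ) - m j)) * (∏ k ∈ Icc 1 (m j),
    -ε k) = ψ ϱ (P.reflection j ξ) * ∏ k ∈ Icc 1 (m j), efac L (ε (P.coroot' j ξ)) (k : ℕ) := by
  rw [h.lead, h.lead, ← mul_prod_erase _ _ (simple_mem b hj),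
    ← mul_prod_erase _ (fun i => ∏ k ∈ Icc 1 (m i), brk L (k - P.coroot' i (P.reflection j ξ)))
      (simple_mem b hj), coroot'_refl_self]
  have e := prod_posRoots_refl b hj fun i => ∏ k ∈ Icc 1 (m i), brk L (k - P.coroot' i ξ)
  have e' : ∀ i, P.coroot' i (P.reflection j ξ) = P.coroot' (ς j i) ξ := fun i => by
    have := coroot'_weyl_right P (𝐬 j) i ξ
    rwa [reflTriple_inv] at this
  simp only [hm] at e
  simp only [e', e, sub_neg_eq_add]
  linear_combination (∏ i ∈ (R₊).erase j, ∏ k ∈ Icc 1 (m i),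
    brk L (k - P.coroot' i ξ)) * prod_brk_reflect L (P.coroot' j ξ) (m j)

lemma IsBACoef.lead_refl (h : IsBACoef b L m ψ) (hL : NonRoot L)
    (hm : WInv P m) {j : ι} (hj : j ∈ b.support) (ξ : M) :
    ψ (P.reflection j ϱ) ξ = ψ ϱ (P.reflection j ξ) := by
  obtain ⟨u, -, hu⟩ := exists_edge_relation b hL (F := ℂ) hm hj le_rfl
  set d : ℂ := ∏ k ∈ Icc 1 (m j), -ε k with hd
  have hd0 : d ≠ 0 := prod_ne_zero_iff.2 fun k _ => neg_ne_zero.2 (qpow_ne_zero _ _)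
  have key : ψ (P.reflection j ϱ) = fun ξ => u / d * ψ ϱ (P.reflection j ξ) := by
    have hlin := (h.lineDiff ϱ).comp_linear (P.reflection j).toLinearMap
    refine eq_of_isNonRes b hL.ne_zero (h.lineDiff _).continuous
      (fun x v => (hlin.continuous x v).const_mul _) fun ξ hξ => ?_
    have h1 := hu (h.axial ξ) 1 (b.isPos_of_mem_support hj) (hξ j (simple_mem b hj))
    have h2 := lead_refl_eq h hm hj ξ
    have h3 : ∏ k ∈ Icc 1 (m j), efac L (ε (P.coroot' j ξ)) (k : ℕ) ≠ 0 :=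
      prod_ne_zero_iff.2 fun k _ => efac_ne_zero (hξ j (simple_mem b hj)) _
    rw [← refl_rhoN b hm hj] at h1
    change ψ (P.reflection j ϱ) ξ * ∏ k ∈ Icc 1 (m j), efac L (ε (P.coroot' j ξ)) (k : ℕ) =
      u * (ψ ϱ ξ * ∏ k ∈ range (m j), efac L (ε (P.coroot' j ξ)) ((k : ℤ) - m j)) at h1
    refine mul_right_cancel₀ h3 ?_
    rw [h1, mul_assoc, ← h2, ← hd]
    field_simp
  obtain ⟨η, hη, hη'⟩ := exists_wall_point (b := b) hL j
  have hres : ∀ k ∈ R₊, k ≠ j → NonRes L (ε (P.coroot' k η)) :=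
    fun k hk hkj => hη' k (mem_filter.2 ⟨hk, hkj, by grind [isPos_simple_neg, mem_posRoots]⟩)
  have h1 := h.eq_reflect hL hm (simple_mem b hj) (Nat.zero_le _)
    (by rw [hη, Nat.cast_zero]) hres ϱ
  have h2 : ψ ϱ η ≠ 0 := h.lead_ne_zero fun i hi k hk => by
    by_cases hij : i = j
    · rw [hij, hη, mul_zero, qpow_zero]
      intro h3
      have h4 := (mem_Icc.1 hk).1
      exact hL (2 * k) (by omega) (by rw [h3]; push_cast; rfl)
    · exact hres i hi hij k
  have h3 : P.reflection j η = η := by rw [P.reflection_apply, hη, zero_smul, sub_zero]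
  rw [zero_smul, sub_zero, key] at h1
  grind

lemma baFn_weyl_eq (ψ : M → M → ℂ) (w : Weyl P) (ξ : M) (x : N) : baFn b L m ψ (w.1.1 ξ)
    (w.1.2.1 x) = 𝓔 (shiftF ξ 𝓗 fun κ => ψ (w.1.1 κ) (w.1.1 ξ)) x := by
  rw [baFn_eq, expSum_shiftF, pair_weyl]
  congr 1
  refine (sum_nbij' (fun κ => w.1.1 κ) (fun κ => w⁻¹.1.1 κ) (fun κ hκ => ?_)
    (fun κ hκ => ?_) (fun κ _ => weyl_inv_applyM P w⁻¹ κ) (fun κ _ => weyl_inv_applyM P w κ)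
    fun κ _ => ?_).symm
  · grind [mem_hullF, weyl_mem_hull]
  · grind [mem_hullF, weyl_mem_hull]
  · rw [pair_weyl]

lemma IsBACoef.weyl (h : IsBACoef b L m ψ) (hL : NonRoot L) (hm : WInv P m) (w : Weyl P)
    (κ ξ : M) : ψ (w.1.1 κ) (w.1.1 ξ) = ψ κ ξ := by
  induction w using weyl_induction_simple b with
  | one => rfl
  | mul j hj w ih =>
    rw [← ih]
    change ψ (P.reflection j (w.1.1 κ)) (P.reflection j (w.1.1 ξ)) = _
    generalize w.1.1 κ = κ
    generalize w.1.1 ξ = ξ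
    by_cases hκ : κ ∈ 𝓗
    swap
    · rw [h.zero κ hκ, h.zero _ fun h' => hκ ?_]
      · rfl
      · have := weyl_mem_hull b (mem_hullF.1 h') (𝐬 j)
        rw [mem_hullF]
        change P.reflection j (P.reflection j κ) ∈ _ at this
        rwa [P.reflection_same] at this
    revert ξ
    refine congrFun (eq_of_isNonRes b hL.ne_zero (F := fun ξ =>
      ψ (P.reflection j κ) (P.reflection j ξ))
      ((h.lineDiff _).comp_linear (P.reflection j).toLinearMap).continuous
      (h.lineDiff κ).continuous fun ξ hξ => ?_)
    have h1 := h.unique hL hm hξ (v := fun κ => ψ (P.reflection j κ) (P.reflection j ξ)) (by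
      have e : 𝓔 (shiftF ξ 𝓗 fun κ =>
          ψ (P.reflection j κ) (P.reflection j ξ)) = fun x =>
          baFn b L m ψ ((𝐬 j).1.1 ξ) ((𝐬 j).1.2.1 x) :=
        funext fun x => (baFn_weyl_eq ψ (𝐬 j) ξ x).symm
      rw [e]
      exact (h.funAxial hL hm _).comp_weyl hm _) κ hκ
    rw [h.lead_refl hL hm hj, P.reflection_same, mul_comm] at h1
    exact mul_left_cancel₀ (h.lead_ne_zero fun i hi k _ => hξ i hi k) h1

end Equivariance

section Duality

variable {ψ : M → M → ℂ}

lemma expSum_periodic {f : M →₀ ℂ} (hf : ∀ ν ∈ f.support, IsWeight P ν) {c : ℂ} (hc : ε c = 1)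
    (i : ι) (x : N) : 𝓔 f (x + c • P.coroot i) = 𝓔 f x := by
  rw [expSum_subset P L f _ subset_rfl, expSum_subset P L f _ subset_rfl]
  refine sum_congr rfl fun ν hν => ?_
  obtain ⟨n, hn⟩ := hf ν hν i
  have e : 2 * P.1 ν (c • P.coroot i) = n * (2 * c) := by
    rw [map_smul, smul_eq_mul, ← hn]; simp only [RootPairing.coroot', flip_apply]; ring
  grind [qpow_pair_add, qpow_int_mul, one_zpow]

lemma IsBACoef.periodic (h : IsBACoef b L m ψ) (hm : WInv P m)
    {c : ℂ} (hc : ε c = 1) (i : ι) (κ ξ : M) : ψ κ (ξ + c • P.root i) = ψ κ ξ := by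
  obtain ⟨f, hf, hf'⟩ := (mem_expSpace P.flip L).1 (h.mem κ)
  rw [← hf']
  refine expSum_periodic (P := P.flip) (fun ν hν => ?_) hc i ξ
  have h1 := (isWeight_rootLat (mem_rootCone.1 (hf ν hν)).2).sub
    ((isDominant_rhoN b.flip (m := m) hm).isWeight b.flip)
  simp_all

lemma IsBACoef.spectral_generic (h : IsBACoef b L m ψ) (hL : NonRoot L) (hm : WInv P m) {ξ : M}
    {i : ι} (hi : i ∈ R₊) {s : ℕ} (hs : s ≤ m i) (hξ : ε (P.coroot' i ξ) = 1) (hres : ∀ k ∈ R₊,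
    k ≠ i → NonRes L (ε (P.coroot' k (ξ + ((s : ℂ) / 2) • P.root i)))) (x : N) : baFn b L m ψ
    (ξ + ((s : ℂ) / 2) • P.root i) x = baFn b L m ψ (ξ - ((s : ℂ) / 2) • P.root i) x := by
  set ξ₁ := ξ + ((s : ℂ) / 2) • P.root i with h₁
  set ξ₂ := ξ - ((s : ℂ) / 2) • P.root i with h₂
  have ha : P.coroot' i ξ₁ = P.coroot' i ξ + s := by simp_all
  have hξ₁ : ε (P.coroot' i ξ₁) = ε s := by rw [ha, mul_add, qpow_add, hξ, one_mul]
  have key : ∀ κ, ψ κ ξ₁ = ψ (κ + s • P.root i) ξ₂ := fun κ => by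
    rw [h.eq_reflect hL hm hi hs hξ₁ hres κ, ← h.weyl hL hm (𝐬 i),
      ← h.periodic hm hξ i _ ξ₂, ← h.periodic hm hξ i _ (_ : M)]
    change ψ (P.reflection i (P.reflection i κ - s • P.root i))
      (P.reflection i ξ₁ + P.coroot' i ξ • P.root i) = _
    have e : P.reflection i ξ₁ = ξ₂ - P.coroot' i ξ • P.root i := by
      rw [P.reflection_apply, ha, h₁, h₂]; module
    rw [map_sub, map_nsmul, P.reflection_same, P.reflection_apply_self, smul_neg, sub_neg_eq_add,
      e, sub_add_cancel, h.periodic hm hξ]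
  set H := 𝓗
  set S := H ∪ H.image (· - s • P.root i)
  have hS2 : H ⊆ S.image (· + s • P.root i) := fun κ hκ => mem_image.2
    ⟨κ - s • P.root i, mem_union_right _ (mem_image_of_mem _ hκ), sub_add_cancel _ _⟩
  rw [baFn_eq, baFn_eq, ← h.sum_subset (subset_union_left : H ⊆ S), ← h.sum_subset hS2,
    sum_image fun _ _ _ _ h => add_right_cancel h, mul_sum, mul_sum]
  refine sum_congr rfl fun κ _ => ?_
  rw [key, mul_left_comm, mul_left_comm _ (ψ _ ξ₂), ← qpow_add_pair, ← qpow_add_pair]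
  refine congrArg (fun μ => ψ (κ + s • P.root i) ξ₂ * ε (P.1 μ x)) ?_
  module

variable (P)

lemma lineDiff_qpow_pair (L : ℂ) (x : N) : LineDiff fun ξ : M => qpow L (2 * P.1 ξ x) := by
  convert lineDiff_qpow L ((2 : ℂ) • P.1.flip x) 0 using 3
  simp

variable {P}

lemma IsBACoef.lineDiff_baFn (h : IsBACoef b L m ψ) (x : N) :
    LineDiff fun ξ => baFn b L m ψ ξ x := by
  simp only [baFn_eq]
  exact (lineDiff_qpow_pair P L x).mul (LineDiff.sum _ fun κ _ =>
    (h.lineDiff κ).mul fun x v => differentiable_const _)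

/-- The Baker–Akhiezer function satisfies the dual axiality conditions in the spectral variable. -/
lemma IsBACoef.spectral_axial (h : IsBACoef b L m ψ) (hL : NonRoot L) (hm : WInv P m)
    (x : N) : FunAxial P.flip L m fun ξ => baFn b L m ψ ξ x := by
  refine funAxial_of_pos b.flip hm fun i hi s hs ξ hξ => ?_
  rw [posRoots_flip] at hi
  obtain ⟨v, hv, hv'⟩ := exists_transversal P.flip i
  replace hv : P.coroot' i v = 0 := hv
  have hd := dense_nonRes (P := P) hL.ne_zero
    ((R₊).filter fun k => k ≠ i) (ξ + ((s : ℂ) / 2) • P.root i) v fun k hk => by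
      rw [mem_filter] at hk
      refine hv' k (fun h => hk.2 (P.coroot.injective h)) fun h => ?_
      simp_all [mem_posRoots, isPos_neg_iff]
  have hF := h.lineDiff_baFn x
  have := congrFun ((hF.continuous (ξ + ((s : ℂ) / 2) • P.root i) v).ext_on hd
    (hF.continuous (ξ - ((s : ℂ) / 2) • P.root i) v) fun t ht => ?_) 0
  · simpa using this
  · have e1 : ξ + ((s : ℂ) / 2) • P.root i + t • v = ξ + t • v + ((s : ℂ) / 2) • P.root i := by abel
    have e2 : ξ - ((s : ℂ) / 2) • P.root i + t • v = ξ + t • v - ((s : ℂ) / 2) • P.root i := by abel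
    simp only
    rw [e1, e2]
    refine h.spectral_generic hL hm hi (mem_Icc.1 hs).2 ?_ (fun k hk hki => ?_) x
    · rwa [map_add, map_smul, hv, smul_zero, add_zero]
    grind

lemma IsBACoef.mem_hull (h : IsBACoef b L m ψ) (hL : NonRoot L) (hm : WInv P m) (κ : M) : ψ
    κ ∈ expSpace P.flip L (hull b.flip (rhoN b.flip m)) := by
  have h0 := fun κ => (mem_expSpace P.flip L).1 (h.mem κ)
  choose a ha ha' using h0
  have hw : ∀ (w : Weyl P) κ ν, a (w.1.1 κ) (w.1.2.1 ν) = a κ ν := fun w κ ν => by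
    have e : a (w.1.1 κ) = (a κ).mapDomain (flipTriple w).1.1 := by
      refine expSum_injective P.flip hL.ne_zero (funext fun ξ => ?_)
      have h1 := expSum_weyl P.flip L (flipTriple w) (a κ) (w⁻¹.1.1 ξ)
      have h2 : (flipTriple w).1.2.1 (w⁻¹.1.1 ξ) = ξ := weyl_inv_applyM P w ξ
      rw [h2, ha', ← h.weyl hL hm w, weyl_inv_applyM] at h1
      rw [ha', h1]
    rw [e]
    exact mapDomain_apply (flipTriple w).1.1.injective _ _
  rw [← ha' κ]
  refine expSum_mem P.flip L fun ν hν w => ?_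
  obtain ⟨w₀, hw₀⟩ := exists_longest b.flip
  set u := unflipTriple (w₀⁻¹ * w)
  have h1 : u.1.2.1 ν ∈ (a (u.1.1 κ)).support := by
    rw [mem_support_iff, hw]; exact mem_support_iff.1 hν
  have h2 := longest_mem_rootCone b.flip hw₀ (ha _ _ h1)
  have h3 : w₀.1.1 (rhoN b.flip m) = -rhoN b.flip m :=
    longest_rho b.flip hw₀ (k := fun i => (m i : ℂ)) (fun i j => congrArg _ (hm i j))
  have h4 : w₀.1.1 (u.1.2.1 ν) = w.1.1 ν := weyl_inv_applyM P.flip w₀ _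
  rw [map_add, h4, h3] at h2
  convert h2 using 1
  abel

lemma tendsto_brk_ray (hL : L ≠ 0) (c : ℂ) {r : ℝ} (hr : 0 < r) : Tendsto
    (fun t : ℝ => exp (-(t * r)) * brk L (c - t / L * r)) atTop (𝓝 (-qpow L (-c))) := by
  have h1 : Tendsto (fun t : ℝ => exp (-(2 * r * t : ℝ))) atTop (𝓝 0) := by
    have := Real.tendsto_exp_neg_atTop_nhds_zero.comp
      (tendsto_id.const_mul_atTop (show 0 < 2 * r by positivity))
    have h2 := (continuous_ofReal.tendsto _).comp this
    simpa [Function.comp_def] using h2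
  have h2 := (h1.const_mul (qpow L c)).sub_const (qpow L (-c))
  rw [mul_zero, zero_sub] at h2
  refine h2.congr fun t => ?_
  have e1 : qpow L (t / L * r) = exp (t * r) := by rw [qpow]; field_simp
  have e2 : exp (-(2 * r * t : ℝ)) = exp (t * r) ^ (-2 : ℤ) := by
    rw [← exp_int_mul]; push_cast; ring
  rw [brk, neg_sub, qpow_sub, qpow_sub, e1, e2, Complex.exp_neg, qpow_neg]
  field_simp

lemma coeff_rho_of_prod (hL : L ≠ 0) {f : M →₀ ℂ} {C : ℂ} (hf : ∀ x, 𝓔 f x = C * ∏ i ∈ R₊,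
    ∏ j ∈ Icc 1 (m i), brk L (j - P.root' i x)) (hr : ∀ μ ∈ f.support, μ - ϱ ∈ rootLat P) : f ϱ =
    C * ∏ i ∈ R₊, ∏ j ∈ Icc 1 (m i), -qpow L (-j) := by
  set K := C * ∏ i ∈ R₊, ∏ j ∈ Icc 1 (m i), -qpow L (-j) with hK
  have hy := regDom_sumFundCo b
  set y := sumFundCo b
  have hsup : ∀ μ ∈ (f - single ϱ K).support, μ - ϱ ∈ rootLat P := fun μ hμ => by
    rcases mem_union.1 (support_sub hμ) with h | h
    · exact hr μ h
    · rw [mem_singleton.1 (support_single_subset h), sub_self]; exact zero_mem _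
  have h1 := re_lt_of_tendsto_ray P hL y ϱ (f - single ϱ K)
    (fun μ hμ => hy.rootLat_real b (hsup μ hμ)) 0 fun x => ?_
  · by_contra hne
    have := h1 ϱ (mem_support_iff.2 (by simpa [sub_eq_zero] using hne))
    simp at this
  have e0 : ∀ t : ℝ, exp (-(2 * t * (P.1 ϱ y + (0 : ℝ)))) = ∏ i ∈ R₊, ∏ j ∈ Icc 1 (m i), exp
    (-(t * P.root' i y)) := fun t => by
    rw [rhoN, pair_rho, ofReal_zero, add_zero, show -(2 * (t : ℂ) * (1 / 2 *
      ∑ i ∈ R₊, (m i : ℂ) * P.root' i y)) =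
      ∑ i ∈ R₊, (m i : ℂ) * (-(t * P.root' i y)) by
        rw [mul_comm (2 : ℂ), mul_assoc, ← mul_assoc 2, mul_one_div_cancel two_ne_zero, one_mul,
          mul_sum, ← sum_neg_distrib]
        grind, exp_sum]
    grind [prod_const, Nat.card_Icc, exp_nat_mul]
  have e1 : ∏ i ∈ R₊, ∏ j ∈ Icc 1 (m i), -qpow L (-(j - P.root' i x)) = (∏ i ∈ R₊,
    ∏ j ∈ Icc 1 (m i), -qpow L (-j)) * ε (P.1 ϱ x) := by
    rw [rhoN, pair_rho, ← mul_assoc, mul_one_div_cancel two_ne_zero, one_mul, qpow_sum,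
      ← prod_mul_distrib]
    refine prod_congr rfl fun i _ => ?_
    have e : ∀ j ∈ Icc 1 (m i), -qpow L (-((j : ℂ) - P.root' i x)) = -qpow L (-j) * qpow L
      (P.root' i x) := fun j _ => by
      grind [qpow_sub, qpow_neg]
    rw [prod_congr rfl e, prod_mul_distrib, prod_const, Nat.card_Icc,
      Nat.add_sub_cancel, qpow_nat_mul]
  have h2 : Tendsto (fun t : ℝ => C * ∏ i ∈ R₊, ∏ j ∈ Icc 1 (m i),
    (exp (-(t * P.root' i y)) * brk L (j - P.root' i (x + ((t : ℂ) / L) • y)))) atTop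
    (𝓝 (C * ∏ i ∈ R₊, ∏ j ∈ Icc 1 (m i), -qpow L (-(j - P.root' i x)))) := by
    refine (tendsto_finsetProd _ fun i hi => tendsto_finsetProd _ fun j _ => ?_).const_mul C
    obtain ⟨r, hr, hr'⟩ := hy.root'_pos b (mem_posRoots.1 hi)
    refine (tendsto_brk_ray hL (j - P.root' i x) hr).congr fun t => ?_
    rw [map_add, map_smul, hr', smul_eq_mul, sub_add_eq_sub_sub]
  have h3 := h2.sub_const (K * ε (P.1 ϱ x))
  rw [e1, hK, mul_assoc, sub_self] at h3
  refine h3.congr fun t => ?_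
  rw [map_sub, Pi.sub_apply, hf, expSum_single, mul_sub]
  congr 1
  · rw [e0]
    simp only [prod_mul_distrib]
    ring
  grind [qpow_ray, ofReal_zero, Complex.exp_neg, exp_ne_zero]

lemma LineDiff.eq_zero_of_mul {F G : M → ℂ} (hF : LineDiff F) (hG : LineDiff G)
    (h : ∀ ξ, F ξ * G ξ = 0) (h0 : ∃ ξ, G ξ ≠ 0) (ξ : M) : F ξ = 0 := by
  by_contra hne
  obtain ⟨η, hη⟩ := exists_common_ne (univ : Finset Bool) (fun i => if i then F else G)
    (fun i _ => by cases i <;> assumption) fun i _ => by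
      cases i
      · exact h0
      · exact ⟨ξ, hne⟩
  exact mul_ne_zero (hη true (mem_univ _)) (hη false (mem_univ _)) (h η)

lemma exists_nonRes (b : P.Base) (hL : L ≠ 0) : ∃ ξ, IsNonRes b L ξ := by
  obtain ⟨t, ht⟩ := (dense_nonRes (P := P) hL (posRoots b) 0 (sumFundCo b.flip)
    fun i _ => root'_sumFundCo_ne_zero b.flip i).nonempty
  exact ⟨_, ht⟩

lemma IsBACoef.exists_proportional (h : IsBACoef b L m ψ) (hL : NonRoot L) (hm : WInv P m)
    {φ : N → N → ℂ} (h' : IsBACoef b.flip L m φ) : ∃ f : M →₀ ℂ, (∀ μ ∈ f.support,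
    μ - ϱ ∈ rootLat P) ∧ f ϱ = ∏ i ∈ R₊, ∏ j ∈ Icc 1 (m i), -qpow L (-j) ∧
    ∀ x ξ, baFn b L m ψ ξ x * φ (rhoN b.flip m) x = 𝓔 f x * baFn b.flip L m φ x ξ := by
  have h0 := fun κ => (mem_expSpace P.flip L).1 (h.mem_hull hL hm κ)
  choose a ha ha' using h0
  set H := 𝓗
  have hρ : ϱ ∈ H := mem_hullF.2 ((isDominant_rhoN b hm).mem_hull b)
  refine ⟨shiftF 0 H fun κ => a κ (rhoN b.flip m), fun μ hμ => ?_, ?_, fun x => ?_⟩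
  · obtain ⟨κ, hκ, rfl⟩ := mem_image.1 (support_shiftF 0 H _ hμ)
    rw [zero_add, ← neg_sub]
    exact neg_mem (mem_rootCone.1 (sub_mem_hull b (mem_hullF.1 hκ))).2
  · have h1 := shiftF_apply 0 H (fun κ => a κ (rhoN b.flip m)) hρ
    rw [zero_add] at h1
    rw [h1]
    have h2 := coeff_rho_of_prod (P := P.flip) (b := b.flip) (m := m) (f := a ϱ) (C := 1)
      hL.ne_zero (fun ξ => by
        rw [ha', h.lead, one_mul, posRoots_flip]; rfl) fun ν hν => by
        rw [← neg_sub]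
        exact neg_mem (mem_rootCone.1 (sub_mem_hull b.flip (ha _ ν hν))).2
    rwa [one_mul, posRoots_flip] at h2
  · intro ξ
    revert x
    have hl1 : LineDiff fun x => baFn b L m ψ ξ x := lineDiff_expSum P L _
    refine congrFun (eq_of_isNonRes b.flip hL.ne_zero (hl1.mul (h'.lineDiff _)).continuous
      ((lineDiff_expSum P L _).mul (h'.lineDiff_baFn ξ)).continuous fun x hx => ?_)
    set v : N → ℂ := fun ν => ∑ κ ∈ H, a κ ν * ε (P.1 κ x) with hv
    have hexp : ∀ ξ, baFn b L m ψ ξ x = expSum P.flip L (shiftF x (hullF b.flip (rhoN b.flip m)) v)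
      ξ := fun ξ => by
      rw [baFn_eq, expSum_shiftF]
      congr 1
      simp only [hv, sum_mul]
      rw [sum_comm]
      refine sum_congr rfl fun κ _ => ?_
      rw [← ha', expSum_subset P.flip L (a κ) ξ fun ν hν =>
        mem_hullF.2 (ha κ ν hν), sum_mul]
      exact sum_congr rfl fun ν _ => by ring
    have hun := h'.unique hL hm hx (v := v) (by
      rw [← funext hexp]; exact h.spectral_axial hL hm x)
    have hA : 𝓔 (shiftF 0 H fun κ => a κ (rhoN b.flip m)) x = v (rhoN b.flip m) := by
      rw [expSum_shiftF]; simp [hv, qpow_zero]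
    rw [hA, hexp, expSum_shiftF, baFn_eq, mul_assoc, mul_left_comm (v _)]
    congr 1
    rw [sum_mul, mul_sum]
    refine sum_congr rfl fun ν hν => ?_
    grind

/-- Duality: the Baker–Akhiezer function is symmetric in its two variables. -/
lemma IsBACoef.duality (h : IsBACoef b L m ψ) (hL : NonRoot L) (hm : WInv P m) {φ : N → N → ℂ}
    (h' : IsBACoef b.flip L m φ) (ξ : M) (x : N) : baFn b L m ψ ξ x = baFn b.flip L m φ x ξ := by
  obtain ⟨f, hf, hfρ, hfe⟩ := h.exists_proportional hL hm h'
  obtain ⟨g, -, -, hge⟩ := h'.exists_proportional hL hm h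
  obtain ⟨ξ₀, hξ₀⟩ := exists_nonRes b hL.ne_zero
  obtain ⟨x₀, hx₀⟩ := exists_nonRes b.flip hL.ne_zero
  have hψ₀ : ψ ϱ ξ₀ ≠ 0 := h.lead_ne_zero fun i hi k _ => hξ₀ i hi k
  have hφ₀ : φ (rhoN b.flip m) x₀ ≠ 0 := h'.lead_ne_zero fun i hi k _ => hx₀ i hi k
  set A := 𝓔 f with hA
  set A' := expSum P.flip L g
  have hlin : LineDiff fun x => baFn b L m ψ ξ₀ x := lineDiff_expSum P L _
  have hne : ∃ x, baFn b L m ψ ξ₀ x ≠ 0 := by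
    by_contra! h0
    have h1 : shiftF ξ₀ 𝓗 (fun κ => ψ κ ξ₀) = 0 :=
      expSum_injective P hL.ne_zero (by exact funext h0)
    have h2 := shiftF_apply ξ₀ 𝓗 (fun κ => ψ κ ξ₀) (mem_hullF.2 ((isDominant_rhoN b hm).mem_hull b))
    rw [h1] at h2
    exact hψ₀ h2.symm
  have hAA : ∀ x, A x * A' ξ₀ - ψ ϱ ξ₀ * φ (rhoN b.flip m) x = 0 := by
    refine LineDiff.eq_zero_of_mul (fun x v =>
      ((lineDiff_expSum P L f x v).mul_const _).sub ((h'.lineDiff _ x v).const_mul _))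
      hlin (fun x => ?_) hne
    have h1 := hfe x ξ₀
    have h2 := hge ξ₀ x
    change baFn b.flip L m φ x ξ₀ * ψ ϱ ξ₀ = A' ξ₀ * baFn b L m ψ ξ₀ x at h2
    linear_combination -(A x) * h2 - ψ ϱ ξ₀ * h1
  set C := ψ ϱ ξ₀ / A' ξ₀
  have hAC : ∀ x, A x = C * φ (rhoN b.flip m) x := fun x => by grind
  have h1 := coeff_rho_of_prod (b := b) (m := m) (C := C) hL.ne_zero (fun x => by
    rw [← hA, hAC, h'.lead, posRoots_flip]; rfl) hf
  have hK : ∏ i ∈ R₊, ∏ j ∈ Icc 1 (m i), -qpow L (-j) ≠ 0 :=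
    prod_ne_zero_iff.2 fun i _ => prod_ne_zero_iff.2 fun j _ => neg_ne_zero.2 (qpow_ne_zero _ _)
  have h2 := LineDiff.eq_zero_of_mul (F := fun x => baFn b L m ψ ξ x - baFn b.flip L m φ x ξ)
    (G := φ (rhoN b.flip m)) (fun y v => (lineDiff_expSum P L _ y v).sub (h'.lineDiff_baFn ξ y v))
    (h'.lineDiff _) (fun y => by grind) ⟨x₀, hφ₀⟩ x
  exact sub_eq_zero.1 h2

end Duality

/-! ### Macdonald operators and symmetrized exponential sums -/

section Symmetrization

variable {k : ι → ℂ} {π : N}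

lemma macOp_eq (b : P.Base) (k : ι → ℂ) (F : N → ℂ) (x : N) : macOp b L k π F x =
    opD P L k (orbitF P π) (∑ τ ∈ orbitF P π, qpow L (-2 * P.1 (rho b k) τ)) F x := by
  rw [macOp, finsum_orbit, finsum_orbit]; rfl

lemma macEig_eq (b : P.Base) (k : ι → ℂ) (μ : M) : macEig b L k π μ =
    ∑ τ ∈ orbitF P π, ε (P.1 (μ + rho b k) τ) := finsum_orbit _ _

lemma opD_sum {O : Finset N} (k : ι → ℂ) (C : ℂ) {κ : Type*} (S : Finset κ) (c : κ → ℂ) (F : κ →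
    N → ℂ) (x : N) : opD P L k O C (fun y => ∑ i ∈ S, c i * F i y) x = ∑ i ∈ S, c i * opD P L k O C
    (F i) x := by
  simp only [opD, ← sum_sub_distrib, mul_sum, mul_add, sum_add_distrib]
  rw [sum_comm]
  grind

variable (P)

/-- The Weyl group invariant exponential sum with given coefficients. -/
noncomputable def orbitSymm (a : M →₀ ℂ) : M →₀ ℂ :=
  a.sum fun ν c => ∑ τ ∈ orbitF P.flip ν, single τ c

variable {P}

lemma expSum_orbitSymm (a : M →₀ ℂ) : 𝓔 (orbitSymm P a) = orbitPoly P L a := by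
  funext x
  have h1 : ∀ ν, orbitSum P L ν x = ∑ τ ∈ orbitF P.flip ν, ε (P.1 τ x) :=
    fun ν => finsum_orbit (P := P.flip) ν _
  simp only [orbitSymm, Finsupp.sum, map_sum, Finset.sum_apply, expSum_single, orbitPoly, h1,
    mul_sum]

lemma orbitSymm_apply (a : M →₀ ℂ) (κ : M) :
    orbitSymm P a κ = ∑ ν ∈ a.support, if κ ∈ orbitF P.flip ν then a ν else 0 := by
  simp only [orbitSymm, Finsupp.sum, finsetSum_apply, single_apply, sum_ite_eq']

lemma mem_orbitF_flip {ν κ : M} : κ ∈ orbitF P.flip ν ↔ ∃ w : Weyl P, w.1.1 ν = κ :=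
    mem_orbitF.trans ⟨fun ⟨w, h⟩ => ⟨unflipTriple w, h⟩, fun ⟨w, h⟩ => ⟨flipTriple w, h⟩⟩

lemma exists_of_orbitSymm_ne_zero {a : M →₀ ℂ} {κ : M} (h : orbitSymm P a κ ≠ 0) :
    ∃ ν ∈ a.support, ∃ w : Weyl P, w.1.1 ν = κ := by
  rw [orbitSymm_apply] at h
  obtain ⟨ν, hν, h1⟩ := exists_ne_zero_of_sum_ne_zero h
  exact ⟨ν, hν, mem_orbitF_flip.1 (by grind)⟩

lemma orbitSymm_weyl {a : M →₀ ℂ} (ha : ∀ ν ∈ a.support, IsDominant b ν) {ν : M}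
    (hν : IsDominant b ν) (w : Weyl P) : orbitSymm P a (w.1.1 ν) = a ν := by
  rw [orbitSymm_apply]
  have h1 : ∀ ν' ∈ a.support, (if w.1.1 ν ∈ orbitF P.flip ν' then a ν' else 0) =
      if ν' = ν then a ν else 0 := fun ν' hν' => by
    by_cases h : ν' = ν
    · simp_all [mem_orbitF_flip]
    · rw [if_neg h, if_neg]
      intro h2
      obtain ⟨v, hv⟩ := mem_orbitF_flip.1 h2
      exact h (eq_of_rDom b ((ha ν' hν').rDom b) (hν.rDom b) (w := v⁻¹ * w) (by
        change v⁻¹.1.1 (w.1.1 ν) = ν'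
        rw [← hv]; simp))
  rw [sum_congr rfl h1, sum_ite_eq']
  grind

lemma orbitSymm_filter {F : M →₀ ℂ} (hF : ∀ κ ∈ F.support, IsWeight P κ) (hinv : ∀ (w : Weyl P) κ,
    F (w.1.1 κ) = F κ) : orbitSymm P (F.filter (IsDominant b)) = F := by
  have ha : ∀ ν ∈ (F.filter (IsDominant b)).support, IsDominant b ν := fun ν hν =>
    (mem_filter.1 (support_filter (IsDominant b) F ▸ hν)).2
  ext κ
  by_cases hκ : F κ = 0
  · rw [hκ]
    by_contra h
    obtain ⟨ν, hν, w, rfl⟩ := exists_of_orbitSymm_ne_zero h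
    rw [hinv] at hκ
    simp_all
  · have hw := hF κ (mem_support_iff.2 hκ)
    obtain ⟨w, hw1, -⟩ := exists_weyl_rDom b (μ := κ) fun i => by
      obtain ⟨n, hn⟩ := hw i
      exact ⟨n, by rw [hn, Complex.ofReal_intCast]⟩
    have hd := isDominant_of_rDom b hw1 (hw.weyl w)
    have h1 := orbitSymm_weyl ha hd w⁻¹
    have h2 : w⁻¹.1.1 (w.1.1 κ) = κ := by simp
    grind [filter_apply_pos]

lemma exists_isMacdonald {F : M →₀ ℂ} {μ : M} {c : ℂ} (hc : c ≠ 0) (hμ : IsDominant b μ)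
    (hF : ∀ κ ∈ F.support, IsWeight P κ) (hinv : ∀ (w : Weyl P) κ, F (w.1.1 κ) = F κ)
    (hlow : ∀ ν ∈ F.support, μ - ν ∈ rootCone b) (hlead : F μ = c) (heig : ∀ π,
    IsMinuscule P π ∨ IsQuasiminuscule P π → ∀ x, IsRegularPt P L x →
    macOp b L k π (𝓔 F) x = macEig b L k π μ * 𝓔 F x) : ∃ a, IsMacdonald b L k μ a ∧ (∀ x,
    𝓔 F x = c * orbitPoly P L a x) ∧ a.support ⊆ F.support := by
  set a := c⁻¹ • F.filter (IsDominant b) with ha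
  have hsupp : ∀ ν ∈ a.support, F ν ≠ 0 ∧ IsDominant b ν := fun ν hν => by
    grind [support_smul, support_filter]
  have hpoly : orbitPoly P L a = c⁻¹ • 𝓔 F := by
    rw [← expSum_orbitSymm, ← map_smul]
    congr 1
    ext κ
    rw [Finsupp.smul_apply, ← DFunLike.congr_fun (orbitSymm_filter (b := b) hF hinv) κ,
      orbitSymm_apply, orbitSymm_apply, ha,
      Finsupp.support_smul_eq (inv_ne_zero hc), smul_eq_mul, mul_sum]
    exact sum_congr rfl fun ν _ => by simp
  refine ⟨a, ⟨?_, fun ν hν => (hsupp ν hν).2,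
    fun ν hν => hlow ν (mem_support_iff.2 (hsupp ν hν).1), fun π hπ x hx => ?_⟩,
    fun x => ?_, fun ν hν => mem_support_iff.2 (hsupp ν hν).1⟩
  · grind [Finsupp.smul_apply, filter_apply_pos, smul_eq_mul]
  · rw [hpoly, macOp_eq, opD_smul, ← macOp_eq, heig π hπ x hx, Pi.smul_apply, smul_eq_mul]
    ring
  simp_all

lemma sum_qpow_rho_neg (b : P.Base) (hk : WInv P k) : ∑ τ ∈ orbitF P π, qpow L
    (-2 * P.1 (rho b k) τ) = ∑ τ ∈ orbitF P π, ε (P.1 (rho b k) τ) := by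
  obtain ⟨w, hw⟩ := exists_longest b
  rw [← sum_weyl_invariant (fun w τ h => weyl_mem_orbitF h w) w
    fun τ => qpow L (-2 * P.1 (rho b k) τ)]
  refine sum_congr rfl fun τ _ => ?_
  have h1 := pair_weyl P w (rho b k) τ
  grind [longest_rho, map_neg₂]

/-- The Macdonald polynomial is unique in the nondegenerate case. -/
lemma IsMacdonald.unique (hL : L ≠ 0) (hk : WInv P k) {μ : M} (hnd : Nondegenerate b L k μ)
    {a a' : M →₀ ℂ} (h : IsMacdonald b L k μ a) (h' : IsMacdonald b L k μ a') : a' = a := by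
  by_contra hne
  set d := a' - a with hd
  have hdd : ∀ ν ∈ d.support, IsDominant b ν ∧ μ - ν ∈ rootCone b := fun ν hν =>
    (mem_union.1 (support_sub hν)).elim (fun h1 => ⟨h'.dominant ν h1, h'.lower ν h1⟩)
      fun h1 => ⟨h.dominant ν h1, h.lower ν h1⟩
  obtain ⟨ν, hν, hmax⟩ := d.support.exists_max_image (fun ν => (P.1 (ν - μ) (sumFundCo b)).re)
    (Finsupp.support_nonempty_iff.2 (sub_ne_zero.2 hne))
  have hy := regDom_sumFundCo b
  have hνμ : ν ≠ μ := by
    rintro rfl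
    exact mem_support_iff.1 hν (by rw [hd, Finsupp.sub_apply, h.lead, h'.lead, sub_self])
  obtain ⟨π, hπ, hπne⟩ := hnd ν (hdd ν hν).1 (hdd ν hν).2 hνμ
  have hs : 𝓔 (orbitSymm P d) = 𝓔 (orbitSymm P a') - 𝓔 (orbitSymm P a) := by
    rw [← map_sub]
    congr 1
    ext κ
    have hU : ∀ e : M →₀ ℂ, e.support ⊆ a'.support ∪ a.support → orbitSymm P e κ = ∑ ν ∈ a'.support
      ∪ a.support, if κ ∈ orbitF P.flip ν then e ν else 0 := fun e he => by
      grind [orbitSymm_apply, Finset.sum_subset]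
    rw [Finsupp.sub_apply, hU d support_sub, hU a' subset_union_left,
      hU a subset_union_right, ← sum_sub_distrib]
    refine sum_congr rfl fun ν _ => ?_
    split_ifs
    · rfl
    · rw [sub_self]
  have hsub : ∀ κ ∈ (orbitSymm P d).support, ∃ ν' ∈ d.support, ν' - κ ∈ rootCone b := fun κ hκ => by
    obtain ⟨ν', hν', w, rfl⟩ := exists_of_orbitSymm_ne_zero (mem_support_iff.1 hκ)
    exact ⟨ν', hν', (hdd ν' hν').1.sub_weyl_mem b w⟩
  have hreal : ∀ κ ∈ (orbitSymm P d).support, ∃ r : ℝ, P.1 (κ - μ) (sumFundCo b) = r := fun κ hκ =>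
    by
    obtain ⟨ν', hν', h1⟩ := hsub κ hκ
    refine hy.rootLat_real b ?_
    rw [← neg_sub, ← sub_add_sub_cancel μ ν' κ]
    grind [neg_mem, add_mem, mem_rootCone]
  have key := opD_leading (f := orbitSymm P d) (h := macEig b L k π μ • orbitSymm P d) b hL hk
    (smallSet_orbitF hπ) (∑ τ ∈ orbitF P π, qpow L (-2 * P.1 (rho b k) τ)) hy hreal
    (fun κ hκ => hreal κ (support_smul hκ)) (fun x hx => by
      have e1 := h.eigen π hπ x hx
      have e2 := h'.eigen π hπ x hx
      rw [map_smul, Pi.smul_apply, smul_eq_mul, ← macOp_eq, hs, Pi.sub_apply, mul_sub,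
        expSum_orbitSymm, expSum_orbitSymm, ← e1, ← e2]
      simp only [macOp_eq, opD, Pi.sub_apply, mul_sub, sum_sub_distrib]
      ring) (fun κ hκ => by
      obtain ⟨ν', hν', h1⟩ := hsub κ hκ
      refine le_trans ?_ (hmax ν' hν')
      obtain ⟨r, hr, h2⟩ := pair_nonneg b (mem_rootCone.1 h1).1
        (fun j hj => by obtain ⟨r, hr, h⟩ := hy j hj; exact ⟨r, hr.le, h⟩)
      have h3 := congrArg Complex.re h2
      grind [map_sub₂, sub_re, ofReal_re]) (μ := ν) le_rfl
  have hdν : orbitSymm P d ν = d ν := orbitSymm_weyl (fun ν hν => (hdd ν hν).1) (hdd ν hν).1 1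
  rw [Finsupp.smul_apply, smul_eq_mul, hdν, sum_qpow_rho_neg b hk, sub_add_cancel, ← macEig_eq,
    mul_comm] at key
  grind

end Symmetrization

section Weyl

variable {ψ : M → M → ℂ} {π : N}

lemma rho_neg_natCast : rho b m⁻ = -ϱ := by
  simp only [rhoN, rho, neg_smul, sum_neg_distrib, smul_neg]

/-- The Baker–Akhiezer function is an eigenfunction of the Macdonald operators. -/
lemma IsBACoef.eigen (h : IsBACoef b L m ψ) (hL : NonRoot L) (hm : WInv P m)
    (hπ : IsMinuscule P π ∨ IsQuasiminuscule P π) {x : N} (hx : IsRegularPt P L x) (ξ : M) : macOp b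
    L m⁻ π (baFn b L m ψ ξ) x = (∑ τ ∈ orbitF P π, ε (P.1 ξ τ)) * baFn b L m ψ ξ x := by
  have hk : ∀ i j, -(m (ς i j) : ℂ) = -(m j : ℂ) := fun i j => by rw [hm]
  simp only [macOp_eq]
  set C := ∑ τ ∈ orbitF P π, qpow L (-2 * P.1 (rho b fun i => -(m i : ℂ)) τ) with hC
  have hF := fun x => (h.lineDiff_baFn x).continuous
  revert ξ
  refine congrFun (eq_of_isNonRes b hL.ne_zero (fun ξ v => ?_)
    (((LineDiff.sum _ fun τ _ => lineDiff_qpow_pair P L τ).mul (h.lineDiff_baFn x)).continuous)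
    fun ξ hξ => ?_)
  · exact (continuous_finsetSum _ fun τ _ =>
      ((hF (x + τ) ξ v).sub (hF x ξ v)).const_mul _).add ((hF x ξ v).const_mul _)
  set H := 𝓗
  have hdom := isDominant_rhoN b hm
  have hρ : ϱ ∈ H := mem_hullF.2 (hdom.mem_hull b)
  have hsup : ∀ v : M → ℂ, ∀ μ ∈ (shiftF ξ H v).support, μ - ξ ∈ hull b ϱ := fun v μ hμ => by
    grind [support_shiftF, add_sub_cancel_left, mem_hullF]
  obtain ⟨g, ⟨hg, hga⟩, hgD⟩ := exists_opD_hull b hL hm (smallSet_orbitF hπ) C (hdom.isWeight b)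
    (F := baFn b L m ψ ξ) ⟨expSum_mem P L (hsup _), h.funAxial hL hm ξ⟩
  obtain ⟨f, hf, rfl⟩ := (mem_expSpace P L).1 hg
  have hfs : shiftF ξ H (fun μ => f (ξ + μ)) = f := shiftF_of_support ξ H f fun μ hμ =>
    mem_image.2 ⟨μ - ξ, mem_hullF.2 (hf μ hμ), add_sub_cancel _ _⟩
  have hlow : ∀ μ, μ - ξ ∈ hull b ϱ → ∃ r : ℝ, r ≤ 0 ∧ P.1 (μ - (ξ + ϱ)) (sumFundCo b) = r := fun μ
    hμ => by
    obtain ⟨r, hr, h1⟩ := pair_nonneg b (mem_rootCone.1 (sub_mem_hull b hμ)).1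
      (fun j hj => by obtain ⟨r, hr, h⟩ := regDom_sumFundCo b j hj; exact ⟨r, hr.le, h⟩)
    refine ⟨-r, by linarith, ?_⟩
    rw [← sub_sub, ← neg_sub, map_neg₂, h1, ofReal_neg]
  have hlead := opD_leading b hL.ne_zero hk (smallSet_orbitF hπ) C (regDom_sumFundCo b)
    (μ₀ := ξ + ϱ) (f := shiftF ξ H fun κ => ψ κ ξ) (h := f) (d := 0) (μ := ξ + ϱ)
    (fun μ hμ => by grind)
    (fun μ hμ => by grind) hgD
    (fun μ hμ => by obtain ⟨r, hr, h1⟩ := hlow μ (hsup _ μ hμ); rw [h1]; exact hr) (by simp)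
  rw [shiftF_apply ξ H _ hρ, hC, sum_qpow_rho_neg b hk, sub_add_cancel, rho_neg_natCast,
    add_neg_cancel_right] at hlead
  have hun := h.unique hL hm hξ (v := fun κ => f (ξ + κ)) (by rw [hfs]; exact hga)
  rw [← hgD x hx, ← hfs, expSum_shiftF, baFn_eq, mul_left_comm]
  congr 1
  rw [mul_sum]
  refine sum_congr rfl fun κ hκ => ?_
  have h1 : f (ξ + κ) = (∑ τ ∈ orbitF P π, ε (P.1 ξ τ)) * ψ κ ξ := by
    refine mul_right_cancel₀ (h.lead_ne_zero fun i hi k _ => hξ i hi k) ?_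
    rw [hun κ hκ, hlead]
    ring
  rw [h1, mul_assoc]

/-- The exponents of `∑_w c_w Ψ(λ, w x)`. -/
noncomputable def weylSum (b : P.Base) (m : ι → ℕ) (ψ : M → M → ℂ) (c : Weyl P → ℂ) (lam : M) : M →₀
    ℂ := ∑ w, c w • (shiftF lam (hullF b (rhoN b m)) fun κ => ψ κ lam).mapDomain (w⁻¹).1.1

variable {c : Weyl P → ℂ} {lam : M}

lemma expSum_weylSum (x : N) : 𝓔 (weylSum b m ψ c lam) x =
    ∑ w, c w * baFn b L m ψ lam (w.1.2.1 x) := by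
  simp only [weylSum, map_sum, map_smul, Finset.sum_apply, Pi.smul_apply, smul_eq_mul]
  refine sum_congr rfl fun w _ => ?_
  have := expSum_weyl P L w⁻¹ (shiftF lam 𝓗 fun κ => ψ κ lam) (w.1.2.1 x)
  have h1 : w⁻¹.1.2.1 (w.1.2.1 x) = x := by simp
  rw [h1] at this
  rw [this]; rfl

lemma mem_support_weylSum {ν : M} (hν : ν ∈ (weylSum b m ψ c lam).support) :
    ∃ w : Weyl P, ∃ κ ∈ hull b ϱ, ν = w.1.1 (lam + κ) := by
  rw [mem_support_iff, weylSum, finsetSum_apply] at hν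
  obtain ⟨w, -, hw⟩ := exists_ne_zero_of_sum_ne_zero hν
  have h1 := Finsupp.mapDomain_support (support_smul (mem_support_iff.2 hw))
  grind [support_shiftF, mem_hullF]

lemma sub_weyl_add_mem (hlam : IsDominant b lam) {κ : M} (hκ : κ ∈ hull b ϱ)
    (w : Weyl P) : lam + ϱ - w.1.1 (lam + κ) ∈ rootCone b := by
  rw [map_add, add_sub_add_comm]
  exact add_mem (hlam.sub_weyl_mem b w) (hκ w)

lemma eq_one_of_weyl_add (hlam : IsDominant b lam) (hreg : ∀ j ∈ b.support, P.coroot' j lam ≠ 0)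
    {κ : M} (hκ : κ ∈ hull b ϱ) {w : Weyl P} (h : w.1.1 (lam + κ) = lam + ϱ) : w = 1 := by
  have h1 := (mem_rootCone.1 (hlam.sub_weyl_mem b w)).1
  have h2 := (mem_rootCone.1 (hκ w)).1
  have h3 : ϱ - w.1.1 κ = -(lam - w.1.1 lam) := by grind
  rw [h3] at h2
  exact eq_one_of_rDom b (hlam.rDom b) hreg
    (sub_eq_zero.1 (realCone_salient b h1 h2)).symm

lemma weylSum_lead (hm : WInv P m) (hlam : IsDominant b lam) (hreg : ∀ j ∈ b.support,
    P.coroot' j lam ≠ 0) (h1 : c 1 = 1) : weylSum b m ψ c lam (lam + ϱ) = ψ ϱ lam := by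
  rw [weylSum, finsetSum_apply, sum_eq_single 1]
  · have := shiftF_apply lam 𝓗 (fun κ => ψ κ lam)
      (mem_hullF.2 ((isDominant_rhoN b hm).mem_hull b))
    simp_all
  · intro w _ hw
    rw [Finsupp.smul_apply, smul_eq_mul, mul_eq_zero]
    refine Or.inr (by_contra fun h2 => ?_)
    obtain ⟨μ, hμ, h3⟩ := mem_image.1 (Finsupp.mapDomain_support (mem_support_iff.2 h2))
    obtain ⟨κ, hκ, rfl⟩ := mem_image.1 (support_shiftF _ _ _ hμ)
    exact hw (inv_eq_one.1 (eq_one_of_weyl_add hlam hreg (mem_hullF.1 hκ) h3))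
  grind

lemma weylSum_eigen (h : IsBACoef b L m ψ) (hL : NonRoot L) (hm : WInv P m)
    (hπ : IsMinuscule P π ∨ IsQuasiminuscule P π) {x : N} (hx : IsRegularPt P L x) : macOp b L m⁻ π
    (𝓔 (weylSum b m ψ c lam)) x = (∑ τ ∈ orbitF P π, ε (P.1 lam τ)) * 𝓔 (weylSum b m ψ c lam) x :=
    by
  rw [funext expSum_weylSum, macOp_eq, opD_sum, mul_sum]
  refine sum_congr rfl fun w _ => ?_
  rw [opD_weyl (fun i j => by rw [hm]) (smallSet_orbitF hπ), ← macOp_eq,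
    h.eigen hL hm hπ (isRegularPt_weyl w hx)]
  ring

lemma isWeight_weylSum (hm : WInv P m) (hlam : IsDominant b lam) :
    ∀ ν ∈ (weylSum b m ψ c lam).support, IsWeight P ν := fun ν hν => by
  obtain ⟨w, κ, hκ, rfl⟩ := mem_support_weylSum hν
  exact ((hlam.isWeight b).add (isWeight_hull_rho b hm κ (mem_hullF.2 hκ))).weyl w

lemma weyl_apply_of_expSum (hL : L ≠ 0) {F : M →₀ ℂ} {w : Weyl P}
    (h : ∀ x, 𝓔 F (w.1.2.1 x) = 𝓔 F x) (κ : M) : F (w.1.1 κ) = F κ := by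
  have h1 : F.mapDomain w.1.1 = F := by
    refine expSum_injective P hL (funext fun x => ?_)
    have h2 := expSum_weyl P L w F (w⁻¹.1.2.1 x)
    rwa [← h, weyl_inv_applyN] at h2
  conv_lhs => rw [← h1]
  exact mapDomain_apply w.1.1.injective _ _

/-- The symmetric sum of Baker–Akhiezer functions is a Macdonald polynomial. -/
lemma IsBACoef.exists_plus (h : IsBACoef b L m ψ) (hL : NonRoot L) (hm : WInv P m)
    (hlam : IsDominant b lam) (hreg : ∀ j ∈ b.support, P.coroot' j lam ≠ 0)
    (hc : ψ ϱ lam ≠ 0) : ∃ a, IsMacdonald b L m⁻ (lam + ϱ) a ∧ (∀ x, ∑ w : Weyl P,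
    baFn b L m ψ lam (w.1.2.1 x) = ψ ϱ lam * orbitPoly P L a x) ∧ ∀ ν ∈ a.support,
    ∃ w : Weyl P, ∃ κ ∈ hull b ϱ, ν = w.1.1 (lam + κ) := by
  have hsum : ∀ x, 𝓔 (weylSum b m ψ (fun _ => 1) lam) x = ∑ w : Weyl P, baFn b L m ψ lam
    (w.1.2.1 x) := fun x => by
    rw [expSum_weylSum]; simp only [one_mul]
  obtain ⟨a, ha, hax, has⟩ := exists_isMacdonald (b := b) (k := fun i => -(m i : ℂ)) hc
    (F := weylSum b m ψ (fun _ => 1) lam) (μ := lam + ϱ) (fun i hi => by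
      obtain ⟨n, hn⟩ := hlam i hi
      obtain ⟨n', hn'⟩ := isDominant_rhoN b hm i hi
      exact ⟨n + n', by rw [map_add, hn, hn', cast_add]⟩) (isWeight_weylSum hm hlam)
    (fun w => weyl_apply_of_expSum (w := w) hL.ne_zero fun x => by
      rw [hsum, hsum]
      exact Fintype.sum_equiv (Equiv.mulRight w) _ _ fun v => rfl)
    (fun ν hν => by
      obtain ⟨w, κ, hκ, rfl⟩ := mem_support_weylSum hν
      exact sub_weyl_add_mem hlam hκ w) (weylSum_lead hm hlam hreg rfl) fun π hπ x hx => by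
      rw [weylSum_eigen h hL hm hπ hx, macEig_eq, rho_neg_natCast]
      simp
  grind [mem_support_weylSum]

end Weyl

/-! ### The antisymmetric sum and the discriminant `δ` -/

/-- `∏_{j = -n}^{n} [a + j]`. -/
noncomputable def dfac (L : ℂ) (n : ℕ) (a : ℂ) : ℂ := ∏ j ∈ Icc (-(n : ℤ)) n, brk L (a + j)

lemma prod_Icc_succ {A : Type*} [CommMonoid A] (n : ℕ) (f : ℤ → A) : ∏ j ∈ Icc
    (-((n + 1 : ℕ) : ℤ)) (n + 1 : ℕ), f j = f (n + 1) * (f (-(n + 1)) * ∏ j ∈ Icc (-(n : ℤ)) n,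
    f j) := by
  have h : Icc (-((n + 1 : ℕ) : ℤ)) (n + 1 : ℕ) = insert ((n : ℤ) + 1)
    (insert (-((n : ℤ) + 1)) (Icc (-(n : ℤ)) n)) := by grind
  grind

lemma dfac_zero (L a : ℂ) : dfac L 0 a = brk L a := by simp [dfac]

lemma dfac_succ (L : ℂ) (n : ℕ) (a : ℂ) :
    dfac L (n + 1) a = brk L (a + (n + 1)) * (brk L (a - (n + 1)) * dfac L n a) := by
  rw [dfac, prod_Icc_succ]; push_cast; rfl

lemma dfac_neg (L : ℂ) (n : ℕ) (a : ℂ) : dfac L n (-a) = -dfac L n a := by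
  induction n with
  | zero => rw [dfac_zero, dfac_zero, brk_neg]
  | succ n ih =>
    rw [dfac_succ, dfac_succ, ih, neg_add_eq_sub, ← neg_sub, brk_neg, ← neg_add', brk_neg]
    ring

lemma dfac_add_one (L : ℂ) (n : ℕ) (a : ℂ) :
    brk L (-n + a) * dfac L n (a + 1) = brk L (n + 1 + a) * dfac L n a := by
  induction n with
  | zero => simp [dfac_zero, mul_comm, add_comm]
  | succ n ih =>
    grind [dfac_succ]

lemma prod_qpow_Icc (L : ℂ) (n : ℕ) (a : ℂ) :
    ∏ j ∈ Icc (-(n : ℤ)) n, qpow L (a + j) = qpow L ((n + (n + 1)) * a) := by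
  induction n with
  | zero => simp
  | succ n ih =>
    rw [prod_Icc_succ, ih, ← qpow_add, ← qpow_add]
    push_cast; ring

section Gauge

variable {k : ι → ℂ}

lemma pfac_mul_dfac_of_nonneg (n : ℕ) {s : ℤ} (hs : IsSmall s) (h0 : 0 ≤ s) (a : ℂ) :
    pfac L (-n) s a * dfac L n (a + s) = pfac L (n + 1) s a * dfac L n a := by
  rw [pfac_of_nonneg L _ a h0, pfac_of_nonneg L _ a h0]
  have h1 := dfac_add_one L n a
  rcases (by unfold IsSmall at hs; omega : s = 0 ∨ s = 1 ∨ s = 2) with rfl | rfl | rfl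
  · simp [hfac]
  · simp only [hfac, Int.cast_one, Complex.one_re, one_pos, if_true,
      if_neg (by norm_num : (1 : ℂ) ≠ 2), mul_one]
    grind
  · have h2 := dfac_add_one L n (a + 1)
    simp only [hfac, Int.cast_ofNat, if_true, Complex.re_ofNat, Nat.ofNat_pos]
    grind

lemma pfac_mul_dfac (n : ℕ) {s : ℤ} (hs : IsSmall s) (a : ℂ) :
    pfac L (-n) s a * dfac L n (a + s) = pfac L (n + 1) s a * dfac L n a := by
  rcases le_total 0 s with h0 | h0
  · exact pfac_mul_dfac_of_nonneg n hs h0 a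
  · have := pfac_mul_dfac_of_nonneg (L := L) n hs.neg (neg_nonneg.2 h0) (-a)
    rw [cast_neg, pfac_neg, pfac_neg, ← neg_add, dfac_neg, dfac_neg] at this
    linear_combination -this

lemma macCoeff_eq_prod_posRoots (b : P.Base) (hk : WInv P k) (τ x : N) : macCoeff P L k τ x = ∏
    i ∈ posRoots b, pfac L (k i) (P.root' i τ) (P.root' i x) := by
  rw [macCoeff_eq_prod, prod_eq_prod_posRoots b]
  exact prod_congr rfl fun i _ => by rw [pfac, hk, root'_neg, root'_neg]

lemma macCoeff_mul_deltaFn (b : P.Base) (hm : WInv P m) {O : Finset N} (hO : SmallSet P O) {τ : N}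
    (hτ : τ ∈ O) (x : N) : macCoeff P L m⁻ τ x * deltaFn b L m (x + τ) = macCoeff P L m⁺ τ x *
    deltaFn b L m x := by
  rw [macCoeff_eq_prod_posRoots b fun i j => by rw [hm],
    macCoeff_eq_prod_posRoots b fun i j => by rw [hm], deltaFn, deltaFn,
    ← prod_mul_distrib, ← prod_mul_distrib]
  refine prod_congr rfl fun i _ => ?_
  obtain ⟨n, hs, hn, -⟩ := hO.small τ hτ i
  rw [map_add, hn]
  exact pfac_mul_dfac (m i) hs _

lemma deltaFn_refl {j : ι} (hj : j ∈ b.support) (hm : WInv P m)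
    (x : N) : deltaFn b L m (P.coreflection j x) = -deltaFn b L m x := by
  have hjp : j ∈ R₊ := simple_mem b hj
  have h : ∀ i, dfac L (m i) (P.root' i (P.coreflection j x)) = dfac L (m (ς j i))
    (P.root' (ς j i) x) := fun i => by
    have := root'_weyl P (𝐬 j) (ς j i) x
    rw [← this, hm]
    simp [reflTriple]
  change ∏ i ∈ R₊, dfac L (m i) _ = -∏ i ∈ R₊, dfac L (m i) _
  rw [prod_congr rfl fun i _ => h i, ← mul_prod_erase _ _ hjp, ← mul_prod_erase _ _ hjp,
    prod_posRoots_refl b hj fun i => dfac L (m i) (P.root' i x), hm, root'_neg, dfac_neg, neg_mul]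

lemma two_mul_pair_rho (b : P.Base) (k : ι → ℂ) (x : N) :
    2 * P.1 (rho b k) x = ∑ i ∈ posRoots b, k i * P.root' i x := by
  grind [pair_rho]

lemma qpow_two_mul_pair_rho (b : P.Base) (x : N) : ε
    (P.1 (rho b fun i => (m i : ℂ) + (m i + 1)) x) = ∏ i ∈ posRoots b, ∏ j ∈ Icc (-(m i : ℤ)) (m i),
    qpow L (P.root' i x + j) := by
  simp only [prod_qpow_Icc]
  rw [two_mul_pair_rho, qpow_sum]

lemma tendsto_deltaFn_ray (hL : L ≠ 0) {y : N} (hy : RegDom b y) (x : N) :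
    Tendsto (fun t : ℝ => exp
      (-(2 * t * P.1 (rho b fun i => (m i : ℂ) + (m i + 1)) y)) *
        deltaFn b L m (x + ((t : ℂ) / L) • y)) atTop
      (𝓝 (ε (P.1 (rho b fun i => (m i : ℂ) + (m i + 1)) x))) := by
  have h : ∀ i ∈ R₊, ∀ j : ℤ, Tendsto (fun t : ℝ => exp (-(t * P.root' i y)) *
      brk L (P.root' i (x + ((t : ℂ) / L) • y) + j)) atTop (𝓝 (qpow L (P.root' i x + j))) := by
    intro i hi j
    obtain ⟨r, hr, hr'⟩ := hy.root'_pos b (mem_posRoots.1 hi)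
    have := (tendsto_brk_ray hL (-(P.root' i x + j)) hr).neg
    rw [neg_neg, neg_neg] at this
    refine this.congr fun t => ?_
    rw [← mul_neg, ← brk_neg, map_add, map_smul, smul_eq_mul, hr']
    ring_nf
  have h1 := tendsto_finsetProd R₊ fun i hi =>
    tendsto_finsetProd (Icc (-(m i : ℤ)) (m i)) fun j _ => h i hi j
  rw [← qpow_two_mul_pair_rho] at h1
  refine h1.congr fun t => ?_
  simp only [prod_mul_distrib, prod_const, ← exp_nat_mul, ← exp_sum]
  rw [mul_right_comm, two_mul_pair_rho]
  refine congrArg₂ _ (congrArg _ ?_) rfl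
  rw [sum_mul, ← sum_neg_distrib]
  refine sum_congr rfl fun i _ => ?_
  have : ((Icc (-(m i : ℤ)) (m i)).card : ℂ) = m i + (m i + 1) := by
    rw [Int.card_Icc, show ((m i : ℤ) + 1 - -(m i : ℤ)).toNat = m i + (m i + 1) by omega]
    push_cast; ring
  rw [this]; ring

lemma deltaFn_eq (x : N) : ε (P.1 (rho b fun i => (m i : ℂ) + (m i + 1)) x) * deltaFn b L m x = ∏
    i ∈ R₊, ∏ j ∈ Icc (-(m i : ℤ)) (m i), (ε (P.root' i x + j) - 1) := by
  rw [qpow_two_mul_pair_rho, deltaFn, ← prod_mul_distrib]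
  refine prod_congr rfl fun i _ => ?_
  rw [← prod_mul_distrib]
  refine prod_congr rfl fun j _ => ?_
  rw [brk_eq, ← mul_assoc, ← qpow_add, add_neg_cancel, qpow_zero, one_mul]

lemma FunAxial.eq_zero_of_deltaFn {f : M →₀ ℂ} (hf : ∀ ν ∈ f.support, IsWeight P ν)
    (ha : FunAxial P L m (𝓔 f)) (hanti : ∀ i x, 𝓔 f (P.coreflection i x) = -𝓔 f x) {x : N} {i : ι}
    {j : ℤ} (hj : j ∈ Icc (-(m i : ℤ)) (m i)) (hx : ε (P.root' i x + j) = 1) : 𝓔 f x = 0 := by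
  set y := x + (j : ℂ) ⊙ i with hy
  have hyr : P.root' i y = P.root' i x + j := by simp_all
  have h1 := ha.int (x := y) (by rw [hyr]; exact hx) (abs_le.2 (mem_Icc.1 hj))
  have h3 := hanti i x
  have e : P.coreflection i x = y + (j : ℂ) ⊙ i + (-(P.root' i x + j)) • P.coroot i := by
    rw [P.coreflection_apply, hy]; module
  rw [e, expSum_periodic hf (by rw [mul_neg, qpow_neg, hx, inv_one]), h1, hy, add_sub_cancel_right]
    at h3
  linear_combination h3 / 2

lemma det_coreflection (i : ι) : det (P.coreflection i : N →ₗ[ℂ] N) = -1 := by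
  have : Module.Finite ℂ N := ⟨⟨univ.image P.coroot, by simp⟩⟩
  have h : (P.coreflection i : N →ₗ[ℂ] N) = transvection (-P.root' i) (P.coroot i) := by
    ext x
    rw [LinearEquiv.coe_coe, P.coreflection_apply, transvection.apply,
      LinearMap.neg_apply, neg_smul, sub_eq_add_neg]
  rw [h, transvection.det, LinearMap.neg_apply]
  norm_num

end Gauge

section Antisymmetric

variable {ψ : M → M → ℂ} {π : N}

/-- An antisymmetric axial exponential sum is divisible by `δ`. -/
lemma FunAxial.exists_eq_deltaFn_mul (hL : NonRoot L) {f : M →₀ ℂ} {μ₀ : M} (hμ₀ : IsWeight P μ₀)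
    (hf : ∀ ν ∈ f.support, ν - μ₀ ∈ rootLat P) (ha : FunAxial P L m (𝓔 f)) (hanti : ∀ i x,
    𝓔 f (P.coreflection i x) = -𝓔 f x) : ∃ g : M →₀ ℂ, (∀ ν ∈ g.support,
    ν - (μ₀ + rho b fun i => (m i : ℂ) + (m i + 1)) ∈ rootLat P) ∧ ∀ x, 𝓔 f x = deltaFn b L m x * 𝓔
    g x := by
  set ρ := rho b fun i => (m i : ℂ) + (m i + 1)
  have hw : ∀ ν ∈ f.support, IsWeight P ν := fun ν hν => by
    have := (isWeight_rootLat (hf ν hν)).add hμ₀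
    rwa [sub_add_cancel] at this
  set J := (R₊).sigma fun i => Icc (-(m i : ℤ)) (m i) with hJ
  have hmem : ∀ j : Σ _ : ι, ℤ, j ∈ J ↔ j.1 ∈ R₊ ∧ j.2 ∈ Icc (-(m j.1 : ℤ)) (m j.1) := fun j => by
    rw [hJ, mem_sigma]
  have hzero : ∀ j ∈ J, ∀ x, ε (P.root' j.1 x + j.2) = 1 → 𝓔 f x = 0 :=
    fun j hj x hx => ha.eq_zero_of_deltaFn hw hanti ((hmem j).1 hj).2 hx
  have hprod : ∀ x, ∏ j ∈ J, (ε (P.root' j.1 x + (j.2 : ℂ)) - 1) = ε (P.1 ρ x) * deltaFn b L m x :=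
    fun x => by
    rw [deltaFn_eq, hJ, prod_sigma]
  have hF : (fun x => ε (P.1 ρ x) * 𝓔 f x) ∈ expSpace P L {ν | ν - (μ₀ + ρ) ∈ rootLat P} :=
    exp_mul_mem_expSpace P L (G := {ν | ν - μ₀ ∈ rootLat P})
    (fun μ hμ => by rw [add_comm μ₀]; simpa using hμ) (expSum_mem P L hf)
  have hne : ∀ x, (∀ j ∈ J, ε (P.root' j.1 x + (j.2 : ℂ)) ≠ 1) →
      deltaFn b L m x ≠ 0 := fun x h =>
    (deltaFn_ne_zero_iff b m x).2 fun i hi j hj => h ⟨i, j⟩ ((hmem _).2 ⟨hi, hj⟩)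
  obtain ⟨g, hg, hgu⟩ := exists_expSpace_eq_of_tendsto P hL.ne_zero J (fun j => j.1)
    (fun j => (j.2 : ℂ)) (fun i μ hμ n => by
      grind [add_sub_right_comm, add_mem, zsmul_mem, root_mem_rootLat]) hF
    (u := fun x => 𝓔 f x / deltaFn b L m x) (fun x hx => by
      grind) fun j hj x hx hx' => by
    have hothers : ∏ j' ∈ J.erase j, (ε (P.root' j'.1 x + (j'.2 : ℂ)) - 1) ≠ 0 := by
      refine prod_ne_zero_iff.2 fun j' hj' => sub_ne_zero.2 ?_
      obtain ⟨hne', hj'J⟩ := mem_erase.1 hj'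
      by_cases h1 : j'.1 = j.1
      · obtain ⟨i, s⟩ := j
        obtain ⟨i', s'⟩ := j'
        obtain rfl : i' = i := h1
        intro h2
        refine hL (2 * (s' - s)) (fun h3 => hne' ?_) ?_
        · rw [show s' = s by omega]
        · have e : ((2 * (s' - s) : ℤ) : ℂ) = 2 * (P.root' i' x + s') + -(2 * (P.root' i' x + s)) :=
            by push_cast; ring
          grind [qpow_add, qpow_neg]
      · have hp := mem_posRoots.1 ((hmem j).1 hj).1
        have hp' := mem_posRoots.1 ((hmem j').1 hj'J).1
        refine hx' j' hj'J (fun h => h1 (P.root.injective h)) fun h => ?_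
        exact posRoots_not_parallel b hp hp' (Ne.symm h1) (-1) (by rw [h, neg_one_smul])
    have hlim := (tendsto_line hF x (P.coroot j.1)).div (tendsto_finsetProd (J.erase j)
      fun j' _ => ((by unfold qpow; fun_prop : Continuous fun t : ℂ =>
        ε (P.root' j'.1 x + t * P.root' j'.1 (P.coroot j.1) + (j'.2 : ℂ)) - 1).tendsto'
          0 (ε (P.root' j'.1 x + (j'.2 : ℂ)) - 1) (by simp)).mono_left
            nhdsWithin_le_nhds) hothers
    rw [hzero j hj x hx, mul_zero, zero_div] at hlim
    refine hlim.congr' ?_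
    filter_upwards [ev_qpow_ne_one hL.ne_zero (P.root' j.1 x + j.2)
      (s := P.root' j.1 (P.coroot j.1)) (by simp)] with t ht
    have h1 : ∀ j' : Σ _ : ι, ℤ, P.root' j'.1 (x + t • P.coroot j.1) = P.root' j'.1 x + t * P.root'
      j'.1 (P.coroot j.1) := fun j' => by
      simp
    have h2 := hprod (x + t • P.coroot j.1)
    rw [← mul_prod_erase _ _ hj] at h2
    simp only [h1] at h2 ⊢
    rw [add_right_comm] at ht
    have h3 := sub_ne_zero.2 ht
    have h4 := qpow_ne_zero L (2 * P.1 ρ (x + t • P.coroot j.1))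
    by_cases h5 : deltaFn b L m (x + t • P.coroot j.1) = 0
    · rw [h5, mul_zero, mul_eq_zero, or_iff_right h3] at h2
      grind [Pi.div_apply]
    grind [Pi.div_apply]
  obtain ⟨g, hg', rfl⟩ := (mem_expSpace P L).1 hg
  refine ⟨g, hg', fun x => ?_⟩
  grind [deltaFn_ne_zero_iff]

end Antisymmetric

section Antisymmetric

variable {ψ : M → M → ℂ} {π : N}
variable {lam : M}

/-- The sign of a Weyl group element. -/
noncomputable def weylDet (w : Weyl P) : ℂ := det (w.1.2.1 : N →ₗ[ℂ] N)

lemma weylDet_one : weylDet (1 : Weyl P) = 1 := LinearMap.det_id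

lemma weylDet_mul_refl (w : Weyl P) (i : ι) : weylDet (w * 𝐬 i) = -weylDet w := by
  have h : ((w * 𝐬 i).1.2.1 : N →ₗ[ℂ] N) = (w.1.2.1 : N →ₗ[ℂ] N) ∘ₗ
    (P.coreflection i : N →ₗ[ℂ] N) := rfl
  rw [weylDet, h, LinearMap.det_comp, det_coreflection, mul_neg_one, weylDet]

lemma rhoN_add_rho : ϱ + rho b m⁺ = rho b fun i => (m i : ℂ) + (m i + 1) := by
  simp only [rhoN, rho, ← smul_add, ← sum_add_distrib, ← add_smul]

lemma two_smul_rho_mem_rootLat (b : P.Base) (m : ι → ℕ) : (rho b fun i => (m i : ℂ) + (m i + 1)) +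
    (rho b fun i => (m i : ℂ) + (m i + 1)) ∈ rootLat P := by
  rw [← two_smul ℂ, rho, smul_smul, mul_one_div_cancel two_ne_zero, one_smul]
  refine sum_mem fun i _ => ?_
  rw [show (m i : ℂ) + (m i + 1) = ((m i + (m i + 1) : ℕ) : ℂ) by push_cast; ring,
    cast_smul_eq_nsmul]
  exact nsmul_mem (root_mem_rootLat P i) _

lemma IsBACoef.exists_quotient (h : IsBACoef b L m ψ) (hL : NonRoot L) (hm : WInv P m)
    (hlam : IsDominant b lam) (hreg : ∀ j ∈ b.support, P.coroot' j lam ≠ 0) : ∃ g : M →₀ ℂ, (∀ x,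
    𝓔 (weylSum b m ψ weylDet lam) x = deltaFn b L m x * 𝓔 g x) ∧ (∀ (w : Weyl P) κ,
    g (w.1.1 κ) = g κ) ∧ (∀ ν ∈ g.support, lam - rho b m⁺ - ν ∈ rootCone b) ∧ g
    (lam - rho b fun i => (m i : ℂ) + 1) = ψ ϱ lam := by
  set f := weylSum b m ψ weylDet lam
  set ρ₁ := rho b fun i => (m i : ℂ) + 1
  set ρ₂ := rho b fun i => (m i : ℂ) + (m i + 1) with hρ₂
  have hρ : ϱ + ρ₁ = ρ₂ := rhoN_add_rho
  have hanti : ∀ i x, 𝓔 f (P.coreflection i x) = -𝓔 f x := fun i x => by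
    rw [expSum_weylSum, expSum_weylSum, ← sum_neg_distrib]
    refine Fintype.sum_equiv (Equiv.mulRight (𝐬 i)) _ _ fun w => ?_
    rw [Equiv.coe_mulRight, weylDet_mul_refl, neg_mul, neg_neg]
    rfl
  have hax : FunAxial P L m (𝓔 f) := fun i s hs x hx => by
    rw [expSum_weylSum, expSum_weylSum]
    exact sum_congr rfl fun w _ => congrArg _ ((h.funAxial hL hm lam).comp_weyl hm w i s hs x hx)
  have hlow : ∀ ν ∈ f.support, lam + ϱ - ν ∈ rootCone b := fun ν hν => by
    obtain ⟨w, κ, hκ, rfl⟩ := mem_support_weylSum hν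
    exact sub_weyl_add_mem hlam hκ w
  obtain ⟨g, hg, hfg⟩ := hax.exists_eq_deltaFn_mul hL (b := b)
    ((hlam.isWeight b).add ((isDominant_rhoN b hm).isWeight b))
    (fun ν hν => by rw [← neg_sub]; grind [neg_mem, mem_rootCone]) hanti
  have hg' : ∀ ν ∈ g.support, ν - (lam - ρ₁) ∈ rootLat P := fun ν hν => by
    have := add_mem (hg ν hν) (two_smul_rho_mem_rootLat b m)
    rw [← hρ₂, ← hρ] at this
    convert this using 1
    abel
  set c := ψ ϱ lam
  have hlim : ∀ y, RegDom b y → ∀ x, Tendsto (fun t : ℝ =>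
      exp (-(2 * t * (P.1 (lam - ρ₁) y))) * 𝓔 g (x + ((t : ℂ) / L) • y)) atTop
      (𝓝 (c * ε (P.1 (lam - ρ₁) x))) := fun y hy x => by
    have h1 := tendsto_expSum_ray P hL.ne_zero (y := y) (μ₀ := lam + ϱ) (f := f) (d := 0)
      (fun μ hμ => by
        obtain ⟨r, hr⟩ := hy.rootLat_real b (mem_rootCone.1 (hlow μ hμ)).2
        exact ⟨-r, by rw [← neg_sub, map_neg₂, hr, ofReal_neg]⟩)
      (fun μ hμ => by
        obtain ⟨r, hr, h1⟩ := pair_nonneg b (mem_rootCone.1 (hlow μ hμ)).1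
          (fun j hj => by obtain ⟨r, hr, h⟩ := hy j hj; exact ⟨r, hr.le, h⟩)
        rw [← neg_sub, map_neg₂, h1]
        simpa using hr) x
    have h2 : f.filter (fun μ => (P.1 (μ - (lam + ϱ)) y).re = (0 : ℝ)) = single
      (lam + ϱ) c := by
      ext μ
      rw [filter_apply, single_apply]
      by_cases h3 : lam + ϱ = μ
      · rw [if_pos h3, ← h3, sub_self, map_zero₂, if_pos Complex.zero_re]
        exact weylSum_lead hm hlam hreg weylDet_one
      · rw [if_neg h3, ite_eq_right_iff]
        intro h4
        by_contra h5
        obtain ⟨r, hr, h6⟩ := pair_pos b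
          (mem_rootCone.1 (hlow μ (mem_support_iff.2 h5))).1 (sub_ne_zero.2 h3) hy
        rw [← neg_sub, map_neg₂, h6] at h4
        simp at h4
        exact hr.ne' h4
    rw [h2, expSum_single] at h1
    have h3 := h1.div (tendsto_deltaFn_ray (m := m) hL.ne_zero hy x) (qpow_ne_zero _ _)
    have e : lam + ϱ = lam - ρ₁ + ρ₂ := by rw [← hρ]; abel
    rw [e, qpow_add_pair, ← mul_assoc, mul_div_cancel_right₀ _ (qpow_ne_zero _ _)] at h3
    refine h3.congr' ?_
    have h4 := (tendsto_deltaFn_ray (m := m) hL.ne_zero hy x).eventually_ne (qpow_ne_zero _ _)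
    filter_upwards [h4] with t ht
    rw [Pi.div_apply, div_eq_iff ht, hfg, map_add₂, ofReal_zero,
      add_zero, mul_add, neg_add, Complex.exp_add]
    ring
  have hlt : ∀ y, RegDom b y → ∀ μ ∈ (g - single (lam - ρ₁) c).support,
    (P.1 (μ - (lam - ρ₁)) y).re < 0 := fun y hy => by
    refine re_lt_of_tendsto_ray P hL.ne_zero y (lam - ρ₁) _ (fun μ hμ => ?_) 0 fun x => ?_
    · rcases mem_union.1 (support_sub hμ) with h1 | h1
      · exact hy.rootLat_real b (hg' μ h1)
      · have := mem_singleton.1 (support_single_subset h1)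
        exact ⟨0, by simp [this]⟩
    · have h1 := (hlim y hy x).sub (tendsto_const_nhds (x := c * ε (P.1 (lam - ρ₁) x)))
      rw [sub_self] at h1
      refine h1.congr fun t => ?_
      rw [map_sub 𝓔, Pi.sub_apply, expSum_single, qpow_ray P hL.ne_zero, ofReal_zero,
        add_zero, mul_sub, Complex.exp_neg]
      field_simp [exp_ne_zero]
  have hlead : g (lam - ρ₁) = c := by
    by_contra hne
    have := hlt _ (regDom_sumFundCo b) (lam - ρ₁) (by
      grind [Finsupp.sub_apply])
    simp at this
  refine ⟨g, hfg, fun w κ => ?_, fun ν hν => ?_, hlead⟩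
  · have hinv : ∀ x, 𝓔 g (w.1.2.1 x) = 𝓔 g x := by
      induction w using weyl_induction_simple b with
      | one => exact fun x => rfl
      | mul j hj w ih =>
        intro x
        change 𝓔 g (P.coreflection j (w.1.2.1 x)) = _
        rw [← ih x]
        generalize w.1.2.1 x = x
        have e : ∀ x, 𝓔 g (P.coreflection j x) = 𝓔 (g.mapDomain (𝐬 j).1.1) x := fun x => by
          rw [← expSum_weyl P L (𝐬 j) g (P.coreflection j x)]
          exact congrArg _ (P.coreflection_same j x)
        rw [e, ← sub_eq_zero, ← Pi.sub_apply, ← map_sub]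
        refine congrFun (eq_zero_of_regular b hL.ne_zero m
          (expSum_mem P L (G := Set.univ) fun _ _ => Set.mem_univ _) ?_) x
        · intro x _ hx
          have h1 := hanti j x
          rw [hfg, hfg, deltaFn_refl hj hm] at h1
          rw [map_sub, Pi.sub_apply, ← e]
          grind
    exact weyl_apply_of_expSum hL.ne_zero hinv κ
  · refine mem_rootCone_of_forall_regDom b (by rw [← neg_sub]; exact neg_mem (hg' ν hν)) fun y hy => ?_
    by_cases h1 : ν = lam - ρ₁
    · simp [h1]
    · have := hlt y hy ν (by
        grind [Finsupp.sub_apply])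
      rw [← neg_sub, map_neg₂, neg_re]
      linarith

end Antisymmetric

section Antisymmetric

variable {ψ : M → M → ℂ} {π : N}
variable {lam : M}

lemma exists_nat_of_shifted (hm : WInv P m)
    (hlam : IsDominant b (lam - rho b fun i => (m i : ℂ) + 1)) {i : ι} (hi : i ∈ R₊) :
    ∃ n : ℕ, m i < n ∧ P.coroot' i lam = n := by
  have h1 : ∀ j ∈ b.support, ∃ n : ℕ, m j < n ∧ P.coroot' j lam = n := fun j hj => by
    obtain ⟨n, hn⟩ := hlam j (simple_mem b hj)
    rw [map_sub, coroot'_rho b (fun i j => by rw [hm]) hj, sub_eq_iff_eq_add] at hn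
    exact ⟨n + (m j + 1), by omega, by grind⟩
  obtain ⟨n, hn⟩ := (isDominant_iff b).2 (fun j hj => let ⟨n, _, h⟩ := h1 j hj; ⟨n, h⟩) i hi
  obtain ⟨r, hr, hr'⟩ := le_coroot' b (k := fun i => (m i : ℝ) + 1) (fun i j => by simp only [hm])
    (fun i => by positivity) (fun j hj => by
      obtain ⟨n, hn, h⟩ := h1 j hj
      exact ⟨n, by exact_mod_cast hn, by rw [h]; simp⟩) (mem_posRoots.1 hi)
  refine ⟨n, ?_, hn⟩
  rw [hn] at hr'
  have : (n : ℝ) = r := by exact_mod_cast hr'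
  rw [← this] at hr
  exact_mod_cast hr

lemma cFactor_ne_zero (hL : NonRoot L) (hm : WInv P m)
    (hlam : IsDominant b (lam - rho b fun i => (m i : ℂ) + 1)) : cFactor b L m lam ≠ 0 := by
  refine prod_ne_zero_iff.2 fun i hi => prod_ne_zero_iff.2 fun j hj => ?_
  obtain ⟨n, hn, h⟩ := exists_nat_of_shifted hm hlam hi
  have := (mem_Icc.1 hj).2
  have h1 := hL.brk_int_ne_zero (n := (j : ℤ) - n) (by omega)
  rw [h]
  exact_mod_cast h1

lemma sum_macCoeff_mul_quotient (h : IsBACoef b L m ψ) (hL : NonRoot L) (hm : WInv P m)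
    (hπ : IsMinuscule P π ∨ IsQuasiminuscule P π) {g : M →₀ ℂ} (hg : ∀ x,
    𝓔 (weylSum b m ψ weylDet lam) x = deltaFn b L m x * 𝓔 g x) {x : N}
    (hx : IsRegularPt P L x) (hx' : deltaFn b L m x ≠ 0) : ∑ τ ∈ orbitF P π, macCoeff P L m⁺ τ x *
    𝓔 g (x + τ) = (∑ τ ∈ orbitF P π, macCoeff P L m⁻ τ x - ∑ τ ∈ orbitF P π,
    qpow L (-2 * P.1 (rho b fun i => -(m i : ℂ)) τ) + ∑ τ ∈ orbitF P π, ε (P.1 lam τ)) *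
    𝓔 g x := by
  have h1 := weylSum_eigen (c := weylDet) (lam := lam) h hL hm hπ hx
  have e : ∑ τ ∈ orbitF P π, macCoeff P L m⁻ τ x * 𝓔 (weylSum b m ψ weylDet lam) (x + τ) =
    deltaFn b L m x * ∑ τ ∈ orbitF P π, macCoeff P L m⁺ τ x * 𝓔 g (x + τ) := by
    rw [mul_sum]
    refine sum_congr rfl fun τ hτ => ?_
    rw [hg]
    linear_combination
      𝓔 g (x + τ) * macCoeff_mul_deltaFn (L := L) b hm (smallSet_orbitF hπ) hτ x
  simp only [macOp_eq, opD, mul_sub, sum_sub_distrib, ← sum_mul, e] at h1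
  grind

/-- The alternating sum of Baker–Akhiezer functions is `δ` times a Macdonald polynomial. -/
lemma IsBACoef.exists_minus (h : IsBACoef b L m ψ) (hL : NonRoot L) (hm : WInv P m)
    (hlam : IsDominant b (lam - rho b fun i => (m i : ℂ) + 1)) : ∃ a, IsMacdonald b L m⁺
    (lam - rho b fun i => (m i : ℂ) + 1) a ∧ ∀ x, ∑ w : Weyl P, weylDet w * baFn b L m ψ lam
    (w.1.2.1 x) = ψ ϱ lam * deltaFn b L m x * orbitPoly P L a x := by
  set ρ₁ := rho b fun i => (m i : ℂ) + 1
  have key : ∀ lam : M, IsDominant b (lam - ρ₁) → ψ ϱ lam ≠ 0 ∧ ∃ g : M →₀ ℂ, (∀ x,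
    𝓔 (weylSum b m ψ weylDet lam) x = deltaFn b L m x * 𝓔 g x) ∧
    (∀ (w : Weyl P) κ, g (w.1.1 κ) = g κ) ∧ (∀ ν ∈ g.support, lam - ρ₁ - ν ∈ rootCone b) ∧ g
    (lam - ρ₁) = ψ ϱ lam := fun lam hlam => by
      refine ⟨by rw [h.lead]; exact cFactor_ne_zero hL hm hlam, h.exists_quotient hL hm
        (fun i hi => ?_) fun j hj => ?_⟩
      · obtain ⟨n, -, hn⟩ := exists_nat_of_shifted hm hlam hi
        exact ⟨n, hn⟩
      · obtain ⟨n, hn, hn'⟩ := exists_nat_of_shifted hm hlam (simple_mem b hj)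
        aesop
  obtain ⟨hc, g, hg, hinv, hlow, hlead⟩ := key lam hlam
  obtain ⟨hc₁, g₁, hg₁, hinv₁, hlow₁, hlead₁⟩ := key ρ₁ (by
    exact fun i _ => ⟨0, by simp⟩)
  rw [sub_self] at hlow₁ hlead₁
  have hg₁x : ∀ x, 𝓔 g₁ x = ψ ϱ ρ₁ := by
    have h1 : g₁ = single 0 (ψ ϱ ρ₁) := by
      ext ν
      by_cases hν : ν = 0
      · rw [hν, hlead₁, single_eq_same]
      · rw [single_eq_of_ne hν]
        by_contra h1
        obtain ⟨w, hw⟩ := exists_longest b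
        have h2 := longest_mem_rootCone b hw (hlow₁ ν (mem_support_iff.2 h1))
        have h3 := hlow₁ (w.1.1 ν) (mem_support_iff.2 (by rwa [hinv₁]))
        rw [zero_sub] at h3
        rw [zero_sub, map_neg, neg_neg] at h2
        refine hν (w.1.1.map_eq_zero_iff.1 ?_)
        grind [realCone_salient, mem_rootCone]
    intro x
    rw [h1, expSum_single]; simp [qpow_zero]
  have hk : ∀ i j, (m (ς i j) : ℂ) + 1 = m j + 1 := fun i j => by rw [hm]
  have hlat : ∀ ν ∈ g.support, IsWeight P ν := fun ν hν => by
    have h1 := (hlam.isWeight b).sub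
      (isWeight_rootLat (mem_rootCone.1 (hlow ν hν)).2)
    rwa [sub_sub_cancel] at h1
  obtain ⟨a, ha, hax, -⟩ := exists_isMacdonald (b := b) (k := fun i => (m i : ℂ) + 1) hc hlam
    hlat hinv hlow hlead fun π hπ x hx => by
      rw [macEig_eq, sub_add_cancel, macOp_eq]
      set C := ∑ τ ∈ orbitF P π, qpow L (-2 * P.1 (rho b fun i => (m i : ℂ) + 1) τ)
      set E := ∑ τ ∈ orbitF P π, ε (P.1 lam τ)
      have hz : ∀ C' x, opD P L m⁺ (orbitF P π) C (𝓔 g) x = opD P L m⁺ (orbitF P π)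
        (C - C') (𝓔 g) x + C' * 𝓔 g x := fun C' x => by
        simp only [opD]; ring
      obtain ⟨T, hT, hTx⟩ := exists_numerator (P := P) (L := L) (O := orbitF P π)
        (G := Set.univ) (fun _ _ _ _ => Set.mem_univ _)
        m⁺ (C - E) (expSum_mem P L (f := g) fun _ _ => Set.mem_univ _)
      have hT0 : T = 0 := eq_zero_of_regular b hL.ne_zero m hT fun x hx hx' => by
        rw [hTx x hx]
        have h1 := sum_macCoeff_mul_quotient h hL hm hπ hg hx hx'
        have h2 := sum_macCoeff_mul_quotient h hL hm hπ hg₁ hx hx'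
        simp only [hg₁x, ← sum_mul] at h2
        have h3 := mul_right_cancel₀ hc₁ h2
        have h4 := sum_qpow_rho_neg (L := L) (π := π) (k := fun i => (m i : ℂ) + 1) b hk
        rw [opD]
        simp only [mul_sub, sum_sub_distrib, h1, ← sum_mul, h3]
        grind
      have h1 := hTx x hx
      rw [hT0, Pi.zero_apply, eq_comm, mul_eq_zero, or_iff_left] at h1
      · rw [hz E, h1, zero_add]
      · refine prod_ne_zero_iff.2 fun j _ => mul_ne_zero ?_ ?_
        · have := (hx j).1
          rw [Ne, brk_eq_zero] at this
          grind
        · have := (hx j).2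
          grind [brk_eq_zero]
  grind [expSum_weylSum]

end Antisymmetric

/-! ### Zonotopes -/

section Zonotope

lemma re_pair_le_sum (hm : WInv P m) {y : N} (hy : ∀ i, ∃ r : ℝ, P.root' i y = r) {κ : M}
    (hκ : κ ∈ hull b ϱ) : (P.1 κ y).re ≤ 1 / 2 * ∑ i ∈ R₊, m i * |(P.root' i y).re| := by
  obtain ⟨w, hw, -⟩ := exists_weyl_rDom b.flip hy
  have hw' : ∀ j ∈ b.support, ∃ r : ℝ, 0 ≤ r ∧ P.root' j ((unflipTriple w).1.2.1 y) = r := hw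
  generalize unflipTriple w = w at hw'
  obtain ⟨r, hr, hr'⟩ := pair_nonneg b (mem_rootCone.1 (hκ w)).1 hw'
  have h1 := congrArg Complex.re hr'
  rw [map_sub₂, pair_weyl, rhoN, pair_rho, sub_re,
    ofReal_re, show (1 / 2 : ℂ) = ((1 / 2 : ℝ) : ℂ) by push_cast; rfl,
    re_ofReal_mul, re_sum] at h1
  have h2 := sum_posRoots_weyl b (fun i => (m i : ℝ) * |(P.root' i (w.1.2.1 y)).re|)
    (fun i => by rw [root'_neg, neg_re, abs_neg, hm]) w
  simp only [root'_weyl, invariant_weyl P hm] at h2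
  have h3 : ∑ i ∈ R₊, ((m i : ℂ) * P.root' i (w.1.2.1 y)).re ≤ ∑ i ∈ R₊, (m i : ℝ) *
    |(P.root' i (w.1.2.1 y)).re| := by
    refine sum_le_sum fun i _ => ?_
    rw [← ofReal_natCast, re_ofReal_mul]
    exact mul_le_mul_of_nonneg_left (le_abs_self _) (Nat.cast_nonneg _)
  linarith

/-- The hull of `ρ_m` is contained in the zonotope of the positive roots. -/
lemma isLocal_of_mem_hull (hm : WInv P m) {κ : M} (hκ : κ ∈ hull b ϱ) : IsLocal b m ϱ κ := by
  have hreal : ∀ i, ∃ r : ℝ, P.coroot' i (κ - ϱ) = r := fun i => by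
    obtain ⟨n, hn⟩ := (isWeight_rootLat (mem_rootCone.1 (sub_mem_hull b hκ)).2).neg i
    exact ⟨n, by rw [← neg_sub, hn]; simp⟩
  have hint : ∀ i k, ∃ r : ℝ, P.coroot' i (P.root k) = r := fun i k => by
    obtain ⟨n, hn⟩ := isWeight_root (P := P) k i
    exact ⟨n, by rw [hn]; simp⟩
  choose r hr using hreal
  choose a ha using hint
  set D : (ι → ℝ) → ι → ℝ := fun l i => r i + ∑ k ∈ R₊, l k * a i k with hD
  obtain ⟨l, hl, hmin⟩ := (isCompact_univ_pi fun i => isCompact_Icc (a := (0 : ℝ)) (b := m i))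
    |>.exists_isMinOn ⟨0, fun i _ => ⟨le_rfl, Nat.cast_nonneg _⟩⟩
    (f := fun l => ∑ i, D l i ^ 2) (by fun_prop)
  have hl : ∀ i, 0 ≤ l i ∧ l i ≤ m i := fun i => hl i (Set.mem_univ i)
  refine ⟨l, hl, ?_⟩
  set p := ϱ - ∑ i ∈ R₊, (l i : ℂ) • P.root i with hp
  have hDl : ∀ i, P.coroot' i (κ - p) = D l i := fun i => by
    rw [hp, ← sub_add, map_add, hr, map_sum, hD]
    simp_all
  set y : N := ∑ i, (D l i : ℂ) • P.coroot i with hy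
  have hpair : ∀ μ, P.1 μ y = ∑ i, (D l i : ℂ) * P.coroot' i μ := fun μ => by rw [hy, map_sum]; simp
  set A : ι → ℝ := fun k => ∑ i, D l i * a i k with hA
  have hyA : ∀ k, P.root' k y = A k := fun k => by rw [hpair, hA]; push_cast; simp only [ha]
  have hfirst : ∀ k ∈ R₊, ∀ t : ℝ, 0 ≤ l k + t → l k + t ≤ m k → 0 ≤ 2 * t * A k + t ^ 2 *
    ∑ i, a i k ^ 2 := fun k hk t h0 h1 => by
    have h2 := isMinOn_iff.1 hmin (update l k (l k + t)) fun i _ => by grind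
    have h3 : ∀ i, D (update l k (l k + t)) i = D l i + t * a i k := fun i => by
      simp only [hD]
      rw [← add_sum_erase _ _ hk, ← add_sum_erase _ (fun k => l k * a i k) hk,
        update_self, sum_congr rfl fun j hj => by rw [update_of_ne (ne_of_mem_erase hj)]]
      ring
    have h4 : ∑ i, (D l i + t * a i k) ^ 2 = ∑ i, D l i ^ 2 + (2 * t * A k + t ^ 2 * ∑ i,
      a i k ^ 2) := by
      simp only [hA, mul_sum, ← sum_add_distrib]
      exact sum_congr rfl fun i _ => by ring
    simp only [h3, h4] at h2
    linarith
  have hslack : ∀ k ∈ R₊, l k * A k = 1 / 2 * (m k * A k - m k * |A k|) := fun k hk => by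
    have hB : 0 ≤ ∑ i, a i k ^ 2 := sum_nonneg fun i _ => sq_nonneg _
    specialize hfirst k hk
    generalize ∑ i, a i k ^ 2 = B at hB hfirst
    have key : ∀ c > 0, ∀ E : ℝ, 0 < E → (∀ t > 0, t ≤ c → 0 ≤ -2 * t * E + t ^ 2 * B) → False := by
      intro c hc E hE h
      have h1 : 0 < E / (B + 1) := by positivity
      have := h (min c (E / (B + 1))) (lt_min hc h1) (min_le_left _ _)
      have h2 := (le_div_iff₀ (by positivity : 0 < B + 1)).1 (min_le_right c (E / (B + 1)))
      have h3 : 0 < min c (E / (B + 1)) := lt_min hc h1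
      nlinarith
    obtain ⟨h0, h1⟩ := hl k
    rcases lt_trichotomy (A k) 0 with h | h | h
    · rcases h1.lt_or_eq with h2 | h2
      · exact (key (m k - l k) (sub_pos.2 h2) (-A k) (neg_pos.2 h) fun t ht ht' => by grind).elim
      · rw [abs_of_neg h, h2]; ring
    · rw [h]; simp
    · rcases h0.lt_or_eq with h2 | h2
      · exact (key (l k) h2 (A k) h fun t ht ht' => by
          have := hfirst (-t) (by linarith) (by linarith)
          linarith).elim
      grind
  have h1 := re_pair_le_sum hm (fun i => ⟨A i, hyA i⟩) hκ
  have h2 : (P.1 p y).re = 1 / 2 * ∑ i ∈ R₊, m i * |(P.root' i y).re| := by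
    have e : P.1 p y = ((1 / 2 * ∑ i ∈ R₊, m i * A i - ∑ i ∈ R₊, l i * A i : ℝ) : ℂ) := by
      rw [hp, map_sub₂, rhoN, pair_rho, map_sum P.1, LinearMap.sum_apply]
      push_cast
      simp only [map_smul₂, smul_eq_mul, ← hyA]
    rw [e, ofReal_re, sum_congr rfl hslack, ← mul_sum, sum_sub_distrib]
    simp only [hyA, ofReal_re]
    ring
  have h3 : (P.1 (κ - p) y).re = ∑ i, D l i ^ 2 := by
    rw [hpair, re_sum]
    refine sum_congr rfl fun i _ => ?_
    rw [hDl, ← ofReal_mul, ofReal_re, sq]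
  rw [map_sub₂, sub_re] at h3
  have h4 := (sum_eq_zero_iff_of_nonneg fun i _ => sq_nonneg (D l i)).1
    (le_antisymm (by linarith) (sum_nonneg fun i _ => sq_nonneg (D l i)))
  refine sub_eq_zero.1 (ext_simple b.flip fun i hi => ?_)
  change P.coroot' i (κ - p) = P.coroot' i 0
  rw [hDl, (pow_eq_zero_iff two_ne_zero).1 (h4 i (mem_univ i)), map_zero]
  rfl

end Zonotope

section Normalized

/-- Uniqueness of the normalized Baker–Akhiezer function. -/
lemma IsBACoef.eq_of_form {φ : M → M → ℂ} (h : IsBACoef b L m φ) (hL : NonRoot L) (hm : WInv P m)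
    {c : M →₀ (M → ℂ)} {Ψ : M → N → ℂ} (hmem : ∀ κ ∈ c.support, IsWeight P κ ∧ IsLocal b m ϱ κ)
    (hform : ∀ ξ x, Ψ ξ x = ε (P.1 ξ x) * c.sum fun κ f => f ξ * ε (P.1 κ x)) (hax : ∀ ξ,
    FunAxial P L m (Ψ ξ)) (hcont : ∀ κ x v, Continuous fun t : ℂ => c κ (x + t • v)) (hlead : ∀ ξ,
    c ϱ ξ = ∏ i ∈ R₊, ∏ j ∈ Icc 1 (m i), brk L (j - P.coroot' i ξ)) : Ψ = baFn b L m φ := by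
  set S := c.support ∪ 𝓗
  have hSmem : ∀ κ ∈ S, IsWeight P κ ∧ IsLocal b m ϱ κ := fun κ hκ => by
    rcases mem_union.1 hκ with h1 | h1
    · exact hmem κ h1
    · exact ⟨isWeight_hull_rho b hm κ h1, isLocal_of_mem_hull hm (mem_hullF.1 h1)⟩
  have hΨ : ∀ ξ x, Ψ ξ x = ε (P.1 ξ x) * ∑ κ ∈ S, c κ ξ * ε (P.1 κ x) := fun ξ x => by
    rw [hform, Finsupp.sum_of_support_subset _ subset_union_left _ (by simp)]
  have hφ : ∀ ξ x, baFn b L m φ ξ x = ε (P.1 ξ x) * ∑ κ ∈ S, φ κ ξ * ε (P.1 κ x) := fun ξ x => by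
    rw [baFn_eq, h.sum_subset subset_union_right]
  set y := sumFundCo b
  choose! r hr hr' using fun i (hi : i ∈ R₊) =>
    (regDom_sumFundCo b).root'_pos b (mem_posRoots.1 hi)
  have hρy : P.1 ϱ y = ((1 / 2 * ∑ i ∈ R₊, m i * r i : ℝ) : ℂ) := by
    rw [rhoN, pair_rho, sum_congr rfl fun i hi => by rw [hr' i hi]]
    push_cast; rfl
  have hpy : ∀ l : ι → ℝ, (P.1 (ϱ - ∑ i ∈ R₊, (l i : ℂ) • P.root i) y).re = 1 / 2 * ∑ i ∈ R₊, m i *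
    r i - ∑ i ∈ R₊, l i * r i := fun l => by
    have : P.1 (∑ i ∈ R₊, (l i : ℂ) • P.root i) y = ((∑ i ∈ R₊, l i * r i : ℝ) : ℂ) := by
      rw [map_sum P.1, LinearMap.sum_apply]
      push_cast
      exact sum_congr rfl fun i hi => by rw [map_smul₂, smul_eq_mul, ← hr' i hi]
    rw [map_sub₂, this, hρy, ← Complex.ofReal_sub, ofReal_re]
  have key : ∀ ξ, IsNonRes b L ξ → ∀ κ ∈ S, c κ ξ = φ κ ξ := fun ξ hξ => by
    by_contra! hne
    have hax' : CoefAxial b L (fun i => ε (P.coroot' i ξ)) m S fun κ => c κ ξ - φ κ ξ := by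
      refine (funAxial_shiftF_iff b hL.ne_zero hm ξ (fun κ hκ => (hSmem κ hκ).1) _).1 ?_
      have e : 𝓔 (shiftF ξ S fun κ => c κ ξ - φ κ ξ) = fun x => Ψ ξ x - baFn b L m φ ξ x := by
        funext x
        rw [expSum_shiftF, hΨ, hφ, ← mul_sub, ← sum_sub_distrib]
        simp only [sub_mul]
      rw [e]
      exact fun i s hs x hx =>
        congrArg₂ (· - ·) (hax ξ i s hs x hx) (h.funAxial hL hm ξ i s hs x hx)
    obtain ⟨κ, hκ, hκ'⟩ := hne
    obtain ⟨p, hp, hp', p', hpS', -, hw⟩ := hax'.exists_width hL (fun κ hκ => (hSmem κ hκ).1)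
      subset_rfl hξ y (fun i hi => by rw [hr' i hi]; exact (hr i hi).ne')
      ⟨κ, hκ, sub_ne_zero.2 hκ'⟩
    obtain ⟨-, l, hl, rfl⟩ := hSmem p hp
    obtain ⟨-, l', hl', rfl⟩ := hSmem p' hpS'
    have h0 : ∀ i ∈ R₊, (m i : ℝ) * |(P.root' i y).re| = m i * r i := fun i hi => by
      rw [hr' i hi, ofReal_re, abs_of_pos (hr i hi)]
    rw [hpy, hpy, sum_congr rfl h0] at hw
    have h1 : ∑ i ∈ R₊, l' i * r i ≤ ∑ i ∈ R₊, m i * r i :=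
      sum_le_sum fun i hi => mul_le_mul_of_nonneg_right (hl' i).2 (hr i hi).le
    have h2 : ∀ i ∈ R₊, 0 ≤ l i * r i := fun i hi => mul_nonneg (hl i).1 (hr i hi).le
    have h3 := (sum_eq_zero_iff_of_nonneg h2).1 (le_antisymm (by linarith) (sum_nonneg h2))
    refine hp' ?_
    rw [sum_eq_zero fun i hi => by
      rw [(mul_eq_zero.1 (h3 i hi)).resolve_right (hr i hi).ne', ofReal_zero, zero_smul],
      sub_zero, hlead, h.lead, sub_self]
  funext ξ x
  rw [hΨ, hφ]
  refine congrArg _ (sum_congr rfl fun κ hκ => ?_)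
  rw [congrFun (eq_of_isNonRes b hL.ne_zero (hcont κ) (h.lineDiff κ).continuous
    fun ξ hξ => key ξ hξ κ hκ) ξ]

end Normalized

section Existence

variable {M N : Type*} [AddCommGroup M] [Module ℂ M] [NormedAddCommGroup N] [NormedSpace ℂ N]
  {P : RootPairing ι ℂ M N} {L : ℂ} {m : ι → ℕ}
variable [P.IsRootSystem] [P.IsCrystallographic] [P.IsReduced] {b : P.Base}
lemma rhoCo_eq : rhoCo b (fun i => (m i : ℂ)) = rhoN b.flip m := by rw [← rho_flip]

lemma isNormalizedBA_iff {φ : N → N → ℂ} (h : IsBACoef b.flip L m φ) (hL : NonRoot L)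
    (hm : WInv P m) (ψ : N → M → ℂ) : IsNormalizedBA b L m ψ ↔ ψ = baFn b.flip L m φ := by
  constructor
  · rintro ⟨c, hc, hcont, hlead⟩
    refine h.eq_of_form hL hm (c := c) (fun κ hκ => ?_) hc.form
      (fun ξ i s hs x hx => hc.axiality i s hs ξ x hx) (fun κ x v => ?_) fun ξ => ?_
    · have := hc.mem κ hκ
      rw [polytopeN, rhoCo_eq] at this
      rwa [IsLocal, posRoots_flip]
    · exact (hcont κ).comp (by fun_prop)
    simp_all [rhoCo_eq, posRoots_flip]
  · rintro rfl
    have hfin : Module.Finite ℂ N := ⟨⟨univ.image P.coroot, by simp⟩⟩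
    refine ⟨onFinset (hullF b.flip (rhoN b.flip m)) φ fun κ hκ => ?_, ⟨fun κ hκ => ?_,
      fun x z => ?_, fun i s hs x z hz => h.funAxial hL hm x i s hs z hz⟩, fun κ => ?_, fun x => ?_⟩
    · by_contra h1
      exact hκ (h.zero κ h1)
    · have h1 := Finsupp.support_onFinset_subset hκ
      refine ⟨isWeight_hull_rho b.flip hm κ h1, ?_⟩
      have h2 := isLocal_of_mem_hull (P := P.flip) hm (mem_hullF.1 h1)
      rw [IsLocal, posRoots_flip] at h2
      rwa [polytopeN, rhoCo_eq]
    · simp [baFn_eq]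
    · rw [Finsupp.onFinset_apply]
      obtain ⟨f, -, hf⟩ := (mem_expSpace _ L).1 (h.mem κ)
      rw [← hf]
      have h1 : ∀ ν : M, Continuous fun x : N => qpow L (2 * P.1 ν x) := fun ν =>
        (continuous_qpow L).comp (continuous_const.mul
          (LinearMap.continuous_of_finiteDimensional (P.1 ν)))
      have h2 : expSum P.flip.flip L f = fun x => ∑ μ ∈ f.support, f μ * qpow L (2 * P.1 μ x) :=
        funext fun x => expSum_subset P L f x subset_rfl
      rw [h2]
      exact continuous_finsetSum _ fun μ _ => continuous_const.mul (h1 μ)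
    · rw [Finsupp.onFinset_apply, rhoCo_eq, h.lead, posRoots_flip]
      rfl

end Existence

section BoxSum

/-- The sums `∑ l_α α` over positive roots with integers `0 ≤ l_α ≤ m_α`. -/
def boxSum (b : P.Base) (m : ι → ℕ) : Set M :=
  {x | ∃ l : ι → ℕ, (∀ i, l i ≤ m i) ∧ x = ∑ i ∈ posRoots b, l i • P.root i}

lemma sum_update_nsmul_root (l : ι → ℕ) {i : ι} (hi : i ∈ R₊) (v : ℕ) : ∑ k ∈ R₊, update l i v k •
    P.root k = ∑ k ∈ R₊, l k • P.root k - l i • P.root i + v • P.root i := by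
  rw [← add_sum_erase _ _ hi, ← add_sum_erase _ (fun k => l k • P.root k) hi,
    update_self, sum_congr (g := fun k => l k • P.root k) rfl fun k hk => by grind]
  abel

lemma update_le {l : ι → ℕ} (hl : ∀ i, l i ≤ m i) {i : ι} {v : ℕ} (hv : v ≤ m i) (k : ι) :
    update l i v k ≤ m k := by
  grind

lemma sum_sub_root_mem_boxSum {l : ι → ℕ} (hl : ∀ i, l i ≤ m i) {i : ι} (hi : i ∈ R₊)
    (h : 0 < l i) : ∑ k ∈ R₊, l k • P.root k - P.root i ∈ boxSum b m := by
  refine ⟨_, update_le hl ((sub_le (l i) 1).trans (hl i)), ?_⟩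
  obtain ⟨n, hn⟩ : ∃ n, l i = n + 1 := ⟨l i - 1, by omega⟩
  rw [sum_update_nsmul_root l hi, hn, Nat.add_sub_cancel, succ_nsmul]
  abel

lemma sum_sub_add_root_mem_boxSum {l : ι → ℕ} (hl : ∀ i, l i ≤ m i) {i i' : ι}
    (hi : i ∈ R₊) (hi' : i' ∈ R₊) (hii : i' ≠ i) (h : 0 < l i) (h' : l i' < m i') :
    ∑ k ∈ R₊, l k • P.root k - P.root i + P.root i' ∈ boxSum b m := by
  have h1 := sum_sub_root_mem_boxSum (b := b) (update_le hl (i := i') h') hi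
    (by rwa [update_of_ne hii.symm])
  rw [sum_update_nsmul_root l hi', succ_nsmul] at h1
  convert h1 using 1
  abel

lemma coroot'_root (i j : ι) : P.coroot' j (P.root i) = (P.pairingIn ℤ i j : ℤ) :=
  (P.algebraMap_pairingIn ℤ i j).symm

lemma sub_root_mem_boxSum (hm : WInv P m) (hC : ∀ i j, 1 < (P.pairing j i).re → 0 < m j → 0 < m i)
    {j : ι} (hj : j ∈ b.support) {x : M} (hx : x ∈ boxSum b m) {n : ℤ} (hn : P.coroot' j x = n)
    (h0 : 0 < n) : x - P.root j ∈ boxSum b m := by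
  obtain ⟨l, hl, rfl⟩ := hx
  have hjp := simple_mem b hj
  rcases Nat.eq_zero_or_pos (l j) with hlj | hlj
  swap
  · exact sum_sub_root_mem_boxSum hl hjp hlj
  have hrr : ∀ i, ς j (ς j i) = i := fun i => by simp
  have hc : ∀ i, P.pairingIn ℤ (ς j i) j = -P.pairingIn ℤ i j := fun i => by
    have : ((P.pairingIn ℤ (ς j i) j : ℤ) : ℂ) = -(P.pairingIn ℤ i j : ℤ) := by
      rw [← coroot'_root, ← coroot'_root, P.root_reflectionPerm, P.reflection_apply, map_sub,
        map_smul]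
      simp; ring
    exact_mod_cast this
  obtain ⟨i, hi, hci, hli⟩ : ∃ i ∈ (R₊).erase j, 0 < P.pairingIn ℤ i j ∧ l (ς j i) < l i := by
    by_contra! hcon
    have h1 : n = ∑ i ∈ (R₊).erase j, l i * P.pairingIn ℤ i j := by
      rw [← add_sum_erase _ _ hjp, hlj, zero_smul, zero_add, map_sum] at hn
      simp only [map_nsmul, coroot'_root, nsmul_eq_mul] at hn
      exact_mod_cast hn.symm
    have h2 := sum_posRoots_refl b hj fun i => (l i : ℤ) * P.pairingIn ℤ i j
    have h3 : ∑ i ∈ (R₊).erase j,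
      ((l i : ℤ) * P.pairingIn ℤ i j + l (ς j i) * P.pairingIn ℤ (ς j i) j) ≤ 0 := by
      refine sum_nonpos fun i hi => ?_
      rw [hc]
      rcases lt_trichotomy 0 (P.pairingIn ℤ i j) with h | h | h
      · simp_all
      · rw [← h]; simp
      · obtain ⟨h4, h5⟩ := mem_erase.1 hi
        have h6 : ς j i ∈ (R₊).erase j := by
          refine mem_erase.2 ⟨fun h => ?_, mem_posRoots.2 ?_⟩
          · grind [mem_posRoots, isPos_simple_neg]
          · exact (mem_posRoots.1 h5).reflectionPerm hj h4
        have := hcon _ h6 (by rw [hc]; omega)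
        simp_all
    rw [sum_add_distrib, h2] at h3
    omega
  obtain ⟨hij, hi⟩ := mem_erase.1 hi
  have hip := mem_posRoots.1 hi
  have hb : b.IsPos j := b.isPos_of_mem_support hj
  have hnp : ∀ c : ℂ, P.root i ≠ c • P.root j := posRoots_not_parallel b hb hip hij.symm
  have hsi : ς j i ∈ R₊ := mem_posRoots.2 (hip.reflectionPerm hj hij)
  have hsr : P.root (ς j i) = P.root i - P.pairingIn ℤ i j • P.root j := by
    rw [P.root_reflectionPerm, P.reflection_apply, coroot'_root, cast_smul_eq_zsmul]
  have hset := P.pairingIn_pairingIn_mem_set_of_isCrystal_of_isRed' i j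
    (fun h => hij (P.root.injective h)) fun h => hnp (-1) (by rw [h, neg_one_smul])
  have hk : P.pairingIn ℤ i j = 1 ∨ (P.pairingIn ℤ i j = 2 ∨ P.pairingIn ℤ i j = 3) ∧ P.pairingIn ℤ
    j i = 1 := by
    simp only [Set.mem_insert_iff, Set.mem_singleton_iff, Prod.mk.injEq] at hset
    omega
  have hli0 : 0 < l i := by omega
  have hswap : ∀ i₁ ∈ R₊, ∀ i₂ ∈ R₊, P.root i₂ = P.root i₁ - P.root j → 0 < l i₁ → l i₂ < m i₂ →
    ∑ k ∈ R₊, l k • P.root k - P.root j ∈ boxSum b m := by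
    intro i₁ h₁ i₂ h₂ h hl₁ hl₂
    have := sum_sub_add_root_mem_boxSum hl h₁ h₂ (fun h' => P.ne_zero j ?_) hl₁ hl₂
    · simp_all
    · grind
  rcases hk with hk | ⟨hk, hk'⟩
  · exact hswap i hi _ hsi (by rw [hsr, hk, one_smul]) hli0 (hli.trans_le ((hl i).trans_eq (hm j i).symm))
  set g := ς (ς i j) (ς i j) with hg
  have hgr : P.root g = P.root i - P.root j := by
    rw [hg, root_neg, P.root_reflectionPerm, P.reflection_apply, coroot'_root, hk']
    simp
  have hgm : 0 < m g := by
    rw [hg, hm, hm]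
    refine hC j i ?_ (hli0.trans_le (hl i))
    rw [← P.algebraMap_pairingIn ℤ]
    rcases hk with hk | hk <;> simp [hk]
  have hgj : g ≠ j := fun h => hnp 2 (by
    grind [two_smul])
  have hgc : P.pairingIn ℤ g j = P.pairingIn ℤ i j - 2 := by
    have h1 : ((P.pairingIn ℤ g j : ℤ) : ℂ) = (P.pairingIn ℤ i j : ℤ) - (2 : ℤ) := by
      rw [← coroot'_root, hgr, map_sub, coroot'_root, coroot'_root]; simp
    exact_mod_cast h1
  have hsg : P.root (ς j g) = P.root (ς j i) + P.root j := by
    rw [P.root_reflectionPerm, P.reflection_apply, coroot'_root, hgc, hgr, hsr,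
      cast_smul_eq_zsmul, sub_smul]
    abel
  have hgp : b.IsPos g := by
    by_contra hneg
    have h1 : b.IsPos (ς i j) := by rwa [hg, isPos_neg_iff, not_not] at hneg
    have h2 : P.root (ς i j) = P.root j - P.root i := by
      rw [← neg_sub, ← hgr, hg, root_neg, neg_neg]
    have hne : ς i j ≠ j := fun h => by rw [h, eq_comm, sub_eq_self] at h2; exact P.ne_zero i h2
    have h3 := h1.reflectionPerm hj hne
    have h4 : P.root (ς j (ς i j)) = -P.root j - P.root (ς j i) := by
      rw [P.root_reflectionPerm, h2, map_sub, P.reflection_apply_self, ← P.root_reflectionPerm]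
    have h5 := add_mem (root_mem_realCone b h3) (root_mem_realCone b (mem_posRoots.1 hsi))
    rw [h4, sub_add_cancel] at h5
    exact P.ne_zero j (realCone_salient b (root_mem_realCone b hb) h5)
  have hgpos := mem_posRoots.2 hgp
  by_cases hA : l g < m g
  · grind
  have hsgpos : ς j g ∈ R₊ := mem_posRoots.2 (hgp.reflectionPerm hj hgj)
  by_cases hB : 0 < l (ς j g)
  · grind
  have hgne : P.pairingIn ℤ g j ≠ 0 := fun h => by
    have : ς j g = g := P.root.injective (by
      rw [P.root_reflectionPerm, P.reflection_apply, coroot'_root, h]; simp)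
    rw [this] at hB
    omega
  refine hswap g hgpos _ hsgpos ?_ (by omega) (by rw [hm]; omega)
  rw [P.root_reflectionPerm, P.reflection_apply, coroot'_root, hgc]
  rcases hk with hk | hk
  · omega
  · rw [hk]; simp

end BoxSum

section Descent

lemma exists_eq_sum_of_mem_rootCone {d : M} (hd : d ∈ rootCone b) :
    ∃ k : b.support → ℕ, d = ∑ j, k j • P.root j := by
  induction hd using AddSubmonoid.closure_induction with
  | mem x hx =>
    obtain ⟨i, hi, rfl⟩ := hx
    exact ⟨Pi.single ⟨i, hi⟩ 1, by simp [Pi.single_apply, ite_smul]⟩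
  | zero => exact ⟨0, by simp⟩
  | add x y _ _ hx hy =>
    obtain ⟨k, rfl⟩ := hx
    obtain ⟨k', rfl⟩ := hy
    exact ⟨k + k', by simp [add_smul, sum_add_distrib]⟩

lemma exists_simple_pair_pos {d : M} (hd : d ∈ rootCone b) (h0 : d ≠ 0) :
    ∃ j ∈ b.support, ∃ n : ℤ, 0 < n ∧ P.coroot' j d = n ∧ d - P.root j ∈ rootCone b := by
  obtain ⟨k, hk⟩ := exists_eq_sum_of_mem_rootCone hd
  have hn : ∀ j, P.coroot' j d = ((∑ i, k i * P.pairingIn ℤ i j : ℤ) : ℂ) := fun j => by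
    rw [hk, map_sum]; push_cast
    exact sum_congr rfl fun i _ => by rw [map_nsmul, coroot'_root, nsmul_eq_mul]
  by_contra! hcon
  have hnp : ∀ j : b.support, ∑ i, k i * P.pairingIn ℤ i j ≤ 0 := fun j => by
    rcases Nat.eq_zero_or_pos (k j) with h | h
    · refine sum_nonpos fun i _ => ?_
      by_cases hij : i = j
      · rw [hij, h]; simp
      · exact mul_nonpos_of_nonneg_of_nonpos (Int.natCast_nonneg _)
          (b.pairingIn_le_zero_of_ne (fun h => hij (Subtype.ext h)) i.2 j.2)
    · by_contra! hpos
      refine hcon j j.2 _ hpos (hn j) ?_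
      obtain ⟨n, hn⟩ : ∃ n, k j = n + 1 := ⟨k j - 1, by omega⟩
      have hr : ∀ i : b.support, P.root i ∈ rootCone b := fun i => simple_mem_rootCone b i.2
      rw [hk, ← add_sum_erase _ _ (mem_univ j), hn, succ_nsmul, add_sub_right_comm,
        add_sub_cancel_right]
      exact add_mem (nsmul_mem (hr j) _) (sum_mem fun i _ => nsmul_mem (hr i) _)
  have hdom : RDom b (-d) := fun j hj => by
    refine ⟨-(∑ i, k i * P.pairingIn ℤ i j : ℤ), ?_, ?_⟩
    · have := hnp ⟨j, hj⟩
      rw [neg_nonneg]; exact_mod_cast this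
    · rw [map_neg, hn]; simp
  obtain ⟨w, hw⟩ := exists_longest b
  have h1 := add_mem (hdom.sub_weyl_mem b w) (mem_rootCone.1 (longest_mem_rootCone b hw hd)).1
  grind [sub_neg_eq_add, add_neg_cancel_right, realCone_salient, mem_rootCone]

lemma mem_of_forall_sub_root_mem {X : Set M} (hX : ∀ j ∈ b.support, ∀ x ∈ X, ∀ n : ℤ, 0 < n →
    P.coroot' j x = n → x - P.root j ∈ X) {ν : M} (hν : IsDominant b ν) {x : M} (hx : x ∈ X)
    (h : x - ν ∈ rootCone b) : ν ∈ X := by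
  obtain ⟨k, hk⟩ := exists_eq_sum_of_mem_rootCone h
  have hpair : ∀ (k : b.support → ℕ), P.1 (∑ j, k j • P.root j) (sumFundCo b) = (∑ j, k j : ℕ) :=
    fun k => by
    simp [root'_sumFundCo]
  induction hN : ∑ j, k j using Nat.strong_induction_on generalizing x k with
  | _ n ih =>
    by_cases h0 : x - ν = 0
    · rwa [← sub_eq_zero.1 h0]
    obtain ⟨j, hj, r, hr, hr', hd⟩ := exists_simple_pair_pos h h0
    obtain ⟨s, hs⟩ := hν j (simple_mem b hj)
    rw [sub_right_comm] at hd
    obtain ⟨k', hk'⟩ := exists_eq_sum_of_mem_rootCone hd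
    refine ih _ ?_ (hX j hj x hx (r + s) (by omega) ?_) hd k' hk' rfl
    · have h1 := hpair k'
      have h2 := hpair k
      have h3 : P.1 (P.root j) (sumFundCo b) = 1 := root'_sumFundCo b hj
      rw [← hk', sub_right_comm, map_sub₂, h3, hk, h2] at h1
      have h4 : (∑ j, k j : ℕ) = ∑ j, k' j + 1 := by
        have : ((∑ j, k j : ℕ) : ℂ) = ((∑ j, k' j + 1 : ℕ) : ℂ) := by grind
        exact_mod_cast this
      omega
    · rw [← sub_add_cancel x ν, map_add, hr', hs]; push_cast; rfl

lemma rhoN_add_rhoN (b : P.Base) (m : ι → ℕ) :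
    rhoN b m + rhoN b m = ∑ i ∈ posRoots b, m i • P.root i := by
  rw [← two_smul ℂ, rhoN, rho, smul_smul, mul_one_div_cancel two_ne_zero, one_smul]
  grind [cast_smul_eq_nsmul]

lemma boxSum_weyl (hm : WInv P m) (w : Weyl P) {x : M}
    (hx : x + ϱ ∈ boxSum b m) : w.1.1 x + ϱ ∈ boxSum b m := by
  induction w using weyl_induction_simple b with
  | one => exact hx
  | mul j hj w ih =>
    obtain ⟨l, hl, h⟩ := ih
    change P.reflection j (w.1.1 x) + _ ∈ _
    refine ⟨fun k => if k = j then m j - l j else l (ς j k), fun k => ?_, ?_⟩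
    · grind
    · have hjp := simple_mem b hj
      have h1 : P.reflection j ϱ = ϱ - m j • P.root j := refl_rhoN b hm hj
      rw [eq_sub_of_add_eq h, map_sub, h1, map_sum, ← add_sum_erase _ _ hjp,
        ← add_sum_erase _ _ hjp]
      rw [map_nsmul, P.reflection_apply_self,
        ← sum_posRoots_refl b hj fun i => P.reflection j (l i • P.root i),
        sum_congr rfl fun k hk => by
          rw [map_nsmul, ← P.root_reflectionPerm, P.reflectionPerm_self j k],
        sum_congr (s₁ := (R₊).erase j) (f := fun k => (if k = j then _ else _) • _)
          rfl fun k hk => by rw [if_neg (ne_of_mem_erase hk)]]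
      obtain ⟨n, hn⟩ := Nat.exists_eq_add_of_le (hl j)
      rw [hn, Nat.add_sub_cancel_left, add_smul, smul_neg]
      abel

lemma isIntLocal_of_mem_hull (hm : WInv P m) (hC : ∀ i j, 1 < (P.pairing j i).re → 0 < m j →
    0 < m i) {κ : M} (hκ : κ ∈ hull b ϱ) : IsIntLocal b m ϱ κ := by
  have hρ := isDominant_rhoN b hm
  have hwt := isWeight_hull_rho b hm κ (mem_hullF.2 hκ)
  obtain ⟨w, hw, -⟩ := exists_weyl_rDom b fun i => by
    obtain ⟨n, hn⟩ := hwt i; exact ⟨n, by rw [hn]; simp⟩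
  have hdom : IsDominant b (w.1.1 κ + ϱ) := fun i hi => by
    obtain ⟨n, hn⟩ := isDominant_of_rDom b hw (hwt.weyl w) i hi
    obtain ⟨n', hn'⟩ := hρ i hi
    exact ⟨n + n', by rw [map_add, hn, hn', cast_add]⟩
  have h1 := mem_of_forall_sub_root_mem (X := boxSum b m)
    (fun j hj x hx n h0 hn => sub_root_mem_boxSum hm hC hj hx hn h0) hdom (x := ϱ + ϱ)
    ⟨m, fun _ => le_rfl, rhoN_add_rhoN b m⟩ (by rw [add_sub_add_right_eq_sub]; exact hκ w)
  have h2 := boxSum_weyl hm w⁻¹ h1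
  have h4 := weyl_inv_applyM P w⁻¹ κ
  rw [inv_inv] at h4
  rw [h4] at h2
  obtain ⟨l, hl, h⟩ := h2
  refine ⟨fun i => m i - l i, fun i => sub_le _ _, ?_⟩
  have h3 : ∑ i ∈ R₊, ((m i - l i : ℕ) : ℂ) • P.root i = ∑ i ∈ R₊, m i • P.root i - ∑ i ∈ R₊, l i •
    P.root i := by
    rw [← sum_sub_distrib]
    refine sum_congr rfl fun i _ => ?_
    rw [Nat.cast_sub (hl i), sub_smul, cast_smul_eq_nsmul, cast_smul_eq_nsmul]
  rw [h3, ← rhoN_add_rhoN, ← h]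
  abel

lemma sub_mem_hull_of_dominant {lam κ₀ κ : M} (hlam : IsDominant b lam) (hκ₀ : IsWeight P κ₀)
    (hκ : κ ∈ hull b κ₀) {w : Weyl P} (hν : IsDominant b (w.1.1 (lam + κ))) :
    w.1.1 (lam + κ) - lam ∈ hull b κ₀ := by
  set ν := w.1.1 (lam + κ)
  obtain ⟨κ, hκT, hmax⟩ := exists_max_image ((hullF b κ₀).filter fun κ => ∃ w : Weyl P,
    w.1.1 (lam + κ) = ν) (fun κ => (P.1 κ (sumFundCo b)).re) ⟨κ,
    mem_filter.2 ⟨mem_hullF.2 hκ, w, rfl⟩⟩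
  obtain ⟨hκ, w, hw⟩ := mem_filter.1 hκT
  rw [mem_hullF] at hκ
  have hdom : RDom b (lam + κ) := fun j hj => by
    obtain ⟨p, hp⟩ := hlam j (simple_mem b hj)
    obtain ⟨r, hr⟩ := isWeight_of_mem_hull b hκ₀ hκ j
    refine ⟨p + r, ?_, by rw [map_add, hp, hr]; push_cast; rfl⟩
    by_contra! hneg
    have hneg' : (p : ℤ) + r < 0 := by exact_mod_cast hneg
    obtain ⟨n, hn⟩ := eq_ofNat_of_zero_le (a := -(p + r)) (by omega)
    obtain ⟨c, hc⟩ := eq_ofNat_of_zero_le (a := -r) (by omega)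
    have h1 := sub_nsmul_mem_hull b hκ (i := ς j j) (c := c) (n := n)
      (by rw [coroot'_neg, hr, ← cast_neg, hc]; rfl) (by omega)
    rw [root_neg, smul_neg, sub_neg_eq_add] at h1
    have h2 := hmax _ (mem_filter.2 ⟨mem_hullF.2 h1, w * 𝐬 j, ?_⟩)
    · have h3 : P.1 (P.root j) (sumFundCo b) = 1 := root'_sumFundCo b hj
      rw [map_add₂, map_nsmul, LinearMap.smul_apply, h3, nsmul_one, add_re, natCast_re] at h2
      have : (n : ℝ) ≤ 0 := by linarith
      have : n ≤ 0 := by exact_mod_cast this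
      omega
    · rw [← hw]
      change w.1.1 (P.reflection j _) = _
      have h4 : (n : ℂ) = -(p + r) := by
        have : ((n : ℤ) : ℂ) = ((-(p + r) : ℤ) : ℂ) := congrArg _ hn.symm
        push_cast at this; exact this
      rw [P.reflection_apply, ← cast_smul_eq_nsmul ℂ, h4, map_add, map_add, hp, hr, map_smul]
      grind [RootPairing.root_coroot'_eq_pairing, pairing_same, smul_eq_mul]
  have := eq_of_rDom b (hν.rDom b) hdom hw
  rwa [this, add_sub_cancel_left]

end Descent

/-! ### Nondegeneracy -/

lemma exists_real_of_sum_zpow {κ : Type*} {O : Finset κ} {n n' : κ → ℤ} {q : ℂ}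
    (hq0 : q ≠ 0) (hq : q ^ 2 ≠ 1) (h : (∃ r : ℝ, q = r) ∨ Transcendental ℚ q)
    (he : ∑ τ ∈ O, q ^ (2 * n τ) = ∑ τ ∈ O, q ^ (2 * n' τ)) :
    ∃ c : ℝ, c ≠ 0 ∧ ∑ τ ∈ O, Real.exp (c * n τ) = ∑ τ ∈ O, Real.exp (c * n' τ) := by
  suffices h : ∃ r : ℝ, r ≠ 0 ∧ r ^ 2 ≠ 1 ∧ ∑ τ ∈ O, r ^ (2 * n τ) = ∑ τ ∈ O, r ^ (2 * n' τ) by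
    obtain ⟨r, h0, h1, h2⟩ := h
    have hpos : 0 < r ^ 2 := by positivity
    have h3 : ∀ k : ℤ, Real.exp (Real.log (r ^ 2) * k) = r ^ (2 * k) := fun k => by
      rw [Real.exp_mul, Real.exp_log hpos, Real.rpow_intCast, zpow_mul]; rfl
    exact ⟨Real.log (r ^ 2), Real.log_ne_zero_of_pos_of_ne_one hpos h1, by simpa only [h3] using h2⟩
  rcases h with ⟨r, rfl⟩ | h
  · exact ⟨r, by exact_mod_cast hq0, by exact_mod_cast hq, by exact_mod_cast he⟩
  · obtain ⟨B, hB⟩ : ∃ B : ℕ, ∀ τ ∈ O, 0 ≤ B + 2 * n τ ∧ 0 ≤ B + 2 * n' τ := by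
      refine ⟨∑ τ ∈ O, (2 * (n τ).natAbs + 2 * (n' τ).natAbs), fun τ hτ => ?_⟩
      have := single_le_sum (f := fun τ => 2 * (n τ).natAbs + 2 * (n' τ).natAbs)
        (fun _ _ => Nat.zero_le _) hτ
      omega
    have key : ∀ {F : Type} [Field F] [CharZero F] {x : F}, x ≠ 0 → ∀ k : κ → ℤ, (∀ τ ∈ O,
      0 ≤ B + 2 * k τ) → (∑ τ ∈ O, Polynomial.X ^ (B + 2 * k τ).toNat : Polynomial ℚ).aeval x = x ^
      B * ∑ τ ∈ O, x ^ (2 * k τ) := by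
      intro F _ _ x hx k hk
      rw [map_sum, mul_sum]
      refine sum_congr rfl fun τ hτ => ?_
      rw [map_pow, Polynomial.aeval_X, ← zpow_natCast, Int.toNat_of_nonneg (hk τ hτ),
        zpow_add₀ hx, zpow_natCast]
    have h1 := (transcendental_iff_injective.1 h) (a₁ := ∑ τ ∈ O, Polynomial.X ^ (B + 2 * n τ).toNat)
      (a₂ := ∑ τ ∈ O, Polynomial.X ^ (B + 2 * n' τ).toNat) (by
        rw [key hq0 n fun τ hτ => (hB τ hτ).1, key hq0 n' fun τ hτ => (hB τ hτ).2, he])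
    have h2 := congrArg (aeval (2 : ℝ)) h1
    rw [key two_ne_zero n fun τ hτ => (hB τ hτ).1, key two_ne_zero n' fun τ hτ => (hB τ hτ).2] at h2
    exact ⟨2, two_ne_zero, by norm_num, mul_left_cancel₀ (by positivity) h2⟩

section Nondegenerate

lemma exists_coroot_of_mem_orbitF {j : ι} {τ : N} (h : τ ∈ orbitF P (P.coroot j)) :
    ∃ i, τ = P.coroot i := by
  obtain ⟨w, rfl⟩ := mem_orbitF.1 h
  exact ⟨_, (coroot_weyl P w j).symm⟩

lemma sum_exp_lt [P.IsIrreducible] {i : ι} {c : ℝ} (hc : c ≠ 0) {y d : M} (hy : RDom b y)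
    (hd : d ∈ realCone b) (hdr : ∀ i, ∃ r : ℝ, P.coroot' i d = r) (h0 : d ≠ 0) : ∑ τ ∈ orbitF P
    (P.coroot i), Real.exp (c * (P.1 y τ).re) < ∑ τ ∈ orbitF P (P.coroot i), Real.exp
    (c * (P.1 (y + d) τ).re) := by
  set O := orbitF P (P.coroot i)
  set E : N → ℝ := fun τ => c * Real.exp (c * (P.1 y τ).re) with hE
  have hv : ∀ j ∈ b.support, ∃ r : ℝ, 0 ≤ r ∧ P.root' j (∑ τ ∈ O, (E τ : ℂ) • τ) = r := by
    intro j hj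
    have hre : ∀ τ ∈ O, P.root' j τ = ((P.root' j τ).re : ℂ) := fun τ hτ => by
      obtain ⟨k, rfl⟩ := exists_coroot_of_mem_orbitF hτ
      have h1 : P.root' j (P.coroot k) = (P.pairingIn ℤ j k : ℂ) :=
        (P.algebraMap_pairingIn ℤ j k).symm
      rw [h1]; simp
    refine ⟨∑ τ ∈ O, E τ * (P.root' j τ).re, ?_, ?_⟩
    · obtain ⟨p, hp, hp'⟩ := hy j hj
      have h1 := sum_weyl_invariant (O := O) (fun w τ h => weyl_mem_orbitF h w) (𝐬 j)
        fun τ => E τ * (P.root' j τ).re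
      have h2 : 0 ≤ ∑ τ ∈ O, (E τ * (P.root' j τ).re +
          E ((𝐬 j).1.2.1 τ) * (P.root' j ((𝐬 j).1.2.1 τ)).re) := by
        refine sum_nonneg fun τ hτ => ?_
        have h3 : P.root' j (P.coreflection j τ) = -P.root' j τ := by
          rw [P.coreflection_apply, map_sub, map_smul]
          simp only [RootPairing.root'_coroot_eq_pairing, pairing_same, smul_eq_mul]
          ring
        have h4 : (P.1 y (P.coreflection j τ)).re = (P.1 y τ).re - p * (P.root' j τ).re := by
          rw [P.coreflection_apply, map_sub, map_smul, hre τ hτ]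
          change (_ - _ * P.coroot' j y).re = _
          rw [hp', sub_re, ← ofReal_mul, ofReal_re, ofReal_re, mul_comm p]
        change 0 ≤ _ + E (P.coreflection j τ) * (P.root' j (P.coreflection j τ)).re
        rw [h3, neg_re, hE]
        dsimp only
        rw [h4]
        set a := (P.root' j τ).re
        set s := (P.1 y τ).re
        rcases le_total 0 (c * a) with h | h
        · have : Real.exp (c * (s - p * a)) ≤ Real.exp (c * s) := exp_le_exp.2 (by nlinarith)
          nlinarith
        · have : Real.exp (c * s) ≤ Real.exp (c * (s - p * a)) := exp_le_exp.2 (by nlinarith)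
          nlinarith
      rw [sum_add_distrib, h1] at h2
      linarith
    · rw [map_sum]; push_cast
      grind [sum_congr, map_smul, smul_eq_mul]
  obtain ⟨r, hr, hr'⟩ := pair_nonneg b hd hv
  have h1 : 0 ≤ ∑ τ ∈ O, E τ * (P.1 d τ).re := by
    have := congrArg Complex.re hr'
    rw [map_sum, re_sum, ofReal_re] at this
    refine hr.trans_eq (this.symm.trans (sum_congr rfl fun τ _ => ?_))
    simp
  have h2 : ∃ τ ∈ O, (P.1 d τ).re ≠ 0 := by
    by_contra! hcon
    refine h0 (eq_zero_of_orbitF (P := P) (P.ne_zero' i) fun τ hτ => ?_)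
    have h3 := hcon τ hτ
    obtain ⟨k, rfl⟩ := exists_coroot_of_mem_orbitF hτ
    obtain ⟨r, hr⟩ := hdr k
    change P.coroot' k d = 0
    change (P.coroot' k d).re = 0 at h3
    rw [hr] at h3 ⊢
    rw [← ofReal_re r, h3]; rfl
  have h3 : ∀ τ, Real.exp (c * (P.1 (y + d) τ).re) = Real.exp (c * (P.1 y τ).re) * Real.exp
    (c * (P.1 d τ).re) := fun τ => by
    rw [map_add₂, add_re, mul_add, Real.exp_add]
  refine (le_add_of_nonneg_right h1).trans_lt ?_
  rw [← sum_add_distrib]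
  obtain ⟨τ, hτ, hne⟩ := h2
  refine sum_lt_sum (fun τ _ => ?_) ⟨τ, hτ, ?_⟩
  · have := Real.add_one_le_exp (c * (P.1 d τ).re)
    rw [h3, hE]
    nlinarith [exp_pos (c * (P.1 y τ).re)]
  · have := Real.add_one_lt_exp (mul_ne_zero hc hne)
    rw [h3, hE]
    nlinarith [exp_pos (c * (P.1 y τ).re)]

lemma sum_exp_weyl {π : N} (c : ℝ) (w : Weyl P) (y : M) : ∑ τ ∈ orbitF P π, Real.exp
    (c * (P.1 (w.1.1 y) τ).re) = ∑ τ ∈ orbitF P π, Real.exp (c * (P.1 y τ).re) := by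
  rw [← sum_weyl_invariant (fun w τ h => weyl_mem_orbitF h w) w]
  simp only [pair_weyl]

lemma nondegenerate_of_sum_exp_ne [P.IsIrreducible] {q : ℂ} (hL : exp L = q) (hq : q ^ 2 ≠ 1)
    (h : (∃ r : ℝ, q = r) ∨ Transcendental ℚ q) {k : ι → ℂ} (hk : IsWeight P (rho b k)) {μ : M}
    (hμ : IsDominant b μ) (hne : ∀ ν, IsDominant b ν → μ - ν ∈ rootCone b → ν ≠ μ →
    ∀ (i : ι) (c : ℝ), c ≠ 0 → ∑ τ ∈ orbitF P (P.coroot i),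
    Real.exp (c * (P.1 (ν + rho b k) τ).re) ≠ ∑ τ ∈ orbitF P (P.coroot i),
    Real.exp (c * (P.1 (μ + rho b k) τ).re)) : Nondegenerate b L k μ := fun ν hν hlow h0 => by
  obtain ⟨i, -⟩ := exists_simple_pair_pos hlow (sub_ne_zero.2 h0.symm)
  have : Nonempty ι := ⟨i⟩
  obtain ⟨i, hi⟩ := exists_isQuasiminuscule P
  refine ⟨_, Or.inr hi, fun he => ?_⟩
  have key : ∀ μ : M, IsDominant b μ → ∃ n : N → ℤ, ∀ τ ∈ orbitF P (P.coroot i), P.1 (μ + rho b k)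
    τ = n τ := fun μ hμ => by
    have h1 : ∀ τ, ∃ n : ℤ, τ ∈ orbitF P (P.coroot i) → P.1 (μ + rho b k) τ = n := fun τ => by
      by_cases hτ : τ ∈ orbitF P (P.coroot i)
      · obtain ⟨j, rfl⟩ := exists_coroot_of_mem_orbitF hτ
        obtain ⟨n, hn⟩ := ((hμ.isWeight b).add hk) j
        exact ⟨n, fun _ => hn⟩
      · exact ⟨0, fun h => absurd h hτ⟩
    choose n hn using h1
    exact ⟨n, hn⟩
  obtain ⟨n, hn⟩ := key ν hν
  obtain ⟨n', hn'⟩ := key μ hμ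
  have hz : ∀ k : ℤ, ε k = q ^ (2 * k) := fun k => by rw [← hL, ← exp_int_mul, qpow]; push_cast; rfl
  rw [macEig_eq, macEig_eq, sum_congr rfl fun τ hτ => by rw [hn τ hτ, hz],
    sum_congr (s₁ := orbitF P (P.coroot i)) (f := fun τ => qpow L _)
      rfl fun τ hτ => by rw [hn' τ hτ, hz]] at he
  obtain ⟨c, hc, he⟩ := exists_real_of_sum_zpow (hL ▸ exp_ne_zero L) hq h he
  refine hne ν hν hlow h0 i c hc ?_
  simp_all

lemma rDom_add {μ ν : M} (hμ : RDom b μ) (hν : RDom b ν) : RDom b (μ + ν) := fun j hj => by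
  obtain ⟨r, hr, h⟩ := hμ j hj
  obtain ⟨s, hs, h'⟩ := hν j hj
  exact ⟨r + s, add_nonneg hr hs, by simp_all⟩

lemma nondegenerate_succ [P.IsIrreducible] {q : ℂ} (hL : exp L = q) (hq : q ^ 2 ≠ 1)
    (h : (∃ r : ℝ, q = r) ∨ Transcendental ℚ q) (hm : WInv P m) {μ : M}
    (hμ : IsDominant b μ) : Nondegenerate b L m⁺ μ := by
  have hρ : IsDominant b (rho b fun i => (m i : ℂ) + 1) := by
    have := isDominant_rhoN b (m := fun i => m i + 1) fun i j => by simp only [hm]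
    simpa [rhoN] using this
  refine nondegenerate_of_sum_exp_ne hL hq h (hρ.isWeight b) hμ fun ν hν hlow h0 i c hc => ?_
  have := sum_exp_lt (i := i) hc (rDom_add (hν.rDom b) (hρ.rDom b)) (mem_rootCone.1 hlow).1
    (fun i => ?_) (sub_ne_zero.2 h0.symm)
  · grind [add_sub_cancel]
  · obtain ⟨n, hn⟩ := (hμ.isWeight b).sub (hν.isWeight b) i
    exact ⟨n, by rw [hn]; simp⟩

lemma IsStable.isDominant_sub (hm : WInv P m) {μ : M}
    (h : IsStable b m μ) : IsDominant b (μ - ϱ - rho b fun i => (m i : ℂ) + 1) := by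
  rw [isDominant_iff]
  intro j hj
  have hjp := simple_mem b hj
  obtain ⟨n, hn⟩ := h.1 j hjp
  have h1 := h.2 j hjp
  rw [hn, natCast_re] at h1
  have h2 : 2 * m j < n := by exact_mod_cast h1
  refine ⟨n - (2 * m j + 1), ?_⟩
  rw [map_sub, map_sub, hn, coroot'_rhoN b hm hj, coroot'_rho b (fun i j => by rw [hm]) hj,
    Nat.cast_sub h2]
  push_cast; ring

lemma IsStable.sub_weyl_mem_realCone (hm : WInv P m) {μ ν : M}
    (h : IsStable b m μ) (hν : IsDominant b ν) (hlow : μ - ν ∈ rootCone b) (u : Weyl P) :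
    μ - ϱ - u.1.1 (ν - ϱ) ∈ realCone b := by
  set m' : ι → ℕ := fun i => 2 * m i + 1 with hm'
  have hmm : ∀ i j, m' (ς i j) = m' j := fun i j => by simp only [hm', hm]
  set ρ₁ := rhoN b fun _ => 1
  have hρ' : rhoN b m' = ϱ + ϱ + ρ₁ := by
    simp only [rhoN, rho, ρ₁, hm', ← smul_add, ← sum_add_distrib]
    congr 1
    refine sum_congr rfl fun i _ => ?_
    module
  have hκ : IsDominant b (μ + μ - (rhoN b m' + rhoN b m')) := by
    rw [isDominant_iff]
    intro j hj
    obtain ⟨n, hn⟩ := (isDominant_iff b).1 (h.isDominant_sub hm) j hj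
    refine ⟨n + n, ?_⟩
    rw [map_sub, map_sub, coroot'_rhoN b hm hj, coroot'_rho b (fun i j => by rw [hm]) hj] at hn
    rw [map_sub, map_add, map_add, coroot'_rhoN b hmm hj, hm']
    push_cast
    linear_combination 2 * hn
  set κ' := μ + μ - (rhoN b m' + rhoN b m') with hκ'
  have hνν : IsDominant b (ν + ν) := fun i hi => by
    obtain ⟨n, hn⟩ := hν i hi
    exact ⟨n + n, by rw [map_add, hn, cast_add]⟩
  obtain ⟨s, hs, v, hv, hsv : s + v = ν + ν⟩ := mem_of_forall_sub_root_mem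
    (X := Set.image2 (· + ·) (boxSum b m') (hull b κ')) (fun j hj x hx n h0 hn => by
      obtain ⟨s, hs, v, hv, rfl⟩ := hx
      have hsw : IsWeight P s := by
        obtain ⟨l, -, rfl⟩ := hs
        exact isWeight_rootLat (sum_mem fun i _ => nsmul_mem (root_mem_rootLat P i) _)
      obtain ⟨n₁, hn₁⟩ := hsw j
      obtain ⟨n₂, hn₂⟩ := isWeight_of_mem_hull b (hκ.isWeight b) hv j
      rw [map_add, hn₁, hn₂] at hn
      have h1 : n₁ + n₂ = n := by exact_mod_cast hn
      rcases lt_or_ge 0 n₁ with h2 | h2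
      · exact ⟨_, sub_root_mem_boxSum hmm (fun i j _ _ => Nat.succ_pos _) hj hs hn₁ h2, v, hv, by
          dsimp only; abel⟩
      · obtain ⟨c, hc⟩ := eq_ofNat_of_zero_le (a := n₂) (by omega)
        have h3 := sub_nsmul_mem_hull b hv (i := j) (c := c) (n := 1) (by rw [hn₂, hc]; rfl)
          (by omega)
        grind) hνν
    (x := μ + μ) ⟨_, ⟨m', fun _ => le_rfl, rhoN_add_rhoN b m'⟩, _, hκ.mem_hull b, by
      rw [hκ']; abel⟩ (by rw [add_sub_add_comm]; exact add_mem hlow hlow)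
  have h1 : rhoN b m' - u.1.1 (s - rhoN b m') ∈ realCone b := by
    obtain ⟨l, hl, he⟩ := boxSum_weyl hmm u (x := s - rhoN b m') (by rwa [sub_add_cancel])
    rw [eq_sub_of_add_eq he, sub_sub_eq_add_sub, rhoN_add_rhoN, ← sum_sub_distrib]
    refine sum_mem fun i hi => ?_
    obtain ⟨n, hn⟩ := Nat.exists_eq_add_of_le (hl i)
    rw [hn, add_smul, add_sub_cancel_left]
    exact nsmul_mem (root_mem_realCone b (mem_posRoots.1 hi)) _
  have h2 := (mem_rootCone.1 (hv u)).1
  have h3 := (mem_rootCone.1 ((isDominant_rhoN b (m := fun _ => 1)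
    fun _ _ => rfl).sub_weyl_mem b u)).1
  have h4 := smul_mem_realCone b (add_mem (add_mem h1 h2) h3) (r := 1 / 2) (by norm_num)
  have h5 : μ - ϱ - u.1.1 (ν - ϱ) = ((1 / 2 : ℝ) : ℂ) •
    (rhoN b m' - u.1.1 (s - rhoN b m') + (κ' - u.1.1 v) + (ρ₁ - u.1.1 ρ₁)) := by
    have h6 : u.1.1 s + u.1.1 v = u.1.1 ν + u.1.1 ν := by rw [← map_add, hsv, map_add]
    rw [map_sub, map_sub, hκ', hρ', map_add, map_add, eq_sub_of_add_eq h6]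
    module
  rwa [h5]

lemma IsStable.nondegenerate [P.IsIrreducible] {q : ℂ} (hL : exp L = q) (hq : q ^ 2 ≠ 1)
    (h : (∃ r : ℝ, q = r) ∨ Transcendental ℚ q) (hm : WInv P m) {μ : M}
    (hμ : IsStable b m μ) : Nondegenerate b L m⁻ μ := by
  have hρ := (isDominant_rhoN b hm).isWeight b
  have hlam := hμ.isDominant_sub hm
  have hlam' : ∀ i ∈ R₊, ∃ n : ℕ, m i < n ∧ P.coroot' i (μ - ϱ) = n := fun i hi =>
    exists_nat_of_shifted hm hlam hi
  refine nondegenerate_of_sum_exp_ne hL hq h (by rw [rho_neg_natCast]; exact hρ.neg) hμ.1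
    fun ν hν hlow h0 i c hc => ?_
  rw [rho_neg_natCast, ← sub_eq_add_neg, ← sub_eq_add_neg]
  have hνw := (hν.isWeight b).sub hρ
  obtain ⟨u, hu, -⟩ := exists_weyl_rDom b fun i => by
    obtain ⟨n, hn⟩ := hνw i; exact ⟨n, by rw [hn]; simp⟩
  have hd := hμ.sub_weyl_mem_realCone hm hν hlow u
  have := sum_exp_lt (i := i) hc hu hd (fun i => ?_) fun h1 => ?_
  · rw [add_sub_cancel, sum_exp_weyl] at this
    exact this.ne
  · obtain ⟨n, hn⟩ := ((hμ.1.isWeight b).sub hρ).sub (hνw.weyl u) i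
    exact ⟨n, by rw [hn]; simp⟩
  · rw [sub_eq_zero] at h1
    have hdom : RDom b (μ - ϱ) := h1 ▸ hu
    refine h0 (sub_left_injective (eq_of_rDom b hdom (fun j hj => ?_) h1.symm).symm)
    obtain ⟨n, hn⟩ := hν j (simple_mem b hj)
    obtain ⟨p, hp⟩ := hνw j
    have h2 := coroot'_weyl P u j (ν - ϱ)
    rw [← h1] at h2
    have hmu : m (u.1.2.2 j) = m j := invariant_weyl P hm u j
    refine ⟨p, ?_, by rw [hp]; simp⟩
    by_contra! hneg
    have hneg' : p < 0 := by exact_mod_cast hneg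
    rcases pos_or_neg b (u.1.2.2 j) with h3 | h3
    · obtain ⟨r, -, hr⟩ := hlam' _ (mem_posRoots.2 h3)
      rw [h2, hp] at hr
      have : p = r := by exact_mod_cast hr
      omega
    · obtain ⟨r, hr1, hr⟩ := hlam' _ (mem_posRoots.2 h3)
      have e1 : m (ς (u.1.2.2 j) (u.1.2.2 j)) = m j := by rw [hm, hmu]
      rw [coroot'_neg, h2, hp] at hr
      rw [map_sub, hn, coroot'_rhoN b hm hj] at hp
      have h4 : -p = r := by exact_mod_cast hr
      have h5 : (n : ℤ) - m j = p := by exact_mod_cast hp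
      omega

end Nondegenerate

section Weyl

variable {ψ : M → M → ℂ}

lemma IsBACoef.exists_plus_of_shifted (h : IsBACoef b L m ψ) (hL : NonRoot L) (hm : WInv P m)
    {lam : M} (hlam : IsDominant b (lam - rho b fun i => (m i : ℂ) + 1)) : ∃ a, IsMacdonald b L m⁻
    (lam + ϱ) a ∧ (∀ x, ∑ w : Weyl P,
    baFn b L m ψ lam (w.1.2.1 x) = cFactor b L m lam * orbitPoly P L a x) ∧ ∀ ν ∈ a.support,
    ν - lam ∈ hull b ϱ := by
  have h1 := fun i (hi : i ∈ R₊) => exists_nat_of_shifted hm hlam hi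
  have hdom : IsDominant b lam := fun i hi => (h1 i hi).imp fun n hn => hn.2
  obtain ⟨a, ha, hx, hs⟩ := h.exists_plus hL hm hdom (fun j hj => by
    obtain ⟨n, hn, hn'⟩ := h1 j (simple_mem b hj)
    rw [hn']
    exact_mod_cast (Nat.zero_le _).trans_lt hn |>.ne') (by
    rw [h.lead]; exact cFactor_ne_zero hL hm hlam)
  refine ⟨a, ha, fun x => by rw [hx, h.lead]; rfl, fun ν hν => ?_⟩
  obtain ⟨w, κ, hκ, rfl⟩ := hs ν hν
  exact sub_mem_hull_of_dominant hdom ((isDominant_rhoN b hm).isWeight b) hκ (ha.dominant _ hν)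

lemma IsBACoef.exists_stable (h : IsBACoef b L m ψ) (hL : NonRoot L) (hm : WInv P m) {μ : M}
    (hμ : IsStable b m μ) : ∃ a, IsMacdonald b L (fun i => -(m i : ℂ)) μ a ∧ (∀ ν ∈ a.support,
    IsLocal b m μ ν) ∧ ((∀ i j, 1 < (P.pairing j i).re → 0 < m j → 0 < m i) → ∀ ν ∈ a.support,
    IsIntLocal b m μ ν) ∧ a.support.card ≤ (hullF b (rhoN b m)).card := by
  obtain ⟨a, ha, -, hs⟩ := h.exists_plus_of_shifted hL hm (hμ.isDominant_sub hm)
  rw [sub_add_cancel] at ha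
  refine ⟨a, ha, fun ν hν => ?_, fun hC ν hν => ?_, ?_⟩
  · obtain ⟨l, hl, h⟩ := isLocal_of_mem_hull hm (hs ν hν)
    exact ⟨l, hl, by rw [eq_add_of_sub_eq h]; abel⟩
  · obtain ⟨l, hl, h⟩ := isIntLocal_of_mem_hull hm hC (hs ν hν)
    exact ⟨l, hl, by rw [eq_add_of_sub_eq h]; abel⟩
  · exact card_le_card_of_injOn (· - (μ - rhoN b m))
      (fun ν hν => mem_hullF.2 (hs ν hν)) (sub_left_injective.injOn)

end Weyl

end MacBA

theorem mainTheorem6 {ι M N : Type*} [Fintype ι] [AddCommGroup M] [Module ℂ M]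
    [NormedAddCommGroup N] [NormedSpace ℂ N]
    (P : RootPairing ι ℂ M N) [P.IsRootSystem] [P.IsCrystallographic] [P.IsReduced]
    [P.IsIrreducible] (b : P.Base)
    (m : ι → ℕ) (hm : ∀ i j, m (P.reflectionPerm i j) = m j)
    (q L : ℂ) (hL : Complex.exp L = q) (hq : ∀ n : ℕ, 0 < n → q ^ n ≠ 1) :
    -- the normalized Baker–Akhiezer function exists and is unique
    (∃! ψ : N → M → ℂ, IsNormalizedBA b L m ψ) ∧
    -- the generalized Weyl formula, for `λ ∈ ρ_{m+1} + P_+`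
    (∀ ψ : N → M → ℂ, IsNormalizedBA b L m ψ →
      ∀ lam : M, IsDominant b (lam - rho b fun i => (m i : ℂ) + 1) →
        cFactor b L m lam ≠ 0 ∧
        (∃ a : M →₀ ℂ,
          IsMacdonald b L (fun i => -(m i : ℂ)) (lam + rho b fun i => (m i : ℂ)) a ∧
          (Nondegenerate b L (fun i => -(m i : ℂ)) (lam + rho b fun i => (m i : ℂ)) →
            ∀ a' : M →₀ ℂ,
              IsMacdonald b L (fun i => -(m i : ℂ)) (lam + rho b fun i => (m i : ℂ)) a' →
              a' = a) ∧
          ∀ x : N, PhiPlus P ψ x lam = cFactor b L m lam * orbitPoly P L a x) ∧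
        (∃ a : M →₀ ℂ,
          IsMacdonald b L (fun i => (m i : ℂ) + 1) (lam - rho b fun i => (m i : ℂ) + 1) a ∧
          (Nondegenerate b L (fun i => (m i : ℂ) + 1) (lam - rho b fun i => (m i : ℂ) + 1) →
            ∀ a' : M →₀ ℂ,
              IsMacdonald b L (fun i => (m i : ℂ) + 1) (lam - rho b fun i => (m i : ℂ) + 1) a' →
              a' = a) ∧
          ∀ x : N, PhiMinus P ψ x lam =
            cFactor b L m lam * deltaFn b L m x * orbitPoly P L a x)) ∧
    -- localization of the stable Macdonald polynomials at `t = q^{-m}`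
    (∃ B : ℕ, ∀ μ : M, IsStable b m μ →
      ∃ a : M →₀ ℂ,
        IsMacdonald b L (fun i => -(m i : ℂ)) μ a ∧
        (Nondegenerate b L (fun i => -(m i : ℂ)) μ →
          ∀ a' : M →₀ ℂ, IsMacdonald b L (fun i => -(m i : ℂ)) μ a' → a' = a) ∧
        (∀ ν ∈ a.support, IsLocal b m μ ν) ∧
        ((∀ i j, 1 < (P.pairing j i).re → 0 < m j → 0 < m i) →
          ∀ ν ∈ a.support, IsIntLocal b m μ ν) ∧
        a.support.card ≤ B) ∧
    -- the polynomials above are determined by their defining equations for real and for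
    -- transcendental `q`
    ((∃ r : ℝ, q = r) ∨ Transcendental ℚ q →
      (∀ μ : M, IsStable b m μ → Nondegenerate b L (fun i => -(m i : ℂ)) μ) ∧
      (∀ μ : M, IsDominant b μ → Nondegenerate b L (fun i => (m i : ℂ) + 1) μ)) := by
  have hL' : NonRoot L := by
    have h1 : ∀ n : ℕ, qpow L n = q ^ n := fun n => by
      rw [← hL, ← Complex.exp_nat_mul]; rfl
    intro n hn he
    obtain ⟨k, rfl | rfl⟩ := n.eq_nat_or_neg
    · exact hq k (by omega) (by rw [← h1]; exact_mod_cast he)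
    · refine hq k (by omega) ?_
      rw [Int.cast_neg, qpow_neg, inv_eq_one] at he
      rw [← h1]; exact_mod_cast he
  have hq2 := hq 2 two_pos
  obtain ⟨φ, hφ⟩ := exists_isBACoef b.flip (P := P.flip) (m := m) hL' hm
  obtain ⟨ψ, hψ⟩ := exists_isBACoef b hL' hm
  have hBA := isNormalizedBA_iff hφ hL' hm
  refine ⟨⟨_, (hBA _).2 rfl, fun _ h => (hBA _).1 h⟩, fun Ψ hΨ lam hlam => ?_,
    ⟨(hullF b (rhoN b m)).card, fun μ hμ => ?_⟩, fun h => ⟨fun μ hμ =>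
      hμ.nondegenerate hL hq2 h hm, fun μ hμ => nondegenerate_succ hL hq2 h hm hμ⟩⟩
  · have hΨ' : ∀ x, Ψ x lam = baFn b L m ψ lam x := fun x => by
      rw [(hBA Ψ).1 hΨ, hψ.duality hL' hm hφ]
    obtain ⟨a, ha, hax, -⟩ := hψ.exists_plus_of_shifted hL' hm hlam
    obtain ⟨a', ha', hax'⟩ := hψ.exists_minus hL' hm hlam
    refine ⟨cFactor_ne_zero hL' hm hlam,
      ⟨a, ha, fun h a' h' => ha.unique hL'.ne_zero (fun i j => by rw [hm]) h h', fun x => ?_⟩,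
      ⟨a', ha', fun h a h' => ha'.unique hL'.ne_zero (fun i j => by rw [hm]) h h', fun x => ?_⟩⟩
    · rw [PhiPlus, sum_weylN P fun w => Ψ (w x) lam, ← hax]
      exact Finset.sum_congr rfl fun w _ => hΨ' _
    · rw [PhiMinus, sum_weylN P fun w => LinearMap.det (w : N →ₗ[ℂ] N) * Ψ (w x) lam]
      simp only [hΨ']
      rw [← show _ = cFactor b L m lam from hψ.lead lam, ← hax']
      rfl
  · obtain ⟨a, ha, h1, h2, h3⟩ := hψ.exists_stable hL' hm hμ
    exact ⟨a, ha, fun h a' h' => ha.unique hL'.ne_zero (fun i j => by rw [hm]) h h', h1, h2, h3⟩
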